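/- Fix $N\ge 1$, an integer $\ell\ge 2$ and $\beta\in[0,1]$. Let $\mathfrak M$ be the class of Lebesgue-measurable subsets of $\mathbb R^N$, and let $\mathfrak C$ be the class of closures of open sets with compact boundary of class $C^{\ell,\beta}$ (near each boundary point the open set is the strict subgraph, in some direction, of a $C^{\ell,\beta}$ function). For $E_n,E\in\mathfrak C$ we say that $E_n\to E$ in $\mathfrak C$ if there are finitely many open cylinders covering $\partial E$ in each of which $E$, and $E_n$ for all large $n$, are subgraphs (in the direction of the axis) of functions $f$ and $f_n$ with $f_n\to f$ in $C^{\ell,\beta}$, while $E_n$ and $E$ coincide outside the union of the cylinders for all large $n$. A functional $J:\mathfrak M\to[0,+\infty]$ is a generalized perimeter if: (i) $J(E)<+\infty$ for all $E\in\mathfrak C$; (ii) $J(\emptyset)=J(\mathbb R^N)=0$; (iii) $J(E)=J(E')$ whenever $|E\triangle E'|=0$; (iv) $J(E)\le\liminf_n J(E_n)$ whenever $|(E_n\triangle E)\cap B_R|\to0$ for every $R>0$; (v) $J(E\cup F)+J(E\cap F)\le J(E)+J(F)$ for all $E,F\in\mathfrak M$; (vi) $J(x+E)=J(E)$ for all $E\in\mathfrak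 M$, $x\in\mathbb R^N$. Let $J$ be a generalized perimeter and let $\kappa(x,E)\in\mathbb R$ be defined for all $E\in\mathfrak C$ and $x\in\partial E$. Assume: (a) $\kappa$ is the first variation of $J$: for every $E\in\mathfrak C$ and every one-parameter family of diffeomorphisms $(\Phi_\varepsilon)_{|\varepsilon|<\delta}$ of $\mathbb R^N$ onto itself, of class $C^{\ell,\beta}$ in $(\varepsilon,x)$ and with inverses of class $C^{\ell,\beta}$, such that $\Phi_0(x)=x$ for all $x$, one has $$\frac{d}{d\varepsilon}J\big(\Phi_\varepsilon(E)\big)\Big|_{\varepsilon=0}=\int_{\partial E}\kappa(x,E)\,\psi(x)\cdot\nu_E(x)\,d\mathcal H^{N-1}(x),\qquad \psi(x)=\frac{\partial\Phi_\varepsilon(x)}{\partial\varepsilon}\Big|_{\varepsilon=0},$$ where $\nu_E$ is the outer unit normal to $E$ (the derivative exists and the integrand is integrable); (b) continuity (axiom C): if $E_n\to E$ in $\mathfrak C$, $x_n\in\partial E_n$, $x\in\partial E$ and $x_n\to x$, then $\kappa(x_n,E_n)\to\kappa(x,E)$. For $E\in\mathfrak C$ and $x\in\partial E$ let $$\kappa^+(x,E)=\inf\Big\{\liminf_n\frac{J(E\cup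 W_n)-J(E)}{|W_n\setminus E|}:\ \overline{W}_n\to\{x\}\text{ in the Hausdorff metric},\ |W_n\setminus E|>0\Big\},$$ $$\kappa^-(x,E)=\sup\Big\{\limsup_n\frac{J(E)-J(E\setminus W_n)}{|W_n\cap E|}:\ \overline{W}_n\to\{x\}\text{ in the Hausdorff metric},\ |W_n\cap E|>0\Big\},$$ where $(W_n)$ ranges over sequences in $\mathfrak M$. Then $\kappa$ is the curvature associated with $J$ in the weak sense: $\kappa^+(x,E)=\kappa^-(x,E)=\kappa(x,E)$ for every $E\in\mathfrak C$ and every $x\in\partial E$. -/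

import Mathlib

open MeasureTheory Filter Topology
open scoped NNReal ENNReal symmDiff RealInnerProductSpace

noncomputable section

namespace NonlocalCurvature

/-- The Euclidean space `ℝ^N`. -/
abbrev Space (N : ℕ) : Type := EuclideanSpace ℝ (Fin N)

/-- `f` is of class `C^{ℓ,β}` on the open set `s`: it is `C^ℓ` there and its derivative of
order `ℓ` is `β`-Hölder continuous on every compact subset of `s`. For `β = 0` this is `C^ℓ`. -/
def IsHolderC {X Y : Type*} [NormedAddCommGroup X] [NormedSpace ℝ X]
    [NormedAddCommGroup Y] [NormedSpace ℝ Y] (ℓ : ℕ) (β : ℝ≥0) (f : X → Y) (s : Set X) : Prop :=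
  ContDiffOn ℝ ℓ f s ∧
    ∀ K ⊆ s, IsCompact K → ∃ C : ℝ≥0, HolderOnWith C β (iteratedFDeriv ℝ ℓ f) K

/-- `f n → g` in the norm of `C^{ℓ,β}` on the open set `s`: uniform convergence of all
derivatives of order at most `ℓ`, and convergence to zero of the `β`-Hölder seminorm of the
difference of the derivatives of order `ℓ`. -/
def TendstoHolderC {X Y : Type*} [NormedAddCommGroup X] [NormedSpace ℝ X]
    [NormedAddCommGroup Y] [NormedSpace ℝ Y] (ℓ : ℕ) (β : ℝ≥0) (f : ℕ → X → Y) (g : X → Y)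
    (s : Set X) : Prop :=
  ∀ ε : ℝ≥0, 0 < ε → ∀ᶠ n in atTop,
    (∀ k ≤ ℓ, ∀ y ∈ s, ‖iteratedFDeriv ℝ k (f n) y - iteratedFDeriv ℝ k g y‖ ≤ ε) ∧
    HolderOnWith ε β (fun y => iteratedFDeriv ℝ ℓ (f n) y - iteratedFDeriv ℝ ℓ g y) s

variable {N : ℕ}

/-- The hyperplane orthogonal to `ν`. -/
abbrev Hyper (ν : Space N) : Submodule ℝ (Space N) := (Submodule.span ℝ {ν})ᗮ

/-- The component of `y - z` in the hyperplane orthogonal to `ν`. -/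
def hcoord (z ν y : Space N) : Hyper ν := (Hyper ν).orthogonalProjectionOnto (y - z)

/-- The open cylinder of centre `z`, axis `ν`, radius `r` and half-height `h`. -/
def cylinder (z ν : Space N) (r h : ℝ) : Set (Space N) :=
  {y | ‖hcoord z ν y‖ < r ∧ |⟪ν, y - z⟫| < h}

/-- The class `𝔠` of the closures of the open sets with compact boundary of class `C^{ℓ,β}`:
near each boundary point the open set is the strict subgraph of a `C^{ℓ,β}` function. -/
def IsRegular (ℓ : ℕ) (β : ℝ≥0) (E : Set (Space N)) : Prop :=
  ∃ U : Set (Space N), IsOpen U ∧ IsCompact (frontier U) ∧ E = closure U ∧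
    ∀ x ∈ frontier U, ∃ (ν : Space N) (r h : ℝ) (f : Hyper ν → ℝ),
      ‖ν‖ = 1 ∧ 0 < r ∧ 0 < h ∧ IsHolderC ℓ β f (Metric.ball 0 r) ∧
      (∀ p ∈ Metric.ball 0 r, |f p| < h) ∧
      ∀ y ∈ cylinder x ν r h, (y ∈ U ↔ ⟪ν, y - x⟫ < f (hcoord x ν y))

/-- Convergence `E n → E` in the class `𝔠`: there are finitely many cylinders covering `∂E` in
which `E`, and `E n` for all large `n`, are the subgraphs of functions that converge in `C^{ℓ,β}`,
and outside of which `E n` and `E` agree for all large `n`. -/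
def TendstoRegular (ℓ : ℕ) (β : ℝ≥0) (En : ℕ → Set (Space N)) (E : Set (Space N)) : Prop :=
  ∃ (m : ℕ) (z ν : Fin m → Space N) (r h : Fin m → ℝ)
    (f : (i : Fin m) → Hyper (ν i) → ℝ) (fn : (i : Fin m) → ℕ → Hyper (ν i) → ℝ),
    (∀ i, ‖ν i‖ = 1 ∧ 0 < r i ∧ 0 < h i) ∧
    frontier E ⊆ ⋃ i, cylinder (z i) (ν i) (r i) (h i) ∧
    (∀ i, IsHolderC ℓ β (f i) (Metric.ball 0 (r i)) ∧
      (∀ p ∈ Metric.ball 0 (r i), |f i p| < h i) ∧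
      ∀ y ∈ cylinder (z i) (ν i) (r i) (h i),
        (y ∈ E ↔ ⟪ν i, y - z i⟫ ≤ f i (hcoord (z i) (ν i) y))) ∧
    (∀ i, (∀ᶠ n in atTop, IsHolderC ℓ β (fn i n) (Metric.ball 0 (r i)) ∧
        ∀ y ∈ cylinder (z i) (ν i) (r i) (h i),
          (y ∈ En n ↔ ⟪ν i, y - z i⟫ ≤ fn i n (hcoord (z i) (ν i) y))) ∧
      TendstoHolderC ℓ β (fn i) (f i) (Metric.ball 0 (r i))) ∧
    ∀ᶠ n in atTop, ∀ y, y ∉ (⋃ i, cylinder (z i) (ν i) (r i) (h i)) → (y ∈ En n ↔ y ∈ E)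

/-- The class `𝔐` of Lebesgue-measurable subsets of `ℝ^N`. -/
def IsLebesgue (E : Set (Space N)) : Prop := NullMeasurableSet E volume

/-- Generalized perimeters; the values of `J` outside `𝔐` play no role. -/
structure IsGeneralizedPerimeter (ℓ : ℕ) (β : ℝ≥0) (J : Set (Space N) → ℝ≥0∞) : Prop where
  finite_of_regular : ∀ E, IsRegular ℓ β E → J E < ⊤
  empty : J ∅ = 0
  univ : J Set.univ = 0
  congr_null : ∀ E F, IsLebesgue E → IsLebesgue F → volume (E ∆ F) = 0 → J E = J F
  lsc : ∀ (En : ℕ → Set (Space N)) (E : Set (Space N)), (∀ n, IsLebesgue (En n)) → IsLebesgue E →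
    (∀ R : ℝ, 0 < R →
      Tendsto (fun n => volume ((En n ∆ E) ∩ Metric.ball 0 R)) atTop (𝓝 0)) →
    J E ≤ liminf (fun n => J (En n)) atTop
  submodular : ∀ E F, IsLebesgue E → IsLebesgue F → J (E ∪ F) + J (E ∩ F) ≤ J E + J F
  translation : ∀ (E : Set (Space N)) (x : Space N), IsLebesgue E →
    J ((fun y => x + y) '' E) = J E

/-- The continuity axiom C) for a function `κ(x, E)` of `E ∈ 𝔠` and `x ∈ ∂E` (the values of `κ`
at other arguments play no role). -/
def IsContinuousCurvature (ℓ : ℕ) (β : ℝ≥0) (κ : Space N → Set (Space N) → ℝ) : Prop :=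
  ∀ (En : ℕ → Set (Space N)) (E : Set (Space N)) (xn : ℕ → Space N) (x : Space N),
    (∀ n, IsRegular ℓ β (En n)) → IsRegular ℓ β E → TendstoRegular ℓ β En E →
    (∀ n, xn n ∈ frontier (En n)) → x ∈ frontier E → Tendsto xn atTop (𝓝 x) →
    Tendsto (fun n => κ (xn n) (En n)) atTop (𝓝 (κ x E))

/-- `n` is the outer unit normal to `E` at `x`: the blow-up of `E` at `x` is the half-space
`{⟪n, ·⟫ ≤ 0}`. -/
def IsOuterUnitNormal (E : Set (Space N)) (x n : Space N) : Prop :=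
  ‖n‖ = 1 ∧ ∀ ε > 0, ∃ r > 0, ∀ y ∈ Metric.ball x r,
    (ε * ‖y - x‖ < ⟪n, y - x⟫ → y ∉ E) ∧ (⟪n, y - x⟫ < -(ε * ‖y - x‖) → y ∈ E)

/-- The outer unit normal `ν_E(x)` (an arbitrary vector if there is none). -/
def outerNormal (E : Set (Space N)) (x : Space N) : Space N :=
  Classical.epsilon (IsOuterUnitNormal E x)

/-- `Φ ε`, for `|ε| < δ`, is a one-parameter family of `C^{ℓ,β}` diffeomorphisms of `ℝ^N` onto
itself, of class `C^{ℓ,β}` in `(ε, x)`, with `Φ 0 = id`. -/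
def IsDiffeoFamily (ℓ : ℕ) (β : ℝ≥0) (δ : ℝ) (Φ : ℝ → Space N → Space N) : Prop :=
  0 < δ ∧
  IsHolderC ℓ β (fun q : ℝ × Space N => Φ q.1 q.2) (Set.Ioo (-δ) δ ×ˢ Set.univ) ∧
  (∀ ε ∈ Set.Ioo (-δ) δ, ∃ Ψ : Space N → Space N, IsHolderC ℓ β Ψ Set.univ ∧
    Function.LeftInverse Ψ (Φ ε) ∧ Function.RightInverse Ψ (Φ ε)) ∧
  ∀ x, Φ 0 x = x

/-- `κ` is the first variation of `J` in the sense of shape derivatives; here `μHE[N - 1]` is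
the `(N-1)`-dimensional Hausdorff measure, normalized to agree with Lebesgue measure on
hyperplanes. -/
def IsFirstVariation (ℓ : ℕ) (β : ℝ≥0) (J : Set (Space N) → ℝ≥0∞)
    (κ : Space N → Set (Space N) → ℝ) : Prop :=
  ∀ E, IsRegular ℓ β E → ∀ (δ : ℝ) (Φ : ℝ → Space N → Space N), IsDiffeoFamily ℓ β δ Φ →
    IntegrableOn (fun x => κ x E * ⟪deriv (fun ε => Φ ε x) 0, outerNormal E x⟫)
      (frontier E) μHE[N - 1] ∧
    HasDerivAt (fun ε => (J (Φ ε '' E)).toReal)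
      (∫ x in frontier E, κ x E * ⟪deriv (fun ε => Φ ε x) 0, outerNormal E x⟫ ∂μHE[N - 1]) 0

/-- `closure (W n) → {x}` in the Hausdorff metric, for Lebesgue-measurable sets `W n`. -/
def ShrinksTo (W : ℕ → Set (Space N)) (x : Space N) : Prop :=
  (∀ n, IsLebesgue (W n)) ∧
    Tendsto (fun n => Metric.hausdorffEDist (closure (W n)) {x}) atTop (𝓝 0)

/-- The upper weak curvature `κ⁺(x, E)`. -/
def kappaPlus (J : Set (Space N) → ℝ≥0∞) (x : Space N) (E : Set (Space N)) : EReal :=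
  sInf {L | ∃ W : ℕ → Set (Space N), ShrinksTo W x ∧ (∀ n, 0 < volume (W n \ E)) ∧
    L = liminf (fun n => ((J (E ∪ W n) : EReal) - (J E : EReal)) /
      (volume (W n \ E) : EReal)) atTop}

/-- The lower weak curvature `κ⁻(x, E)`. -/
def kappaMinus (J : Set (Space N) → ℝ≥0∞) (x : Space N) (E : Set (Space N)) : EReal :=
  sSup {L | ∃ W : ℕ → Set (Space N), ShrinksTo W x ∧ (∀ n, 0 < volume (W n ∩ E)) ∧
    L = limsup (fun n => ((J E : EReal) - (J (E \ W n) : EReal)) /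
      (volume (W n ∩ E) : EReal)) atTop}

end NonlocalCurvature

end

/-!
The upper bound for `κ⁺` and the lower bound for `κ⁻` come from test sets: between the graph of the
boundary function `f` near `x` and the graph of `f + lam * b`, for a bump function `b` with small
support, `J` changes by `lam * κ * ∫ b` to first order, because the first variation of `J` is the
integral of `κ`, and `κ` is continuous (`GraphChart.exists_bump_variation`).

For the other two bounds an arbitrary small set `W` has to be added to `E`, or removed from it. It
has no smooth boundary, so that the first variation does not apply to `E ∪ W`. Instead `W` is
averaged.

* Let `levelPerimeter J v = ∫₀¹ J {v > θ} dθ` be the coarea extension of `J` to functions. By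
  uncrossing (submodularity), the law of large numbers and lower semicontinuity, it satisfies
  Jensen's inequality for random sets: `levelPerimeter J` at the mean of the indicators of random
  sets is at most the mean of their `J` (`IsGeneralizedPerimeter.levelPerimeter_mean_le`). If the
  random sets are nested, there is equality.
* Near `x` the set `E` is a leaf of the foliation by `E_s = {t ≤ f + s}`, where `t` is the height in
  a cylinder. Let `s` be uniform in `(-σ, σ)`, and replace `E_s`, with probability `lam * m' s`, by
  `E_s ∪ (W + a)` for a random vector `a` with a smooth law, where `m` is a smooth step from `0` to
  `1` in a short interval of positive `s`. The mean of these random sets differs from that of the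
  leaves by a multiple of `lam * ψ`, where `ψ = χ * m (t - f)` and `χ` is a mollification of the
  indicator of `W`. So it is also the mean of the nested sets `{t - lam * ψ ≤ f + s}`. These are
  regular deformations of the leaves (`GraphChart.exists_levelFamily`, by solving for `t`), and the
  first variation bounds `J` on them from below, with the main term `lam * κ * ∫ ψ`.
* Comparison of the two expressions for the mean yields that `κ * ∫ ψ` is, up to a small error, at
  most the mean cost of adding `W + a` to the leaves `E_s` (`LevelFamily.mean_inequality`).
* For small `s > 0` and `a` small compared to `s`, the set `E_s` contains a translate of `E` near
  `W`. Submodularity and lower semicontinuity then show that adding `W + a` to `E_s` costs hardly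
  more than `J (E ∪ W) - J E` (`IsLscSubmodular.eventually_union_le`,
  `GraphChart.exists_union_cost`).
* As the mollification is refined and the step is moved to `0`, `∫ ψ` tends to the volume of
  `W \ E`. Hence `κ * |W \ E|` is at most `J (E ∪ W) - J E`, up to an error which is small compared
  to `|W \ E|` if `W` is close to `x` (`GraphChart.exists_union_lower_bound`).

The removal of `W` is treated in the same way, with the leaves for `s < 0`.
-/

noncomputable section

namespace NonlocalCurvature

variable {N : ℕ}

/-! ### Superlevel sets of generalized perimeters -/

section Functional

variable {ℓ : ℕ} {β : ℝ≥0} {J : Set (Space N) → ℝ≥0∞}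

/-- Lower semicontinuity along sets whose indicators converge almost everywhere. -/
lemma IsGeneralizedPerimeter.le_liminf (hJ : IsGeneralizedPerimeter ℓ β J)
    {A : ℕ → Set (Space N)} {B : Set (Space N)} (hA : ∀ n, MeasurableSet (A n))
    (hB : MeasurableSet B) (h : ∀ᵐ y, ∀ᶠ n in atTop, (y ∈ A n ↔ y ∈ B)) :
    J B ≤ liminf (fun n => J (A n)) atTop := by
  refine hJ.lsc A B (fun n => (hA n).nullMeasurableSet) hB.nullMeasurableSet fun R _ => ?_
  have hfin : IsFiniteMeasure (volume.restrict (Metric.ball (0 : Space N) R)) :=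
    ⟨by simpa using measure_ball_lt_top⟩
  have := tendsto_measure_of_ae_tendsto_indicator_of_isFiniteMeasure
    (μ := volume.restrict (Metric.ball (0 : Space N) R)) atTop
    (A := (∅ : Set (Space N))) (As := fun n => A n ∆ B) MeasurableSet.empty
    (fun n => (hA n).symmDiff hB) ?_
  · simpa [Measure.restrict_apply ((hA _).symmDiff hB)] using this
  · refine ae_restrict_of_ae (h.mono fun y hy => hy.mono fun n hn => ?_)
    simp only [Set.mem_symmDiff, Set.mem_empty_iff_false]
    tauto

lemma IsGeneralizedPerimeter.congr_ae (hJ : IsGeneralizedPerimeter ℓ β J)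
    {A B : Set (Space N)} (hA : MeasurableSet A) (hB : MeasurableSet B)
    (h : ∀ᵐ y, y ∈ A ↔ y ∈ B) : J A = J B := by
  refine hJ.congr_null A B hA.nullMeasurableSet hB.nullMeasurableSet ?_
  rw [measure_symmDiff_eq_zero_iff]
  filter_upwards [h] with y hy
  exact propext hy

/-- The number of the sets `A 0, …, A (n - 1)` that contain `y`. -/
def countMem {α : Type*} (A : ℕ → Set α) (n : ℕ) (y : α) : ℕ :=
  ∑ i ∈ Finset.range n, (A i).indicator (fun _ => 1) y

lemma countMem_succ {α : Type*} (A : ℕ → Set α) (n : ℕ) (y : α) :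
    countMem A (n + 1) y = countMem A n y + (A n).indicator (fun _ => 1) y :=
  Finset.sum_range_succ _ _

lemma countMem_le {α : Type*} (A : ℕ → Set α) (n : ℕ) (y : α) : countMem A n y ≤ n := by
  induction n with
  | zero => simp [countMem]
  | succ n ih =>
    rw [countMem_succ]
    have : (A n).indicator (fun _ => 1) y ≤ 1 := Set.indicator_le_self' (by simp) y
    omega

lemma measurable_countMem {α : Type*} [MeasurableSpace α] {A : ℕ → Set α}
    (hA : ∀ n, MeasurableSet (A n)) (n : ℕ) : Measurable (countMem A n) :=
  Finset.measurable_sum _ fun i _ => measurable_const.indicator (hA i)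

/-- Uncrossing: replacing finitely many sets by the nested sets of the points that lie in more than
`k` of them does not increase the total perimeter. -/
lemma IsGeneralizedPerimeter.sum_countMem_le (hJ : IsGeneralizedPerimeter ℓ β J)
    {A : ℕ → Set (Space N)} (hA : ∀ n, MeasurableSet (A n)) (n : ℕ) :
    ∑ k ∈ Finset.range n, J {y | k < countMem A n y} ≤ ∑ i ∈ Finset.range n, J (A i) := by
  induction n with
  | zero => simp
  | succ n ih =>
    have hm : ∀ k, MeasurableSet {y | k < countMem A n y} := fun k =>
      measurableSet_lt measurable_const (measurable_countMem hA n)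
    have hm' : ∀ k, MeasurableSet {y | k ≤ countMem A n y} := fun k =>
      measurableSet_le measurable_const (measurable_countMem hA n)
    have key : ∀ K, (∑ k ∈ Finset.range K, J {y | k < countMem A (n + 1) y}) +
        J ({y | K ≤ countMem A n y} ∩ A n) ≤
        (∑ k ∈ Finset.range K, J {y | k < countMem A n y}) + J (A n) := by
      intro K
      induction K with
      | zero => simp
      | succ K ihK =>
        have hs := hJ.submodular {y | K < countMem A n y} ({y | K ≤ countMem A n y} ∩ A n)
          (hm K).nullMeasurableSet ((hm' K).inter (hA n)).nullMeasurableSet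
        have e1 : {y | K < countMem A n y} ∪ ({y | K ≤ countMem A n y} ∩ A n) =
            {y | K < countMem A (n + 1) y} := by
          ext y
          simp only [Set.mem_union, Set.mem_ofPred_eq, Set.mem_inter_iff, countMem_succ]
          by_cases hy : y ∈ A n
          · simp [hy]; omega
          · simp [hy]
        have e2 : {y | K < countMem A n y} ∩ ({y | K ≤ countMem A n y} ∩ A n) =
            {y | K + 1 ≤ countMem A n y} ∩ A n := by
          ext y
          simp only [Set.mem_ofPred_eq, Set.mem_inter_iff]
          constructor
          · rintro ⟨h1, -, h3⟩; exact ⟨h1, h3⟩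
          · rintro ⟨h1, h3⟩; exact ⟨h1, by omega, h3⟩
        rw [e1, e2] at hs
        rw [Finset.sum_range_succ, Finset.sum_range_succ]
        calc _ = (∑ k ∈ Finset.range K, J {y | k < countMem A (n + 1) y}) +
              (J {y | K < countMem A (n + 1) y} + J ({y | K + 1 ≤ countMem A n y} ∩ A n)) := by
              rw [add_assoc]
          _ ≤ (∑ k ∈ Finset.range K, J {y | k < countMem A (n + 1) y}) +
              (J {y | K < countMem A n y} + J ({y | K ≤ countMem A n y} ∩ A n)) := by gcongr
          _ = ((∑ k ∈ Finset.range K, J {y | k < countMem A (n + 1) y}) +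
              J ({y | K ≤ countMem A n y} ∩ A n)) + J {y | K < countMem A n y} := by ring
          _ ≤ ((∑ k ∈ Finset.range K, J {y | k < countMem A n y}) + J (A n)) +
              J {y | K < countMem A n y} := by gcongr
          _ = _ := by ring
    calc _ ≤ _ := le_self_add
      _ ≤ _ := key (n + 1)
      _ = (∑ k ∈ Finset.range n, J {y | k < countMem A n y}) + J (A n) := by
          rw [Finset.sum_range_succ]
          have : {y | n < countMem A n y} = ∅ := by
            ext y; simpa using countMem_le A n y
          rw [this, hJ.empty, add_zero]
      _ ≤ _ := by rw [Finset.sum_range_succ]; gcongr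

/-- The integral of the perimeters of the superlevel sets of `v` over the levels in `(0, 1)`: the
coarea extension of `J` from sets to functions with values in `[0, 1]`. -/
def levelPerimeter (J : Set (Space N) → ℝ≥0∞) (v : Space N → ℝ) : ℝ≥0∞ :=
  ∫⁻ θ in Set.Ioo (0 : ℝ) 1, J {y | θ < v y}

/-- All but countably many level sets of a measurable function are null sets. -/
lemma countable_setOf_not_ae_ne {v : Space N → ℝ} (hv : Measurable v) :
    {θ | ¬ ∀ᵐ y, v y ≠ θ}.Countable := by
  refine (Measure.countable_meas_level_set_pos (μ := (volume : Measure (Space N))) hv).mono ?_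
  intro θ hθ
  simp only [Set.mem_ofPred_eq, ae_iff, ne_eq, not_not] at hθ ⊢
  exact pos_iff_ne_zero.2 hθ

lemma ae_level_ae_ne {v : Space N → ℝ} (hv : Measurable v) :
    ∀ᵐ θ : ℝ, ∀ᵐ y, v y ≠ θ := (countable_setOf_not_ae_ne hv).measure_zero volume

lemma measurableSet_superlevel {v : Space N → ℝ} (hv : Measurable v) (θ : ℝ) :
    MeasurableSet {y | θ < v y} := measurableSet_lt measurable_const hv

lemma IsGeneralizedPerimeter.measurable_level (hJ : IsGeneralizedPerimeter ℓ β J)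
    {v : Space N → ℝ} (hv : Measurable v) : Measurable fun θ : ℝ => J {y | θ < v y} := by
  refine measurable_of_Ioi fun c => ?_
  set S := (fun θ : ℝ => J {y | θ < v y}) ⁻¹' Set.Ioi c
  set D := {θ | ¬ ∀ᵐ y, v y ≠ θ}
  -- off the countable set `D` the function is lower semicontinuous
  have hS : S = interior S ∪ (S ∩ D) := by
    refine Set.Subset.antisymm (fun θ hθ => ?_)
      (Set.union_subset interior_subset Set.inter_subset_left)
    by_cases hD : θ ∈ D
    · exact Or.inr ⟨hθ, hD⟩
    refine Or.inl ?_
    by_contra hint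
    have hfr : ∃ᶠ θ' in 𝓝 θ, θ' ∉ S := by
      rw [mem_interior_iff_mem_nhds] at hint
      exact fun h => hint (h.mono fun _ => not_not.1)
    obtain ⟨θs, hθs, hθS⟩ := exists_seq_forall_of_frequently hfr
    have hle := hJ.le_liminf (A := fun n => {y | θs n < v y}) (B := {y | θ < v y})
      (fun n => measurableSet_superlevel hv _) (measurableSet_superlevel hv _) (by
        filter_upwards [not_not.1 hD] with y hy
        rcases lt_or_gt_of_ne hy with h | h
        · filter_upwards [hθs.eventually (lt_mem_nhds h)] with n hn
          constructor <;> intro <;> linarith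
        · filter_upwards [hθs.eventually (gt_mem_nhds h)] with n hn
          constructor <;> intro <;> linarith)
    have h2 : liminf (fun n => J {y | θs n < v y}) atTop ≤ c := by
      refine (liminf_le_liminf (Eventually.of_forall fun n => ?_)).trans (liminf_const c).le
      exact not_lt.1 (hθS n)
    exact absurd (lt_of_lt_of_le hθ (hle.trans h2)) (lt_irrefl c)
  rw [hS]
  exact isOpen_interior.measurableSet.union
    ((countable_setOf_not_ae_ne hv).mono Set.inter_subset_right).measurableSet

lemma superlevel_eventually_iff {v : Space N → ℝ} {vn : ℕ → Space N → ℝ} {θ : ℝ}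
    (h : ∀ᵐ y, Tendsto (fun n => vn n y) atTop (𝓝 (v y))) (hθ : ∀ᵐ y, v y ≠ θ) :
    ∀ᵐ y, ∀ᶠ n in atTop, (y ∈ {y | θ < vn n y} ↔ y ∈ {y | θ < v y}) := by
  filter_upwards [h, hθ] with y hy hne
  rcases lt_or_gt_of_ne hne with h | h
  · filter_upwards [hy.eventually (gt_mem_nhds h)] with n hn
    constructor <;> intro <;> linarith
  · filter_upwards [hy.eventually (lt_mem_nhds h)] with n hn
    constructor <;> intro <;> linarith

/-- Lower semicontinuity of the coarea extension. -/
lemma IsGeneralizedPerimeter.levelPerimeter_le_liminf (hJ : IsGeneralizedPerimeter ℓ β J)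
    {v : Space N → ℝ} {vn : ℕ → Space N → ℝ} (hv : Measurable v) (hvn : ∀ n, Measurable (vn n))
    (h : ∀ᵐ y, Tendsto (fun n => vn n y) atTop (𝓝 (v y))) :
    levelPerimeter J v ≤ liminf (fun n => levelPerimeter J (vn n)) atTop := by
  refine le_trans (lintegral_mono_ae ?_) (lintegral_liminf_le fun n => hJ.measurable_level (hvn n))
  refine ae_restrict_of_ae ?_
  filter_upwards [ae_level_ae_ne hv] with θ hθ
  exact hJ.le_liminf (fun n => measurableSet_superlevel (hvn n) _) (measurableSet_superlevel hv _)
    (superlevel_eventually_iff h hθ)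

/-- The law of large numbers, simultaneously for a section of a measurable set at almost every
point and for one integrable function. -/
lemma exists_sample {Ω : Type*} [MeasurableSpace Ω] (P : Measure Ω) [IsProbabilityMeasure P]
    {A : Set (Ω × Space N)} (hA : MeasurableSet A) {g : Ω → ℝ} (hgm : Measurable g)
    (hg : Integrable g P) (p : Ω → Prop) (hp : ∀ᵐ ω ∂P, p ω) :
    ∃ ω : ℕ → Ω, (∀ i, p (ω i)) ∧
      Tendsto (fun n : ℕ => (∑ i ∈ Finset.range n, g (ω i)) / n) atTop (𝓝 (∫ a, g a ∂P)) ∧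
      ∀ᵐ y, Tendsto (fun n : ℕ => (countMem (fun i => {y | (ω i, y) ∈ A}) n y : ℝ) / n) atTop
        (𝓝 (P.real {a | (a, y) ∈ A})) := by
  set PP := Measure.infinitePi (fun _ : ℕ => P)
  have slln : ∀ X : Ω → ℝ, Measurable X → Integrable X P → ∀ᵐ ω ∂PP,
      Tendsto (fun n : ℕ => (∑ i ∈ Finset.range n, X (ω i)) / n) atTop (𝓝 (∫ a, X a ∂P)) := by
    intro X hX hXi
    have hmp := fun i => measurePreserving_eval_infinitePi (fun _ : ℕ => P) i
    have h := ProbabilityTheory.strong_law_ae_real (μ := PP) (fun (i : ℕ) ω => X (ω i))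
      ((hmp 0).integrable_comp_of_integrable hXi)
      (fun i j hij => (ProbabilityTheory.iIndepFun_infinitePi (P := fun _ : ℕ => P)
        (X := fun _ => X) (fun _ => hX)).indepFun hij)
      (fun i => ⟨(hX.comp (measurable_pi_apply i)).aemeasurable,
        (hX.comp (measurable_pi_apply 0)).aemeasurable, by
          have h1 : Measure.map (fun ω : ℕ → Ω => X (ω i)) PP = P.map X := by
            rw [← (hmp i).map_eq, Measure.map_map hX (hmp i).measurable]; rfl
          have h2 : Measure.map (fun ω : ℕ → Ω => X (ω 0)) PP = P.map X := by
            rw [← (hmp 0).map_eq, Measure.map_map hX (hmp 0).measurable]; rfl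
          rw [h1, h2]⟩)
    have e : ∫ ω, X (ω 0) ∂PP = ∫ a, X a ∂P := by
      have := (hmp 0).map_eq
      rw [← this, integral_map (hmp 0).measurable.aemeasurable
        (by rw [this]; exact hX.aestronglyMeasurable)]
    simpa only [e] using h
  have hprob : ∀ᵐ ω ∂PP, ∀ i, p (ω i) := by
    rw [ae_all_iff]
    intro i
    exact (measurePreserving_eval_infinitePi (fun _ : ℕ => P) i).quasiMeasurePreserving.ae hp
  have hsec : ∀ y, MeasurableSet {a | (a, y) ∈ A} := fun y =>
    measurableSet_preimage measurable_prodMk_right hA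
  have hcnt : Measurable fun q : (ℕ → Ω) × Space N => P.real {a | (a, q.2) ∈ A} := by
    refine Measurable.ennreal_toReal ?_
    exact (measurable_measure_prodMk_right hA).comp measurable_snd
  have hcnt2 : ∀ n : ℕ, Measurable fun q : (ℕ → Ω) × Space N =>
      (countMem (fun i => {y | (q.1 i, y) ∈ A}) n q.2 : ℝ) / n := by
    intro n
    refine Measurable.div_const ?_ _
    have : (fun q : (ℕ → Ω) × Space N => (countMem (fun i => {y | (q.1 i, y) ∈ A}) n q.2 : ℝ)) =
        fun q => ∑ i ∈ Finset.range n, A.indicator (fun _ => (1 : ℝ)) (q.1 i, q.2) := by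
      ext q
      simp only [countMem, Nat.cast_sum]
      refine Finset.sum_congr rfl fun i _ => ?_
      by_cases h : (q.1 i, q.2) ∈ A <;> simp [h]
    rw [this]
    refine Finset.measurable_sum _ fun i _ => ?_
    exact (measurable_const.indicator hA).comp
      (((measurable_pi_apply i).comp measurable_fst).prodMk measurable_snd)
  have hae : ∀ᵐ ω ∂PP, ∀ᵐ y : Space N,
      Tendsto (fun n : ℕ => (countMem (fun i => {y | (ω i, y) ∈ A}) n y : ℝ) / n) atTop
        (𝓝 (P.real {a | (a, y) ∈ A})) := by
    rw [Measure.ae_ae_comm]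
    · refine Eventually.of_forall fun y => ?_
      have := slln ({a | (a, y) ∈ A}.indicator fun _ => (1 : ℝ))
        (measurable_const.indicator (hsec y))
        ((integrable_const (1 : ℝ)).indicator (hsec y))
      rw [integral_indicator_const _ (hsec y), smul_eq_mul, mul_one] at this
      filter_upwards [this] with ω hω
      refine hω.congr fun n => ?_
      congr 1
      simp only [countMem, Nat.cast_sum]
      refine Finset.sum_congr rfl fun i _ => ?_
      by_cases h : (ω i, y) ∈ A <;> simp [h]
    · have : {q : (ℕ → Ω) × Space N | Tendsto (fun n : ℕ =>
          (countMem (fun i => {y | (q.1 i, y) ∈ A}) n q.2 : ℝ) / n) atTop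
            (𝓝 (P.real {a | (a, q.2) ∈ A}))} = {q | Tendsto (fun n : ℕ =>
          (countMem (fun i => {y | (q.1 i, y) ∈ A}) n q.2 : ℝ) / n -
            P.real {a | (a, q.2) ∈ A}) atTop (𝓝 0)} := by
        ext q
        simp only [Set.mem_ofPred_eq]
        exact (tendsto_sub_nhds_zero_iff).symm
      rw [this]
      exact measurableSet_tendsto _ fun n => (hcnt2 n).sub hcnt
  obtain ⟨ω, h1, h2, h3⟩ := (hprob.and ((slln g hgm hg).and hae)).exists
  exact ⟨ω, h1, h2, h3⟩

/-- Jensen's inequality for random sets: the coarea extension of the mean of the indicators of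
random sets is at most the mean of their perimeters. -/
lemma IsGeneralizedPerimeter.levelPerimeter_mean_le (hJ : IsGeneralizedPerimeter ℓ β J)
    {Ω : Type*} [MeasurableSpace Ω] (P : Measure Ω) [IsProbabilityMeasure P]
    {A : Set (Ω × Space N)} (hA : MeasurableSet A) {g : Ω → ℝ≥0∞} (hg : Measurable g)
    (hJg : ∀ᵐ ω ∂P, J {y | (ω, y) ∈ A} ≤ g ω) :
    levelPerimeter J (fun y => P.real {a | (a, y) ∈ A}) ≤ ∫⁻ ω, g ω ∂P := by
  by_cases htop : ∫⁻ ω, g ω ∂P = ⊤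
  · simp [htop]
  have hint : Integrable (fun ω => (g ω).toReal) P :=
    integrable_toReal_of_lintegral_ne_top hg.aemeasurable htop
  obtain ⟨ω, h1, h2, h3⟩ := exists_sample P hA hg.ennreal_toReal hint
    (fun ω => J {y | (ω, y) ∈ A} ≤ g ω ∧ g ω < ⊤)
    (hJg.and (ae_lt_top hg htop))
  set B : ℕ → Set (Space N) := fun i => {y | (ω i, y) ∈ A}
  have hB : ∀ i, MeasurableSet (B i) := fun i => measurableSet_preimage measurable_prodMk_left hA
  have hu : Measurable fun y => P.real {a | (a, y) ∈ A} :=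
    (measurable_measure_prodMk_right hA).ennreal_toReal
  have hvn : ∀ n : ℕ, Measurable fun y => (countMem B n y : ℝ) / n := fun n =>
    (measurable_from_nat.comp (measurable_countMem hB n)).div_const _
  refine (hJ.levelPerimeter_le_liminf hu hvn h3).trans ?_
  have hlim : Tendsto (fun n : ℕ => ENNReal.ofReal ((∑ i ∈ Finset.range n, (g (ω i)).toReal) / n))
      atTop (𝓝 (∫⁻ ω, g ω ∂P)) := by
    have := (ENNReal.continuous_ofReal.tendsto _).comp h2
    rwa [integral_toReal hg.aemeasurable (ae_lt_top hg htop), ENNReal.ofReal_toReal htop] at this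
  rw [← hlim.liminf_eq]
  refine liminf_le_liminf ?_
  filter_upwards [eventually_gt_atTop 0] with n hn
  have hn' : (0 : ℝ) < n := by exact_mod_cast hn
  -- the superlevel sets of `countMem B n / n` are constant for levels in `[k/n, (k+1)/n)`
  have hcover : Set.Ioo (0 : ℝ) 1 ⊆
      ⋃ k ∈ Finset.range n, Set.Ico ((k : ℝ) / n) ((k + 1 : ℝ) / n) := by
    intro θ hθ
    simp only [Set.mem_iUnion, Finset.mem_range, Set.mem_Ico, exists_prop]
    refine ⟨⌊θ * n⌋₊, ?_, ?_, ?_⟩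
    · rw [Nat.floor_lt (by have := hθ.1; positivity)]
      nlinarith [hθ.2]
    · rw [div_le_iff₀ hn']
      exact Nat.floor_le (by have := hθ.1; positivity)
    · rw [lt_div_iff₀ hn']
      exact Nat.lt_floor_add_one _
  calc levelPerimeter J (fun y => (countMem B n y : ℝ) / n)
      ≤ ∫⁻ θ in ⋃ k ∈ Finset.range n, Set.Ico ((k : ℝ) / n) ((k + 1 : ℝ) / n),
        J {y | θ < (countMem B n y : ℝ) / n} := lintegral_mono_set hcover
    _ ≤ ∑ k ∈ Finset.range n, ∫⁻ θ in Set.Ico ((k : ℝ) / n) ((k + 1 : ℝ) / n),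
        J {y | θ < (countMem B n y : ℝ) / n} := by
        rw [← lintegral_biUnion_finset]
        · intro i _ j _ hij
          refine Set.disjoint_left.2 fun θ hi hj => hij ?_
          have a1 := (div_le_iff₀ hn').1 hi.1
          have a2 := (lt_div_iff₀ hn').1 hi.2
          have b1 := (div_le_iff₀ hn').1 hj.1
          have b2 := (lt_div_iff₀ hn').1 hj.2
          have c1 : i < j + 1 := by exact_mod_cast a1.trans_lt b2
          have c2 : j < i + 1 := by exact_mod_cast b1.trans_lt a2
          omega
        · exact fun _ _ => measurableSet_Ico
    _ = ∑ k ∈ Finset.range n, J {y | k < countMem B n y} * ENNReal.ofReal (1 / n) := by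
        refine Finset.sum_congr rfl fun k _ => ?_
        rw [setLIntegral_congr_fun (g := fun _ => J {y | k < countMem B n y}) measurableSet_Ico]
        · rw [setLIntegral_const, Real.volume_Ico]
          congr 2
          ring
        · intro θ hθ
          have a1 := (div_le_iff₀ hn').1 hθ.1
          have a2 := (lt_div_iff₀ hn').1 hθ.2
          have : {y | θ < (countMem B n y : ℝ) / n} = {y | k < countMem B n y} := by
            ext y
            simp only [Set.mem_ofPred_eq, lt_div_iff₀ hn']
            constructor
            · intro h
              exact_mod_cast a1.trans_lt h
            · intro h
              have : (k : ℝ) + 1 ≤ countMem B n y := by exact_mod_cast h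
              linarith
          simp only [this]
    _ ≤ (∑ i ∈ Finset.range n, g (ω i)) * ENNReal.ofReal (1 / n) := by
        rw [← Finset.sum_mul]
        exact mul_le_mul_left ((hJ.sum_countMem_le hB n).trans
          (Finset.sum_le_sum fun i _ => (h1 i).1)) _
    _ = ENNReal.ofReal ((∑ i ∈ Finset.range n, (g (ω i)).toReal) / n) := by
        rw [div_eq_mul_one_div (∑ i ∈ _, (g (ω i)).toReal),
          ENNReal.ofReal_mul (Finset.sum_nonneg fun _ _ =>
          ENNReal.toReal_nonneg), ENNReal.ofReal_sum_of_nonneg fun _ _ => ENNReal.toReal_nonneg]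
        congr 1
        exact Finset.sum_congr rfl fun i _ => (ENNReal.ofReal_toReal (h1 i).2.ne).symm

instance volume_restrict_Ioo_isProbabilityMeasure :
    IsProbabilityMeasure (volume.restrict (Set.Ioo (0 : ℝ) 1)) := ⟨by simp⟩

end Functional


/-! ### Calculus in the classes `C^{ℓ,β}` -/

section HolderCalculus

set_option linter.unusedSectionVars false

variable {X Y Z : Type} [NormedAddCommGroup X] [NormedSpace ℝ X]
  [NormedAddCommGroup Y] [NormedSpace ℝ Y] [NormedAddCommGroup Z] [NormedSpace ℝ Z]
  {ℓ : ℕ} {β : ℝ≥0}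

/-- `f` is `β`-Hölder continuous in a neighbourhood of `x`. -/
def LocHolderAt (β : ℝ≥0) (f : X → Y) (x : X) : Prop :=
  ∃ C : ℝ, 0 ≤ C ∧ ∀ᶠ p in 𝓝 x ×ˢ 𝓝 x, ‖f p.1 - f p.2‖ ≤ C * ‖p.1 - p.2‖ ^ (β : ℝ)

lemma LocHolderAt.congr {f g : X → Y} {x : X} (hf : LocHolderAt β f x) (h : f =ᶠ[𝓝 x] g) :
    LocHolderAt β g x := by
  obtain ⟨C, hC, H⟩ := hf
  refine ⟨C, hC, ?_⟩
  filter_upwards [H, h.prod_inl (𝓝 x), h.prod_inr (𝓝 x)] with p h1 h2 h3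
  rwa [← h2, ← h3]

lemma LocHolderAt.bounded {f : X → Y} {x : X} (hf : LocHolderAt β f x) :
    ∃ M : ℝ, 0 ≤ M ∧ ∀ᶠ y in 𝓝 x, ‖f y‖ ≤ M := by
  obtain ⟨C, hC, H⟩ := hf
  refine ⟨‖f x‖ + C, by positivity, ?_⟩
  have h1 : ∀ᶠ y in 𝓝 x, ‖f y - f x‖ ≤ C * ‖y - x‖ ^ (β : ℝ) :=
    (H.curry).mono fun y hy => hy.self_of_nhds
  filter_upwards [h1, Metric.ball_mem_nhds x one_pos] with y hy hb
  have hb' : ‖y - x‖ ≤ 1 := by rw [← dist_eq_norm]; exact (Metric.mem_ball.1 hb).le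
  have h2 : ‖y - x‖ ^ (β : ℝ) ≤ 1 := Real.rpow_le_one (norm_nonneg _) hb' β.coe_nonneg
  have h3 : ‖f y‖ ≤ ‖f x‖ + ‖f y - f x‖ := by
    simpa using norm_add_le (f x) (f y - f x)
  nlinarith

lemma LocHolderAt.add {f g : X → Y} {x : X} (hf : LocHolderAt β f x) (hg : LocHolderAt β g x) :
    LocHolderAt β (fun y => f y + g y) x := by
  obtain ⟨C, hC, H⟩ := hf
  obtain ⟨D, hD, K⟩ := hg
  refine ⟨C + D, by positivity, ?_⟩
  filter_upwards [H, K] with p h1 h2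
  calc ‖f p.1 + g p.1 - (f p.2 + g p.2)‖ = ‖(f p.1 - f p.2) + (g p.1 - g p.2)‖ := by congr 1; abel
    _ ≤ _ := norm_add_le _ _
    _ ≤ _ := by rw [add_mul]; exact add_le_add h1 h2

lemma LocHolderAt.bilinear (B : Y →L[ℝ] Z →L[ℝ] X) {W : Type} [NormedAddCommGroup W]
    [NormedSpace ℝ W] {f : W → Y} {g : W → Z} {x : W} (hf : LocHolderAt β f x)
    (hg : LocHolderAt β g x) : LocHolderAt β (fun y => B (f y) (g y)) x := by
  obtain ⟨M, hM, HM⟩ := hf.bounded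
  obtain ⟨L, hL, HL⟩ := hg.bounded
  obtain ⟨C, hC, H⟩ := hf
  obtain ⟨D, hD, K⟩ := hg
  refine ⟨‖B‖ * (C * L + M * D), by positivity, ?_⟩
  filter_upwards [H, K, HM.prod_inr (𝓝 x), HL.prod_inl (𝓝 x)] with p h1 h2 h3 h4
  have e : B (f p.1) (g p.1) - B (f p.2) (g p.2) =
      B (f p.1 - f p.2) (g p.1) + B (f p.2) (g p.1 - g p.2) := by
    simp only [map_sub, sub_apply]; abel
  rw [e]
  refine (norm_add_le _ _).trans ?_
  have b1 := B.le_opNorm₂ (f p.1 - f p.2) (g p.1)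
  have b2 := B.le_opNorm₂ (f p.2) (g p.1 - g p.2)
  set d := ‖p.1 - p.2‖ ^ (β : ℝ)
  have hd : 0 ≤ d := by positivity
  calc _ ≤ ‖B‖ * ‖f p.1 - f p.2‖ * ‖g p.1‖ + ‖B‖ * ‖f p.2‖ * ‖g p.1 - g p.2‖ := add_le_add b1 b2
    _ ≤ ‖B‖ * (C * d) * L + ‖B‖ * M * (D * d) := by gcongr
    _ = _ := by ring

lemma LocHolderAt.of_contDiffAt {f : X → Y} {x : X} (hβ : β ≤ 1) (hf : ContDiffAt ℝ 1 f x) :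
    LocHolderAt β f x := by
  obtain ⟨K, t, ht, hK⟩ := hf.exists_lipschitzOnWith
  refine ⟨K, K.coe_nonneg, ?_⟩
  have ht2 : t ∩ Metric.ball x (1 / 2) ∈ 𝓝 x := inter_mem ht (Metric.ball_mem_nhds x (by norm_num))
  filter_upwards [prod_mem_prod ht2 ht2] with p hp
  have h1 := hK.dist_le_mul _ hp.1.1 _ hp.2.1
  rw [dist_eq_norm, dist_eq_norm] at h1
  have h2 : ‖p.1 - p.2‖ ≤ 1 := by
    rw [← dist_eq_norm]
    have a := Metric.mem_ball.1 hp.1.2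
    have b := Metric.mem_ball.1 hp.2.2
    have := dist_triangle_right p.1 p.2 x
    linarith
  refine h1.trans ?_
  gcongr
  exact Real.self_le_rpow_of_le_one (norm_nonneg _) h2 (by exact_mod_cast hβ)

lemma LocHolderAt.comp {f : Y → Z} {g : X → Y} {x : X} (hf : LocHolderAt β f (g x))
    (hg : ContDiffAt ℝ 1 g x) : LocHolderAt β (fun y => f (g y)) x := by
  obtain ⟨C, hC, H⟩ := hf
  obtain ⟨K, t, ht, hK⟩ := hg.exists_lipschitzOnWith
  refine ⟨C * (K : ℝ) ^ (β : ℝ), by positivity, ?_⟩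
  have hc : Tendsto (Prod.map g g) (𝓝 x ×ˢ 𝓝 x) (𝓝 (g x) ×ˢ 𝓝 (g x)) :=
    hg.continuousAt.tendsto.prodMap hg.continuousAt.tendsto
  filter_upwards [hc.eventually H, prod_mem_prod ht ht] with p h1 h2
  simp only [Prod.map_fst, Prod.map_snd] at h1
  have h3 := hK.dist_le_mul _ h2.1 _ h2.2
  rw [dist_eq_norm, dist_eq_norm] at h3
  refine h1.trans ?_
  rw [mul_assoc, ← Real.mul_rpow K.coe_nonneg (norm_nonneg _)]
  exact mul_le_mul_of_nonneg_left (Real.rpow_le_rpow (norm_nonneg _) h3 β.coe_nonneg) hC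

/-- `f` is of class `C^{ℓ,β}` in a neighbourhood of `x`. In finite dimension, this holds at all points
of an open set if and only if `f` is of class `C^{ℓ,β}` on it in the sense of `IsHolderC`. -/
def IsHolderAt (ℓ : ℕ) (β : ℝ≥0) (f : X → Y) (x : X) : Prop :=
  ContDiffAt ℝ ℓ f x ∧ LocHolderAt β (iteratedFDeriv ℝ ℓ f) x

lemma IsHolderAt.congr {f g : X → Y} {x : X} (hf : IsHolderAt ℓ β f x) (h : f =ᶠ[𝓝 x] g) :
    IsHolderAt ℓ β g x :=
  ⟨hf.1.congr_of_eventuallyEq h.symm, hf.2.congr (h.iteratedFDeriv ℝ ℓ)⟩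

lemma LocHolderAt.congr_norm {f : X → Y} {g : X → Z} {x : X} (hf : LocHolderAt β f x)
    (h : ∀ a b, ‖g a - g b‖ = ‖f a - f b‖) : LocHolderAt β g x := by
  obtain ⟨C, hC, H⟩ := hf
  exact ⟨C, hC, H.mono fun p hp => by rwa [h]⟩

/-- The recursion by which the rules of calculus are proved by induction on `ℓ`. -/
lemma isHolderAt_succ_iff {f : X → Y} {x : X} : IsHolderAt (ℓ + 1) β f x ↔
    (∀ᶠ y in 𝓝 x, DifferentiableAt ℝ f y) ∧ IsHolderAt ℓ β (fderiv ℝ f) x := by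
  have hn : ∀ a b, ‖iteratedFDeriv ℝ (ℓ + 1) f a - iteratedFDeriv ℝ (ℓ + 1) f b‖ =
      ‖iteratedFDeriv ℝ ℓ (fderiv ℝ f) a - iteratedFDeriv ℝ ℓ (fderiv ℝ f) b‖ := by
    intro a b
    rw [iteratedFDeriv_succ_eq_comp_right, iteratedFDeriv_succ_eq_comp_right, ← dist_eq_norm,
      ← dist_eq_norm]
    exact (continuousMultilinearCurryRightEquiv' ℝ ℓ X Y).symm.dist_map _ _
  constructor
  · rintro ⟨h1, h2⟩
    have h1' : ContDiffAt ℝ ((ℓ : WithTop ℕ∞) + 1) f x := by exact_mod_cast h1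
    refine ⟨?_, h1'.fderiv_right le_rfl, h2.congr_norm fun a b => (hn a b).symm⟩
    filter_upwards [h1'.eventually (by simp)] with y hy
    exact hy.differentiableAt (by simp)
  · rintro ⟨h1, h2, h3⟩
    refine ⟨?_, h3.congr_norm hn⟩
    have : ContDiffAt ℝ ((ℓ : WithTop ℕ∞) + 1) f x := by
      rw [contDiffAt_succ_iff_hasFDerivAt]
      refine ⟨fderiv ℝ f, ⟨_, h1, fun y hy => ?_⟩, h2⟩
      exact DifferentiableAt.hasFDerivAt hy
    exact_mod_cast this

lemma IsHolderAt.of_contDiffAt {f : X → Y} {x : X} (hβ : β ≤ 1)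
    (hf : ContDiffAt ℝ (ℓ + 1 : ℕ) f x) : IsHolderAt ℓ β f x := by
  refine ⟨hf.of_le (by exact_mod_cast Nat.le_succ ℓ), LocHolderAt.of_contDiffAt hβ ?_⟩
  exact hf.iteratedFDeriv_right (by norm_cast; omega)

lemma IsHolderAt.pred {f : X → Y} {x : X} (hβ : β ≤ 1) (hf : IsHolderAt (ℓ + 1) β f x) :
    IsHolderAt ℓ β f x := IsHolderAt.of_contDiffAt hβ hf.1

lemma IsHolderAt.add {f g : X → Y} {x : X} (hf : IsHolderAt ℓ β f x) (hg : IsHolderAt ℓ β g x) :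
    IsHolderAt ℓ β (fun y => f y + g y) x := by
  refine ⟨hf.1.add hg.1, (hf.2.add hg.2).congr ?_⟩
  filter_upwards [hf.1.eventually (by simp), hg.1.eventually (by simp)] with y h1 h2
  exact (iteratedFDeriv_add_apply h1 h2).symm

/-- The classes `C^{ℓ,β}` are closed under continuous bilinear products. -/
lemma IsHolderAt.bilinear (hβ : β ≤ 1) (ℓ : ℕ) :
    ∀ {V Y Z W : Type} [NormedAddCommGroup V] [NormedSpace ℝ V] [NormedAddCommGroup Y]
      [NormedSpace ℝ Y] [NormedAddCommGroup Z] [NormedSpace ℝ Z] [NormedAddCommGroup W]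
      [NormedSpace ℝ W] (B : Y →L[ℝ] Z →L[ℝ] W) {f : V → Y} {g : V → Z} {x : V},
      IsHolderAt ℓ β f x → IsHolderAt ℓ β g x → IsHolderAt ℓ β (fun y => B (f y) (g y)) x := by
  induction ℓ with
  | zero =>
    intro V Y Z W _ _ _ _ _ _ _ _ B f g x hf hg
    have h0 : ∀ {U T : Type} [NormedAddCommGroup U] [NormedSpace ℝ U] [NormedAddCommGroup T]
        [NormedSpace ℝ T] (k : U → T) (a b : U),
        ‖iteratedFDeriv ℝ 0 k a - iteratedFDeriv ℝ 0 k b‖ = ‖k a - k b‖ := by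
      intro U T _ _ _ _ k a b
      simp only [iteratedFDeriv_zero_eq_comp, Function.comp_apply, ← map_sub,
        LinearIsometryEquiv.norm_map]
    refine ⟨?_, ?_⟩
    · have h1 := hf.1
      have h2 := hg.1
      exact ((B.contDiff.contDiffAt.comp x h1).clm_apply h2)
    · exact (LocHolderAt.bilinear B (hf.2.congr_norm fun a b => (h0 f a b).symm)
        (hg.2.congr_norm fun a b => (h0 g a b).symm)).congr_norm fun a b => h0 _ a b
  | succ ℓ ih =>
    intro V Y Z W _ _ _ _ _ _ _ _ B f g x hf hg
    have hf' := isHolderAt_succ_iff.1 hf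
    have hg' := isHolderAt_succ_iff.1 hg
    rw [isHolderAt_succ_iff]
    refine ⟨?_, ?_⟩
    · filter_upwards [hf'.1, hg'.1] with y h1 h2
      exact (B.hasFDerivAt_of_bilinear h1.hasFDerivAt h2.hasFDerivAt).differentiableAt
    · refine ((ih (B.precompR V) (hf.pred hβ) hg'.2).add
        (ih (B.precompL V) hf'.2 (hg.pred hβ))).congr ?_
      filter_upwards [hf'.1, hg'.1] with y h1 h2
      exact (B.fderiv_of_bilinear h1 h2).symm

/-- The classes `C^{ℓ,β}` are closed under composition with an inner function that is also `C^1`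
(which matters only for `ℓ = 0`). -/
lemma IsHolderAt.comp (hβ : β ≤ 1) (ℓ : ℕ) :
    ∀ {X Y Z : Type} [NormedAddCommGroup X] [NormedSpace ℝ X] [NormedAddCommGroup Y]
      [NormedSpace ℝ Y] [NormedAddCommGroup Z] [NormedSpace ℝ Z] {f : Y → Z} {g : X → Y} {x : X},
      IsHolderAt ℓ β f (g x) → IsHolderAt ℓ β g x → ContDiffAt ℝ 1 g x →
      IsHolderAt ℓ β (fun y => f (g y)) x := by
  induction ℓ with
  | zero =>
    intro X Y Z _ _ _ _ _ _ f g x hf hg hg1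
    refine ⟨hf.1.comp x hg.1, ?_⟩
    have h0 : ∀ {U T : Type} [NormedAddCommGroup U] [NormedSpace ℝ U] [NormedAddCommGroup T]
        [NormedSpace ℝ T] (k : U → T) (a b : U),
        ‖iteratedFDeriv ℝ 0 k a - iteratedFDeriv ℝ 0 k b‖ = ‖k a - k b‖ := by
      intro U T _ _ _ _ k a b
      simp only [iteratedFDeriv_zero_eq_comp, Function.comp_apply, ← map_sub,
        LinearIsometryEquiv.norm_map]
    exact ((hf.2.congr_norm fun a b => (h0 f a b).symm).comp hg1).congr_norm fun a b => h0 _ a b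
  | succ ℓ ih =>
    intro X Y Z _ _ _ _ _ _ f g x hf hg hg1
    have hf' := isHolderAt_succ_iff.1 hf
    have hg' := isHolderAt_succ_iff.1 hg
    have hev := hg1.continuousAt.eventually hf'.1
    rw [isHolderAt_succ_iff]
    refine ⟨?_, ?_⟩
    · filter_upwards [hev, hg'.1] with y h1 h2
      exact h1.comp y h2
    · refine (IsHolderAt.bilinear hβ ℓ (ContinuousLinearMap.compL ℝ X Y Z)
        (ih hf'.2 (hg.pred hβ) hg1) hg'.2).congr ?_
      filter_upwards [hev, hg'.1] with y h1 h2
      exact (fderiv_fun_comp y h1 h2).symm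

lemma IsHolderAt.mul (hβ : β ≤ 1) {f g : X → ℝ} {x : X} (hf : IsHolderAt ℓ β f x)
    (hg : IsHolderAt ℓ β g x) : IsHolderAt ℓ β (fun y => f y * g y) x :=
  IsHolderAt.bilinear hβ ℓ (ContinuousLinearMap.mul ℝ ℝ) hf hg

lemma IsHolderAt.smul (hβ : β ≤ 1) {f : X → ℝ} {g : X → Y} {x : X} (hf : IsHolderAt ℓ β f x)
    (hg : IsHolderAt ℓ β g x) : IsHolderAt ℓ β (fun y => f y • g y) x :=
  IsHolderAt.bilinear hβ ℓ (ContinuousLinearMap.lsmul ℝ ℝ) hf hg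

lemma IsHolderAt.of_contDiff (hβ : β ≤ 1) {f : X → Y} {n : ℕ∞}
    (hf : ContDiff ℝ n f) (hn : (ℓ + 1 : ℕ) ≤ n) (x : X) : IsHolderAt ℓ β f x :=
  IsHolderAt.of_contDiffAt hβ (hf.contDiffAt.of_le (by exact_mod_cast hn))

lemma IsHolderAt.const (hβ : β ≤ 1) (c : Y) (x : X) : IsHolderAt ℓ β (fun _ => c) x :=
  IsHolderAt.of_contDiffAt hβ contDiffAt_const

lemma IsHolderAt.id (hβ : β ≤ 1) (x : X) : IsHolderAt ℓ β (fun y => y) x :=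
  IsHolderAt.of_contDiffAt hβ contDiffAt_id

lemma IsHolderAt.clm (hβ : β ≤ 1) (L : X →L[ℝ] Y) (x : X) : IsHolderAt ℓ β (fun y => L y) x :=
  IsHolderAt.of_contDiffAt hβ L.contDiff.contDiffAt

lemma IsHolderAt.clm_comp (hβ : β ≤ 1) (L : Y →L[ℝ] Z) {f : X → Y} {x : X}
    (hf : IsHolderAt ℓ β f x) : IsHolderAt ℓ β (fun y => L (f y)) x :=
  (IsHolderAt.bilinear hβ ℓ (ContinuousLinearMap.id ℝ (Y →L[ℝ] Z))
    (IsHolderAt.const hβ L x) hf)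

lemma IsHolderAt.neg (hβ : β ≤ 1) {f : X → Y} {x : X} (hf : IsHolderAt ℓ β f x) :
    IsHolderAt ℓ β (fun y => -f y) x :=
  hf.clm_comp hβ (-ContinuousLinearMap.id ℝ Y)

lemma IsHolderAt.sub (hβ : β ≤ 1) {f g : X → Y} {x : X} (hf : IsHolderAt ℓ β f x)
    (hg : IsHolderAt ℓ β g x) : IsHolderAt ℓ β (fun y => f y - g y) x := by
  simpa only [sub_eq_add_neg] using hf.add (hg.neg hβ)

lemma IsHolderAt.prodMk (hβ : β ≤ 1) {f : X → Y} {g : X → Z} {x : X} (hf : IsHolderAt ℓ β f x)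
    (hg : IsHolderAt ℓ β g x) : IsHolderAt ℓ β (fun y => (f y, g y)) x := by
  have := (hf.clm_comp hβ (ContinuousLinearMap.inl ℝ Y Z)).add
    (hg.clm_comp hβ (ContinuousLinearMap.inr ℝ Y Z))
  simpa using this

lemma LocHolderAt.exists_holderOnWith {f : X → Y} {K : Set X} (hK : IsCompact K)
    (hf : ∀ x ∈ K, LocHolderAt β f x) : ∃ C : ℝ≥0, HolderOnWith C β f K := by
  by_contra! hcon
  -- a sequence of pairs at which the Hölder quotients blow up
  have h1 : ∀ n : ℕ, ∃ p : X × X, p ∈ K ×ˢ K ∧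
      (n : ℝ) * ‖p.1 - p.2‖ ^ (β : ℝ) < ‖f p.1 - f p.2‖ := by
    intro n
    have := hcon n
    simp only [HolderOnWith, not_forall, not_le] at this
    obtain ⟨a, ha, b, hb, h⟩ := this
    refine ⟨(a, b), ⟨ha, hb⟩, ?_⟩
    rw [edist_dist, edist_dist, ENNReal.ofReal_rpow_of_nonneg dist_nonneg β.coe_nonneg] at h
    have e : ((n : ℝ≥0) : ℝ≥0∞) = ENNReal.ofReal n := by simp
    rw [e, ← ENNReal.ofReal_mul (by positivity)] at h
    have := (ENNReal.ofReal_lt_ofReal_iff_of_nonneg (by positivity)).1 h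
    simpa [dist_eq_norm] using this
  choose p hpK hp using h1
  obtain ⟨q, hq, φ, hφ, hlim⟩ := (hK.prod hK).tendsto_subseq hpK
  rw [nhds_prod_eq] at hlim
  obtain ⟨C, hC, HC⟩ := hf q.1 hq.1
  by_cases hqq : q.1 = q.2
  · rw [← hqq] at hlim
    obtain ⟨n, h2, h3⟩ := ((hlim.eventually HC).and
      (eventually_gt_atTop (⌈C⌉₊))).exists
    have h4 := hp (φ n)
    have h5 : C ≤ (φ n : ℝ) := (Nat.le_ceil C).trans (by exact_mod_cast h3.le.trans (hφ.id_le n))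
    have h6 : C * ‖(p (φ n)).1 - (p (φ n)).2‖ ^ (β : ℝ) ≤
        (φ n : ℝ) * ‖(p (φ n)).1 - (p (φ n)).2‖ ^ (β : ℝ) := by gcongr
    exact absurd h2 (not_le.2 (lt_of_le_of_lt h6 h4))
  · obtain ⟨M, hM, HM⟩ := (hf q.1 hq.1).bounded
    obtain ⟨L, hL, HL⟩ := (hf q.2 hq.2).bounded
    have hd : 0 < ‖q.1 - q.2‖ / 2 := by
      have : 0 < ‖q.1 - q.2‖ := norm_pos_iff.2 (sub_ne_zero.2 hqq)
      linarith
    have hcont : Tendsto (fun n => ‖(p (φ n)).1 - (p (φ n)).2‖) atTop (𝓝 ‖q.1 - q.2‖) :=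
      ((tendsto_fst.comp hlim).sub (tendsto_snd.comp hlim)).norm
    set c := (‖q.1 - q.2‖ / 2) ^ (β : ℝ)
    have hc : 0 < c := Real.rpow_pos_of_pos hd _
    obtain ⟨n, h2, h3, h4, h5⟩ := (((tendsto_fst.comp hlim).eventually HM).and
      (((tendsto_snd.comp hlim).eventually HL).and
        ((hcont.eventually (lt_mem_nhds (half_lt_self (by linarith)))).and
          (eventually_gt_atTop ⌈(M + L) / c⌉₊)))).exists
    have h6 := hp (φ n)
    simp only [Function.comp_apply] at h2 h3
    have h7 : (M + L) / c ≤ (φ n : ℝ) :=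
      (Nat.le_ceil _).trans (by exact_mod_cast h5.le.trans (hφ.id_le n))
    rw [div_le_iff₀ hc] at h7
    have h8 : c ≤ ‖(p (φ n)).1 - (p (φ n)).2‖ ^ (β : ℝ) :=
      Real.rpow_le_rpow hd.le h4.le β.coe_nonneg
    have h9 : (φ n : ℝ) * c ≤ (φ n : ℝ) * ‖(p (φ n)).1 - (p (φ n)).2‖ ^ (β : ℝ) := by gcongr
    have h10 := norm_sub_le (f (p (φ n)).1) (f (p (φ n)).2)
    linarith

lemma isHolderC_of_isHolderAt {f : X → Y} {s : Set X} (h : ∀ x ∈ s, IsHolderAt ℓ β f x) :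
    IsHolderC ℓ β f s :=
  ⟨fun x hx => (h x hx).1.contDiffWithinAt, fun _ hKs hK =>
    LocHolderAt.exists_holderOnWith hK fun x hx => (h x (hKs hx)).2⟩

lemma IsHolderC.isHolderAt [ProperSpace X] {f : X → Y} {s : Set X} (h : IsHolderC ℓ β f s)
    (hs : IsOpen s) {x : X} (hx : x ∈ s) : IsHolderAt ℓ β f x := by
  refine ⟨h.1.contDiffAt (hs.mem_nhds hx), ?_⟩
  obtain ⟨ε, hε, hb⟩ := Metric.nhds_basis_closedBall.mem_iff.1 (hs.mem_nhds hx)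
  obtain ⟨C, hC⟩ := h.2 _ hb (isCompact_closedBall x ε)
  refine ⟨C, C.coe_nonneg, ?_⟩
  filter_upwards [prod_mem_prod (Metric.closedBall_mem_nhds x hε)
    (Metric.closedBall_mem_nhds x hε)] with p hp
  have := hC.dist_le hp.1 hp.2
  simpa [dist_eq_norm] using this

end HolderCalculus


/-! ### Smooth inversion along a fibre -/

section FiberInverse

variable {X : Type} [NormedAddCommGroup X] [NormedSpace ℝ X] [CompleteSpace X]

/-- The linear isomorphism `(u, v) ↦ (u, A u + c v)`. -/
def shearEquiv (A : X →L[ℝ] ℝ) {c : ℝ} (hc : c ≠ 0) : (X × ℝ) ≃L[ℝ] (X × ℝ) :=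
  ContinuousLinearEquiv.equivOfInverse
    ((ContinuousLinearMap.fst ℝ X ℝ).prod
      (A.comp (ContinuousLinearMap.fst ℝ X ℝ) + c • ContinuousLinearMap.snd ℝ X ℝ))
    ((ContinuousLinearMap.fst ℝ X ℝ).prod
      (c⁻¹ • (ContinuousLinearMap.snd ℝ X ℝ - A.comp (ContinuousLinearMap.fst ℝ X ℝ))))
    (fun q => by ext <;> simp [hc]) (fun q => by ext <;> simp [hc])

lemma strictMono_id_add {k : ℝ → ℝ} (hk : Differentiable ℝ k)
    (hd : ∀ t, |deriv k t| ≤ 1 / 2) : StrictMono fun t => t + k t := by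
  refine strictMono_of_deriv_pos fun t => ?_
  have e : deriv (fun t => t + k t) t = 1 + deriv k t :=
    ((hasDerivAt_id' t).add (hk t).hasDerivAt).deriv
  rw [e]
  have := (abs_le.1 (hd t)).1
  linarith

lemma surjective_id_add {k : ℝ → ℝ} (hk : Continuous k) {M : ℝ} (hM : ∀ t, |k t| ≤ M) :
    Function.Surjective fun t => t + k t := by
  refine (continuous_id.add hk).surjective ?_ ?_
  · exact tendsto_atTop_mono
      (fun t => by have := (abs_le.1 (hM t)).1; simp only [Pi.add_apply, id]; linarith)
      (tendsto_atTop_add_const_right _ (-M) tendsto_id)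
  · exact tendsto_atBot_mono
      (fun t => by have := (abs_le.1 (hM t)).2; simp only [Pi.add_apply, id]; linarith)
      (tendsto_atBot_add_const_right _ M tendsto_id)

/-- If `h` is smooth and bounded with `|∂_t h| ≤ 1/2`, the maps `t ↦ t + h (x, t)` are invertible,
with inverses depending smoothly on all variables. -/
lemma exists_fiberInverse {n : WithTop ℕ∞} (hn : n ≠ 0) {h : X × ℝ → ℝ} {O : Set X} (hO : IsOpen O)
    (hh : ContDiffOn ℝ n h (O ×ˢ Set.univ))
    (hd : ∀ x ∈ O, ∀ t, |deriv (fun t => h (x, t)) t| ≤ 1 / 2)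
    {M : ℝ} (hM : ∀ x ∈ O, ∀ t, |h (x, t)| ≤ M) :
    ∃ S : X × ℝ → ℝ, ContDiffOn ℝ n S (O ×ˢ Set.univ) ∧
      (∀ x ∈ O, ∀ t, S (x, t) + h (x, S (x, t)) = t) ∧
      (∀ x ∈ O, ∀ t, S (x, t + h (x, t)) = t) := by
  classical
  have hat : ∀ x ∈ O, ∀ t, ContDiffAt ℝ n h (x, t) := fun x hx t =>
    hh.contDiffAt ((hO.prod isOpen_univ).mem_nhds ⟨hx, trivial⟩)
  have hdiff : ∀ x ∈ O, ∀ t, DifferentiableAt ℝ h (x, t) := fun x hx t =>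
    (hat x hx t).differentiableAt hn
  have hdx : ∀ x ∈ O, ∀ t, HasDerivAt (fun t => h (x, t)) (fderiv ℝ h (x, t) (0, 1)) t := by
    intro x hx t
    have h1 : HasDerivAt (fun t : ℝ => (x, t)) ((0 : X), (1 : ℝ)) t :=
      (hasDerivAt_const t x).prodMk (hasDerivAt_id t)
    exact (hdiff x hx t).hasFDerivAt.comp_hasDerivAt t h1
  have hmono : ∀ x ∈ O, StrictMono fun t => t + h (x, t) := fun x hx =>
    strictMono_id_add (fun t => (hdx x hx t).differentiableAt) (hd x hx)
  have hsurj : ∀ x ∈ O, Function.Surjective fun t => t + h (x, t) := fun x hx =>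
    surjective_id_add (continuous_iff_continuousAt.2 fun t => (hdx x hx t).continuousAt) (hM x hx)
  set S : X × ℝ → ℝ := fun q => if hq : q.1 ∈ O then (hsurj q.1 hq q.2).choose else 0
  have hS : ∀ x ∈ O, ∀ t, S (x, t) + h (x, S (x, t)) = t := by
    intro x hx t
    have := (hsurj x hx t).choose_spec
    simpa [S, hx] using this
  have hS' : ∀ x ∈ O, ∀ t, S (x, t + h (x, t)) = t := fun x hx t =>
    (hmono x hx).injective (hS x hx _)
  refine ⟨S, ?_, hS, hS'⟩
  rintro ⟨x, t⟩ ⟨hx, -⟩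
  refine ContDiffAt.contDiffWithinAt ?_
  set τ := S (x, t)
  set F : X × ℝ → X × ℝ := fun q => (q.1, q.2 + h q)
  have hF : ContDiffAt ℝ n F (x, τ) :=
    contDiffAt_fst.prodMk (contDiffAt_snd.add (hat x hx τ))
  set L := fderiv ℝ h (x, τ)
  have hc : 1 + L (0, 1) ≠ 0 := by
    have := (abs_le.1 (hd x hx τ)).1
    rw [(hdx x hx τ).deriv] at this
    intro h0
    change -(1 / 2) ≤ L (0, 1) at this
    linarith
  set F' := shearEquiv (L.comp (ContinuousLinearMap.inl ℝ X ℝ)) hc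
  have hF' : HasFDerivAt F (F' : X × ℝ →L[ℝ] X × ℝ) (x, τ) := by
    have := (hasFDerivAt_fst (𝕜 := ℝ) (p := (x, τ))).prodMk
      ((hasFDerivAt_snd (𝕜 := ℝ) (p := (x, τ))).add (hdiff x hx τ).hasFDerivAt)
    refine this.congr_fderiv ?_
    ext <;> simp [F', shearEquiv, ContinuousLinearEquiv.equivOfInverse, L, ← Prod.zero_eq_mk]
  have hloc := hF.to_localInverse hF' hn
  have hFx : F (x, τ) = (x, t) := by simp only [F, τ, hS x hx t]
  have hright := (hF.hasStrictFDerivAt' hF' hn).eventually_right_inverse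
  rw [hFx] at hloc hright
  refine (contDiffAt_snd.comp (x, t) hloc).congr_of_eventuallyEq ?_
  filter_upwards [hright, (hO.prod isOpen_univ).mem_nhds ⟨hx, trivial⟩] with z hz hzO
  have hz' : F ((hF.localInverse hF' hn) z) = z := hz
  have e1 : ((hF.localInverse hF' hn) z).1 = z.1 := congrArg (fun q => q.1) hz'
  have e2 : ((hF.localInverse hF' hn) z).2 + h ((hF.localInverse hF' hn) z) = z.2 :=
    congrArg (fun q => q.2) hz'
  refine (hmono z.1 hzO.1).injective ?_
  simp only [Function.comp_apply]
  rw [show S z = S (z.1, z.2) from rfl, hS z.1 hzO.1 z.2, ← e2, ← e1]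

end FiberInverse


/-! ### Orthogonal coordinates -/

section Coordinates

variable {x ν : Space N}

/-- The height of `y - x` in the direction `ν`. -/
def tcoord (x ν y : Space N) : ℝ := ⟪ν, y - x⟫

/-- The point with coordinates `p ∈ ν^⊥` and `t` in the system with origin `x` and axis `ν`. -/
def point (x ν : Space N) (p : Hyper ν) (t : ℝ) : Space N := x + (p : Space N) + t • ν

lemma inner_hyper (p : Hyper ν) : ⟪ν, (p : Space N)⟫ = 0 :=
  Submodule.mem_orthogonal_singleton_iff_inner_right.1 p.2

lemma hcoord_eq (x ν y : Space N) :
    hcoord x ν y = (Hyper ν).orthogonalProjectionOnto (y - x) := rfl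

lemma hcoord_sub (x ν y z : Space N) :
    hcoord x ν y - hcoord x ν z = (Hyper ν).orthogonalProjectionOnto (y - z) := by
  rw [hcoord_eq, hcoord_eq, ← map_sub]; congr 1; abel

lemma tcoord_sub (x ν y z : Space N) : tcoord x ν y - tcoord x ν z = ⟪ν, y - z⟫ := by
  rw [tcoord, tcoord, ← inner_sub_right]; congr 1; abel

@[simp] lemma hcoord_self (x ν : Space N) : hcoord x ν x = 0 := by simp [hcoord]

@[simp] lemma tcoord_self (x ν : Space N) : tcoord x ν x = 0 := by simp [tcoord]

lemma tcoord_point (hν : ‖ν‖ = 1) (p : Hyper ν) (t : ℝ) : tcoord x ν (point x ν p t) = t := by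
  have : point x ν p t - x = (p : Space N) + t • ν := by rw [point]; abel
  rw [tcoord, this, inner_add_right, inner_hyper, inner_smul_right, real_inner_self_eq_norm_sq, hν]
  norm_num

lemma projectionOnto_hyper_self (ν : Space N) : (Hyper ν).orthogonalProjectionOnto ν = 0 :=
  Submodule.orthogonalProjectionOnto_orthogonalComplement_singleton_eq_zero ν

lemma hcoord_point (p : Hyper ν) (t : ℝ) : hcoord x ν (point x ν p t) = p := by
  have : point x ν p t - x = (p : Space N) + t • ν := by rw [point]; abel
  rw [hcoord_eq, this, map_add, map_smul, projectionOnto_hyper_self,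
    Submodule.orthogonalProjectionOnto_mem_subspace_eq_self, smul_zero, add_zero]

lemma projection_add_inner (hν : ‖ν‖ = 1) (v : Space N) :
    ((Hyper ν).orthogonalProjectionOnto v : Space N) + ⟪ν, v⟫ • ν = v := by
  have := Submodule.starProjection_add_starProjection_orthogonal
    (K := Submodule.span ℝ {ν}) v
  rw [Submodule.starProjection_unit_singleton ℝ hν] at this
  rw [add_comm]
  exact this

lemma point_coords (hν : ‖ν‖ = 1) (y : Space N) :
    point x ν (hcoord x ν y) (tcoord x ν y) = y := by
  rw [point, add_assoc, hcoord_eq, tcoord, projection_add_inner hν]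
  abel

lemma point_sub (x ν : Space N) (p q : Hyper ν) (s t : ℝ) :
    point x ν p s - point x ν q t = ((p - q : Hyper ν) : Space N) + (s - t) • ν := by
  simp only [point, sub_smul, Submodule.coe_sub]; abel

lemma norm_sq_hyper_add (hν : ‖ν‖ = 1) (p : Hyper ν) (t : ℝ) :
    ‖(p : Space N) + t • ν‖ ^ 2 = ‖p‖ ^ 2 + t ^ 2 := by
  have h := norm_add_sq_eq_norm_sq_add_norm_sq_of_inner_eq_zero (p : Space N) (t • ν) (by
    rw [inner_smul_right, real_inner_comm, inner_hyper, mul_zero])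
  rw [norm_smul, hν, mul_one, Real.norm_eq_abs] at h
  rw [sq, h, ← sq, ← sq, sq_abs]
  rfl

lemma norm_sq_coords (hν : ‖ν‖ = 1) (v : Space N) :
    ‖v‖ ^ 2 = ‖(Hyper ν).orthogonalProjectionOnto v‖ ^ 2 + ⟪ν, v⟫ ^ 2 := by
  rw [← norm_sq_hyper_add hν, projection_add_inner hν]

lemma norm_projection_le (v : Space N) : ‖(Hyper ν).orthogonalProjectionOnto v‖ ≤ ‖v‖ := by
  have := (Hyper ν).orthogonalProjectionOnto.le_of_opNorm_le
    (Submodule.orthogonalProjectionOnto_norm_le (Hyper ν)) v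
  simpa using this

lemma abs_inner_le (hν : ‖ν‖ = 1) (v : Space N) : |⟪ν, v⟫| ≤ ‖v‖ := by
  simpa [hν] using abs_real_inner_le_norm ν v

lemma norm_hcoord_le (y : Space N) : ‖hcoord x ν y‖ ≤ ‖y - x‖ := norm_projection_le _

lemma abs_tcoord_le (hν : ‖ν‖ = 1) (y : Space N) : |tcoord x ν y| ≤ ‖y - x‖ := abs_inner_le hν _

lemma norm_sub_le_coords (hν : ‖ν‖ = 1) (y : Space N) :
    ‖y - x‖ ≤ ‖hcoord x ν y‖ + |tcoord x ν y| := by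
  have := norm_sq_coords hν (y - x)
  rw [← hcoord_eq, ← tcoord] at this
  refine abs_le_of_sq_le_sq' ?_ (by positivity) |>.2
  rw [this, add_sq, sq_abs]
  nlinarith [norm_nonneg (hcoord x ν y), abs_nonneg (tcoord x ν y),
    mul_nonneg (norm_nonneg (hcoord x ν y)) (abs_nonneg (tcoord x ν y))]

lemma contDiff_hcoord {n : WithTop ℕ∞} : ContDiff ℝ n (hcoord x ν) :=
  (Hyper ν).orthogonalProjectionOnto.contDiff.comp (contDiff_id.sub contDiff_const)

lemma contDiff_tcoord {n : WithTop ℕ∞} : ContDiff ℝ n (tcoord x ν) :=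
  (innerSL ℝ ν).contDiff.comp (contDiff_id.sub contDiff_const)

lemma continuous_hcoord : Continuous (hcoord x ν) := (contDiff_hcoord (n := 0)).continuous

lemma continuous_tcoord : Continuous (tcoord x ν) := (contDiff_tcoord (n := 0)).continuous

lemma contDiff_point {n : WithTop ℕ∞} :
    ContDiff ℝ n fun q : Hyper ν × ℝ => point x ν q.1 q.2 :=
  (contDiff_const.add ((Hyper ν).subtypeL.contDiff.comp contDiff_fst)).add
    (contDiff_snd.smul contDiff_const)

lemma continuous_point : Continuous fun q : Hyper ν × ℝ => point x ν q.1 q.2 :=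
  (contDiff_point (n := 0)).continuous

lemma hcoord_add_smul (y : Space N) (c : ℝ) : hcoord x ν (y + c • ν) = hcoord x ν y := by
  rw [← sub_eq_zero, hcoord_sub, add_sub_cancel_left, map_smul, projectionOnto_hyper_self, smul_zero]

lemma tcoord_add_smul (hν : ‖ν‖ = 1) (y : Space N) (c : ℝ) :
    tcoord x ν (y + c • ν) = tcoord x ν y + c := by
  have := tcoord_sub x ν (y + c • ν) y
  rw [add_sub_cancel_left, inner_smul_right, real_inner_self_eq_norm_sq, hν] at this
  linarith

lemma coords_ext (hν : ‖ν‖ = 1) {y z : Space N} (h1 : hcoord x ν y = hcoord x ν z)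
    (h2 : tcoord x ν y = tcoord x ν z) : y = z := by
  rw [← point_coords (x := x) hν y, h1, h2, point_coords hν]

lemma mem_cylinder_iff {r h : ℝ} {y : Space N} :
    y ∈ cylinder x ν r h ↔ ‖hcoord x ν y‖ < r ∧ |tcoord x ν y| < h := Iff.rfl

lemma isOpen_cylinder (r h : ℝ) : IsOpen (cylinder x ν r h) :=
  (isOpen_lt continuous_hcoord.norm continuous_const).inter
    (isOpen_lt continuous_tcoord.abs continuous_const)

/-- Orthogonal coordinates preserve Lebesgue measure. -/
lemma measurePreserving_point (hν : ‖ν‖ = 1) :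
    MeasurePreserving (fun q : Hyper ν × ℝ => point x ν q.1 q.2) (volume.prod volume) volume := by
  let L : WithLp 2 (Hyper ν × ℝ) ≃ₗᵢ[ℝ] Space N :=
    { toFun := fun q => (q.fst : Space N) + q.snd • ν
      map_add' := fun a b => by
        simp only [WithLp.add_fst, WithLp.add_snd, Submodule.coe_add, add_smul]; abel
      map_smul' := fun c a => by
        simp only [WithLp.smul_fst, WithLp.smul_snd, Submodule.coe_smul, smul_add, smul_smul,
          smul_eq_mul, RingHom.id_apply]
      invFun := fun v => WithLp.toLp 2 ((Hyper ν).orthogonalProjectionOnto v, ⟪ν, v⟫)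
      left_inv := fun q => by
        have h1 := hcoord_point (x := (0 : Space N)) q.fst q.snd
        have h2 := tcoord_point (x := (0 : Space N)) hν q.fst q.snd
        simp only [point, hcoord, tcoord, zero_add, sub_zero] at h1 h2
        beta_reduce
        rw [h1, h2]; rfl
      right_inv := fun v => projection_add_inner hν v
      norm_map' := fun q => by
        change ‖(q.fst : Space N) + q.snd • ν‖ = ‖q‖
        rw [← sq_eq_sq₀ (norm_nonneg _) (norm_nonneg _), norm_sq_hyper_add hν,
          WithLp.prod_norm_sq_eq_of_L2, Real.norm_eq_abs, sq_abs] }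
  have h1 := L.measurePreserving.comp (WithLp.volume_preserving_toLp (Hyper ν) ℝ)
  have h2 := (measurePreserving_add_left (volume : Measure (Space N)) x).comp h1
  have e : (fun q : Hyper ν × ℝ => point x ν q.1 q.2) =
      (fun z => x + z) ∘ (⇑L ∘ WithLp.toLp 2) := by
    ext1 q
    exact add_assoc _ _ _
  rw [e]
  exact h2

end Coordinates

/-! ### Graph charts and graph perturbations -/

section Charts

variable {ℓ : ℕ} {β : ℝ≥0}

/-- A chart of the open set `U` around the point `x`: in a cylinder with centre `x`, the set `U` is
the strict subgraph of a function `f` which is of class `C^{ℓ,β}` on the whole hyperplane, with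
`f 0 = 0`, and which is small compared to the height of the cylinder. -/
structure GraphChart (ℓ : ℕ) (β : ℝ≥0) (U : Set (Space N)) (x : Space N) where
  /-- the axis of the cylinder -/
  ν : Space N
  /-- the radius of the cylinder -/
  r : ℝ
  /-- the half-height of the cylinder -/
  h : ℝ
  /-- the function whose subgraph is `U` -/
  f : Hyper ν → ℝ
  norm_ν : ‖ν‖ = 1
  r_pos : 0 < r
  h_pos : 0 < h
  holder : ∀ p, IsHolderAt ℓ β f p
  f_zero : f 0 = 0
  f_le : ∀ p, ‖p‖ ≤ r → |f p| ≤ h / 4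
  mem_iff : ∀ y ∈ cylinder x ν r h, (y ∈ U ↔ tcoord x ν y < f (hcoord x ν y))

lemma IsHolderAt.continuousAt {X Y : Type} [NormedAddCommGroup X] [NormedSpace ℝ X]
    [NormedAddCommGroup Y] [NormedSpace ℝ Y] {f : X → Y} {x : X}
    (hf : IsHolderAt ℓ β f x) : ContinuousAt f x := hf.1.continuousAt

lemma GraphChart.continuous {U : Set (Space N)} {x : Space N} (C : GraphChart ℓ β U x) :
    Continuous C.f := continuous_iff_continuousAt.2 fun p => (C.holder p).continuousAt

/-- A boundary point of a regular set has a chart, with arbitrarily small cylinder. -/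
lemma exists_graphChart (hβ : β ≤ 1) {U : Set (Space N)} (hU : IsOpen U) {x : Space N}
    (hx : x ∈ frontier U) {O : Set (Space N)} (hO : O ∈ 𝓝 x)
    (hch : ∃ (ν : Space N) (r h : ℝ) (f : Hyper ν → ℝ),
      ‖ν‖ = 1 ∧ 0 < r ∧ 0 < h ∧ IsHolderC ℓ β f (Metric.ball 0 r) ∧
      (∀ p ∈ Metric.ball 0 r, |f p| < h) ∧
      ∀ y ∈ cylinder x ν r h, (y ∈ U ↔ ⟪ν, y - x⟫ < f (hcoord x ν y))) :
    ∃ C : GraphChart ℓ β U x, cylinder x C.ν C.r C.h ⊆ O := by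
  obtain ⟨ν, r, h, f, hν, hr, hh, hf, hfh, hmem⟩ := hch
  have hfc : ContinuousOn f (Metric.ball 0 r) := hf.1.continuousOn
  have hxc : x ∈ cylinder x ν r h := by simp [cylinder, hr, hh]
  have hfc0 : ContinuousAt f 0 := hfc.continuousAt (Metric.ball_mem_nhds 0 hr)
  have hcomp : ContinuousAt (fun y => f (hcoord x ν y)) x :=
    ContinuousAt.comp (by simpa using hfc0) continuous_hcoord.continuousAt
  have hf0 : f 0 = 0 := by
    refine le_antisymm ?_ ?_
    · have : x ∉ U := fun h => (hU.frontier_eq ▸ hx).2 h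
      rw [hmem x hxc] at this
      simpa using this
    · by_contra! hneg
      have hev : ∀ᶠ y in 𝓝 x, y ∉ U := by
        have h1 : ContinuousAt (fun y => f (hcoord x ν y) - tcoord x ν y) x :=
          hcomp.sub continuous_tcoord.continuousAt
        have h2 : f (hcoord x ν x) - tcoord x ν x < 0 := by simpa using hneg
        filter_upwards [h1.eventually (gt_mem_nhds h2), (isOpen_cylinder r h).mem_nhds hxc]
          with y hy hyc
        rw [hmem y hyc, not_lt]
        change f (hcoord x ν y) ≤ tcoord x ν y
        linarith
      exact (mem_closure_iff_frequently.1 (frontier_subset_closure hx)) (hev.mono fun y hy => hy)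
  obtain ⟨ε, hε, hεO⟩ := Metric.mem_nhds_iff.1 hO
  set h' := min (h / 2) (ε / 2)
  have hh' : 0 < h' := by positivity
  have hev : ∀ᶠ p in 𝓝 (0 : Hyper ν), |f p| < h' / 4 := by
    have := hfc0.abs
    rw [ContinuousAt, hf0, abs_zero] at this
    exact this.eventually (gt_mem_nhds (by positivity))
  obtain ⟨r₁, hr₁, hb⟩ := Metric.eventually_nhds_iff_ball.1 hev
  set r' := min (min (r / 4) (ε / 2)) (r₁ / 2)
  have hr' : 0 < r' := by positivity
  have hr'r : r' ≤ r / 4 := (min_le_left _ _).trans (min_le_left _ _)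
  have hr'ε : r' ≤ ε / 2 := (min_le_left _ _).trans (min_le_right _ _)
  have hr'1 : r' ≤ r₁ / 2 := min_le_right _ _
  -- a cutoff function makes `f` globally defined
  let χ : ContDiffBump (0 : Hyper ν) := ⟨r / 4, r / 2, by linarith, by linarith⟩
  have hχ1 : ∀ p : Hyper ν, ‖p‖ ≤ r' → χ p = 1 := fun p hp =>
    χ.one_of_mem_closedBall (by simpa using hp.trans hr'r)
  refine ⟨⟨ν, r', h', fun p => χ p * f p, hν, hr', hh', ?_, ?_, ?_, ?_⟩, ?_⟩
  · intro p
    by_cases hp : ‖p‖ < r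
    · exact (IsHolderAt.of_contDiff hβ (χ.contDiff (n := ⊤)) le_top p).mul hβ
        (hf.isHolderAt Metric.isOpen_ball (by simpa using hp))
    · refine (IsHolderAt.const hβ (0 : ℝ) p).congr ?_
      have : ∀ᶠ q in 𝓝 p, r / 2 < ‖q‖ :=
        continuous_norm.continuousAt.eventually (lt_mem_nhds (by linarith))
      filter_upwards [this] with q hq
      rw [χ.zero_of_le_dist (by simpa using hq.le), zero_mul]
  · simp [hf0]
  · intro p hp
    rw [hχ1 p hp, one_mul]
    refine (hb p ?_).le
    simp only [Metric.mem_ball, dist_zero_right]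
    linarith
  · intro y hy
    rw [mem_cylinder_iff] at hy
    have : y ∈ cylinder x ν r h := by
      rw [mem_cylinder_iff]
      exact ⟨by linarith, hy.2.trans_le ((min_le_left _ _).trans (by linarith))⟩
    rw [hmem y this, hχ1 _ hy.1.le, one_mul]
    rfl
  · intro y hy
    rw [mem_cylinder_iff] at hy
    refine hεO ?_
    rw [Metric.mem_ball, dist_eq_norm]
    have := norm_sub_le_coords (x := x) hν y
    have h3 : h' ≤ ε / 2 := min_le_right _ _
    dsimp only at hy
    linarith [hy.1, hy.2]

end Charts


/-! ### Topology and regularity of graph perturbations -/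

section Subgraph

variable {x ν : Space N}

lemma frequently_nhds_add_smul {P : Space N → Prop} {y : Space N} {a : ℝ → ℝ}
    (ha : Tendsto a atTop (𝓝 0)) (h : ∀ᶠ s in atTop, P (y + a s • ν)) :
    ∃ᶠ z in 𝓝 y, P z := by
  have hl : Tendsto (fun s => y + a s • ν) atTop (𝓝 y) := by
    simpa using tendsto_const_nhds.add (ha.smul_const ν)
  exact hl.frequently h.frequently

/-- Near a point, the closure of a strict subgraph is the closed subgraph. -/
lemma mem_closure_subgraph_iff (hν : ‖ν‖ = 1) {V : Set (Space N)} {G : Hyper ν → ℝ}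
    (hG : Continuous G) {y : Space N}
    (H : ∀ᶠ z in 𝓝 y, (z ∈ V ↔ tcoord x ν z < G (hcoord x ν z))) :
    y ∈ closure V ↔ tcoord x ν y ≤ G (hcoord x ν y) := by
  have hGc : Continuous fun z => G (hcoord x ν z) := hG.comp continuous_hcoord
  rw [mem_closure_iff_frequently]
  constructor
  · intro hf
    by_contra! hlt
    have h1 := (isOpen_lt hGc continuous_tcoord).mem_nhds hlt
    refine hf ?_
    filter_upwards [H, h1] with z hz hz1 hzV
    exact absurd (hz.1 hzV) (not_lt.2 (le_of_lt hz1))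
  · intro hle
    have := frequently_nhds_add_smul (ν := ν) (y := y)
      (P := fun z => tcoord x ν z < G (hcoord x ν z)) (a := fun s : ℝ => -s⁻¹)
      (by simpa using (tendsto_inv_atTop_zero (𝕜 := ℝ)).neg) (by
        filter_upwards [eventually_gt_atTop 0] with s hs
        rw [tcoord_add_smul hν, hcoord_add_smul]
        have : 0 < s⁻¹ := inv_pos.2 hs
        linarith)
    exact (this.and_eventually H).mono fun z hz => hz.2.2 hz.1

lemma mem_frontier_closure_subgraph_iff (hν : ‖ν‖ = 1) {V : Set (Space N)} {G : Hyper ν → ℝ}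
    (hG : Continuous G) {y : Space N}
    (H : ∀ᶠ z in 𝓝 y, (z ∈ V ↔ tcoord x ν z < G (hcoord x ν z))) :
    y ∈ frontier (closure V) ↔ tcoord x ν y = G (hcoord x ν y) := by
  have hGc : Continuous fun z => G (hcoord x ν z) := hG.comp continuous_hcoord
  have hcl : ∀ᶠ z in 𝓝 y, (z ∈ closure V ↔ tcoord x ν z ≤ G (hcoord x ν z)) := by
    filter_upwards [H.eventually_nhds] with z hz
    exact mem_closure_subgraph_iff hν hG hz
  rw [isClosed_closure.frontier_eq, Set.mem_sdiff, hcl.self_of_nhds, mem_interior_iff_mem_nhds]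
  constructor
  · rintro ⟨h1, h2⟩
    refine h1.antisymm ?_
    by_contra! hlt
    refine h2 ?_
    filter_upwards [hcl, (isOpen_lt continuous_tcoord hGc).mem_nhds hlt] with z hz hz1
    exact hz.2 (le_of_lt hz1)
  · intro he
    refine ⟨he.le, fun hmem => ?_⟩
    have := frequently_nhds_add_smul (ν := ν) (y := y)
      (P := fun z => G (hcoord x ν z) < tcoord x ν z) (a := fun s : ℝ => s⁻¹)
      tendsto_inv_atTop_zero (by
        filter_upwards [eventually_gt_atTop 0] with s hs
        rw [tcoord_add_smul hν, hcoord_add_smul]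
        have : 0 < s⁻¹ := inv_pos.2 hs
        linarith)
    refine this ?_
    filter_upwards [hcl, hmem] with z hz hz1
    exact not_lt.2 (hz.1 hz1)

lemma mem_frontier_subgraph_iff (hν : ‖ν‖ = 1) {V : Set (Space N)} (hV : IsOpen V)
    {G : Hyper ν → ℝ} (hG : Continuous G) {y : Space N}
    (H : ∀ᶠ z in 𝓝 y, (z ∈ V ↔ tcoord x ν z < G (hcoord x ν z))) :
    y ∈ frontier V ↔ tcoord x ν y = G (hcoord x ν y) := by
  rw [hV.frontier_eq, Set.mem_sdiff, mem_closure_subgraph_iff hν hG H, H.self_of_nhds, not_lt]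
  exact ⟨fun h => h.1.antisymm h.2, fun h => ⟨h.le, h.ge⟩⟩

end Subgraph

section Perturbation

variable {ℓ : ℕ} {β : ℝ≥0}

/-- `U` is an open set with compact boundary of class `C^{ℓ,β}`; the closures of these sets form
the class `𝔠`. -/
def RegularOpen (ℓ : ℕ) (β : ℝ≥0) (U : Set (Space N)) : Prop :=
  IsOpen U ∧ IsCompact (frontier U) ∧
    ∀ x ∈ frontier U, ∃ (ν : Space N) (r h : ℝ) (f : Hyper ν → ℝ),
      ‖ν‖ = 1 ∧ 0 < r ∧ 0 < h ∧ IsHolderC ℓ β f (Metric.ball 0 r) ∧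
      (∀ p ∈ Metric.ball 0 r, |f p| < h) ∧
      ∀ y ∈ cylinder x ν r h, (y ∈ U ↔ ⟪ν, y - x⟫ < f (hcoord x ν y))

lemma RegularOpen.isRegular {U : Set (Space N)} (hU : RegularOpen ℓ β U) :
    IsRegular ℓ β (closure U) := ⟨U, hU.1, hU.2.1, rfl, hU.2.2⟩

namespace GraphChart

variable {U : Set (Space N)} {x : Space N} (C : GraphChart ℓ β U x)

/-- The cylinder of the chart. -/
def cyl : Set (Space N) := cylinder x C.ν C.r C.h

/-- The compact core of the cylinder, in which all perturbations take place. -/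
def core : Set (Space N) := {y | ‖hcoord x C.ν y‖ ≤ C.r / 2 ∧ |tcoord x C.ν y| ≤ C.h / 2}

/-- The functions by which the chart function may be perturbed: small functions of class `C^{ℓ,β}`
supported in the ball of half the radius of the cylinder. -/
structure Admissible (g : Hyper C.ν → ℝ) : Prop where
  holder : ∀ p, IsHolderAt ℓ β g p
  supp : ∀ p, C.r / 2 ≤ ‖p‖ → g p = 0
  le : ∀ p, |g p| ≤ C.h / 4

/-- The open set obtained from `U` by replacing the chart function `f` by `f + g`. -/
def perturbOpen (g : Hyper C.ν → ℝ) : Set (Space N) :=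
  {y | (y ∈ C.cyl ∧ tcoord x C.ν y < C.f (hcoord x C.ν y) + g (hcoord x C.ν y)) ∨
    (y ∉ C.cyl ∧ y ∈ U)}

/-- The closed set obtained from `closure U` by replacing the chart function `f` by `f + g`. -/
def perturb (g : Hyper C.ν → ℝ) : Set (Space N) :=
  {y | (y ∈ C.cyl ∧ tcoord x C.ν y ≤ C.f (hcoord x C.ν y) + g (hcoord x C.ν y)) ∨
    (y ∉ C.cyl ∧ y ∈ closure U)}

variable {C} {g : Hyper C.ν → ℝ}

lemma isOpen_cyl : IsOpen C.cyl := isOpen_cylinder _ _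

lemma mem_cyl_iff {y : Space N} :
    y ∈ C.cyl ↔ ‖hcoord x C.ν y‖ < C.r ∧ |tcoord x C.ν y| < C.h := Iff.rfl

lemma core_subset_cyl : C.core ⊆ C.cyl := fun y hy => by
  have := C.r_pos
  have := C.h_pos
  exact ⟨by linarith [hy.1], by have := hy.2; change |tcoord x C.ν y| < C.h; linarith⟩

lemma isClosed_core : IsClosed C.core :=
  (isClosed_le continuous_hcoord.norm continuous_const).inter
    (isClosed_le continuous_tcoord.abs continuous_const)

lemma isCompact_core : IsCompact C.core := by
  refine Metric.isCompact_of_isClosed_isBounded isClosed_core ?_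
  refine (Metric.isBounded_iff_subset_closedBall x).2 ⟨C.r / 2 + C.h / 2, fun y hy => ?_⟩
  rw [Metric.mem_closedBall, dist_eq_norm]
  linarith [norm_sub_le_coords (x := x) C.norm_ν y, hy.1, hy.2]

lemma Admissible.continuous (hg : C.Admissible g) : Continuous g :=
  continuous_iff_continuousAt.2 fun p => (hg.holder p).continuousAt

lemma Admissible.continuous_add (hg : C.Admissible g) : Continuous fun p => C.f p + g p :=
  C.continuous.add hg.continuous

lemma Admissible.abs_add_le (hg : C.Admissible g) {p : Hyper C.ν} (hp : ‖p‖ ≤ C.r) :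
    |C.f p + g p| ≤ C.h / 2 := by
  have := _root_.abs_add_le (C.f p) (g p)
  linarith [C.f_le p hp, hg.le p]

lemma admissible_zero (hβ : β ≤ 1) : C.Admissible fun _ => 0 :=
  ⟨fun p => IsHolderAt.const hβ 0 p, fun _ _ => rfl, fun _ => by
    have := C.h_pos; rw [abs_zero]; positivity⟩

lemma mem_perturbOpen_of_mem_cyl {y : Space N} (hy : y ∈ C.cyl) : y ∈ C.perturbOpen g ↔
    tcoord x C.ν y < C.f (hcoord x C.ν y) + g (hcoord x C.ν y) := by
  simp [perturbOpen, hy]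

lemma mem_perturb_of_mem_cyl {y : Space N} (hy : y ∈ C.cyl) : y ∈ C.perturb g ↔
    tcoord x C.ν y ≤ C.f (hcoord x C.ν y) + g (hcoord x C.ν y) := by
  simp [perturb, hy]

lemma mem_perturb_of_notMem_cyl {y : Space N} (hy : y ∉ C.cyl) :
    y ∈ C.perturb g ↔ y ∈ closure U := by
  simp [perturb, hy]

lemma Admissible.mem_perturbOpen_of_notMem_core (hg : C.Admissible g) {y : Space N}
    (hy : y ∉ C.core) : y ∈ C.perturbOpen g ↔ y ∈ U := by
  by_cases hyc : y ∈ C.cyl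
  · rw [mem_perturbOpen_of_mem_cyl hyc, C.mem_iff y hyc]
    rw [mem_cyl_iff] at hyc
    by_cases hp : ‖hcoord x C.ν y‖ ≤ C.r / 2
    · have ht : C.h / 2 < |tcoord x C.ν y| := by
        by_contra! h
        exact hy ⟨hp, h⟩
      have h1 := abs_le.1 (hg.abs_add_le hyc.1.le)
      have h2 := abs_le.1 (C.f_le _ hyc.1.le)
      have := C.h_pos
      rcases lt_abs.1 ht with h | h
      · constructor <;> intro <;> linarith
      · constructor <;> intro <;> linarith
    · rw [hg.supp _ (not_le.1 hp).le, add_zero]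
  · simp [perturbOpen, hyc]

lemma eventually_mem_perturbOpen {y : Space N} (hy : y ∈ C.cyl) :
    ∀ᶠ z in 𝓝 y, (z ∈ C.perturbOpen g ↔
      tcoord x C.ν z < C.f (hcoord x C.ν z) + g (hcoord x C.ν z)) := by
  filter_upwards [isOpen_cyl.mem_nhds hy] with z hz
  exact mem_perturbOpen_of_mem_cyl hz

lemma Admissible.eventually_mem_iff (hg : C.Admissible g) {y : Space N} (hy : y ∉ C.core) :
    ∀ᶠ z in 𝓝 y, (z ∈ C.perturbOpen g ↔ z ∈ U) := by
  filter_upwards [isClosed_core.isOpen_compl.mem_nhds hy] with z hz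
  exact hg.mem_perturbOpen_of_notMem_core hz

lemma Admissible.isOpen_perturbOpen (hg : C.Admissible g) (hU : IsOpen U) :
    IsOpen (C.perturbOpen g) := by
  rw [isOpen_iff_mem_nhds]
  intro y hy
  by_cases hyc : y ∈ C.cyl
  · rw [mem_perturbOpen_of_mem_cyl hyc] at hy
    filter_upwards [eventually_mem_perturbOpen (g := g) hyc,
      (isOpen_lt continuous_tcoord (hg.continuous_add.comp continuous_hcoord)).mem_nhds hy]
      with z h1 h2
    exact h1.2 h2
  · have hyK : y ∉ C.core := fun h => hyc (core_subset_cyl h)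
    rw [hg.mem_perturbOpen_of_notMem_core hyK] at hy
    filter_upwards [hg.eventually_mem_iff hyK, hU.mem_nhds hy] with z h1 h2
    exact h1.2 h2

lemma mem_closure_congr {A B : Set (Space N)} {y : Space N}
    (h : ∀ᶠ z in 𝓝 y, (z ∈ A ↔ z ∈ B)) : y ∈ closure A ↔ y ∈ closure B := by
  rw [mem_closure_iff_frequently, mem_closure_iff_frequently]
  exact frequently_congr h

lemma mem_frontier_congr {A B : Set (Space N)} {y : Space N}
    (h : ∀ᶠ z in 𝓝 y, (z ∈ A ↔ z ∈ B)) : y ∈ frontier A ↔ y ∈ frontier B := by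
  rw [frontier, frontier, Set.mem_sdiff, Set.mem_sdiff, mem_closure_congr h,
    mem_interior_iff_mem_nhds, mem_interior_iff_mem_nhds]
  have : A ∈ 𝓝 y ↔ B ∈ 𝓝 y := eventually_congr h
  rw [this]

lemma Admissible.closure_perturbOpen (hg : C.Admissible g) :
    closure (C.perturbOpen g) = C.perturb g := by
  ext y
  by_cases hyc : y ∈ C.cyl
  · rw [mem_perturb_of_mem_cyl hyc]
    exact mem_closure_subgraph_iff C.norm_ν hg.continuous_add (eventually_mem_perturbOpen hyc)
  · rw [mem_perturb_of_notMem_cyl hyc]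
    exact mem_closure_congr (hg.eventually_mem_iff fun h => hyc (core_subset_cyl h))

lemma Admissible.isClosed_perturb (hg : C.Admissible g) : IsClosed (C.perturb g) :=
  hg.closure_perturbOpen ▸ isClosed_closure

lemma Admissible.mem_frontier_perturb_iff (hg : C.Admissible g) {y : Space N} (hy : y ∈ C.cyl) :
    y ∈ frontier (C.perturb g) ↔
      tcoord x C.ν y = C.f (hcoord x C.ν y) + g (hcoord x C.ν y) := by
  rw [← hg.closure_perturbOpen]
  exact mem_frontier_closure_subgraph_iff C.norm_ν hg.continuous_add (eventually_mem_perturbOpen hy)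

lemma Admissible.mem_frontier_perturbOpen_iff (hg : C.Admissible g) (hU : IsOpen U) {y : Space N}
    (hy : y ∈ C.cyl) : y ∈ frontier (C.perturbOpen g) ↔
      tcoord x C.ν y = C.f (hcoord x C.ν y) + g (hcoord x C.ν y) :=
  mem_frontier_subgraph_iff C.norm_ν (hg.isOpen_perturbOpen hU) hg.continuous_add
    (eventually_mem_perturbOpen hy)

lemma Admissible.frontier_subset (hg : C.Admissible g) :
    frontier (C.perturbOpen g) ⊆ frontier U ∪ C.core := by
  intro y hy
  by_cases hyK : y ∈ C.core
  · exact Or.inr hyK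
  · exact Or.inl ((mem_frontier_congr (hg.eventually_mem_iff hyK)).1 hy)

lemma Admissible.isCompact_frontier (hg : C.Admissible g) (hU : RegularOpen ℓ β U) :
    IsCompact (frontier (C.perturbOpen g)) :=
  (hU.2.1.union isCompact_core).of_isClosed_subset isClosed_frontier hg.frontier_subset

lemma hcoord_eq_sub (y z : Space N) (ν : Space N) :
    hcoord z ν y = hcoord x ν y - hcoord x ν z := by
  rw [hcoord_sub]; rfl

lemma tcoord_eq_sub (y z : Space N) (ν : Space N) :
    tcoord z ν y = tcoord x ν y - tcoord x ν z := by
  rw [tcoord_sub]; rfl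

/-- Graph perturbations of regular sets are regular. -/
lemma Admissible.regularOpen (hβ : β ≤ 1) (hg : C.Admissible g) (hU : RegularOpen ℓ β U) :
    RegularOpen ℓ β (C.perturbOpen g) := by
  refine ⟨hg.isOpen_perturbOpen hU.1, hg.isCompact_frontier hU, fun z hz => ?_⟩
  by_cases hzc : z ∈ C.cyl
  · rw [hg.mem_frontier_perturbOpen_iff hU.1 hzc] at hz
    have hzc' := mem_cyl_iff.1 hzc
    set p₀ := hcoord x C.ν z
    set t₀ := tcoord x C.ν z
    have ht₀ : |t₀| ≤ C.h / 2 := hz ▸ hg.abs_add_le hzc'.1.le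
    set G : Hyper C.ν → ℝ := fun p => C.f (p + p₀) + g (p + p₀) - t₀
    have hG : ∀ p, IsHolderAt ℓ β G p := by
      intro p
      have hsh : IsHolderAt ℓ β (fun p => p + p₀) p :=
        (IsHolderAt.id hβ p).add (IsHolderAt.const hβ p₀ p)
      have hc1 : ContDiffAt ℝ 1 (fun p => p + p₀) p := contDiffAt_id.add contDiffAt_const
      exact ((IsHolderAt.comp hβ ℓ (C.holder _) hsh hc1).add
        (IsHolderAt.comp hβ ℓ (hg.holder _) hsh hc1)).sub hβ (IsHolderAt.const hβ t₀ p)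
    have hG0 : G 0 = 0 := by simp only [G, zero_add, ← hz, sub_self]
    have hh := C.h_pos
    have hev : ∀ᶠ p in 𝓝 (0 : Hyper C.ν), |G p| < C.h / 4 := by
      have := (hG 0).continuousAt.abs
      rw [ContinuousAt, hG0, abs_zero] at this
      exact this.eventually (gt_mem_nhds (by positivity))
    obtain ⟨r₁, hr₁, hb⟩ := Metric.eventually_nhds_iff_ball.1 hev
    have hr2 : 0 < C.r - ‖p₀‖ := by linarith [hzc'.1]
    refine ⟨C.ν, min r₁ (C.r - ‖p₀‖), C.h / 4, G, C.norm_ν, lt_min hr₁ hr2, by positivity,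
      isHolderC_of_isHolderAt fun p _ => hG p, fun p hp => hb p
        (Metric.ball_subset_ball (min_le_left _ _) hp), fun y hy => ?_⟩
    have e1 := hcoord_eq_sub (x := x) y z C.ν
    have e2 := tcoord_eq_sub (x := x) y z C.ν
    rw [mem_cylinder_iff, e2] at hy
    have hyc : y ∈ C.cyl := by
      refine ⟨?_, ?_⟩
      · have h1 := hy.1.trans_le (min_le_right _ _)
        have h2 : ‖hcoord x C.ν y‖ ≤ ‖hcoord z C.ν y‖ + ‖p₀‖ := by
          rw [e1]
          simpa using norm_add_le (hcoord x C.ν y - hcoord x C.ν z) (hcoord x C.ν z)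
        linarith
      · have h1 := abs_lt.1 hy.2
        have h2 := abs_le.1 ht₀
        change |tcoord x C.ν y| < C.h
        rw [abs_lt]
        constructor <;> linarith
    rw [mem_perturbOpen_of_mem_cyl hyc]
    change _ ↔ tcoord z C.ν y < G (hcoord z C.ν y)
    simp only [G, e1, e2, p₀, t₀, sub_add_cancel]
    constructor <;> intro <;> linarith
  · have hzK : z ∉ C.core := fun h => hzc (core_subset_cyl h)
    have hzU := (mem_frontier_congr (hg.eventually_mem_iff hzK)).1 hz
    obtain ⟨D, hD⟩ := exists_graphChart hβ hU.1 hzU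
      (isClosed_core.isOpen_compl.mem_nhds hzK) (hU.2.2 z hzU)
    refine ⟨D.ν, D.r, D.h, D.f, D.norm_ν, D.r_pos, D.h_pos,
      isHolderC_of_isHolderAt fun p _ => D.holder p, fun p hp => ?_, fun y hy => ?_⟩
    · have := D.f_le p (by simpa using (Metric.mem_ball.1 hp).le)
      linarith [D.h_pos]
    · rw [hg.mem_perturbOpen_of_notMem_core (hD hy)]
      exact D.mem_iff y hy

lemma Admissible.isRegular (hβ : β ≤ 1) (hg : C.Admissible g) (hU : RegularOpen ℓ β U) :
    IsRegular ℓ β (C.perturb g) := by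
  rw [← hg.closure_perturbOpen]
  exact (hg.regularOpen hβ hU).isRegular

/-- If `g n → g` in `C^{ℓ,β}`, the corresponding perturbations converge in the class `𝔠`. -/
lemma tendstoRegular_perturb (hβ : β ≤ 1) (hU : RegularOpen ℓ β U) {gn : ℕ → Hyper C.ν → ℝ}
    (hg : C.Admissible g) (hgn : ∀ n, C.Admissible (gn n))
    (hlim : TendstoHolderC ℓ β gn g (Metric.ball 0 C.r)) :
    TendstoRegular ℓ β (fun n => C.perturb (gn n)) (C.perturb g) := by
  classical
  have hR := hg.regularOpen hβ hU
  -- charts of `U` away from the core of the cylinder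
  have hch : ∀ z : (frontier (C.perturbOpen g) \ C.cyl : Set (Space N)),
      ∃ D : GraphChart ℓ β U z, cylinder z D.ν D.r D.h ⊆ C.coreᶜ := by
    rintro ⟨z, hz, hzc⟩
    have hzK : z ∉ C.core := fun h => hzc (core_subset_cyl h)
    have hzU := (mem_frontier_congr (hg.eventually_mem_iff hzK)).1 hz
    exact exists_graphChart hβ hU.1 hzU (isClosed_core.isOpen_compl.mem_nhds hzK) (hU.2.2 z hzU)
  choose D hD using hch
  have hcomp : IsCompact (frontier (C.perturbOpen g) \ C.cyl) := hR.2.1.diff isOpen_cyl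
  obtain ⟨T, hT⟩ := hcomp.elim_finite_subcover
    (fun z : (frontier (C.perturbOpen g) \ C.cyl : Set (Space N)) =>
      cylinder z.1 (D z).ν (D z).r (D z).h) (fun z => isOpen_cylinder _ _) (fun y hy =>
        Set.mem_iUnion.2 ⟨⟨y, hy⟩, by
          rw [mem_cylinder_iff, hcoord_self, tcoord_self, norm_zero, abs_zero]
          exact ⟨(D ⟨y, hy⟩).r_pos, (D ⟨y, hy⟩).h_pos⟩⟩)
  let ι := Option T
  let z : ι → Space N := fun o => o.elim x fun y => y.1.1
  let ν : ι → Space N := fun o => o.elim C.ν fun y => (D y.1).ν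
  let r : ι → ℝ := fun o => o.elim C.r fun y => (D y.1).r
  let h : ι → ℝ := fun o => o.elim C.h fun y => (D y.1).h
  let f : (o : ι) → Hyper (ν o) → ℝ := fun o => match o with
    | none => fun p => C.f p + g p
    | some y => (D y.1).f
  let fn : (o : ι) → ℕ → Hyper (ν o) → ℝ := fun o => match o with
    | none => fun n p => C.f p + gn n p
    | some y => fun _ => (D y.1).f
  let e := (Fintype.equivFin ι).symm
  have hsome : ∀ (g' : Hyper C.ν → ℝ), C.Admissible g' → ∀ y : T,
      ∀ w ∈ cylinder y.1.1 (D y.1).ν (D y.1).r (D y.1).h,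
        (w ∈ C.perturb g' ↔ ⟪(D y.1).ν, w - y.1.1⟫ ≤ (D y.1).f (hcoord y.1.1 (D y.1).ν w)) := by
    intro g' hg' y w hw
    rw [← hg'.closure_perturbOpen, mem_closure_congr (hg'.eventually_mem_iff (hD y.1 hw))]
    refine mem_closure_subgraph_iff (D y.1).norm_ν (D y.1).continuous ?_
    filter_upwards [(isOpen_cylinder _ _).mem_nhds hw] with u hu
    exact (D y.1).mem_iff u hu
  have hunion : ⋃ i, cylinder (z (e i)) (ν (e i)) (r (e i)) (h (e i)) =
      ⋃ o, cylinder (z o) (ν o) (r o) (h o) :=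
    e.surjective.iUnion_comp fun o => cylinder (z o) (ν o) (r o) (h o)
  have h3 : ∀ o : ι, IsHolderC ℓ β (f o) (Metric.ball 0 (r o)) ∧
      (∀ p ∈ Metric.ball 0 (r o), |f o p| < h o) ∧
      ∀ y ∈ cylinder (z o) (ν o) (r o) (h o),
        (y ∈ C.perturb g ↔ ⟪ν o, y - z o⟫ ≤ f o (hcoord (z o) (ν o) y)) := by
    rintro (_ | y)
    · refine ⟨isHolderC_of_isHolderAt fun p _ => (C.holder p).add (hg.holder p), fun p hp => ?_,
        fun y hy => mem_perturb_of_mem_cyl hy⟩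
      have hp' : ‖(p : Hyper C.ν)‖ < C.r := mem_ball_zero_iff.1 hp
      have := hg.abs_add_le (p := p) hp'.le
      exact lt_of_le_of_lt this (by simp only [Option.elim, h]; linarith [C.h_pos])
    · refine ⟨isHolderC_of_isHolderAt fun p _ => (D y.1).holder p, fun p hp => ?_,
        hsome g hg y⟩
      have hp' : ‖(p : Hyper (D y.1).ν)‖ < (D y.1).r := mem_ball_zero_iff.1 hp
      have := (D y.1).f_le p hp'.le
      exact lt_of_le_of_lt this (by simp only [Option.elim, h]; linarith [(D y.1).h_pos])
  have h4 : ∀ o : ι, (∀ᶠ n in atTop, IsHolderC ℓ β (fn o n) (Metric.ball 0 (r o)) ∧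
        ∀ y ∈ cylinder (z o) (ν o) (r o) (h o),
          (y ∈ C.perturb (gn n) ↔ ⟪ν o, y - z o⟫ ≤ fn o n (hcoord (z o) (ν o) y))) ∧
      TendstoHolderC ℓ β (fn o) (f o) (Metric.ball 0 (r o)) := by
    rintro (_ | y)
    · refine ⟨Eventually.of_forall fun n =>
        ⟨isHolderC_of_isHolderAt fun p _ => (C.holder p).add ((hgn n).holder p),
          fun y hy => mem_perturb_of_mem_cyl hy⟩, fun ε hε => ?_⟩
      have hd : ∀ k ≤ ℓ, ∀ n, ∀ p : Hyper C.ν,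
          iteratedFDeriv ℝ k (fun p => C.f p + gn n p) p -
            iteratedFDeriv ℝ k (fun p => C.f p + g p) p =
          iteratedFDeriv ℝ k (gn n) p - iteratedFDeriv ℝ k g p := by
        intro k hk n p
        have hk' : (k : WithTop ℕ∞) ≤ ℓ := by exact_mod_cast hk
        have h1 := iteratedFDeriv_add_apply ((C.holder p).1.of_le hk')
          (((hgn n).holder p).1.of_le hk')
        have h2 := iteratedFDeriv_add_apply ((C.holder p).1.of_le hk')
          ((hg.holder p).1.of_le hk')
        change iteratedFDeriv ℝ k (C.f + gn n) p - iteratedFDeriv ℝ k (C.f + g) p = _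
        rw [h1, h2]
        abel
      filter_upwards [hlim ε hε] with n hn
      refine ⟨fun k hk p hp => (congrArg norm (hd k hk n p)).trans_le (hn.1 k hk p hp),
        fun p hp q hq => le_of_eq_of_le ?_ (hn.2 p hp q hq)⟩
      exact congrArg₂ edist (hd ℓ le_rfl n p) (hd ℓ le_rfl n q)
    · refine ⟨Eventually.of_forall fun n =>
        ⟨isHolderC_of_isHolderAt fun p _ => (D y.1).holder p, hsome _ (hgn n) y⟩, fun ε hε => ?_⟩
      refine Eventually.of_forall fun n => ⟨fun k _ p _ => ?_, fun p _ q _ => ?_⟩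
      · exact (congrArg norm (sub_self (iteratedFDeriv ℝ k (D y.1).f p))).trans_le
          (norm_zero.trans_le ε.coe_nonneg)
      · refine le_of_eq_of_le (congrArg₂ edist (sub_self (iteratedFDeriv ℝ ℓ (D y.1).f p))
          (sub_self (iteratedFDeriv ℝ ℓ (D y.1).f q))) ?_
        exact (edist_self (0 : ContinuousMultilinearMap ℝ
          (fun _ : Fin ℓ => Hyper (D y.1).ν) ℝ)).trans_le zero_le
  refine ⟨Fintype.card ι, z ∘ e, ν ∘ e, r ∘ e, h ∘ e, fun i => f (e i), fun i => fn (e i),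
    fun i => ?_, ?_, fun i => ?_, fun i => ?_, ?_⟩
  · simp only [Function.comp_apply]
    rcases e i with _ | y
    · exact ⟨C.norm_ν, C.r_pos, C.h_pos⟩
    · exact ⟨(D y.1).norm_ν, (D y.1).r_pos, (D y.1).h_pos⟩
  · simp only [Function.comp_apply]
    rw [hunion]
    intro y hy
    have hy' : y ∈ frontier (C.perturbOpen g) := by
      rw [← hg.closure_perturbOpen] at hy
      exact frontier_closure_subset hy
    by_cases hyc : y ∈ C.cyl
    · exact Set.mem_iUnion.2 ⟨none, hyc⟩
    · obtain ⟨w, hw⟩ := Set.mem_iUnion.1 (hT ⟨hy', hyc⟩)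
      obtain ⟨hwT, hw⟩ := Set.mem_iUnion.1 hw
      exact Set.mem_iUnion.2 ⟨some ⟨w, hwT⟩, hw⟩
  · exact h3 (e i)
  · exact h4 (e i)
  · refine Eventually.of_forall fun n y hy => ?_
    have hyc : y ∉ C.cyl := by
      intro h'
      refine hy ?_
      simp only [Function.comp_apply]
      rw [hunion]
      exact Set.mem_iUnion.2 ⟨none, h'⟩
    rw [mem_perturb_of_notMem_cyl hyc, mem_perturb_of_notMem_cyl hyc]

end GraphChart

end Perturbation


/-! ### Vertical diffeomorphisms -/

section Vertical

variable {ℓ : ℕ} {β : ℝ≥0}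

namespace GraphChart

variable {U : Set (Space N)} {x : Space N} (C : GraphChart ℓ β U x)

/-- A cutoff function in the vertical variable, equal to `1` on the core of the cylinder and to `0`
near its top and bottom. -/
def chi : ContDiffBump (0 : ℝ) :=
  ⟨C.h / 2, 3 * C.h / 4, by have := C.h_pos; positivity, by have := C.h_pos; linarith⟩

variable {C}

lemma chi_eq_one {t : ℝ} (ht : |t| ≤ C.h / 2) : C.chi t = 1 :=
  C.chi.one_of_mem_closedBall (by rw [Metric.mem_closedBall, dist_zero_right]; exact ht)

lemma chi_eq_zero {t : ℝ} (ht : C.h ≤ |t|) : C.chi t = 0 :=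
  C.chi.zero_of_le_dist (by
    have := C.h_pos
    simp only [chi, dist_zero_right, Real.norm_eq_abs]
    linarith)

lemma abs_chi_le (t : ℝ) : |C.chi t| ≤ 1 := by
  rw [abs_of_nonneg C.chi.nonneg]
  exact C.chi.le_one

/-- Amplitudes of vertical maps up to `M` are small enough for the maps to be invertible. -/
lemma exists_chi_deriv_bound (C : GraphChart ℓ β U x) :
    ∃ M > 0, ∀ t : ℝ, |deriv C.chi t| * M ≤ 1 / 2 := by
  have hc : Continuous (deriv C.chi) := (C.chi.contDiff (n := 1)).continuous_deriv le_rfl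
  obtain ⟨K, hK⟩ := (C.chi.hasCompactSupport.deriv).exists_bound_of_continuous hc
  have hK0 : 0 ≤ K := (norm_nonneg _).trans (hK 0)
  refine ⟨1 / (2 * (K + 1)), by positivity, fun t => ?_⟩
  have := hK t
  rw [Real.norm_eq_abs] at this
  rw [mul_one_div, div_le_div_iff₀ (by positivity) (by norm_num)]
  linarith

variable (C) in
/-- The vertical map `y ↦ y + χ(t) m(p) ν`, where `p` and `t` are the coordinates of `y`. -/
def flow (m : Hyper C.ν → ℝ) (y : Space N) : Space N :=
  y + (C.chi (tcoord x C.ν y) * m (hcoord x C.ν y)) • C.ν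

lemma hcoord_flow (m : Hyper C.ν → ℝ) (y : Space N) :
    hcoord x C.ν (C.flow m y) = hcoord x C.ν y := hcoord_add_smul _ _

lemma tcoord_flow (m : Hyper C.ν → ℝ) (y : Space N) :
    tcoord x C.ν (C.flow m y) =
      tcoord x C.ν y + C.chi (tcoord x C.ν y) * m (hcoord x C.ν y) :=
  tcoord_add_smul C.norm_ν _ _

lemma differentiable_chi_mul (μ : ℝ) : Differentiable ℝ fun t => C.chi t * μ :=
  ((C.chi.contDiff (n := 1)).differentiable one_ne_zero).mul_const μ

lemma abs_deriv_chi_mul_le {M : ℝ} (hM : ∀ t : ℝ, |deriv C.chi t| * M ≤ 1 / 2) {μ : ℝ}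
    (hμ : |μ| ≤ M) (t : ℝ) : |deriv (fun t => C.chi t * μ) t| ≤ 1 / 2 := by
  rw [deriv_mul_const (((C.chi.contDiff (n := 1)).differentiable one_ne_zero) t), abs_mul]
  exact (mul_le_mul_of_nonneg_left hμ (abs_nonneg _)).trans (hM t)

lemma strictMono_chi {M : ℝ} (hM : ∀ t : ℝ, |deriv C.chi t| * M ≤ 1 / 2) {μ : ℝ}
    (hμ : |μ| ≤ M) : StrictMono fun t => t + C.chi t * μ :=
  strictMono_id_add (differentiable_chi_mul μ) (abs_deriv_chi_mul_le hM hμ)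

/-- Vertical maps with a small `C^{ℓ,β}` amplitude form families of diffeomorphisms. -/
lemma isDiffeoFamily_flow (hβ : β ≤ 1) (hℓ : 1 ≤ ℓ) {M : ℝ}
    (hM : ∀ t : ℝ, |deriv C.chi t| * M ≤ 1 / 2) {δ : ℝ} (hδ : 0 < δ) {m : ℝ → Hyper C.ν → ℝ}
    (hm : ∀ ε ∈ Set.Ioo (-δ) δ, ∀ p,
      IsHolderAt ℓ β (fun q : ℝ × Hyper C.ν => m q.1 q.2) (ε, p))
    (h0 : ∀ p, m 0 p = 0) (hsmall : ∀ ε ∈ Set.Ioo (-δ) δ, ∀ p, |m ε p| < M) :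
    IsDiffeoFamily ℓ β δ fun ε => C.flow (m ε) := by
  have hℓ1 : (1 : WithTop ℕ∞) ≤ (ℓ : WithTop ℕ∞) := by exact_mod_cast hℓ
  refine ⟨hδ, isHolderC_of_isHolderAt ?_, fun ε hε => ?_, fun y => by simp [flow, h0]⟩
  · rintro ⟨ε, y⟩ ⟨hε, -⟩
    have hy : IsHolderAt ℓ β (fun q : ℝ × Space N => q.2) (ε, y) :=
      IsHolderAt.clm hβ (ContinuousLinearMap.snd ℝ ℝ (Space N)) _
    have hin : ContDiff ℝ (⊤ : ℕ∞) fun q : ℝ × Space N => (q.1, hcoord x C.ν q.2) :=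
      contDiff_fst.prodMk (contDiff_hcoord.comp contDiff_snd)
    have h1 : IsHolderAt ℓ β (fun q : ℝ × Space N => m q.1 (hcoord x C.ν q.2)) (ε, y) :=
      IsHolderAt.comp hβ ℓ (f := fun q : ℝ × Hyper C.ν => m q.1 q.2)
        (g := fun q : ℝ × Space N => (q.1, hcoord x C.ν q.2)) (hm ε hε _)
        (IsHolderAt.of_contDiff hβ hin le_top _) (hin.contDiffAt.of_le (mod_cast le_top))
    have hc : ContDiff ℝ (⊤ : ℕ∞) fun q : ℝ × Space N => C.chi (tcoord x C.ν q.2) :=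
      C.chi.contDiff.comp (contDiff_tcoord.comp contDiff_snd)
    exact hy.add (((IsHolderAt.of_contDiff hβ hc le_top _).mul hβ h1).smul hβ
      (IsHolderAt.const hβ C.ν _))
  · have hopen : IsOpen {μ : ℝ | |μ| < M} := isOpen_lt continuous_abs continuous_const
    obtain ⟨S, hS, hS1, hS2⟩ := exists_fiberInverse (n := ((⊤ : ℕ∞) : WithTop ℕ∞)) (by simp)
      (h := fun q : ℝ × ℝ => C.chi q.2 * q.1) hopen
      ((C.chi.contDiff.comp contDiff_snd).mul contDiff_fst).contDiffOn
      (fun μ hμ t => abs_deriv_chi_mul_le hM (le_of_lt hμ) t) (M := M) (fun μ hμ t => by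
        dsimp only
        rw [abs_mul]
        exact (mul_le_of_le_one_left (abs_nonneg _) (abs_chi_le t)).trans (le_of_lt hμ))
    set Ψ : Space N → Space N := fun y =>
      point x C.ν (hcoord x C.ν y) (S (m ε (hcoord x C.ν y), tcoord x C.ν y)) with hΨ
    refine ⟨Ψ, isHolderC_of_isHolderAt fun y _ => ?_, fun y => ?_, fun y => ?_⟩
    · have hin : ContDiff ℝ (⊤ : ℕ∞) fun y : Space N => (ε, hcoord x C.ν y) :=
        contDiff_const.prodMk contDiff_hcoord
      have h1 : IsHolderAt ℓ β (fun y : Space N => m ε (hcoord x C.ν y)) y :=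
        IsHolderAt.comp hβ ℓ (f := fun q : ℝ × Hyper C.ν => m q.1 q.2)
          (g := fun y : Space N => (ε, hcoord x C.ν y)) (hm ε hε _)
          (IsHolderAt.of_contDiff hβ hin le_top _) (hin.contDiffAt.of_le (mod_cast le_top))
      have h2 : IsHolderAt ℓ β (fun y : Space N => (m ε (hcoord x C.ν y), tcoord x C.ν y)) y :=
        h1.prodMk hβ (IsHolderAt.of_contDiff hβ (n := ⊤) contDiff_tcoord le_top _)
      have hSat : ContDiffAt ℝ ((⊤ : ℕ∞) : WithTop ℕ∞) S
          (m ε (hcoord x C.ν y), tcoord x C.ν y) :=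
        hS.contDiffAt ((hopen.prod isOpen_univ).mem_nhds ⟨hsmall ε hε _, trivial⟩)
      have h3 : IsHolderAt ℓ β
          (fun y : Space N => S (m ε (hcoord x C.ν y), tcoord x C.ν y)) y :=
        IsHolderAt.comp hβ ℓ (g := fun y : Space N => (m ε (hcoord x C.ν y), tcoord x C.ν y))
          (IsHolderAt.of_contDiffAt hβ (hSat.of_le (mod_cast le_top))) h2 (h2.1.of_le hℓ1)
      have hh : IsHolderAt ℓ β (fun y : Space N => hcoord x C.ν y) y :=
        IsHolderAt.of_contDiff hβ (n := ⊤) contDiff_hcoord le_top y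
      have h4 : IsHolderAt ℓ β (fun y : Space N => x + (Hyper C.ν).subtypeL (hcoord x C.ν y)) y :=
        (IsHolderAt.const hβ x y).add (hh.clm_comp hβ (Hyper C.ν).subtypeL)
      exact h4.add (h3.smul hβ (IsHolderAt.const hβ C.ν y))
    · have := hS2 (m ε (hcoord x C.ν y)) (hsmall ε hε _) (tcoord x C.ν y)
      simp only [hΨ, hcoord_flow, tcoord_flow]
      dsimp only at this
      rw [this, point_coords C.norm_ν]
    · refine coords_ext (x := x) C.norm_ν ?_ ?_
      · rw [hcoord_flow, hΨ, hcoord_point]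
      · have := hS1 (m ε (hcoord x C.ν y)) (hsmall ε hε _) (tcoord x C.ν y)
        dsimp only at this
        rw [tcoord_flow, hΨ]
        simp only [hcoord_point, tcoord_point C.norm_ν]
        exact this

/-- The image of a graph perturbation under a vertical map is a graph perturbation. -/
lemma flow_image_perturb {M : ℝ} (hM : ∀ t : ℝ, |deriv C.chi t| * M ≤ 1 / 2)
    {g g' : Hyper C.ν → ℝ} (hg : C.Admissible g) (hg' : C.Admissible g')
    (hsmall : ∀ p, |g' p - g p| ≤ M) (hsurj : Function.Surjective (C.flow fun p => g' p - g p)) :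
    C.flow (fun p => g' p - g p) '' C.perturb g = C.perturb g' := by
  have key : ∀ y, C.flow (fun p => g' p - g p) y ∈ C.perturb g' ↔ y ∈ C.perturb g := by
    intro y
    set p := hcoord x C.ν y with hp
    set t := tcoord x C.ν y with ht
    set T : ℝ → ℝ := fun t => t + C.chi t * (g' p - g p) with hT
    have hmono : StrictMono T := strictMono_chi hM (hsmall p)
    have hh := C.h_pos
    have htop : T C.h = C.h := by
      simp only [hT]
      rw [chi_eq_zero (le_abs_self _), zero_mul, add_zero]
    have hbot : T (-C.h) = -C.h := by
      simp only [hT]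
      rw [chi_eq_zero (by rw [abs_neg]; exact le_abs_self _), zero_mul, add_zero]
    have htc : tcoord x C.ν (C.flow (fun p => g' p - g p) y) = T t := tcoord_flow _ _
    have hhc : hcoord x C.ν (C.flow (fun p => g' p - g p) y) = p := hcoord_flow _ _
    have hcyl : C.flow (fun p => g' p - g p) y ∈ C.cyl ↔ y ∈ C.cyl := by
      rw [mem_cyl_iff, mem_cyl_iff, htc, hhc, abs_lt, abs_lt]
      have e1 : -C.h < T t ↔ -C.h < t := by rw [← hbot, hmono.lt_iff_lt, hbot]
      have e2 : T t < C.h ↔ t < C.h := by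
        conv_lhs => rw [← htop]
        exact hmono.lt_iff_lt
      rw [e1, e2]
    by_cases hy : y ∈ C.cyl
    · rw [mem_perturb_of_mem_cyl hy, mem_perturb_of_mem_cyl (hcyl.2 hy), htc, hhc]
      have hτ : T (C.f p + g p) = C.f p + g' p := by
        simp only [hT]
        rw [chi_eq_one (hg.abs_add_le (mem_cyl_iff.1 hy).1.le)]
        ring
      rw [← hτ, hmono.le_iff_le]
    · have hid : C.flow (fun p => g' p - g p) y = y := by
        have : C.chi t * (g' p - g p) = 0 := by
          by_cases hpr : ‖p‖ < C.r
          · have : C.h ≤ |t| := by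
              by_contra! h
              exact hy ⟨hpr, h⟩
            rw [chi_eq_zero this, zero_mul]
          · have : C.r / 2 ≤ ‖p‖ := by linarith [C.r_pos]
            rw [hg.supp p this, hg'.supp p this, sub_zero, mul_zero]
        rw [flow, this, zero_smul, add_zero]
      rw [hid, mem_perturb_of_notMem_cyl hy, mem_perturb_of_notMem_cyl hy]
  ext z
  constructor
  · rintro ⟨y, hy, rfl⟩
    exact (key y).2 hy
  · intro hz
    obtain ⟨y, rfl⟩ := hsurj z
    exact ⟨y, (key y).1 hz, rfl⟩

/-- Along a one-parameter family of perturbations of class `C^{ℓ,β}`, the functional is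
differentiable, with the derivative given by the first variation. -/
lemma hasDerivAt_perturb (hβ : β ≤ 1) (hℓ : 1 ≤ ℓ) {J : Set (Space N) → ℝ≥0∞}
    {κ : Space N → Set (Space N) → ℝ} (hκ : IsFirstVariation ℓ β J κ) (hU : RegularOpen ℓ β U)
    {g : ℝ → Hyper C.ν → ℝ} {c : ℝ}
    (hg : ∀ᶠ lam in 𝓝 c, C.Admissible (g lam))
    (hj : ∀ᶠ lam in 𝓝 c, ∀ p, IsHolderAt ℓ β (fun q : ℝ × Hyper C.ν => g q.1 q.2) (lam, p)) :
    IntegrableOn (fun y => κ y (C.perturb (g c)) *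
      ⟪(C.chi (tcoord x C.ν y) * deriv (fun lam => g lam (hcoord x C.ν y)) c) • C.ν,
        outerNormal (C.perturb (g c)) y⟫) (frontier (C.perturb (g c))) μHE[N - 1] ∧
    HasDerivAt (fun lam => (J (C.perturb (g lam))).toReal)
      (∫ y in frontier (C.perturb (g c)), κ y (C.perturb (g c)) *
        ⟪(C.chi (tcoord x C.ν y) * deriv (fun lam => g lam (hcoord x C.ν y)) c) • C.ν,
        outerNormal (C.perturb (g c)) y⟫ ∂μHE[N - 1]) c := by
  obtain ⟨M, hM0, hM⟩ := exists_chi_deriv_bound C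
  have hgc := hg.self_of_nhds
  have hjc := hj.self_of_nhds
  have hsm : ∀ᶠ lam in 𝓝 c, ∀ p ∈ Metric.closedBall (0 : Hyper C.ν) (C.r / 2),
      |g lam p - g c p| < M := by
    refine (isCompact_closedBall _ _).eventually_forall_of_forall_eventually fun p _ => ?_
    have h1 : ContinuousAt (fun q : ℝ × Hyper C.ν => g q.1 q.2) (c, p) := (hjc p).continuousAt
    have h2 : ContinuousAt (fun q : ℝ × Hyper C.ν => |g q.1 q.2 - g c q.2|) (c, p) :=
      (h1.sub (hgc.continuous.continuousAt.comp continuousAt_snd)).abs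
    have h3 : |g c p - g c p| < M := by simpa using hM0
    exact h2.eventually (gt_mem_nhds h3)
  obtain ⟨δ, hδ, hball⟩ := Metric.eventually_nhds_iff.1 (hg.and (hj.and hsm))
  have hδ' : ∀ ε ∈ Set.Ioo (-δ) δ, dist (c + ε) c < δ := fun ε hε => by
    rw [Real.dist_eq, add_sub_cancel_left, abs_lt]; exact hε
  set m : ℝ → Hyper C.ν → ℝ := fun ε p => g (c + ε) p - g c p with hmdef
  have hmM : ∀ ε ∈ Set.Ioo (-δ) δ, ∀ p, |m ε p| < M := by
    intro ε hε p
    obtain ⟨h1, -, h3⟩ := hball (hδ' ε hε)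
    by_cases hp : ‖p‖ ≤ C.r / 2
    · exact h3 p (by simpa using hp)
    · simp only [hmdef]
      rw [h1.supp p (not_le.1 hp).le, hgc.supp p (not_le.1 hp).le]
      simpa using hM0
  have hfam : IsDiffeoFamily ℓ β δ fun ε => C.flow (m ε) := by
    refine isDiffeoFamily_flow hβ hℓ hM hδ (fun ε hε p => ?_) (fun p => by simp [hmdef]) hmM
    have hsh : ContDiff ℝ (⊤ : ℕ∞) fun q : ℝ × Hyper C.ν => (c + q.1, q.2) :=
      (contDiff_const.add contDiff_fst).prodMk contDiff_snd
    have h1 : IsHolderAt ℓ β (fun q : ℝ × Hyper C.ν => g (c + q.1) q.2) (ε, p) :=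
      IsHolderAt.comp hβ ℓ (f := fun q : ℝ × Hyper C.ν => g q.1 q.2)
        (g := fun q : ℝ × Hyper C.ν => (c + q.1, q.2)) ((hball (hδ' ε hε)).2.1 p)
        (IsHolderAt.of_contDiff hβ hsh le_top _) (hsh.contDiffAt.of_le (mod_cast le_top))
    have h2 : IsHolderAt ℓ β (fun q : ℝ × Hyper C.ν => g c q.2) (ε, p) :=
      IsHolderAt.comp hβ ℓ (f := g c) (g := fun q : ℝ × Hyper C.ν => q.2) (hgc.holder p)
        (IsHolderAt.clm hβ (ContinuousLinearMap.snd ℝ ℝ (Hyper C.ν)) _) contDiffAt_snd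
    exact h1.sub hβ h2
  have hder : ∀ y, deriv (fun ε => C.flow (m ε) y) 0 =
      (C.chi (tcoord x C.ν y) * deriv (fun lam => g lam (hcoord x C.ν y)) c) • C.ν := by
    intro y
    have h1 : DifferentiableAt ℝ (fun q : ℝ × Hyper C.ν => g q.1 q.2) (c, hcoord x C.ν y) :=
      (hjc _).1.differentiableAt (by
        have : ℓ ≠ 0 := by omega
        exact_mod_cast this)
    have h2 : DifferentiableAt ℝ (fun lam => g lam (hcoord x C.ν y)) c :=
      DifferentiableAt.comp c (g := fun q : ℝ × Hyper C.ν => g q.1 q.2)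
        (f := fun lam => (lam, hcoord x C.ν y)) h1
        (differentiableAt_id.prodMk (differentiableAt_const _))
    have h3 : HasDerivAt (fun ε => g (c + ε) (hcoord x C.ν y))
        (deriv (fun lam => g lam (hcoord x C.ν y)) c) 0 := by
      have := HasDerivAt.comp_const_add (f := fun lam => g lam (hcoord x C.ν y)) c 0
        (by rw [add_zero]; exact h2.hasDerivAt)
      exact this
    have h4 := (((h3.sub_const (g c (hcoord x C.ν y))).const_mul
      (C.chi (tcoord x C.ν y))).smul_const C.ν).const_add y
    exact h4.deriv
  have himg : ∀ ε ∈ Set.Ioo (-δ) δ, C.flow (m ε) '' C.perturb (g c) = C.perturb (g (c + ε)) := by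
    intro ε hε
    obtain ⟨Ψ, -, -, hr⟩ := hfam.2.2.1 ε hε
    exact flow_image_perturb hM hgc (hball (hδ' ε hε)).1 (fun p => (hmM ε hε p).le) hr.surjective
  obtain ⟨hI, hD⟩ := hκ _ (hgc.isRegular hβ hU) δ _ hfam
  simp only [hder] at hI hD
  refine ⟨hI, ?_⟩
  have hD' := hD.congr_of_eventuallyEq
    (f₁ := fun ε => (J (C.perturb (g (c + ε)))).toReal) (by
      filter_upwards [Ioo_mem_nhds (neg_lt_zero.2 hδ) hδ] with ε hε
      rw [himg ε hε])
  have := HasDerivAt.comp_sub_const (f := fun ε => (J (C.perturb (g (c + ε)))).toReal) c c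
    (by rw [sub_self]; exact hD')
  simpa using this

end GraphChart

end Vertical

/-! ### The area of a nearly flat graph -/

section Area

open Module

/-- Comparison of the Hausdorff measures of two images of the same set, if the distances in the
first are at most `K` times the distances in the second. -/
lemma euclideanHausdorffMeasure_image_le {A Y Z : Type*} [MetricSpace Y] [MeasurableSpace Y]
    [BorelSpace Y] [MetricSpace Z] [MeasurableSpace Z] [BorelSpace Z] {f : A → Y} {g : A → Z}
    {s : Set A} {K : ℝ≥0} (h : ∀ p ∈ s, ∀ q ∈ s, dist (f p) (f q) ≤ K * dist (g p) (g q)) (d : ℕ) :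
    μHE[d] (f '' s) ≤ (K : ℝ≥0∞) ^ d * μHE[d] (g '' s) := by
  rcases s.eq_empty_or_nonempty with rfl | ⟨a, -⟩
  · simp
  have : Nonempty A := ⟨a⟩
  set k : Z → Y := fun z => f (Function.invFunOn g s z)
  have hinv : ∀ z ∈ g '' s, Function.invFunOn g s z ∈ s ∧ g (Function.invFunOn g s z) = z :=
    fun z hz => ⟨Function.invFunOn_mem hz, Function.invFunOn_eq hz⟩
  have hk : LipschitzOnWith K k (g '' s) := by
    refine LipschitzOnWith.of_dist_le_mul fun z hz w hw => ?_
    have := h _ (hinv z hz).1 _ (hinv w hw).1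
    rwa [(hinv z hz).2, (hinv w hw).2] at this
  have himg : f '' s ⊆ k '' (g '' s) := by
    rintro _ ⟨p, hp, rfl⟩
    refine ⟨g p, ⟨p, hp, rfl⟩, ?_⟩
    have hz := hinv (g p) ⟨p, hp, rfl⟩
    have := h _ hz.1 _ hp
    rw [hz.2, dist_self, mul_zero] at this
    exact dist_le_zero.1 this
  have := hk.hausdorffMeasure_image_le (Nat.cast_nonneg d)
  rw [ENNReal.rpow_natCast] at this
  simp only [Measure.euclideanHausdorffMeasure_def, Measure.smul_apply]
  calc _ ≤ Measure.addHaarScalarFactor (volume : Measure (EuclideanSpace ℝ (Fin d))) μH[d] •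
        ((K : ℝ≥0∞) ^ d * μH[d] (g '' s)) := by
        gcongr
        exact (measure_mono himg).trans this
    _ = _ := by rw [ENNReal.smul_def, ENNReal.smul_def, smul_eq_mul, smul_eq_mul]; ring

/-- The linear map `p ↦ p + μ ⟪a, p⟫ a` with `μ = 1 / (1 + √(1 + |a|²))`. It has the same metric
distortion as the graph of the linear function `⟪a, ·⟫`. -/
def graphDistortion {H : Type*} [NormedAddCommGroup H] [InnerProductSpace ℝ H] (a : H) :
    H →ₗ[ℝ] H :=
  LinearMap.transvection (innerSL ℝ a).toLinearMap ((1 + √(1 + ‖a‖ ^ 2))⁻¹ • a)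

lemma norm_sq_graphDistortion {H : Type*} [NormedAddCommGroup H] [InnerProductSpace ℝ H]
    (a p : H) : ‖graphDistortion a p‖ ^ 2 = ‖p‖ ^ 2 + ⟪a, p⟫ ^ 2 := by
  have e : graphDistortion a p = p + (⟪a, p⟫ * (1 + √(1 + ‖a‖ ^ 2))⁻¹) • a := by
    simp [graphDistortion, LinearMap.transvection.apply, smul_smul]
  have hs : √(1 + ‖a‖ ^ 2) ^ 2 = 1 + ‖a‖ ^ 2 := Real.sq_sqrt (by positivity)
  have hp : 0 < 1 + √(1 + ‖a‖ ^ 2) := by positivity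
  rw [e, norm_add_sq_real, norm_smul, inner_smul_right, mul_pow, Real.norm_eq_abs, sq_abs,
    real_inner_comm a p]
  set S := √(1 + ‖a‖ ^ 2)
  have ha : ‖a‖ ^ 2 = S ^ 2 - 1 := by linarith
  rw [ha]
  field_simp
  ring

lemma det_graphDistortion {H : Type*} [NormedAddCommGroup H] [InnerProductSpace ℝ H]
    [FiniteDimensional ℝ H] (a : H) :
    LinearMap.det (graphDistortion a) = √(1 + ‖a‖ ^ 2) := by
  have hs : √(1 + ‖a‖ ^ 2) ^ 2 = 1 + ‖a‖ ^ 2 := Real.sq_sqrt (by positivity)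
  have hp : 0 < 1 + √(1 + ‖a‖ ^ 2) := by positivity
  rw [graphDistortion, LinearMap.transvection.det]
  simp only [ContinuousLinearMap.coe_coe, innerSL_apply_apply, inner_smul_right,
    real_inner_self_eq_norm_sq]
  set S := √(1 + ‖a‖ ^ 2)
  have ha : ‖a‖ ^ 2 = S ^ 2 - 1 := by linarith
  rw [ha]
  field_simp
  ring

variable {x ν : Space N}

lemma finrank_hyper (hν : ‖ν‖ = 1) : finrank ℝ (Hyper ν) = N - 1 := by
  have h1 := Submodule.finrank_add_finrank_orthogonal (Submodule.span ℝ {ν})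
  have hν0 : ν ≠ 0 := by rintro rfl; simp at hν
  rw [finrank_span_singleton hν0, finrank_euclideanSpace_fin] at h1
  exact (Nat.sub_eq_of_eq_add' h1.symm).symm

/-- A graph which is `C^1`-close to a linear one has nearly the same metric distortion. -/
lemma norm_graph_sub_le (hν : ‖ν‖ = 1) {a : Hyper ν} {G : Hyper ν → ℝ} {ε : ℝ} (hε0 : 0 ≤ ε)
    {p q : Hyper ν} (h : |G p - G q - ⟪a, p - q⟫| ≤ ε * ‖p - q‖) :
    ‖point x ν p (G p) - point x ν q (G q)‖ ≤ (1 + ε) * ‖graphDistortion a (p - q)‖ ∧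
    (1 - ε) * ‖graphDistortion a (p - q)‖ ≤ ‖point x ν p (G p) - point x ν q (G q)‖ := by
  have e1 : point x ν p (G p) - point x ν q (G q) =
      (((p - q : Hyper ν) : Space N) + ⟪a, p - q⟫ • ν) + (G p - G q - ⟪a, p - q⟫) • ν := by
    rw [point_sub, sub_smul (G p - G q)]; abel
  have e2 : ‖((p - q : Hyper ν) : Space N) + ⟪a, p - q⟫ • ν‖ = ‖graphDistortion a (p - q)‖ := by
    rw [← sq_eq_sq₀ (norm_nonneg _) (norm_nonneg _), norm_sq_hyper_add hν, norm_sq_graphDistortion]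
  have e3 : ‖p - q‖ ≤ ‖graphDistortion a (p - q)‖ := by
    refine abs_le_of_sq_le_sq' ?_ (norm_nonneg _) |>.2
    rw [norm_sq_graphDistortion]
    nlinarith [sq_nonneg ⟪a, p - q⟫]
  have e4 : ‖(G p - G q - ⟪a, p - q⟫) • ν‖ ≤ ε * ‖graphDistortion a (p - q)‖ := by
    rw [norm_smul, hν, mul_one, Real.norm_eq_abs]
    exact h.trans (mul_le_mul_of_nonneg_left e3 hε0)
  rw [e1]
  constructor
  · refine (norm_add_le _ _).trans ?_
    rw [e2]; linarith
  · have := norm_sub_le_norm_add (((p - q : Hyper ν) : Space N) + ⟪a, p - q⟫ • ν)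
      ((G p - G q - ⟪a, p - q⟫) • ν)
    rw [e2] at this
    linarith

lemma volume_image_graphDistortion (a : Hyper ν) (s : Set (Hyper ν)) :
    volume (graphDistortion a '' s) = ENNReal.ofReal (√(1 + ‖a‖ ^ 2)) * volume s := by
  rw [Measure.addHaar_image_linearMap, det_graphDistortion, abs_of_nonneg (Real.sqrt_nonneg _)]

/-- An upper bound for the area of a graph over a set on which the slope is close to `a`. -/
lemma euclideanHausdorffMeasure_graph_le (hν : ‖ν‖ = 1) {a : Hyper ν} {G : Hyper ν → ℝ} {ε : ℝ}
    (hε0 : 0 ≤ ε) {s : Set (Hyper ν)}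
    (h : ∀ p ∈ s, ∀ q ∈ s, |G p - G q - ⟪a, p - q⟫| ≤ ε * ‖p - q‖) :
    μHE[N - 1] ((fun p => point x ν p (G p)) '' s) ≤
      ENNReal.ofReal ((1 + ε) ^ (N - 1)) * (ENNReal.ofReal (√(1 + ‖a‖ ^ 2)) * volume s) := by
  have := euclideanHausdorffMeasure_image_le (f := fun p => point x ν p (G p))
    (g := graphDistortion a) (s := s) (K := Real.toNNReal (1 + ε)) (fun p hp q hq => by
      rw [dist_eq_norm, dist_eq_norm, ← map_sub, Real.coe_toNNReal _ (by positivity)]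
      exact (norm_graph_sub_le hν hε0 (h p hp q hq)).1) (N - 1)
  rw [← finrank_hyper hν, InnerProductSpace.euclideanHausdorffMeasure_eq_volume,
    volume_image_graphDistortion] at this
  rw [← finrank_hyper hν, ENNReal.ofReal_pow (by positivity)]
  exact this

/-- A lower bound for the area of a graph over a set on which the slope is close to `a`. -/
lemma le_euclideanHausdorffMeasure_graph (hν : ‖ν‖ = 1) {a : Hyper ν} {G : Hyper ν → ℝ} {ε : ℝ}
    (hε0 : 0 ≤ ε) (hε : ε ≤ 1 / 2) {s : Set (Hyper ν)}
    (h : ∀ p ∈ s, ∀ q ∈ s, |G p - G q - ⟪a, p - q⟫| ≤ ε * ‖p - q‖) :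
    ENNReal.ofReal (√(1 + ‖a‖ ^ 2)) * volume s ≤ ENNReal.ofReal ((1 + 2 * ε) ^ (N - 1)) *
      μHE[N - 1] ((fun p => point x ν p (G p)) '' s) := by
  have := euclideanHausdorffMeasure_image_le (g := fun p => point x ν p (G p))
    (f := graphDistortion a) (s := s) (K := Real.toNNReal (1 + 2 * ε)) (fun p hp q hq => by
      rw [dist_eq_norm, dist_eq_norm, ← map_sub, Real.coe_toNNReal _ (by positivity)]
      have h1 := (norm_graph_sub_le (x := x) hν hε0 (h p hp q hq)).2
      have h2 : (1 + 2 * ε) * ((1 - ε) * ‖graphDistortion a (p - q)‖) ≤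
        (1 + 2 * ε) * ‖point x ν p (G p) - point x ν q (G q)‖ := by gcongr
      refine le_trans ?_ h2
      rw [← mul_assoc]
      exact le_mul_of_one_le_left (norm_nonneg _) (by nlinarith)) (N - 1)
  rw [← finrank_hyper hν, InnerProductSpace.euclideanHausdorffMeasure_eq_volume,
    volume_image_graphDistortion] at this
  rw [← finrank_hyper hν, ENNReal.ofReal_pow (by positivity)]
  exact this

/-- Integrals against two comparable measures are close. -/
lemma abs_integral_sub_le_of_le {α : Type*} [MeasurableSpace α] {μ μ' : Measure α} {K : ℝ}
    (hK : 1 ≤ K) (h1 : μ ≤ ENNReal.ofReal K • μ') (h2 : μ' ≤ ENNReal.ofReal K • μ)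
    {u : α → ℝ} (hu : Integrable u μ) (hu' : Integrable u μ') :
    |∫ z, u z ∂μ - ∫ z, u z ∂μ'| ≤ (K - 1) * ∫ z, |u z| ∂μ' := by
  have hmono : ∀ (μ₁ μ₂ : Measure α), μ₁ ≤ ENNReal.ofReal K • μ₂ → ∀ v : α → ℝ, (∀ z, 0 ≤ v z) →
      Integrable v μ₂ → ∫ z, v z ∂μ₁ ≤ K * ∫ z, v z ∂μ₂ := by
    intro μ₁ μ₂ h v hv hvi
    have := integral_mono_measure h (Eventually.of_forall hv)
      (hvi.smul_measure ENNReal.ofReal_ne_top)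
    rwa [integral_smul_measure, ENNReal.toReal_ofReal (by linarith), smul_eq_mul] at this
  have hpos : ∀ v : α → ℝ, (∀ z, 0 ≤ v z) → Integrable v μ → Integrable v μ' →
      |∫ z, v z ∂μ - ∫ z, v z ∂μ'| ≤ (K - 1) * ∫ z, v z ∂μ' := by
    intro v hv hvi hvi'
    have e1 := hmono μ μ' h1 v hv hvi'
    have e2 := hmono μ' μ h2 v hv hvi
    have e3 : 0 ≤ ∫ z, v z ∂μ' := integral_nonneg hv
    have e4 : 0 ≤ ∫ z, v z ∂μ := integral_nonneg hv
    rw [abs_le]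
    constructor
    · rcases le_total (∫ z, v z ∂μ) (∫ z, v z ∂μ') with h | h
      · nlinarith
      · nlinarith
    · linarith
  have hp := hpos (fun z => max (u z) 0) (fun z => le_max_right _ _) hu.pos_part hu'.pos_part
  have hn := hpos (fun z => max (-u z) 0) (fun z => le_max_right _ _) hu.neg_part hu'.neg_part
  have e : ∀ z, u z = max (u z) 0 - max (-u z) 0 := fun z => by
    rcases le_total 0 (u z) with h | h <;> simp [h]
  have ea : ∀ z, |u z| = max (u z) 0 + max (-u z) 0 := fun z => by
    rcases le_total 0 (u z) with h | h <;> simp [h, abs_of_nonneg, abs_of_nonpos]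
  have i1 : ∫ z, u z ∂μ = ∫ z, max (u z) 0 ∂μ - ∫ z, max (-u z) 0 ∂μ := by
    rw [← integral_sub hu.pos_part hu.neg_part]; exact integral_congr_ae (Eventually.of_forall e)
  have i2 : ∫ z, u z ∂μ' = ∫ z, max (u z) 0 ∂μ' - ∫ z, max (-u z) 0 ∂μ' := by
    rw [← integral_sub hu'.pos_part hu'.neg_part]; exact integral_congr_ae (Eventually.of_forall e)
  have i3 : ∫ z, |u z| ∂μ' = ∫ z, max (u z) 0 ∂μ' + ∫ z, max (-u z) 0 ∂μ' := by
    rw [← integral_add hu'.pos_part hu'.neg_part]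
    exact integral_congr_ae (Eventually.of_forall ea)
  rw [i1, i2, i3, mul_add]
  rw [abs_le] at hp hn ⊢
  constructor <;> linarith [hp.1, hp.2, hn.1, hn.2]

end Area

/-! ### The outer normal of a subgraph -/

section Normal

variable {x ν : Space N}

lemma IsOuterUnitNormal.eq {E : Set (Space N)} {y n₁ n₂ : Space N}
    (h₁ : IsOuterUnitNormal E y n₁) (h₂ : IsOuterUnitNormal E y n₂) : n₁ = n₂ := by
  by_contra hne
  have hv : 0 < ‖n₁ - n₂‖ := norm_pos_iff.2 (sub_ne_zero.2 hne)
  have hsq : ‖n₁ - n₂‖ ^ 2 = 2 - 2 * ⟪n₁, n₂⟫ := by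
    rw [norm_sub_sq_real, h₁.1, h₂.1]; ring
  set c := 1 - ⟪n₁, n₂⟫ with hc
  have hc0 : 0 < c := by nlinarith [sq_pos_of_pos hv]
  have i1 : ⟪n₁, n₁ - n₂⟫ = c := by
    rw [inner_sub_right, real_inner_self_eq_norm_sq, h₁.1]; ring
  have i2 : ⟪n₂, n₁ - n₂⟫ = -c := by
    rw [inner_sub_right, real_inner_self_eq_norm_sq, h₂.1, real_inner_comm]; ring
  set ε := c / (2 * ‖n₁ - n₂‖)
  have hε : 0 < ε := by positivity
  obtain ⟨r₁, hr₁, H₁⟩ := h₁.2 ε hε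
  obtain ⟨r₂, hr₂, H₂⟩ := h₂.2 ε hε
  set s := min r₁ r₂ / (2 * ‖n₁ - n₂‖)
  have hs : 0 < s := by have := lt_min hr₁ hr₂; positivity
  set z := y + s • (n₁ - n₂)
  have hz : z - y = s • (n₁ - n₂) := add_sub_cancel_left _ _
  have hzn : ‖z - y‖ = s * ‖n₁ - n₂‖ := by rw [hz, norm_smul, Real.norm_of_nonneg hs.le]
  have hsm : s * ‖n₁ - n₂‖ = min r₁ r₂ / 2 := by simp only [s]; field_simp
  have hzb : ‖z - y‖ < min r₁ r₂ := by
    rw [hzn, hsm]; linarith [lt_min hr₁ hr₂]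
  have hεz : ε * ‖z - y‖ = s * (c / 2) := by
    rw [hzn]; simp only [ε]; field_simp
  have hlt : s * (c / 2) < s * c := by nlinarith [mul_pos hs hc0]
  refine (H₁ z ?_).1 ?_ ((H₂ z ?_).2 ?_)
  · rw [Metric.mem_ball, dist_eq_norm]; exact hzb.trans_le (min_le_left _ _)
  · rw [hεz, hz, inner_smul_right, i1]; exact hlt
  · rw [Metric.mem_ball, dist_eq_norm]; exact hzb.trans_le (min_le_right _ _)
  · rw [hεz, hz, inner_smul_right, i2]; linarith

/-- The outer normal of the subgraph of `G` at a point of differentiability. -/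
lemma isOuterUnitNormal_subgraph (hν : ‖ν‖ = 1) {E : Set (Space N)} {G : Hyper ν → ℝ}
    {y : Space N} (hG : DifferentiableAt ℝ G (hcoord x ν y))
    (hy : tcoord x ν y = G (hcoord x ν y))
    (H : ∀ᶠ z in 𝓝 y, (z ∈ E ↔ tcoord x ν z ≤ G (hcoord x ν z))) :
    IsOuterUnitNormal E y ((√(1 + ‖fderiv ℝ G (hcoord x ν y)‖ ^ 2))⁻¹ •
      (ν - ((InnerProductSpace.toDual ℝ (Hyper ν)).symm (fderiv ℝ G (hcoord x ν y)) :
        Space N))) := by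
  set b := (InnerProductSpace.toDual ℝ (Hyper ν)).symm (fderiv ℝ G (hcoord x ν y)) with hb
  have hbn : ‖b‖ = ‖fderiv ℝ G (hcoord x ν y)‖ := LinearIsometryEquiv.norm_map _ _
  have hbi : ∀ v, fderiv ℝ G (hcoord x ν y) v = ⟪b, v⟫ := fun v =>
    (InnerProductSpace.toDual_symm_apply (x := v)).symm
  rw [← hbn]
  set S := √(1 + ‖b‖ ^ 2)
  have hS1 : 1 ≤ S := Real.one_le_sqrt.2 (by nlinarith [sq_nonneg ‖b‖])
  have hS0 : 0 < S := by linarith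
  have hSsq : S ^ 2 = 1 + ‖b‖ ^ 2 := Real.sq_sqrt (by positivity)
  have hnorm : ‖ν - (b : Space N)‖ = S := by
    rw [← sq_eq_sq₀ (norm_nonneg _) hS0.le, norm_sub_sq_real, inner_hyper, hν, hSsq]
    simp
  have hin : ∀ w : Space N, S * ⟪S⁻¹ • (ν - (b : Space N)), w⟫ =
      ⟪ν, w⟫ - ⟪b, (Hyper ν).orthogonalProjectionOnto w⟫ := by
    intro w
    rw [inner_smul_left, inner_sub_left]
    have : ⟪(b : Space N), w⟫ = ⟪b, (Hyper ν).orthogonalProjectionOnto w⟫ :=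
      (Submodule.inner_orthogonalProjectionOnto_eq_of_mem_left b w).symm
    rw [this]
    simp only [conj_trivial]
    rw [← mul_assoc, mul_inv_cancel₀ hS0.ne', one_mul]
  refine ⟨by rw [norm_smul, hnorm, norm_inv, Real.norm_of_nonneg hS0.le, inv_mul_cancel₀ hS0.ne'],
    fun ε hε => ?_⟩
  have hder := (hasFDerivAt_iff_isLittleO.1 hG.hasFDerivAt).def hε
  have hev : ∀ᶠ z in 𝓝 y, ‖G (hcoord x ν z) - G (hcoord x ν y) -
      fderiv ℝ G (hcoord x ν y) (hcoord x ν z - hcoord x ν y)‖ ≤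
      ε * ‖hcoord x ν z - hcoord x ν y‖ := continuous_hcoord.continuousAt.eventually hder
  obtain ⟨r, hr, hball⟩ := Metric.eventually_nhds_iff_ball.1 (H.and hev)
  refine ⟨r, hr, fun z hz => ?_⟩
  obtain ⟨h1, h2⟩ := hball z hz
  rw [hbi, Real.norm_eq_abs, hcoord_sub] at h2
  have h3 := h2.trans (mul_le_mul_of_nonneg_left (norm_projection_le (z - y)) hε.le)
  rw [abs_le] at h3
  have h4 := hin (z - y)
  have h5 := tcoord_sub x ν z y
  have h6 : ε * ‖z - y‖ ≤ S * (ε * ‖z - y‖) := le_mul_of_one_le_left (by positivity) hS1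
  constructor
  · intro hlt
    rw [h1, not_le]
    have := mul_lt_mul_of_pos_left hlt hS0
    linarith
  · intro hlt
    rw [h1]
    have := mul_lt_mul_of_pos_left hlt hS0
    linarith

lemma inner_outerNormal_subgraph (hν : ‖ν‖ = 1) {E : Set (Space N)} {G : Hyper ν → ℝ}
    {y : Space N} (hG : DifferentiableAt ℝ G (hcoord x ν y))
    (hy : tcoord x ν y = G (hcoord x ν y))
    (H : ∀ᶠ z in 𝓝 y, (z ∈ E ↔ tcoord x ν z ≤ G (hcoord x ν z))) :
    ⟪ν, outerNormal E y⟫ = (√(1 + ‖fderiv ℝ G (hcoord x ν y)‖ ^ 2))⁻¹ := by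
  have h1 := isOuterUnitNormal_subgraph hν hG hy H
  have h2 : IsOuterUnitNormal E y (outerNormal E y) := Classical.epsilon_spec ⟨_, h1⟩
  rw [h2.eq h1, inner_smul_right, inner_sub_right, inner_hyper, real_inner_self_eq_norm_sq, hν]
  norm_num

lemma abs_inv_sqrt_sub_le (s t : ℝ) : |(√(1 + s ^ 2))⁻¹ - (√(1 + t ^ 2))⁻¹| ≤ |s - t| := by
  set S := √(1 + s ^ 2)
  set T := √(1 + t ^ 2)
  have hS : S ^ 2 = 1 + s ^ 2 := Real.sq_sqrt (by positivity)
  have hT : T ^ 2 = 1 + t ^ 2 := Real.sq_sqrt (by positivity)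
  have hS1 : 1 ≤ S := Real.one_le_sqrt.2 (by nlinarith [sq_nonneg s])
  have hT1 : 1 ≤ T := Real.one_le_sqrt.2 (by nlinarith [sq_nonneg t])
  have hsS : |s| ≤ S := abs_le_of_sq_le_sq (by linarith) (by linarith)
  have htT : |t| ≤ T := abs_le_of_sq_le_sq (by linarith) (by linarith)
  have e1 : S⁻¹ - T⁻¹ = (T - S) / (S * T) := by field_simp
  have e2 : |T - S| * (S + T) = |t - s| * |t + s| := by
    rw [← abs_of_nonneg (show 0 ≤ S + T by linarith), ← abs_mul, ← abs_mul]
    congr 1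
    nlinarith
  have e3 : |t + s| ≤ S + T := (abs_add_le t s).trans (by linarith)
  have e4 : |T - S| ≤ |t - s| := by
    have h : |T - S| * (S + T) ≤ |t - s| * (S + T) := by
      rw [e2]; exact mul_le_mul_of_nonneg_left e3 (abs_nonneg _)
    exact le_of_mul_le_mul_right h (by linarith)
  rw [e1, abs_div, abs_of_pos (show 0 < S * T by positivity), abs_sub_comm s t]
  refine (div_le_self (abs_nonneg _) ?_).trans e4
  nlinarith

end Normal

/-! ### Estimating the first variation -/

section FirstVariation

variable {ℓ : ℕ} {β : ℝ≥0}

/-- The error made when the first variation of a graph perturbation is computed with constant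
curvature and constant slope, if these are known up to `ε`. -/
def variationError (N : ℕ) (κ₀ c ε : ℝ) : ℝ :=
  ε * (1 + |κ₀|) * (c * (1 + 2 * ε) ^ (N - 1)) + |κ₀| * ((1 + 2 * ε) ^ (N - 1) - 1)

lemma exists_variationError_le (N : ℕ) (κ₀ c : ℝ) {η : ℝ} (hη : 0 < η) :
    ∃ ε > 0, ε ≤ 1 / 2 ∧ variationError N κ₀ c ε ≤ η := by
  have hc : Continuous (variationError N κ₀ c) := by unfold variationError; fun_prop
  have h0 : variationError N κ₀ c 0 = 0 := by simp [variationError]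
  have h1 : ∀ᶠ ε in 𝓝 (0 : ℝ), variationError N κ₀ c ε < η :=
    hc.continuousAt.eventually (gt_mem_nhds (by rw [h0]; exact hη))
  obtain ⟨δ, hδ, hb⟩ := Metric.eventually_nhds_iff.1 h1
  refine ⟨min (δ / 2) (1 / 2), by positivity, min_le_right _ _, (hb ?_).le⟩
  rw [Real.dist_eq, sub_zero, abs_of_pos (by positivity)]
  exact (min_le_left _ _).trans_lt (by linarith)

namespace GraphChart

variable {U : Set (Space N)} {x : Space N} {C : GraphChart ℓ β U x} {g : Hyper C.ν → ℝ}

lemma Admissible.differentiable_add (hℓ : 1 ≤ ℓ) (hg : C.Admissible g) :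
    Differentiable ℝ fun p => C.f p + g p := fun p =>
  ((C.holder p).add (hg.holder p)).1.differentiableAt (by
    have : ℓ ≠ 0 := by omega
    exact_mod_cast this)

lemma Admissible.point_mem_cyl (hg : C.Admissible g) {p : Hyper C.ν} (hp : ‖p‖ < C.r) :
    point x C.ν p (C.f p + g p) ∈ C.cyl := by
  rw [mem_cyl_iff, hcoord_point, tcoord_point C.norm_ν]
  have := hg.abs_add_le hp.le
  exact ⟨hp, by linarith [C.h_pos]⟩

lemma Admissible.point_mem_frontier (hg : C.Admissible g) {p : Hyper C.ν} (hp : ‖p‖ < C.r) :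
    point x C.ν p (C.f p + g p) ∈ frontier (C.perturb g) := by
  rw [hg.mem_frontier_perturb_iff (hg.point_mem_cyl hp), hcoord_point, tcoord_point C.norm_ν]

/-- The first variation of a graph perturbation in a small cylinder is close to the integral over
the base of the vertical velocity times the curvature at the centre. -/
lemma Admissible.abs_firstVariation_sub_le (hℓ : 1 ≤ ℓ) (hg : C.Admissible g)
    {L : Hyper C.ν →L[ℝ] ℝ} {k : Space N → ℝ} {κ₀ ε ρ : ℝ} (hε0 : 0 ≤ ε) (hε : ε ≤ 1 / 2)
    (hρ : ρ ≤ C.r / 2)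
    (hL : ∀ p, ‖p‖ < ρ → ‖fderiv ℝ (fun p => C.f p + g p) p - L‖ ≤ ε)
    (hk : ∀ p, ‖p‖ < ρ → |k (point x C.ν p (C.f p + g p)) - κ₀| ≤ ε)
    {u : Hyper C.ν → ℝ} (hu : Continuous u) (hus : ∀ p, ρ ≤ ‖p‖ → u p = 0)
    (hI : IntegrableOn (fun y => k y * ⟪(C.chi (tcoord x C.ν y) * u (hcoord x C.ν y)) • C.ν,
      outerNormal (C.perturb g) y⟫) (frontier (C.perturb g)) μHE[N - 1]) :
    |∫ y in frontier (C.perturb g), k y *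
        ⟪(C.chi (tcoord x C.ν y) * u (hcoord x C.ν y)) • C.ν,
          outerNormal (C.perturb g) y⟫ ∂μHE[N - 1] - κ₀ * ∫ p, u p| ≤
      variationError N κ₀ (√(1 + ‖L‖ ^ 2)) ε * ∫ p, |u p| := by
  have hrpos := C.r_pos
  have hhpos := C.h_pos
  set F : Space N → ℝ := fun y => k y *
    ⟪(C.chi (tcoord x C.ν y) * u (hcoord x C.ν y)) • C.ν, outerNormal (C.perturb g) y⟫ with hF
  set G : Hyper C.ν → ℝ := fun p => C.f p + g p with hG
  set c := √(1 + ‖L‖ ^ 2) with hc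
  set K := (1 + 2 * ε) ^ (N - 1) with hKdef
  have hc1 : 1 ≤ c := Real.one_le_sqrt.2 (by nlinarith [sq_nonneg ‖L‖])
  have hK1 : 1 ≤ K := one_le_pow₀ (by linarith)
  have hGc : Continuous G := hg.continuous_add
  have hGd : Differentiable ℝ G := hg.differentiable_add hℓ
  -- the part of the graph lying over the small ball
  set Γ : Set (Space N) := {y | ‖hcoord x C.ν y‖ < ρ ∧ tcoord x C.ν y = G (hcoord x C.ν y)} with hΓ
  have hΓm : MeasurableSet Γ :=
    (isOpen_lt continuous_hcoord.norm continuous_const).measurableSet.inter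
      (isClosed_eq continuous_tcoord (hGc.comp continuous_hcoord)).measurableSet
  have hΓcyl : ∀ y ∈ Γ, y ∈ C.cyl := by
    rintro y ⟨h1, h2⟩
    have h3 : ‖hcoord x C.ν y‖ < C.r := by linarith
    refine ⟨h3, ?_⟩
    have := hg.abs_add_le h3.le
    change |tcoord x C.ν y| < C.h
    rw [h2]
    exact this.trans_lt (by linarith)
  have hΓfr : Γ ⊆ frontier (C.perturb g) := fun y hy =>
    (hg.mem_frontier_perturb_iff (hΓcyl y hy)).2 hy.2
  have hΓpt : ∀ y ∈ Γ, point x C.ν (hcoord x C.ν y) (G (hcoord x C.ν y)) = y := by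
    rintro y ⟨-, h2⟩
    rw [← h2, point_coords C.norm_ν]
  have hFzero : ∀ y ∈ frontier (C.perturb g) \ Γ, F y = 0 := by
    rintro y ⟨hy1, hy2⟩
    have : C.chi (tcoord x C.ν y) * u (hcoord x C.ν y) = 0 := by
      by_cases hp : ‖hcoord x C.ν y‖ < ρ
      · by_cases ht : C.h ≤ |tcoord x C.ν y|
        · rw [chi_eq_zero ht, zero_mul]
        · have hyc : y ∈ C.cyl := mem_cyl_iff.2 ⟨by linarith, not_le.1 ht⟩
          exact absurd ⟨hp, (hg.mem_frontier_perturb_iff hyc).1 hy1⟩ hy2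
      · rw [hus _ (not_lt.1 hp), mul_zero]
    simp only [hF]
    rw [this, zero_smul, inner_zero_left, mul_zero]
  have hint : ∫ y in frontier (C.perturb g), F y ∂μHE[N - 1] = ∫ y in Γ, F y ∂μHE[N - 1] :=
    setIntegral_eq_of_subset_of_forall_sdiff_eq_zero isClosed_frontier.measurableSet hΓfr hFzero
  have hIΓ : IntegrableOn F Γ μHE[N - 1] := hI.mono_set hΓfr
  -- the projected area measure is comparable to Lebesgue measure
  set a := (InnerProductSpace.toDual ℝ (Hyper C.ν)).symm L with ha
  have han : ‖a‖ = ‖L‖ := LinearIsometryEquiv.norm_map _ _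
  have hai : ∀ v, ⟪a, v⟫ = L v := fun v => InnerProductSpace.toDual_symm_apply
  have hlip : ∀ p ∈ Metric.ball (0 : Hyper C.ν) ρ, ∀ q ∈ Metric.ball (0 : Hyper C.ν) ρ,
      |G p - G q - ⟪a, p - q⟫| ≤ ε * ‖p - q‖ := by
    intro p hp q hq
    rw [hai]
    exact (convex_ball (0 : Hyper C.ν) ρ).norm_image_sub_le_of_norm_hasFDerivWithin_le'
      (fun z _ => (hGd z).hasFDerivAt.hasFDerivWithinAt)
      (fun z hz => hL z (mem_ball_zero_iff.1 hz)) hq hp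
  set μ : Measure (Hyper C.ν) := (μHE[N - 1].restrict Γ).map (hcoord x C.ν) with hμ
  set μ' : Measure (Hyper C.ν) :=
    ENNReal.ofReal c • (volume.restrict (Metric.ball (0 : Hyper C.ν) ρ)) with hμ'
  have himg : ∀ s : Set (Hyper C.ν), hcoord x C.ν ⁻¹' s ∩ Γ =
      (fun p => point x C.ν p (G p)) '' (s ∩ Metric.ball 0 ρ) := by
    intro s
    ext y
    constructor
    · rintro ⟨h1, h2⟩
      exact ⟨hcoord x C.ν y, ⟨h1, mem_ball_zero_iff.2 h2.1⟩, hΓpt y h2⟩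
    · rintro ⟨p, ⟨h1, h2⟩, rfl⟩
      refine ⟨by rwa [Set.mem_preimage, hcoord_point], ?_, ?_⟩
      · rw [hcoord_point]; exact mem_ball_zero_iff.1 h2
      · rw [hcoord_point, tcoord_point C.norm_ν]
  have hμs : ∀ s, MeasurableSet s → μ s =
      μHE[N - 1] ((fun p => point x C.ν p (G p)) '' (s ∩ Metric.ball 0 ρ)) := by
    intro s hs
    rw [hμ, Measure.map_apply continuous_hcoord.measurable hs,
      Measure.restrict_apply (continuous_hcoord.measurable hs), himg]
  have hμ's : ∀ s, MeasurableSet s →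
      μ' s = ENNReal.ofReal c * volume (s ∩ Metric.ball 0 ρ) := by
    intro s hs
    rw [hμ', Measure.smul_apply, Measure.restrict_apply hs, smul_eq_mul]
  have hle1 : μ ≤ ENNReal.ofReal K • μ' := by
    refine Measure.le_iff.2 fun s hs => ?_
    rw [hμs s hs, Measure.smul_apply, hμ's s hs, smul_eq_mul]
    have h1 := euclideanHausdorffMeasure_graph_le (x := x) C.norm_ν hε0
      (s := s ∩ Metric.ball 0 ρ) (fun p hp q hq => hlip p hp.2 q hq.2)
    rw [han] at h1
    refine h1.trans ?_
    have : (1 + ε) ^ (N - 1) ≤ K := pow_le_pow_left₀ (by linarith) (by linarith) _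
    gcongr
  have hle2 : μ' ≤ ENNReal.ofReal K • μ := by
    refine Measure.le_iff.2 fun s hs => ?_
    rw [hμ's s hs, Measure.smul_apply, hμs s hs, smul_eq_mul]
    have h1 := le_euclideanHausdorffMeasure_graph (x := x) C.norm_ν hε0 hε
      (s := s ∩ Metric.ball 0 ρ) (fun p hp q hq => hlip p hp.2 q hq.2)
    rwa [han] at h1
  have hucs : HasCompactSupport u := by
    refine HasCompactSupport.intro (isCompact_closedBall (0 : Hyper C.ν) ρ) fun p hp => hus p ?_
    rw [Metric.mem_closedBall, dist_zero_right, not_le] at hp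
    exact hp.le
  have hui : Integrable u := hu.integrable_of_hasCompactSupport hucs
  have hui' : Integrable u μ' := (hui.mono_measure Measure.restrict_le_self).smul_measure
    ENNReal.ofReal_ne_top
  have huiμ : Integrable u μ := (hui'.smul_measure ENNReal.ofReal_ne_top).mono_measure hle1
  have hball : ∀ v : Hyper C.ν → ℝ, (∀ p, ρ ≤ ‖p‖ → v p = 0) →
      ∫ p, v p ∂μ' = c * ∫ p, v p := by
    intro v hv
    rw [hμ', integral_smul_measure, ENNReal.toReal_ofReal (by linarith), smul_eq_mul,
      setIntegral_eq_integral_of_forall_compl_eq_zero fun p hp =>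
        hv p (not_lt.1 fun h => hp (mem_ball_zero_iff.2 h))]
  have huabs : ∫ p, |u p| ∂μ' = c * ∫ p, |u p| :=
    hball (fun p => |u p|) fun p hp => by rw [hus p hp, abs_zero]
  have huint : ∫ p, u p ∂μ' = c * ∫ p, u p := hball u hus
  -- pointwise comparison of the integrand
  have hpt : ∀ y ∈ Γ, |F y - κ₀ / c * u (hcoord x C.ν y)| ≤
      ε * (1 + |κ₀|) * |u (hcoord x C.ν y)| := by
    intro y hy
    have hyc := hΓcyl y hy
    have hchi : C.chi (tcoord x C.ν y) = 1 := by
      refine chi_eq_one ?_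
      rw [hy.2]
      exact hg.abs_add_le (mem_cyl_iff.1 hyc).1.le
    have hn : ⟪C.ν, outerNormal (C.perturb g) y⟫ =
        (√(1 + ‖fderiv ℝ G (hcoord x C.ν y)‖ ^ 2))⁻¹ := by
      refine inner_outerNormal_subgraph C.norm_ν (hGd _) hy.2 ?_
      filter_upwards [isOpen_cyl.mem_nhds hyc] with z hz
      exact mem_perturb_of_mem_cyl hz
    have hFy : F y = k y * (√(1 + ‖fderiv ℝ G (hcoord x C.ν y)‖ ^ 2))⁻¹ *
        u (hcoord x C.ν y) := by
      simp only [hF]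
      rw [inner_smul_left, hn, hchi]
      simp only [conj_trivial]
      ring
    set S := (√(1 + ‖fderiv ℝ G (hcoord x C.ν y)‖ ^ 2))⁻¹ with hS
    have hS0 : 0 ≤ S := by positivity
    have hS1 : S ≤ 1 := inv_le_one_of_one_le₀ (Real.one_le_sqrt.2 (by
      nlinarith [sq_nonneg ‖fderiv ℝ G (hcoord x C.ν y)‖]))
    have hSc : |S - c⁻¹| ≤ ε := by
      have h1 : |‖fderiv ℝ G (hcoord x C.ν y)‖ - ‖L‖| ≤ ‖fderiv ℝ G (hcoord x C.ν y) - L‖ :=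
        abs_norm_sub_norm_le (fderiv ℝ G (hcoord x C.ν y)) L
      exact (abs_inv_sqrt_sub_le _ _).trans (h1.trans (hL _ hy.1))
    have hky : |k y - κ₀| ≤ ε := by
      have := hk _ hy.1
      rwa [hΓpt y hy] at this
    have e : F y - κ₀ / c * u (hcoord x C.ν y) =
        ((k y - κ₀) * S + κ₀ * (S - c⁻¹)) * u (hcoord x C.ν y) := by
      rw [hFy, div_eq_mul_inv]; ring
    rw [e, abs_mul]
    refine mul_le_mul_of_nonneg_right ?_ (abs_nonneg _)
    refine (_root_.abs_add_le _ _).trans ?_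
    rw [abs_mul, abs_mul, abs_of_nonneg hS0]
    have h1 : |k y - κ₀| * S ≤ ε * 1 := mul_le_mul hky hS1 hS0 hε0
    have h2 : |κ₀| * |S - c⁻¹| ≤ |κ₀| * ε := mul_le_mul_of_nonneg_left hSc (abs_nonneg _)
    linarith
  have hmap : ∀ v : Hyper C.ν → ℝ, Continuous v →
      ∫ y in Γ, v (hcoord x C.ν y) ∂μHE[N - 1] = ∫ p, v p ∂μ := fun v hv =>
    (integral_map continuous_hcoord.measurable.aemeasurable hv.aestronglyMeasurable).symm
  have hiu : Integrable (fun y => u (hcoord x C.ν y)) (μHE[N - 1].restrict Γ) :=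
    (integrable_map_measure hu.aestronglyMeasurable
      continuous_hcoord.measurable.aemeasurable).1 huiμ
  have h1 : |∫ y in Γ, F y ∂μHE[N - 1] - κ₀ / c * ∫ p, u p ∂μ| ≤
      ε * (1 + |κ₀|) * ∫ p, |u p| ∂μ := by
    rw [← hmap u hu, ← integral_const_mul, ← integral_sub hIΓ (hiu.const_mul _),
      ← hmap _ hu.abs, ← integral_const_mul]
    rw [← Real.norm_eq_abs]
    refine norm_integral_le_of_norm_le (g := fun y => ε * (1 + |κ₀|) * |u (hcoord x C.ν y)|)
      (hiu.abs.const_mul _) ?_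
    filter_upwards [ae_restrict_mem hΓm] with y hy
    exact hpt y hy
  have h2 := abs_integral_sub_le_of_le hK1 hle1 hle2 huiμ hui'
  have h3 : ∫ p, |u p| ∂μ ≤ K * (c * ∫ p, |u p|) := by
    have := integral_mono_measure hle1 (Eventually.of_forall fun p => abs_nonneg (u p))
      (hui'.abs.smul_measure ENNReal.ofReal_ne_top)
    rwa [integral_smul_measure, ENNReal.toReal_ofReal (by linarith), smul_eq_mul, huabs] at this
  rw [huabs, huint] at h2
  rw [hint]
  have hκc : |κ₀ / c| * c = |κ₀| := by
    rw [abs_div, abs_of_pos (by linarith : 0 < c), div_mul_cancel₀ _ (by linarith)]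
  have h4 : |κ₀ / c * (∫ p, u p ∂μ - c * ∫ p, u p)| ≤ |κ₀| * (K - 1) * ∫ p, |u p| := by
    rw [abs_mul]
    calc _ ≤ |κ₀ / c| * ((K - 1) * (c * ∫ p, |u p|)) :=
          mul_le_mul_of_nonneg_left h2 (abs_nonneg _)
      _ = (|κ₀ / c| * c) * ((K - 1) * ∫ p, |u p|) := by ring
      _ = _ := by rw [hκc]; ring
  have h5 : ε * (1 + |κ₀|) * ∫ p, |u p| ∂μ ≤ ε * (1 + |κ₀|) * (K * (c * ∫ p, |u p|)) :=
    mul_le_mul_of_nonneg_left h3 (by positivity)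
  have e : ∫ y in Γ, F y ∂μHE[N - 1] - κ₀ * ∫ p, u p =
      (∫ y in Γ, F y ∂μHE[N - 1] - κ₀ / c * ∫ p, u p ∂μ) +
        κ₀ / c * (∫ p, u p ∂μ - c * ∫ p, u p) := by
    have hc0 : c ≠ 0 := by linarith
    field_simp
    ring
  rw [e]
  refine (_root_.abs_add_le _ _).trans ((add_le_add (h1.trans h5) h4).trans (le_of_eq ?_))
  rw [variationError]
  ring

end GraphChart

end FirstVariation

/-! ### Convergence in Hölder spaces -/

section HolderConvergence

variable {ℓ : ℕ} {β : ℝ≥0}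
variable {X Y P : Type} [NormedAddCommGroup X] [NormedSpace ℝ X] [NormedAddCommGroup Y]
  [NormedSpace ℝ Y] [NormedAddCommGroup P] [NormedSpace ℝ P]

lemma TendstoHolderC.const (f : X → Y) (s : Set X) : TendstoHolderC ℓ β (fun _ => f) f s := by
  refine fun ε _ => Eventually.of_forall fun n => ⟨fun k _ y _ => ?_, fun y _ z _ => ?_⟩
  · rw [sub_self, norm_zero]; exact ε.coe_nonneg
  · simp

lemma TendstoHolderC.add {f f' : ℕ → X → Y} {g g' : X → Y} {s : Set X}
    (h : TendstoHolderC ℓ β f g s) (h' : TendstoHolderC ℓ β f' g' s)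
    (hf : ∀ᶠ n in atTop, ∀ y ∈ s, ContDiffAt ℝ ℓ (f n) y)
    (hf' : ∀ᶠ n in atTop, ∀ y ∈ s, ContDiffAt ℝ ℓ (f' n) y)
    (hg : ∀ y ∈ s, ContDiffAt ℝ ℓ g y) (hg' : ∀ y ∈ s, ContDiffAt ℝ ℓ g' y) :
    TendstoHolderC ℓ β (fun n y => f n y + f' n y) (fun y => g y + g' y) s := by
  intro ε hε
  filter_upwards [h (ε / 2) (by positivity), h' (ε / 2) (by positivity), hf, hf']
    with n h1 h2 h3 h4
  have e : ∀ k ≤ ℓ, ∀ y ∈ s, iteratedFDeriv ℝ k (fun y => f n y + f' n y) y -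
      iteratedFDeriv ℝ k (fun y => g y + g' y) y =
      (iteratedFDeriv ℝ k (f n) y - iteratedFDeriv ℝ k g y) +
      (iteratedFDeriv ℝ k (f' n) y - iteratedFDeriv ℝ k g' y) := by
    intro k hk y hy
    have hk' : (k : WithTop ℕ∞) ≤ ℓ := by exact_mod_cast hk
    have e1 := iteratedFDeriv_add_apply ((h3 y hy).of_le hk') ((h4 y hy).of_le hk')
    have e2 := iteratedFDeriv_add_apply ((hg y hy).of_le hk') ((hg' y hy).of_le hk')
    change iteratedFDeriv ℝ k (f n + f' n) y - iteratedFDeriv ℝ k (g + g') y = _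
    rw [e1, e2]
    abel
  refine ⟨fun k hk y hy => ?_, fun y hy z hz => ?_⟩
  · rw [e k hk y hy]
    refine (norm_add_le _ _).trans ((add_le_add (h1.1 k hk y hy) (h2.1 k hk y hy)).trans_eq ?_)
    push_cast
    ring
  · simp only []
    rw [e ℓ le_rfl y hy, e ℓ le_rfl z hz]
    refine (edist_add_add_le _ _ _ _).trans ((add_le_add (h1.2 y hy z hz)
      (h2.2 y hy z hz)).trans_eq ?_)
    rw [← add_mul, ← ENNReal.coe_add, add_halves]

lemma holderOnWith_of_dist_le {X Y : Type*} [PseudoMetricSpace X] [PseudoMetricSpace Y]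
    {f : X → Y} {s : Set X} {C : ℝ≥0}
    (h : ∀ y ∈ s, ∀ z ∈ s, dist (f y) (f z) ≤ C * dist y z ^ (β : ℝ)) : HolderOnWith C β f s := by
  intro y hy z hz
  rw [edist_dist, edist_dist, ENNReal.ofReal_rpow_of_nonneg dist_nonneg β.coe_nonneg,
    ← ENNReal.ofReal_coe_nnreal, ← ENNReal.ofReal_mul C.coe_nonneg]
  exact ENNReal.ofReal_le_ofReal (h y hy z hz)

lemma iteratedFDeriv_slice {q : P × X → Y} {k : ℕ} {z : P} {y : X}
    (hq : ContDiffAt ℝ k q (z, y)) :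
    iteratedFDeriv ℝ k (fun y => q (z, y)) y =
      (iteratedFDeriv ℝ k q (z, y)).compContinuousLinearMap
        fun _ => ContinuousLinearMap.inr ℝ P X := by
  set q' : P × X → Y := fun w => q ((z, 0) + w)
  have e1 : (fun y => q (z, y)) = q' ∘ ContinuousLinearMap.inr ℝ P X := by
    ext1 y; simp [q']
  have hpt : ((z, 0) : P × X) + ContinuousLinearMap.inr ℝ P X y = (z, y) := by simp
  have hq' : ContDiffAt ℝ k q' (ContinuousLinearMap.inr ℝ P X y) := by
    refine ContDiffAt.comp _ (g := q) (f := fun w => ((z, 0) : P × X) + w) (by rwa [hpt])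
      (contDiffAt_const.add contDiffAt_id)
  have e2 : iteratedFDeriv ℝ k q' (ContinuousLinearMap.inr ℝ P X y) =
      iteratedFDeriv ℝ k q (z, y) := by
    rw [iteratedFDeriv_comp_add_left, hpt]
  rw [e1, ← e2]
  obtain ⟨s, hs, hso, hys⟩ := eventually_nhds_iff.1 (hq'.eventually (by simp))
  have hpre : IsOpen (ContinuousLinearMap.inr ℝ P X ⁻¹' s) :=
    hso.preimage (ContinuousLinearMap.inr ℝ P X).continuous
  have := (ContinuousLinearMap.inr ℝ P X).iteratedFDerivWithin_comp_right
    (fun w hw => (hs w hw).contDiffWithinAt) hso.uniqueDiffOn hpre.uniqueDiffOn hys le_rfl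
  rwa [iteratedFDerivWithin_of_isOpen k hpre hys, iteratedFDerivWithin_of_isOpen k hso hys]
    at this

/-- If `c n → 0` and `q` is of class `C^{ℓ,β}` jointly with a parameter ranging over a compact set,
then `c n • q (z n, ·) → 0` in `C^{ℓ,β}`. -/
lemma tendstoHolderC_mul_slice [ProperSpace X] {q : P × X → ℝ} {K : Set P} (hK : IsCompact K)
    {r : ℝ} (hq : ∀ z ∈ K, ∀ y ∈ Metric.closedBall (0 : X) r, IsHolderAt ℓ β q (z, y))
    {c : ℕ → ℝ} (hc : Tendsto c atTop (𝓝 0)) {z : ℕ → P} (hz : ∀ n, z n ∈ K) :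
    TendstoHolderC ℓ β (fun n y => c n * q (z n, y)) (fun _ => 0) (Metric.ball 0 r) := by
  have hKr : IsCompact (K ×ˢ Metric.closedBall (0 : X) r) := hK.prod (isCompact_closedBall _ _)
  have hb : ∀ k : ℕ, ∃ B : ℝ, k ≤ ℓ → ∀ w ∈ K ×ˢ Metric.closedBall (0 : X) r,
      ‖iteratedFDeriv ℝ k q w‖ ≤ B := by
    intro k
    by_cases hk : k ≤ ℓ
    · have hcont : ContinuousOn (iteratedFDeriv ℝ k q) (K ×ˢ Metric.closedBall (0 : X) r) :=
        fun w hw => ((hq w.1 hw.1 w.2 hw.2).1.continuousAt_iteratedFDeriv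
          (by exact_mod_cast hk)).continuousWithinAt
      obtain ⟨B, hB⟩ := hKr.exists_bound_of_continuousOn hcont
      exact ⟨B, fun _ => hB⟩
    · exact ⟨0, fun h => absurd h hk⟩
  choose B hB using hb
  obtain ⟨H, hH⟩ := LocHolderAt.exists_holderOnWith hKr fun w hw => (hq w.1 hw.1 w.2 hw.2).2
  set M : ℝ := H + 1 + ∑ k ∈ Finset.range (ℓ + 1), |B k|
  have hM0 : 0 < M := by
    have := Finset.sum_nonneg (s := Finset.range (ℓ + 1)) fun k _ => abs_nonneg (B k)
    have := H.coe_nonneg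
    positivity
  have hHM : (H : ℝ) ≤ M := by
    have := Finset.sum_nonneg (s := Finset.range (ℓ + 1)) fun k _ => abs_nonneg (B k)
    simp only [M]; linarith
  have hBM : ∀ k ≤ ℓ, B k ≤ M := by
    intro k hk
    have := Finset.single_le_sum (f := fun k => |B k|) (fun k _ => abs_nonneg (B k))
      (Finset.mem_range.2 (Nat.lt_succ_of_le hk))
    have := le_abs_self (B k)
    have := H.coe_nonneg
    simp only [M]
    linarith
  intro ε hε
  have hev : ∀ᶠ n in atTop, |c n| < ε / M := by
    have := hc.abs
    rw [abs_zero] at this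
    exact this.eventually (gt_mem_nhds (by positivity))
  filter_upwards [hev] with n hn
  have hcM : |c n| * M ≤ ε := by
    rw [lt_div_iff₀ hM0] at hn
    exact hn.le
  have hmem : ∀ y ∈ Metric.ball (0 : X) r, (z n, y) ∈ K ×ˢ Metric.closedBall (0 : X) r :=
    fun y hy => ⟨hz n, Metric.ball_subset_closedBall hy⟩
  have hder : ∀ k ≤ ℓ, ∀ y ∈ Metric.ball (0 : X) r,
      iteratedFDeriv ℝ k (fun y => c n * q (z n, y)) y - iteratedFDeriv ℝ k (fun _ => (0 : ℝ)) y =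
      c n • (iteratedFDeriv ℝ k q (z n, y)).compContinuousLinearMap
        fun _ => ContinuousLinearMap.inr ℝ P X := by
    intro k hk y hy
    have hk' : (k : WithTop ℕ∞) ≤ ℓ := by exact_mod_cast hk
    have hqy := (hq _ (hmem y hy).1 _ (hmem y hy).2).1.of_le hk'
    have hsl : ContDiffAt ℝ k (fun y => q (z n, y)) y :=
      ContDiffAt.comp y (g := q) (f := fun y => (z n, y)) hqy (contDiffAt_const.prodMk contDiffAt_id)
    have h0 : iteratedFDeriv ℝ k (fun _ : X => (0 : ℝ)) y = 0 := by
      have := iteratedFDeriv_fun_zero (𝕜 := ℝ) (E := X) (F := ℝ) (n := k)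
      exact congrFun this y
    rw [h0, sub_zero, ← iteratedFDeriv_slice hqy]
    exact iteratedFDeriv_const_smul_apply (a := c n) hsl
  have hinr : ‖ContinuousLinearMap.inr ℝ P X‖ ≤ 1 := ContinuousLinearMap.norm_inr_le_one ℝ P X
  have hcomp : ∀ (k : ℕ) (A : ContinuousMultilinearMap ℝ (fun _ : Fin k => P × X) ℝ),
      ‖A.compContinuousLinearMap fun _ => ContinuousLinearMap.inr ℝ P X‖ ≤ ‖A‖ := by
    intro k A
    refine (A.norm_compContinuousLinearMap_le _).trans ?_
    refine mul_le_of_le_one_right (norm_nonneg _) ?_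
    exact Finset.prod_le_one (fun _ _ => norm_nonneg _) fun _ _ => hinr
  refine ⟨fun k hk y hy => ?_, holderOnWith_of_dist_le ?_⟩
  · rw [hder k hk y hy, norm_smul, Real.norm_eq_abs]
    exact (mul_le_mul_of_nonneg_left (((hcomp k _).trans (hB k hk _ (hmem y hy))).trans
      (hBM k hk)) (abs_nonneg _)).trans hcM
  · intro y hy w hw
    rw [hder ℓ le_rfl y hy, hder ℓ le_rfl w hw, dist_eq_norm, ← smul_sub, norm_smul,
      Real.norm_eq_abs]
    have e : ((iteratedFDeriv ℝ ℓ q (z n, y)).compContinuousLinearMap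
          fun _ => ContinuousLinearMap.inr ℝ P X) -
        ((iteratedFDeriv ℝ ℓ q (z n, w)).compContinuousLinearMap
          fun _ => ContinuousLinearMap.inr ℝ P X) =
        (iteratedFDeriv ℝ ℓ q (z n, y) - iteratedFDeriv ℝ ℓ q (z n, w)).compContinuousLinearMap
          fun _ => ContinuousLinearMap.inr ℝ P X := by
      ext v; simp
    rw [e]
    have h1 := hH.dist_le (hmem y hy) (hmem w hw)
    rw [dist_eq_norm, show dist (z n, y) (z n, w) = dist y w by simp [Prod.dist_eq]] at h1
    have h0 : 0 ≤ dist y w ^ (β : ℝ) := Real.rpow_nonneg dist_nonneg _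
    calc |c n| * _ ≤ |c n| * (H * dist y w ^ (β : ℝ)) :=
          mul_le_mul_of_nonneg_left ((hcomp ℓ _).trans h1) (abs_nonneg _)
      _ ≤ |c n| * (M * dist y w ^ (β : ℝ)) := by gcongr
      _ = (|c n| * M) * dist y w ^ (β : ℝ) := by ring
      _ ≤ _ := mul_le_mul_of_nonneg_right hcM h0

end HolderConvergence

/-! ### The foliation of a chart and its deformations -/

section LevelFamilies

variable {ℓ : ℕ} {β : ℝ≥0}

namespace GraphChart

variable {U : Set (Space N)} {x : Space N} (C : GraphChart ℓ β U x)

/-- A cutoff function on the base of the cylinder. -/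
def eta : ContDiffBump (0 : Hyper C.ν) :=
  ⟨C.r / 4, 3 * C.r / 8, by have := C.r_pos; positivity, by have := C.r_pos; linarith⟩

/-- The leaf with parameter `s` of the foliation of the chart: the perturbation by `s` times the
cutoff function. -/
def leaf (s : ℝ) : Set (Space N) := C.perturb fun p => s * C.eta p

/-- The deformations of the leaves given by a function `ψ` supported in the cylinder of radius `ρ`:
the subgraph of `f + g (lam, s)` is given by the inequality `t - lam * ψ ≤ f + s * η`. In other
words, in the region where `η = 1` the graphs of `f + g (lam, ·)` are the level sets of
`t - f - lam * ψ`. -/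
structure LevelFamily (ρ : ℝ) (ψ : Space N → ℝ) where
  /-- the bound for the parameter `lam` -/
  lam : ℝ
  /-- the displacement of the leaves, divided by `lam` -/
  R : ℝ × ℝ → Hyper C.ν → ℝ
  lam_pos : 0 < lam
  holder : ∀ z : ℝ × ℝ, |z.1| < lam → ∀ p,
    IsHolderAt ℓ β (fun q : (ℝ × ℝ) × Hyper C.ν => R q.1 q.2) (z, p)
  supp : ∀ z p, ρ ≤ ‖p‖ → R z p = 0
  small : ∀ z : ℝ × ℝ, |z.1| < lam → ∀ p, |z.1 * R z p| ≤ C.h / 8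
  mem_iff : ∀ z : ℝ × ℝ, |z.1| < lam → ∀ p t,
    (t - z.1 * ψ (point x C.ν p t) ≤ C.f p + z.2 * C.eta p ↔
      t ≤ C.f p + (z.2 * C.eta p + z.1 * R z p))
  zero : ∀ s p, R (0, s) p = ψ (point x C.ν p (C.f p + s * C.eta p))

variable {C}

lemma eta_eq_one {p : Hyper C.ν} (hp : ‖p‖ ≤ C.r / 4) : C.eta p = 1 :=
  C.eta.one_of_mem_closedBall (by rw [Metric.mem_closedBall, dist_zero_right]; exact hp)

lemma eta_eq_zero {p : Hyper C.ν} (hp : 3 * C.r / 8 ≤ ‖p‖) : C.eta p = 0 :=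
  C.eta.zero_of_le_dist (by rw [dist_zero_right]; exact hp)

lemma abs_mul_eta_le (s : ℝ) (p : Hyper C.ν) : |s * C.eta p| ≤ |s| := by
  rw [abs_mul, abs_of_nonneg C.eta.nonneg]
  exact mul_le_of_le_one_right (abs_nonneg _) C.eta.le_one

lemma holderAt_eta (hβ : β ≤ 1) (p : Hyper C.ν) : IsHolderAt ℓ β C.eta p :=
  IsHolderAt.of_contDiff hβ (n := ⊤) C.eta.contDiff le_top p

lemma admissible_mul_eta (hβ : β ≤ 1) {s : ℝ} (hs : |s| ≤ C.h / 4) :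
    C.Admissible fun p => s * C.eta p :=
  ⟨fun p => (IsHolderAt.const hβ s p).mul hβ (holderAt_eta hβ p), fun p hp => by
    rw [eta_eq_zero (by linarith [C.r_pos]), mul_zero], fun p => (abs_mul_eta_le s p).trans hs⟩

lemma perturb_zero : C.perturb (fun _ => 0) = closure U := by
  ext y
  by_cases hy : y ∈ C.cyl
  · rw [mem_perturb_of_mem_cyl hy, add_zero]
    refine (mem_closure_subgraph_iff C.norm_ν C.continuous ?_).symm
    filter_upwards [isOpen_cyl.mem_nhds hy] with z hz
    exact C.mem_iff z hz
  · rw [mem_perturb_of_notMem_cyl hy]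

lemma leaf_zero : C.leaf 0 = closure U := by
  rw [leaf, ← perturb_zero (C := C)]
  simp only [zero_mul]

/-- Level families exist for products of a smooth function supported in a thin cylinder and a
smooth function of `t - f`. -/
lemma exists_levelFamily (hβ : β ≤ 1) (hℓ : 1 ≤ ℓ) {χ : Space N → ℝ} {m : ℝ → ℝ}
    (hχ : ContDiff ℝ (⊤ : ℕ∞) χ) (hχc : HasCompactSupport χ) (hm : ContDiff ℝ (⊤ : ℕ∞) m)
    {B : ℝ} (hmB : ∀ q, |m q| ≤ B) (hmB' : ∀ q, |deriv m q| ≤ B) {ρ : ℝ}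
    (hs : ∀ y, χ y ≠ 0 → ‖hcoord x C.ν y‖ < ρ) :
    Nonempty (C.LevelFamily ρ fun y => χ y * m (tcoord x C.ν y - C.f (hcoord x C.ν y))) := by
  obtain ⟨K, hK⟩ := (hχc.fderiv (𝕜 := ℝ)).exists_bound_of_continuous
    (hχ.continuous_fderiv (by simp))
  obtain ⟨M, hM⟩ := hχc.exists_bound_of_continuous hχ.continuous
  have hK0 : 0 ≤ K := (norm_nonneg _).trans (hK 0)
  have hM0 : 0 ≤ M := (norm_nonneg _).trans (hM 0)
  have hB0 : 0 ≤ B := (abs_nonneg _).trans (hmB 0)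
  have hh := C.h_pos
  set K' := K * B + M * B
  have hK'0 : 0 ≤ K' := by positivity
  set M' := M * B
  have hM'0 : 0 ≤ M' := by positivity
  set lam := min (1 / (2 * (K' + 1))) (C.h / (8 * (M' + 1)))
  have hlam : 0 < lam := by positivity
  have hlamK : ∀ {a : ℝ}, |a| < lam → |a| * K' ≤ 1 / 2 := by
    intro a ha
    have h1 : |a| ≤ 1 / (2 * (K' + 1)) := ha.le.trans (min_le_left _ _)
    rw [le_div_iff₀ (by positivity)] at h1
    nlinarith [abs_nonneg a]
  have hlamM : ∀ {a : ℝ}, |a| < lam → |a| * M' ≤ C.h / 8 := by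
    intro a ha
    have h1 : |a| ≤ C.h / (8 * (M' + 1)) := ha.le.trans (min_le_right _ _)
    rw [le_div_iff₀ (by positivity)] at h1
    nlinarith [abs_nonneg a]
  -- The value `f p` is treated as an independent parameter, so that everything is smooth.
  set O : Set ((ℝ × Hyper C.ν) × ℝ) := {q | |q.1.1| < lam}
  have hO : IsOpen O := isOpen_lt (continuous_fst.comp continuous_fst).abs continuous_const
  set Ψ : (Hyper C.ν × ℝ) × ℝ → ℝ := fun w => χ (point x C.ν w.1.1 w.2) * m (w.2 - w.1.2) with hΨ
  have hΨc : ContDiff ℝ (⊤ : ℕ∞) Ψ :=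
    (hχ.comp (contDiff_point.comp ((contDiff_fst.comp contDiff_fst).prodMk contDiff_snd))).mul
      (hm.comp (contDiff_snd.sub (contDiff_snd.comp contDiff_fst)))
  set k : ((ℝ × Hyper C.ν) × ℝ) × ℝ → ℝ :=
    fun q => -q.1.1.1 * Ψ ((q.1.1.2, q.1.2), q.2) with hk
  have hkc : ContDiff ℝ (⊤ : ℕ∞) k :=
    (contDiff_fst.comp (contDiff_fst.comp contDiff_fst)).neg.mul (hΨc.comp
      (((contDiff_snd.comp (contDiff_fst.comp contDiff_fst)).prodMk
        (contDiff_snd.comp contDiff_fst)).prodMk contDiff_snd))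
  have hkd : ∀ q : (ℝ × Hyper C.ν) × ℝ, ∀ t,
      HasDerivAt (fun t => k (q, t)) (-q.1.1 * (fderiv ℝ χ (point x C.ν q.1.2 t) C.ν * m (t - q.2) +
        χ (point x C.ν q.1.2 t) * deriv m (t - q.2))) t := by
    intro q t
    have h1 : HasDerivAt (fun t : ℝ => point x C.ν q.1.2 t) C.ν t := by
      have := ((hasDerivAt_id t).smul_const C.ν).const_add (x + (q.1.2 : Space N))
      simpa [point] using this
    have h2 := (hχ.differentiable (by simp) _).hasFDerivAt.comp_hasDerivAt t h1
    have h3 : HasDerivAt (fun t => m (t - q.2)) (deriv m (t - q.2)) t := by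
      have := ((hm.differentiable (by simp) (t - q.2)).hasDerivAt).comp t
        ((hasDerivAt_id t).sub_const q.2)
      simpa [Function.comp_def] using this
    exact (h2.mul h3).const_mul (-q.1.1)
  have hkd' : ∀ q ∈ O, ∀ t, |deriv (fun t => k (q, t)) t| ≤ 1 / 2 := by
    intro q hq t
    rw [(hkd q t).deriv, abs_mul, abs_neg]
    refine le_trans ?_ (hlamK hq)
    refine mul_le_mul_of_nonneg_left ?_ (abs_nonneg _)
    have h1 := (fderiv ℝ χ (point x C.ν q.1.2 t)).le_of_opNorm_le (hK _) C.ν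
    rw [C.norm_ν, mul_one, Real.norm_eq_abs] at h1
    refine (_root_.abs_add_le _ _).trans (add_le_add ?_ ?_)
    · rw [abs_mul]
      exact mul_le_mul h1 (hmB _) (abs_nonneg _) hK0
    · rw [abs_mul]
      exact mul_le_mul (hM _) (hmB' _) (abs_nonneg _) hM0
  have hΨM : ∀ w, |Ψ w| ≤ M' := fun w => by
    simp only [hΨ]
    rw [abs_mul]
    exact mul_le_mul (hM _) (hmB _) (abs_nonneg _) hM0
  have hkM : ∀ q ∈ O, ∀ t, |k (q, t)| ≤ C.h / 8 := by
    intro q hq t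
    simp only [hk]
    rw [abs_mul, abs_neg]
    exact (mul_le_mul_of_nonneg_left (hΨM _) (abs_nonneg _)).trans (hlamM hq)
  obtain ⟨S, hS, hS1, hS2⟩ := exists_fiberInverse (n := ((⊤ : ℕ∞) : WithTop ℕ∞)) (by simp) hO
    hkc.contDiffOn hkd' hkM
  have hRsup : ∀ (p : Hyper C.ν) (t : ℝ), ρ ≤ ‖p‖ → χ (point x C.ν p t) = 0 := by
    intro p t hp
    by_contra h
    have := hs _ h
    rw [hcoord_point] at this
    linarith
  refine ⟨⟨lam, fun z p => Ψ ((p, C.f p), S (((z.1, p), C.f p), C.f p + z.2 * C.eta p)), hlam,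
    fun z hz p => ?_, fun z p hp => ?_, fun z hz p => ?_, fun z hz p t => ?_, fun s p => ?_⟩⟩
  · have hfst : IsHolderAt ℓ β (fun q : (ℝ × ℝ) × Hyper C.ν => q.1.1) (z, p) :=
      IsHolderAt.of_contDiff hβ (n := ⊤) (contDiff_fst.comp contDiff_fst) le_top _
    have hsnd : IsHolderAt ℓ β (fun q : (ℝ × ℝ) × Hyper C.ν => q.1.2) (z, p) :=
      IsHolderAt.of_contDiff hβ (n := ⊤) (contDiff_snd.comp contDiff_fst) le_top _
    have hp : IsHolderAt ℓ β (fun q : (ℝ × ℝ) × Hyper C.ν => q.2) (z, p) :=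
      IsHolderAt.of_contDiff hβ (n := ⊤) contDiff_snd le_top _
    have hf : IsHolderAt ℓ β (fun q : (ℝ × ℝ) × Hyper C.ν => C.f q.2) (z, p) :=
      IsHolderAt.comp hβ ℓ (f := C.f) (g := fun q : (ℝ × ℝ) × Hyper C.ν => q.2) (C.holder p) hp
        contDiffAt_snd
    have heta : IsHolderAt ℓ β (fun q : (ℝ × ℝ) × Hyper C.ν => C.eta q.2) (z, p) :=
      IsHolderAt.of_contDiff hβ (n := ⊤) (C.eta.contDiff.comp contDiff_snd) le_top _
    have hin := ((hfst.prodMk hβ hp).prodMk hβ hf).prodMk hβ (hf.add (hsnd.mul hβ heta))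
    have hℓ1 : (1 : WithTop ℕ∞) ≤ (ℓ : WithTop ℕ∞) := by exact_mod_cast hℓ
    have hSat : ContDiffAt ℝ ((⊤ : ℕ∞) : WithTop ℕ∞) S
        (((z.1, p), C.f p), C.f p + z.2 * C.eta p) :=
      hS.contDiffAt ((hO.prod isOpen_univ).mem_nhds ⟨hz, trivial⟩)
    have hSh : IsHolderAt ℓ β (fun q : (ℝ × ℝ) × Hyper C.ν =>
        S (((q.1.1, q.2), C.f q.2), C.f q.2 + q.1.2 * C.eta q.2)) (z, p) :=
      IsHolderAt.comp hβ ℓ (f := S)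
        (g := fun q : (ℝ × ℝ) × Hyper C.ν =>
          (((q.1.1, q.2), C.f q.2), C.f q.2 + q.1.2 * C.eta q.2))
        (IsHolderAt.of_contDiffAt hβ (hSat.of_le (mod_cast le_top))) hin (hin.1.of_le hℓ1)
    have hin2 := (hp.prodMk hβ hf).prodMk hβ hSh
    exact IsHolderAt.comp hβ ℓ (f := Ψ)
      (g := fun q : (ℝ × ℝ) × Hyper C.ν =>
        ((q.2, C.f q.2), S (((q.1.1, q.2), C.f q.2), C.f q.2 + q.1.2 * C.eta q.2)))
      (IsHolderAt.of_contDiff hβ hΨc le_top _) hin2 (hin2.1.of_le hℓ1)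
  · simp only [hΨ]
    rw [hRsup _ _ hp, zero_mul]
  · rw [abs_mul]
    exact (mul_le_mul_of_nonneg_left (hΨM _) (abs_nonneg _)).trans (hlamM hz)
  · rw [tcoord_point C.norm_ν, hcoord_point]
    have hmono : StrictMono fun t => t + k (((z.1, p), C.f p), t) :=
      strictMono_id_add (fun t => (hkd ((z.1, p), C.f p) t).differentiableAt)
        (hkd' ((z.1, p), C.f p) hz)
    set τ := C.f p + z.2 * C.eta p
    have h1 := hS1 ((z.1, p), C.f p) hz τ
    have h2 : S (((z.1, p), C.f p), τ) =
        τ + z.1 * Ψ ((p, C.f p), S (((z.1, p), C.f p), τ)) := by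
      simp only [hk] at h1
      linarith
    have h3 := hmono.le_iff_le (a := t) (b := S (((z.1, p), C.f p), τ))
    rw [h1] at h3
    rw [← add_assoc, ← h2, ← h3]
    simp only [hk, hΨ]
    rw [neg_mul, ← sub_eq_add_neg]
  · have h1 := hS1 (((0 : ℝ), p), C.f p) (by simpa [O] using hlam) (C.f p + s * C.eta p)
    simp only [hk, neg_zero, zero_mul, add_zero] at h1
    simp only [h1, hΨ]
    rw [tcoord_point C.norm_ν, hcoord_point]

namespace LevelFamily

variable {ρ : ℝ} {ψ : Space N → ℝ} (F : C.LevelFamily ρ ψ)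

/-- The perturbation with parameters `z = (lam, s)`. -/
def g (z : ℝ × ℝ) (p : Hyper C.ν) : ℝ := z.2 * C.eta p + z.1 * F.R z p

variable {F}

lemma g_zero (s : ℝ) : F.g (0, s) = fun p => s * C.eta p := by
  ext p; simp [g]

lemma holder_g (hβ : β ≤ 1) {z : ℝ × ℝ} (hz : |z.1| < F.lam) (p : Hyper C.ν) :
    IsHolderAt ℓ β (fun q : (ℝ × ℝ) × Hyper C.ν => F.g q.1 q.2) (z, p) := by
  have hfst : IsHolderAt ℓ β (fun q : (ℝ × ℝ) × Hyper C.ν => q.1.1) (z, p) :=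
    IsHolderAt.of_contDiff hβ (n := ⊤) (contDiff_fst.comp contDiff_fst) le_top _
  have hsnd : IsHolderAt ℓ β (fun q : (ℝ × ℝ) × Hyper C.ν => q.1.2) (z, p) :=
    IsHolderAt.of_contDiff hβ (n := ⊤) (contDiff_snd.comp contDiff_fst) le_top _
  have heta : IsHolderAt ℓ β (fun q : (ℝ × ℝ) × Hyper C.ν => C.eta q.2) (z, p) :=
    IsHolderAt.of_contDiff hβ (n := ⊤) (C.eta.contDiff.comp contDiff_snd) le_top _
  exact (hsnd.mul hβ heta).add (hfst.mul hβ (F.holder z hz p))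

lemma admissible_g (hβ : β ≤ 1) (hℓ : 1 ≤ ℓ) (hρ : ρ ≤ C.r / 2) {z : ℝ × ℝ}
    (hz : |z.1| < F.lam) (hs : |z.2| ≤ C.h / 8) : C.Admissible (F.g z) := by
  have hℓ1 : (1 : WithTop ℕ∞) ≤ (ℓ : WithTop ℕ∞) := by exact_mod_cast hℓ
  refine ⟨fun p => ?_, fun p hp => ?_, fun p => ?_⟩
  · have hin : ContDiff ℝ (⊤ : ℕ∞) fun p : Hyper C.ν => (z, p) := contDiff_const.prodMk contDiff_id
    exact IsHolderAt.comp hβ ℓ (f := fun q : (ℝ × ℝ) × Hyper C.ν => F.g q.1 q.2)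
      (g := fun p => (z, p)) (holder_g hβ hz p) (IsHolderAt.of_contDiff hβ hin le_top _)
      (hin.contDiffAt.of_le (mod_cast le_top))
  · rw [g, eta_eq_zero (by linarith [C.r_pos]), F.supp z p (by linarith), mul_zero, mul_zero,
      add_zero]
  · refine (_root_.abs_add_le _ _).trans ?_
    linarith [abs_mul_eta_le (C := C) z.2 p, F.small z hz p]

lemma tendstoHolderC_g (hβ : β ≤ 1) {z : ℕ → ℝ × ℝ} {s : ℝ}
    (hz : ∀ n, |(z n).1| ≤ F.lam / 2) (h1 : Tendsto (fun n => (z n).1) atTop (𝓝 0))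
    (h2 : Tendsto (fun n => (z n).2) atTop (𝓝 s)) :
    TendstoHolderC ℓ β (fun n => F.g (z n)) (F.g (0, s)) (Metric.ball 0 C.r) := by
  obtain ⟨B, hB⟩ := (Metric.isBounded_iff_subset_closedBall 0).1
    (Metric.isBounded_range_of_tendsto _ h2)
  have hlam := F.lam_pos
  have hK : IsCompact (Set.Icc (-(F.lam / 2)) (F.lam / 2) ×ˢ Metric.closedBall (0 : ℝ) B) :=
    isCompact_Icc.prod (isCompact_closedBall _ _)
  have e1 := tendstoHolderC_mul_slice (ℓ := ℓ) (β := β) (r := C.r) hK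
    (q := fun q : (ℝ × ℝ) × Hyper C.ν => F.R q.1 q.2)
    (fun w hw p _ => F.holder w (by
      have := abs_le.2 hw.1
      linarith) p) h1 (z := z)
    (fun n => ⟨abs_le.1 (hz n), hB ⟨n, rfl⟩⟩)
  have e2 := tendstoHolderC_mul_slice (ℓ := ℓ) (β := β) (r := C.r)
      (isCompact_singleton (x := (0 : ℝ)))
    (q := fun q : ℝ × Hyper C.ν => C.eta q.2) (fun w _ p _ =>
      IsHolderAt.of_contDiff hβ (n := ⊤) (C.eta.contDiff.comp contDiff_snd) le_top _)
    (c := fun n => (z n).2 - s) (by simpa using h2.sub_const s) (z := fun _ => 0) (fun _ => rfl)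
  have hc : ∀ (a : ℝ) (p : Hyper C.ν), ContDiffAt ℝ ℓ (fun p => a * C.eta p) p := fun a p =>
    contDiffAt_const.mul C.eta.contDiffAt
  have hR : ∀ n (p : Hyper C.ν), ContDiffAt ℝ ℓ (fun p => (z n).1 * F.R (z n) p) p := fun n p =>
    contDiffAt_const.mul (ContDiffAt.comp p
      (g := fun q : (ℝ × ℝ) × Hyper C.ν => F.R q.1 q.2) (f := fun p => (z n, p))
      (F.holder (z n) ((hz n).trans_lt (by linarith)) p).1 (contDiffAt_const.prodMk contDiffAt_id))
  have e3 := (TendstoHolderC.const (ℓ := ℓ) (β := β) (fun p : Hyper C.ν => s * C.eta p)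
    (Metric.ball 0 C.r)).add e2 (Eventually.of_forall fun n p _ => hc s p)
    (Eventually.of_forall fun n p _ => hc _ p) (fun p _ => hc s p) (fun p _ => contDiffAt_const)
  have e4 := e3.add e1 (Eventually.of_forall fun n p _ => (hc s p).add (hc _ p))
    (Eventually.of_forall fun n p _ => hR n p) (fun p _ => (hc s p).add contDiffAt_const)
    (fun p _ => contDiffAt_const)
  have i1 : (fun n => F.g (z n)) = fun n (p : Hyper C.ν) =>
      s * C.eta p + ((z n).2 - s) * C.eta p + (z n).1 * F.R (z n) p := by
    ext n p; simp only [g]; ring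
  have i2 : F.g (0, s) = fun p : Hyper C.ν => s * C.eta p + 0 + 0 := by
    ext p; simp [g]
  rw [i1, i2]
  exact e4

end LevelFamily

end GraphChart

end LevelFamilies

/-! ### Closeness of curvatures and the lower bound for deformations -/

section Closeness

variable {ℓ : ℕ} {β : ℝ≥0}

lemma norm_iteratedFDeriv_one_sub {X : Type} [NormedAddCommGroup X] [NormedSpace ℝ X]
    {f g : X → ℝ} {y : X} (hf : ContDiffAt ℝ 1 f y) (hg : ContDiffAt ℝ 1 g y) :
    ‖iteratedFDeriv ℝ 1 f y - iteratedFDeriv ℝ 1 g y‖ = ‖fderiv ℝ f y - fderiv ℝ g y‖ := by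
  rw [← iteratedFDeriv_sub_apply (by exact_mod_cast hf) (by exact_mod_cast hg),
    norm_iteratedFDeriv_one,
    fderiv_sub (hf.differentiableAt one_ne_zero) (hg.differentiableAt one_ne_zero)]

namespace GraphChart

variable {U : Set (Space N)} {x : Space N} {C : GraphChart ℓ β U x}

lemma admissible_leaf (hβ : β ≤ 1) {s : ℝ} (hs : |s| ≤ C.h / 8) :
    C.Admissible fun p => s * C.eta p :=
  admissible_mul_eta hβ (by linarith [C.h_pos])

set_option maxHeartbeats 1000000 in
/-- The curvatures of the leaves near the centre of the chart are close to the curvature at the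
centre. -/
lemma exists_curvature_leaf_close (hβ : β ≤ 1) {κ : Space N → Set (Space N) → ℝ}
    (hC : IsContinuousCurvature ℓ β κ) (hU : RegularOpen ℓ β U) {ε : ℝ} (hε : 0 < ε) :
    ∃ δ > 0, ∀ s : ℝ, |s| ≤ δ → ∀ p : Hyper C.ν, ‖p‖ ≤ δ →
      |κ (point x C.ν p (C.f p + s * C.eta p)) (C.leaf s) - κ x (closure U)| ≤ ε := by
  by_contra! hcon
  have hr := C.r_pos
  have hh := C.h_pos
  set δ : ℕ → ℝ := fun n => min (1 / ((n : ℝ) + 1)) (min (C.h / 8) (C.r / 2))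
  have hδ : ∀ n, 0 < δ n := fun n => by
    have : (0 : ℝ) < 1 / ((n : ℝ) + 1) := by positivity
    exact lt_min this (lt_min (by positivity) (by positivity))
  have hδ0 : Tendsto δ atTop (𝓝 0) := by
    refine squeeze_zero (fun n => (hδ n).le) (fun n => min_le_left _ _) ?_
    exact tendsto_one_div_add_atTop_nhds_zero_nat
  choose s hs p hp hbad using fun n => hcon (δ n) (hδ n)
  have hs0 : Tendsto s atTop (𝓝 0) := squeeze_zero_norm hs hδ0
  have hp0 : Tendsto p atTop (𝓝 0) := squeeze_zero_norm hp hδ0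
  have hsh : ∀ n, |s n| ≤ C.h / 8 := fun n =>
    (hs n).trans ((min_le_right _ _).trans (min_le_left _ _))
  have hpr : ∀ n, ‖p n‖ < C.r := fun n =>
    ((hp n).trans ((min_le_right _ _).trans (min_le_right _ _))).trans_lt (by linarith)
  have hadm : ∀ n, C.Admissible fun p => s n * C.eta p := fun n => admissible_leaf hβ (hsh n)
  have h0 : C.Admissible fun _ => (0 : ℝ) := admissible_zero hβ
  have hconv : TendstoHolderC ℓ β (fun n p => s n * C.eta p) (fun _ => 0) (Metric.ball 0 C.r) :=
    tendstoHolderC_mul_slice (isCompact_singleton (x := (0 : ℝ)))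
      (q := fun q : ℝ × Hyper C.ν => C.eta q.2) (fun w _ p _ =>
        IsHolderAt.of_contDiff hβ (n := ⊤) (C.eta.contDiff.comp contDiff_snd) le_top _)
      hs0 (z := fun _ => 0) (fun _ => rfl)
  have hxf : x ∈ frontier (C.perturb fun _ => 0) := by
    have := h0.point_mem_frontier (p := 0) (by simpa using hr)
    simpa [point, C.f_zero] using this
  have hlim := hC (fun n => C.leaf (s n)) (C.perturb fun _ => 0)
    (fun n => point x C.ν (p n) (C.f (p n) + s n * C.eta (p n))) x
    (fun n => (hadm n).isRegular hβ hU) (h0.isRegular hβ hU)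
    (tendstoRegular_perturb hβ hU h0 hadm hconv)
    (fun n => (hadm n).point_mem_frontier (hpr n)) hxf (by
      have h1 : Tendsto (fun n => C.f (p n) + s n * C.eta (p n)) atTop (𝓝 (C.f 0 + 0)) := by
        refine (C.continuous.continuousAt.tendsto.comp hp0).add ?_
        exact squeeze_zero_norm (fun n => (abs_mul_eta_le (s n) (p n)).trans (hs n)) hδ0
      have h2 : Tendsto (fun n => point x C.ν (p n) (C.f (p n) + s n * C.eta (p n))) atTop
          (𝓝 (point x C.ν 0 (C.f 0 + 0))) :=
        (continuous_point (x := x) (ν := C.ν)).continuousAt.tendsto.comp (hp0.prodMk_nhds h1)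
      simpa [point, C.f_zero] using h2)
  rw [perturb_zero, Metric.tendsto_atTop] at hlim
  obtain ⟨n, hn⟩ := hlim ε hε
  exact absurd (hn n le_rfl) (not_lt.2 (hbad n).le)

namespace LevelFamily

variable {ρ : ℝ} {ψ : Space N → ℝ} {F : C.LevelFamily ρ ψ}

set_option maxHeartbeats 1000000 in
/-- Small deformations of the leaves have almost the same curvature and slope. -/
lemma exists_close (hβ : β ≤ 1) (hℓ : 1 ≤ ℓ) {κ : Space N → Set (Space N) → ℝ}
    (hC : IsContinuousCurvature ℓ β κ) (hU : RegularOpen ℓ β U) {ε κ₀ σ : ℝ} (hε : 0 < ε)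
    (hρ : ρ < C.r / 4) (hσ : σ ≤ C.h / 8) {L : Hyper C.ν →L[ℝ] ℝ}
    (hL : ∀ p, ‖p‖ ≤ ρ → ‖fderiv ℝ C.f p - L‖ ≤ ε)
    (hκ : ∀ s : ℝ, |s| ≤ σ → ∀ p : Hyper C.ν, ‖p‖ ≤ ρ →
      |κ (point x C.ν p (C.f p + s * C.eta p)) (C.leaf s) - κ₀| ≤ ε) :
    ∃ δ > 0, δ < F.lam ∧ ∀ a : ℝ, |a| ≤ δ → ∀ s : ℝ, |s| ≤ σ → ∀ p : Hyper C.ν, ‖p‖ < ρ →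
      |κ (point x C.ν p (C.f p + F.g (a, s) p)) (C.perturb (F.g (a, s))) - κ₀| ≤ 2 * ε ∧
      ‖fderiv ℝ (fun p => C.f p + F.g (a, s) p) p - L‖ ≤ 2 * ε := by
  by_contra hcon
  push Not at hcon
  have hℓ1 : (1 : WithTop ℕ∞) ≤ (ℓ : WithTop ℕ∞) := by exact_mod_cast hℓ
  have hr := C.r_pos
  have hh := C.h_pos
  have hlam := F.lam_pos
  set δ : ℕ → ℝ := fun n => min (1 / ((n : ℝ) + 1)) (F.lam / 2)
  have hδ : ∀ n, 0 < δ n := fun n => by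
    have : (0 : ℝ) < 1 / ((n : ℝ) + 1) := by positivity
    exact lt_min this (by positivity)
  have hδl : ∀ n, δ n < F.lam := fun n => (min_le_right _ _).trans_lt (by linarith)
  have hδ0 : Tendsto δ atTop (𝓝 0) := by
    refine squeeze_zero (fun n => (hδ n).le) (fun n => min_le_left _ _) ?_
    exact tendsto_one_div_add_atTop_nhds_zero_nat
  choose a ha s hs p hp hbad using fun n => hcon (δ n) (hδ n) (hδl n)
  have hcomp : IsCompact (Set.Icc (-σ) σ ×ˢ Metric.closedBall (0 : Hyper C.ν) ρ) :=
    isCompact_Icc.prod (isCompact_closedBall _ _)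
  obtain ⟨⟨s₀, p₀⟩, ⟨hs₀, hp₀⟩, φ, hφ, hlimsp⟩ := hcomp.tendsto_subseq
    (x := fun n => (s n, p n)) fun n => ⟨abs_le.1 (hs n), by
      rw [mem_closedBall_zero_iff]; exact (hp n).le⟩
  have hs₀' : |s₀| ≤ σ := abs_le.2 hs₀
  have hp₀' : ‖p₀‖ ≤ ρ := mem_closedBall_zero_iff.1 hp₀
  have hls : Tendsto (fun n => s (φ n)) atTop (𝓝 s₀) := (continuous_fst.tendsto _).comp hlimsp
  have hlp : Tendsto (fun n => p (φ n)) atTop (𝓝 p₀) := (continuous_snd.tendsto _).comp hlimsp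
  have hla : Tendsto (fun n => a (φ n)) atTop (𝓝 0) :=
    (squeeze_zero_norm ha hδ0).comp hφ.tendsto_atTop
  set z : ℕ → ℝ × ℝ := fun n => (a (φ n), s (φ n))
  have hzl : ∀ n, |(z n).1| ≤ F.lam / 2 := fun n => (ha (φ n)).trans (min_le_right _ _)
  have hadm : ∀ n, C.Admissible (F.g (z n)) := fun n =>
    admissible_g hβ hℓ (by linarith) ((hzl n).trans_lt (by linarith)) ((hs (φ n)).trans hσ)
  have hadm0 : C.Admissible (F.g (0, s₀)) :=
    admissible_g hβ hℓ (by linarith) (by simpa using hlam) (hs₀'.trans hσ)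
  have hconv : TendstoHolderC ℓ β (fun n => F.g (z n)) (F.g (0, s₀)) (Metric.ball 0 C.r) :=
    tendstoHolderC_g hβ hzl hla hls
  have hpr : ∀ n, ‖p (φ n)‖ < C.r := fun n => (hp (φ n)).trans (by linarith)
  -- the heights of the graphs converge
  have hgl : Tendsto (fun n => F.g (z n) (p (φ n))) atTop (𝓝 (F.g (0, s₀) p₀)) := by
    have h1 : ContinuousAt (fun q : (ℝ × ℝ) × Hyper C.ν => F.g q.1 q.2) ((0, s₀), p₀) :=
      (holder_g hβ (by simpa using hlam) p₀).continuousAt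
    exact h1.tendsto.comp ((hla.prodMk_nhds hls).prodMk_nhds hlp)
  have hlim := hC (fun n => C.perturb (F.g (z n))) (C.perturb (F.g (0, s₀)))
    (fun n => point x C.ν (p (φ n)) (C.f (p (φ n)) + F.g (z n) (p (φ n))))
    (point x C.ν p₀ (C.f p₀ + F.g (0, s₀) p₀))
    (fun n => (hadm n).isRegular hβ hU) (hadm0.isRegular hβ hU)
    (tendstoRegular_perturb hβ hU hadm0 hadm hconv)
    (fun n => (hadm n).point_mem_frontier (hpr n))
    (hadm0.point_mem_frontier (hp₀'.trans_lt (by linarith))) (by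
      have h1 := (C.continuous.continuousAt.tendsto.comp hlp).add hgl
      exact (continuous_point (x := x) (ν := C.ν)).continuousAt.tendsto.comp (hlp.prodMk_nhds h1))
  have hκ0 : |κ (point x C.ν p₀ (C.f p₀ + F.g (0, s₀) p₀)) (C.perturb (F.g (0, s₀))) - κ₀| ≤ ε := by
    rw [g_zero]
    exact hκ s₀ hs₀' p₀ hp₀'
  have hev1 := Metric.tendsto_atTop.1 hlim ε hε
  obtain ⟨n₁, hn₁⟩ := hev1
  obtain ⟨n₂, hn₂⟩ := eventually_atTop.1 (hconv ε.toNNReal (Real.toNNReal_pos.2 hε))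
  set n := max n₁ n₂
  have hgood1 := hn₁ n (le_max_left _ _)
  have hgood2 := (hn₂ n (le_max_right _ _)).1 1 hℓ (p (φ n)) (mem_ball_zero_iff.2 (hpr n))
  have hb := hbad (φ n)
  refine absurd ?_ (not_le.2 (hb ?_))
  · have hd : ‖fderiv ℝ (F.g (z n)) (p (φ n)) - fderiv ℝ (F.g (0, s₀)) (p (φ n))‖ ≤ ε := by
      rw [Real.coe_toNNReal _ hε.le] at hgood2
      rwa [norm_iteratedFDeriv_one_sub (((hadm n).holder _).1.of_le hℓ1)
        ((hadm0.holder _).1.of_le hℓ1)] at hgood2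
    have hd0 : fderiv ℝ (F.g (0, s₀)) (p (φ n)) = 0 := by
      have hev : F.g (0, s₀) =ᶠ[𝓝 (p (φ n))] fun _ => s₀ := by
        have : ∀ᶠ q in 𝓝 (p (φ n)), ‖q‖ < C.r / 4 :=
          continuous_norm.continuousAt.eventually (gt_mem_nhds ((hp _).trans hρ))
        filter_upwards [this] with q hq
        rw [g_zero]
        change s₀ * C.eta q = s₀
        rw [eta_eq_one hq.le, mul_one]
      rw [hev.fderiv_eq, fderiv_fun_const]
      rfl
    have hdiff : ∀ {f : Hyper C.ν → ℝ}, (∀ p, IsHolderAt ℓ β f p) → Differentiable ℝ f :=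
      fun hf p => (hf p).1.differentiableAt (by
        have : ℓ ≠ 0 := by omega
        exact_mod_cast this)
    rw [hd0, sub_zero] at hd
    have e : fderiv ℝ (fun p => C.f p + F.g (a (φ n), s (φ n)) p) (p (φ n)) - L =
        (fderiv ℝ C.f (p (φ n)) - L) + fderiv ℝ (F.g (z n)) (p (φ n)) := by
      rw [fderiv_fun_add (hdiff C.holder _) (hdiff (hadm n).holder _)]
      abel
    rw [e]
    have h := norm_add_le (fderiv ℝ C.f (p (φ n)) - L) (fderiv ℝ (F.g (z n)) (p (φ n)))
    exact le_trans h (by linarith [hL _ (hp (φ n)).le])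
  · rw [Real.dist_eq] at hgood1
    have := abs_sub_le (κ (point x C.ν (p (φ n)) (C.f (p (φ n)) + F.g (z n) (p (φ n))))
      (C.perturb (F.g (z n))))
      (κ (point x C.ν p₀ (C.f p₀ + F.g (0, s₀) p₀)) (C.perturb (F.g (0, s₀)))) κ₀
    change |κ (point x C.ν (p (φ n)) (C.f (p (φ n)) + F.g (z n) (p (φ n))))
      (C.perturb (F.g (z n))) - κ₀| ≤ 2 * ε
    linarith

/-- The derivative of the deformation with respect to the first parameter. -/
def u (F : C.LevelFamily ρ ψ) (z : ℝ × ℝ) (p : Hyper C.ν) : ℝ :=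
  deriv (fun a => F.g (a, z.2) p) z.1

lemma hasDerivAt_g (hβ : β ≤ 1) (hℓ : 1 ≤ ℓ) {z : ℝ × ℝ} (hz : |z.1| < F.lam) (p : Hyper C.ν) :
    HasDerivAt (fun a => F.g (a, z.2) p)
      (fderiv ℝ (fun q : (ℝ × ℝ) × Hyper C.ν => F.g q.1 q.2) (z, p) ((1, 0), 0)) z.1 := by
  have h1 : DifferentiableAt ℝ (fun q : (ℝ × ℝ) × Hyper C.ν => F.g q.1 q.2) (z, p) :=
    (holder_g hβ hz p).1.differentiableAt (by
      have : ℓ ≠ 0 := by omega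
      exact_mod_cast this)
  have h2 : HasDerivAt (fun a : ℝ => ((a, z.2), p)) (((1 : ℝ), (0 : ℝ)), (0 : Hyper C.ν)) z.1 :=
    ((hasDerivAt_id z.1).prodMk (hasDerivAt_const z.1 z.2)).prodMk (hasDerivAt_const z.1 p)
  exact h1.hasFDerivAt.comp_hasDerivAt z.1 h2

lemma continuousAt_u (hβ : β ≤ 1) (hℓ : 1 ≤ ℓ) {z : ℝ × ℝ} (hz : |z.1| < F.lam)
    (p : Hyper C.ν) : ContinuousAt (fun q : (ℝ × ℝ) × Hyper C.ν => F.u q.1 q.2) (z, p) := by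
  have h1 : ContinuousAt (fun q' => fderiv ℝ (fun q : (ℝ × ℝ) × Hyper C.ν => F.g q.1 q.2) q'
      ((1, 0), 0)) (z, p) := by
    have := (holder_g hβ hz p).1.continuousAt_fderiv (by
      have : ℓ ≠ 0 := by omega
      exact_mod_cast this)
    exact this.clm_apply continuousAt_const
  refine h1.congr ?_
  have : ∀ᶠ q : (ℝ × ℝ) × Hyper C.ν in 𝓝 (z, p), |q.1.1| < F.lam :=
    (continuous_fst.comp continuous_fst).abs.continuousAt.eventually (gt_mem_nhds hz)
  filter_upwards [this] with q hq
  exact ((hasDerivAt_g hβ hℓ (z := q.1) hq q.2).deriv).symm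

lemma u_eq_zero {z : ℝ × ℝ} {p : Hyper C.ν} (hp : ρ ≤ ‖p‖) : F.u z p = 0 := by
  have : (fun a => F.g (a, z.2) p) = fun _ => z.2 * C.eta p := by
    ext a; rw [g, F.supp _ _ hp, mul_zero, add_zero]
  rw [u, this, deriv_const]

lemma u_zero (hℓ : 1 ≤ ℓ) (s : ℝ) (p : Hyper C.ν) :
    F.u (0, s) p = ψ (point x C.ν p (C.f p + s * C.eta p)) := by
  have h1 : DifferentiableAt ℝ (fun q : (ℝ × ℝ) × Hyper C.ν => F.R q.1 q.2) ((0, s), p) :=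
    (F.holder (0, s) (by simpa using F.lam_pos) p).1.differentiableAt (by
      have : ℓ ≠ 0 := by omega
      exact_mod_cast this)
  have h2 : DifferentiableAt ℝ (fun a : ℝ => F.R (a, s) p) 0 :=
    DifferentiableAt.comp 0 (g := fun q : (ℝ × ℝ) × Hyper C.ν => F.R q.1 q.2)
      (f := fun a : ℝ => ((a, s), p)) h1
      ((differentiableAt_id.prodMk (differentiableAt_const _)).prodMk (differentiableAt_const _))
  have h3 := (((hasDerivAt_id (0 : ℝ)).mul h2.hasDerivAt).const_add (s * C.eta p)).deriv
  rw [u]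
  refine Eq.trans ?_ (h3.trans ?_)
  · rfl
  · simp [F.zero]

/-- The value of the functional on small deformations of the leaves is bounded below to first
order, uniformly over the leaves. -/
lemma exists_lower_bound (hβ : β ≤ 1) (hℓ : 1 ≤ ℓ) {J : Set (Space N) → ℝ≥0∞}
    {κ : Space N → Set (Space N) → ℝ} (hκ : IsFirstVariation ℓ β J κ)
    (hC : IsContinuousCurvature ℓ β κ) (hU : RegularOpen ℓ β U) {ε κ₀ σ : ℝ} (hε : 0 < ε)
    (hε4 : ε ≤ 1 / 4) (hρ : ρ < C.r / 4) (hσ : σ ≤ C.h / 8) {L : Hyper C.ν →L[ℝ] ℝ}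
    (hL : ∀ p, ‖p‖ ≤ ρ → ‖fderiv ℝ C.f p - L‖ ≤ ε)
    (hκ₀ : ∀ s : ℝ, |s| ≤ σ → ∀ p : Hyper C.ν, ‖p‖ ≤ ρ →
      |κ (point x C.ν p (C.f p + s * C.eta p)) (C.leaf s) - κ₀| ≤ ε)
    {ε' : ℝ} (hε' : 0 < ε') :
    ∃ δ > 0, δ < F.lam ∧ ∀ a : ℝ, 0 < a → a ≤ δ → ∀ s : ℝ, |s| ≤ σ →
      (J (C.leaf s)).toReal + a * (κ₀ * (∫ p, ψ (point x C.ν p (C.f p + s * C.eta p))) -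
        variationError N κ₀ (√(1 + ‖L‖ ^ 2)) (2 * ε) *
          (∫ p, |ψ (point x C.ν p (C.f p + s * C.eta p))|) - ε') ≤
      (J (C.perturb (F.g (a, s)))).toReal := by
  obtain ⟨δ₁, hδ₁, hδ₁l, hclose⟩ := exists_close (F := F) hβ hℓ hC hU hε hρ hσ hL hκ₀
  have hr := C.r_pos
  have hlam := F.lam_pos
  set err := variationError N κ₀ (√(1 + ‖L‖ ^ 2)) (2 * ε)
  set V : ℝ × ℝ → ℝ := fun z => κ₀ * (∫ p, F.u z p) - err * ∫ p, |F.u z p| with hV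
  have hopen : IsOpen {z : ℝ × ℝ | |z.1| < F.lam} := isOpen_lt continuous_fst.abs continuous_const
  have hucont : ContinuousOn (fun q : (ℝ × ℝ) × Hyper C.ν => F.u q.1 q.2)
      ({z : ℝ × ℝ | |z.1| < F.lam} ×ˢ Set.univ) := fun q hq =>
    (continuousAt_u hβ hℓ (z := q.1) hq.1 q.2).continuousWithinAt
  have hsupp : ∀ (z : ℝ × ℝ) (p : Hyper C.ν), p ∉ Metric.closedBall (0 : Hyper C.ν) ρ →
      F.u z p = 0 := fun z p hp => by
    rw [mem_closedBall_zero_iff, not_le] at hp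
    exact u_eq_zero hp.le
  have hV1 : ContinuousOn (fun z => ∫ p, F.u z p) {z : ℝ × ℝ | |z.1| < F.lam} :=
    continuousOn_integral_of_compact_support (isCompact_closedBall (0 : Hyper C.ν) ρ)
      hucont (fun z p _ hp => hsupp z p hp)
  have hV2 : ContinuousOn (fun z => ∫ p, |F.u z p|) {z : ℝ × ℝ | |z.1| < F.lam} :=
    continuousOn_integral_of_compact_support (isCompact_closedBall (0 : Hyper C.ν) ρ)
      hucont.abs (fun z p _ hp => by rw [hsupp z p hp, abs_zero])
  have hVc : ContinuousOn V {z : ℝ × ℝ | |z.1| < F.lam} :=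
    (hV1.const_mul κ₀).sub (hV2.const_mul err)
  have hunif : ∀ᶠ a : ℝ in 𝓝 0, ∀ s ∈ Set.Icc (-σ) σ, V (0, s) - ε' < V (a, s) := by
    refine isCompact_Icc.eventually_forall_of_forall_eventually fun s _ => ?_
    have h1 : ContinuousAt V (0, s) := hVc.continuousAt (hopen.mem_nhds (by simpa using hlam))
    have h2 : ContinuousAt (fun z : ℝ × ℝ => V (0, z.2)) (0, s) :=
      ContinuousAt.comp (g := V) (f := fun z : ℝ × ℝ => ((0 : ℝ), z.2)) (x := ((0 : ℝ), s)) h1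
        (continuousAt_const.prodMk continuousAt_snd)
    have h3 : V (0, s) - V (0, s) < ε' := by rw [sub_self]; exact hε'
    filter_upwards [(h2.sub h1).eventually (gt_mem_nhds h3)] with z hz
    change V (0, z.2) - V z < ε' at hz
    change V (0, z.2) - ε' < V z
    linarith
  obtain ⟨δ₂, hδ₂, hball⟩ := Metric.eventually_nhds_iff.1 hunif
  refine ⟨min δ₁ (δ₂ / 2), by positivity, (min_le_left _ _).trans_lt hδ₁l, fun a ha0 ha s hs => ?_⟩
  have haδ : a ≤ δ₁ := ha.trans (min_le_left _ _)
  have haδ2 : a ≤ δ₂ / 2 := ha.trans (min_le_right _ _)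
  have hfam : ∀ b : ℝ, |b| < F.lam →
      (∀ᶠ b' in 𝓝 b, C.Admissible (F.g (b', s))) ∧ ∀ᶠ b' in 𝓝 b, ∀ p,
        IsHolderAt ℓ β (fun q : ℝ × Hyper C.ν => F.g (q.1, s) q.2) (b', p) := by
    intro b hb
    have hev : ∀ᶠ b' : ℝ in 𝓝 b, |b'| < F.lam :=
      continuous_abs.continuousAt.eventually (gt_mem_nhds hb)
    refine ⟨?_, ?_⟩
    · filter_upwards [hev] with b' hb'
      exact admissible_g hβ hℓ (by linarith) hb' (hs.trans hσ)
    · filter_upwards [hev] with b' hb' p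
      have hin : ContDiff ℝ (⊤ : ℕ∞) fun q : ℝ × Hyper C.ν => ((q.1, s), q.2) :=
        (contDiff_fst.prodMk contDiff_const).prodMk contDiff_snd
      exact IsHolderAt.comp hβ ℓ (f := fun q : (ℝ × ℝ) × Hyper C.ν => F.g q.1 q.2)
        (g := fun q : ℝ × Hyper C.ν => ((q.1, s), q.2)) (holder_g hβ (z := (b', s)) hb' p)
        (IsHolderAt.of_contDiff hβ hin le_top _) (hin.contDiffAt.of_le (mod_cast le_top))
  have hder := fun (b : ℝ) (hb : |b| < F.lam) =>
    hasDerivAt_perturb hβ hℓ hκ hU (g := fun b => F.g (b, s)) (c := b) (hfam b hb).1 (hfam b hb).2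
  have habs : ∀ b ∈ Set.Icc 0 a, |b| ≤ δ₁ := fun b hb => by
    rw [abs_of_nonneg hb.1]; exact hb.2.trans haδ
  obtain ⟨b, hb, hslope⟩ := exists_hasDerivAt_eq_slope
    (fun b => (J (C.perturb (F.g (b, s)))).toReal) _ ha0
    (fun b hb => ((hder b ((habs b hb).trans_lt hδ₁l)).2.continuousAt).continuousWithinAt)
    (fun b hb => (hder b ((habs b ⟨hb.1.le, hb.2.le⟩).trans_lt hδ₁l)).2)
  have hbI : b ∈ Set.Icc 0 a := ⟨hb.1.le, hb.2.le⟩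
  have hbl := (habs b hbI).trans_lt hδ₁l
  have hest := (admissible_g (F := F) (z := (b, s)) hβ hℓ (by linarith) hbl
    (hs.trans hσ)).abs_firstVariation_sub_le hℓ (L := L)
    (k := fun y => κ y (C.perturb (F.g (b, s)))) (κ₀ := κ₀) (ε := 2 * ε) (ρ := ρ)
    (by linarith) (by linarith) (by linarith)
    (fun p hp => (hclose b (habs b hbI) s hs p hp).2)
    (fun p hp => (hclose b (habs b hbI) s hs p hp).1)
    (u := F.u (b, s)) (by
      refine continuous_iff_continuousAt.2 fun p => ?_
      exact ContinuousAt.comp (g := fun q : (ℝ × ℝ) × Hyper C.ν => F.u q.1 q.2)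
        (f := fun p => ((b, s), p)) (x := p) (continuousAt_u hβ hℓ (z := (b, s)) hbl p)
        (continuousAt_const.prodMk continuousAt_id))
    (fun p hp => u_eq_zero hp) (hder b hbl).1
  have hVb : V (0, s) - ε' < V (b, s) := hball (by
    rw [Real.dist_eq, sub_zero, abs_of_nonneg hb.1.le]; linarith [hb.2]) s (abs_le.1 hs)
  have hlow := (abs_le.1 hest).1
  have hV0 : V (0, s) = κ₀ * (∫ p, ψ (point x C.ν p (C.f p + s * C.eta p))) -
      err * ∫ p, |ψ (point x C.ν p (C.f p + s * C.eta p))| := by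
    simp only [hV, u_zero hℓ]
  have h0 : C.perturb (F.g (0, s)) = C.leaf s := by rw [g_zero, leaf]
  rw [← hV0]
  rw [h0, sub_zero, eq_div_iff ha0.ne'] at hslope
  have hfin : V (0, s) - ε' ≤ ∫ y in frontier (C.perturb (F.g (b, s))),
      κ y (C.perturb (F.g (b, s))) *
        ⟪(C.chi (tcoord x C.ν y) * F.u (b, s) (hcoord x C.ν y)) • C.ν,
          outerNormal (C.perturb (F.g (b, s))) y⟫ ∂μHE[N - 1] := by
    have : V (b, s) = κ₀ * (∫ p, F.u (b, s) p) - err * ∫ p, |F.u (b, s) p| := rfl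
    linarith
  have := mul_le_mul_of_nonneg_left hfin ha0.le
  have hslope' := hslope
  rw [mul_comm] at hslope'
  have e : a * (∫ y in frontier (C.perturb (F.g (b, s))),
      κ y (C.perturb (F.g (b, s))) *
        ⟪(C.chi (tcoord x C.ν y) * F.u (b, s) (hcoord x C.ν y)) • C.ν,
          outerNormal (C.perturb (F.g (b, s))) y⟫ ∂μHE[N - 1]) =
      (J (C.perturb (F.g (a, s)))).toReal - (J (C.leaf s)).toReal := hslope'
  linarith

end LevelFamily

end GraphChart

end Closeness

/-! ### Means of random sets -/

section Means

variable {ℓ : ℕ} {β : ℝ≥0} {J : Set (Space N) → ℝ≥0∞}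

/-- The uniform distribution on the unit interval. -/
abbrev unitMeasure : Measure ℝ := volume.restrict (Set.Ioo 0 1)

lemma unitMeasure_real_of_subset {S : Set ℝ} {d : ℝ} (hd : d ∈ Set.Icc (0 : ℝ) 1)
    (h1 : Set.Ioo 0 d ⊆ S) (h2 : S ∩ Set.Ioo 0 1 ⊆ Set.Icc 0 d) : unitMeasure.real S = d := by
  have e : ∀ a : ℝ, 0 ≤ a → a ≤ 1 → unitMeasure.real (Set.Ioo 0 a) = a := fun a h0 h1 => by
    rw [measureReal_restrict_apply measurableSet_Ioo, Set.inter_eq_left.2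
      (Set.Ioo_subset_Ioo_right h1), Real.volume_real_Ioo_of_le h0, sub_zero]
  refine le_antisymm ?_ ?_
  · have h3 : unitMeasure.real S ≤ volume.real (Set.Icc 0 d) := by
      rw [measureReal_def, measureReal_def]
      refine ENNReal.toReal_mono (by simp) ?_
      rw [Measure.restrict_apply' measurableSet_Ioo]
      exact measure_mono h2
    rwa [Real.volume_real_Icc_of_le hd.1, sub_zero] at h3
  · rw [← e d hd.1 hd.2]
    exact measureReal_mono h1

/-- Equality in Jensen's inequality for a decreasing family of sets: the superlevel sets of the mean
are almost everywhere equal to the members of the family. -/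
lemma IsGeneralizedPerimeter.levelPerimeter_mean_of_antitone (hJ : IsGeneralizedPerimeter ℓ β J)
    {A : Set (ℝ × Space N)} (hA : MeasurableSet A)
    (hmono : ∀ y θ θ', θ' ≤ θ → (θ, y) ∈ A → (θ', y) ∈ A) :
    levelPerimeter J (fun y => unitMeasure.real {θ | (θ, y) ∈ A}) =
      ∫⁻ θ in Set.Ioo 0 1, J {y | (θ, y) ∈ A} := by
  set v : Space N → ℝ := fun y => unitMeasure.real {θ | (θ, y) ∈ A} with hv
  have hvm : Measurable v := (measurable_measure_prodMk_right hA).ennreal_toReal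
  refine setLIntegral_congr_fun_ae measurableSet_Ioo ?_
  filter_upwards [ae_level_ae_ne hvm] with θ hθ hθ1
  refine hJ.congr_ae (measurableSet_superlevel hvm θ) (measurable_prodMk_left hA) ?_
  have e : unitMeasure.real (Set.Ioo 0 θ) = θ :=
    unitMeasure_real_of_subset ⟨hθ1.1.le, hθ1.2.le⟩ subset_rfl
      (Set.inter_subset_left.trans Set.Ioo_subset_Icc_self)
  filter_upwards [hθ] with y hy
  refine ⟨fun h => ?_, fun h => ?_⟩
  · by_contra hn
    refine absurd h (not_lt.2 ?_)
    have h1 : v y ≤ volume.real (Set.Ioo 0 θ) := by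
      change (unitMeasure _).toReal ≤ (volume _).toReal
      refine ENNReal.toReal_mono (by simp) ?_
      rw [Measure.restrict_apply' measurableSet_Ioo]
      refine measure_mono fun t ht => ⟨ht.2.1, ?_⟩
      by_contra hθt
      exact hn (hmono y t θ (not_lt.1 hθt) ht.1)
    rwa [Real.volume_real_Ioo_of_le hθ1.1.le, sub_zero] at h1
  · refine lt_of_le_of_ne ?_ (Ne.symm hy)
    calc θ = unitMeasure.real (Set.Ioo 0 θ) := e.symm
      _ ≤ v y := measureReal_mono fun t ht => hmono y θ t ht.2.le h

lemma unitMeasure_real_threshold {σ c : ℝ} (hσ : 0 < σ) (hc : |c| ≤ σ) :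
    unitMeasure.real {θ | c ≤ σ - 2 * σ * θ} = 1 / 2 - c / (2 * σ) := by
  have hc' := abs_le.1 hc
  have h0 : c / (2 * σ) ≤ 1 / 2 := by rw [div_le_iff₀ (by positivity)]; linarith
  have h1 : -(1 / 2) ≤ c / (2 * σ) := by rw [le_div_iff₀ (by positivity)]; linarith
  have key : ∀ θ : ℝ, c ≤ σ - 2 * σ * θ ↔ θ ≤ 1 / 2 - c / (2 * σ) := fun θ => by
    have : c = c / (2 * σ) * (2 * σ) := by field_simp
    constructor
    · intro h
      have h3 : 2 * σ * (c / (2 * σ)) ≤ 2 * σ * (1 / 2 - θ) := by linarith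
      have := le_of_mul_le_mul_left h3 (by positivity)
      linarith
    · intro h
      have := mul_le_mul_of_nonneg_left h (by positivity : 0 ≤ 2 * σ)
      linarith
  refine unitMeasure_real_of_subset ⟨by linarith, by linarith⟩ (fun θ hθ => ?_) fun θ hθ => ?_
  · exact (key θ).2 hθ.2.le
  · exact ⟨hθ.2.1.le, (key θ).1 hθ.1⟩

lemma integral_unitMeasure (σ : ℝ) (k : ℝ → ℝ) :
    2 * σ * ∫ θ, k (σ - 2 * σ * θ) ∂unitMeasure = ∫ s in (-σ)..σ, k s := by
  have h := intervalIntegral.smul_integral_comp_sub_mul (a := 0) (b := 1) k (2 * σ) σ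
  rw [intervalIntegral.integral_of_le zero_le_one, integral_Ioc_eq_integral_Ioo] at h
  rw [show σ - 2 * σ * 1 = -σ by ring, show σ - 2 * σ * 0 = σ by ring] at h
  exact h

/-- The mean, at a fixed point, of the random set which, given `θ`, is a random set of the
family `B` with probability `w θ`, and is the set of the family `L` otherwise. -/
lemma mixture_real {Ω : Type*} [MeasurableSpace Ω] (P : Measure Ω) [IsProbabilityMeasure P]
    {w : ℝ → ℝ} (hw : Measurable w) (hw0 : ∀ θ, w θ ∈ Set.Icc (0 : ℝ) 1) {B : Set (ℝ × Ω)}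
    (hB : MeasurableSet B) {L : Set ℝ} (hL : MeasurableSet L) :
    (unitMeasure.prod (unitMeasure.prod P)).real
      {q | (q.2.1 < w q.1 ∧ (q.1, q.2.2) ∈ B) ∨ (w q.1 ≤ q.2.1 ∧ q.1 ∈ L)} =
      ∫ θ, (L.indicator 1 θ + w θ * (P.real {a | (θ, a) ∈ B} - L.indicator 1 θ)) ∂unitMeasure := by
  have hm1 : MeasurableSet {q : ℝ × (ℝ × Ω) | q.2.1 < w q.1} :=
    measurableSet_lt (measurable_fst.comp measurable_snd) (hw.comp measurable_fst)
  have hm2 : MeasurableSet {q : ℝ × (ℝ × Ω) | w q.1 ≤ q.2.1} :=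
    measurableSet_le (hw.comp measurable_fst) (measurable_fst.comp measurable_snd)
  have hm3 : MeasurableSet {q : ℝ × (ℝ × Ω) | (q.1, q.2.2) ∈ B} :=
    (measurable_fst.prodMk (measurable_snd.comp measurable_snd)) hB
  have hm : MeasurableSet {q : ℝ × (ℝ × Ω) |
      (q.2.1 < w q.1 ∧ (q.1, q.2.2) ∈ B) ∨ (w q.1 ≤ q.2.1 ∧ q.1 ∈ L)} :=
    (hm1.inter hm3).union (hm2.inter (measurable_fst hL))
  rw [measureReal_def, Measure.prod_apply hm, ← integral_toReal
    (measurable_measure_prodMk_left hm).aemeasurable (Eventually.of_forall fun _ =>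
      measure_lt_top _ _)]
  refine integral_congr_ae (Eventually.of_forall fun θ => ?_)
  have hsec : Prod.mk θ ⁻¹' {q : ℝ × (ℝ × Ω) |
      (q.2.1 < w q.1 ∧ (q.1, q.2.2) ∈ B) ∨ (w q.1 ≤ q.2.1 ∧ q.1 ∈ L)} =
      (Set.Iio (w θ) ×ˢ {a | (θ, a) ∈ B}) ∪ (Set.Ici (w θ) ×ˢ {_a | θ ∈ L}) := by
    ext ⟨c, a⟩
    simp
  have hBθ : MeasurableSet {a | (θ, a) ∈ B} := measurable_prodMk_left hB
  have hdisj : Disjoint (Set.Iio (w θ) ×ˢ {a | (θ, a) ∈ B})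
      (Set.Ici (w θ) ×ˢ {_a : Ω | θ ∈ L}) := by
    rw [Set.disjoint_left]
    rintro ⟨c, a⟩ h1 h2
    have h3 : c < w θ := h1.1
    have h4 : w θ ≤ c := h2.1
    exact (h3.trans_le h4).false
  have e1 : unitMeasure.real (Set.Iio (w θ)) = w θ :=
    unitMeasure_real_of_subset (hw0 θ) (fun t ht => ht.2) fun t ht => ⟨ht.2.1.le, ht.1.le⟩
  have e2 : unitMeasure.real (Set.Ici (w θ)) = 1 - w θ := by
    rw [← Set.compl_Iio, probReal_compl_eq_one_sub measurableSet_Iio, e1]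
  change ((unitMeasure.prod P) _).toReal = _
  rw [hsec, ← measureReal_def, measureReal_union hdisj
    (measurableSet_Ici.prod (MeasurableSet.const _)), measureReal_prod_prod, measureReal_prod_prod,
    e1, e2]
  by_cases hθ : θ ∈ L
  · simp [hθ]; ring
  · simp [hθ]

end Means

/-! ### The mean inequality for a random modification of the leaves -/

section MeanInequality

variable {ℓ : ℕ} {β : ℝ≥0} {J : Set (Space N) → ℝ≥0∞}

namespace GraphChart

variable {U : Set (Space N)} {x : Space N} {C : GraphChart ℓ β U x}

lemma measurableSet_perturb_family {Z : Type} [TopologicalSpace Z] [MeasurableSpace Z]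
    [OpensMeasurableSpace Z] [SecondCountableTopology Z] {G : Z × Hyper C.ν → ℝ}
    (hG : Continuous G) :
    MeasurableSet {q : Z × Space N | q.2 ∈ C.perturb fun p => G (q.1, p)} := by
  have hcyl : MeasurableSet {q : Z × Space N | q.2 ∈ C.cyl} :=
    measurable_snd isOpen_cyl.measurableSet
  have h1 : IsClosed {q : Z × Space N | tcoord x C.ν q.2 ≤
      C.f (hcoord x C.ν q.2) + G (q.1, hcoord x C.ν q.2)} := by
    have hh := (continuous_hcoord (x := x) (ν := C.ν)).comp (continuous_snd (X := Z))
    exact isClosed_le (continuous_tcoord.comp continuous_snd)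
      ((C.continuous.comp hh).add (hG.comp (continuous_fst.prodMk hh)))
  exact (hcyl.inter h1.measurableSet).union
    (hcyl.compl.inter (measurable_snd isClosed_closure.measurableSet))

lemma measurableSet_leaf : MeasurableSet {q : ℝ × Space N | q.2 ∈ C.leaf q.1} :=
  measurableSet_perturb_family (G := fun q : ℝ × Hyper C.ν => q.1 * C.eta q.2)
    (continuous_fst.mul (C.eta.continuous.comp continuous_snd))

lemma continuousOn_leaf (hβ : β ≤ 1) (hℓ : 1 ≤ ℓ) {κ : Space N → Set (Space N) → ℝ}
    (hκ : IsFirstVariation ℓ β J κ) (hU : RegularOpen ℓ β U) {σ : ℝ} (hσ : σ ≤ C.h / 8) :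
    ContinuousOn (fun s => (J (C.leaf s)).toReal) (Set.Icc (-σ) σ) := by
  intro s hs
  have hev : ∀ᶠ s' : ℝ in 𝓝 s, |s'| < C.h / 4 :=
    continuous_abs.continuousAt.eventually (gt_mem_nhds (by
      have := abs_le.2 hs; linarith [C.h_pos]))
  refine (hasDerivAt_perturb hβ hℓ hκ hU (g := fun s p => s * C.eta p) (c := s) ?_ ?_).2
    |>.continuousAt.continuousWithinAt
  · filter_upwards [hev] with s' hs'
    exact admissible_mul_eta hβ hs'.le
  · refine Eventually.of_forall fun s' p => ?_
    exact IsHolderAt.of_contDiff hβ (n := ⊤)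
      (contDiff_fst.mul (C.eta.contDiff.comp contDiff_snd)) le_top _

/-- The region of the chart in which the leaves are the level sets of `t - f`, with values bounded
by `c`. -/
def tube (C : GraphChart ℓ β U x) (c : ℝ) : Set (Space N) :=
  {y | y ∈ C.cyl ∧ ‖hcoord x C.ν y‖ ≤ C.r / 4 ∧ |tcoord x C.ν y - C.f (hcoord x C.ν y)| ≤ c}

lemma mem_leaf_of_mem_tube {c s : ℝ} {y : Space N} (hy : y ∈ C.tube c) :
    y ∈ C.leaf s ↔ tcoord x C.ν y - C.f (hcoord x C.ν y) ≤ s := by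
  rw [leaf, mem_perturb_of_mem_cyl hy.1, eta_eq_one hy.2.1, mul_one, sub_le_iff_le_add']

/-- Integration in the coordinates given by the leaves. -/
lemma integral_leaves {σ c : ℝ} (hσc : c < σ) {ψ : Space N → ℝ} (hψ : Continuous ψ)
    (hs : ∀ y, ψ y ≠ 0 → y ∈ C.tube c) :
    2 * σ * ∫ θ, (∫ p, ψ (point x C.ν p (C.f p + (σ - 2 * σ * θ) * C.eta p))) ∂unitMeasure =
      ∫ y, ψ y := by
  rw [integral_unitMeasure σ fun s => ∫ p, ψ (point x C.ν p (C.f p + s * C.eta p))]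
  set G : Hyper C.ν × ℝ → ℝ := fun q => ψ (point x C.ν q.1 (C.f q.1 + q.2)) with hG
  have hGs : ∀ q, G q ≠ 0 → ‖q.1‖ ≤ C.r / 4 ∧ |q.2| ≤ c := by
    intro q hq
    have := (hs _ hq).2
    rwa [hcoord_point, tcoord_point C.norm_ν, add_sub_cancel_left] at this
  have hGc : Continuous G := hψ.comp (continuous_point.comp (continuous_fst.prodMk
    ((C.continuous.comp continuous_fst).add continuous_snd)))
  have hGi : Integrable G (volume.prod volume) := by
    refine hGc.integrable_of_hasCompactSupport (HasCompactSupport.intro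
      ((isCompact_closedBall (0 : Hyper C.ν) (C.r / 4)).prod (isCompact_Icc (a := -c) (b := c)))
      fun q hq => ?_)
    by_contra h
    exact hq ⟨mem_closedBall_zero_iff.2 (hGs q h).1, abs_le.1 (hGs q h).2⟩
  have h1 : ∀ s, (∫ p, ψ (point x C.ν p (C.f p + s * C.eta p))) = ∫ p, G (p, s) := by
    intro s
    refine integral_congr_ae (Eventually.of_forall fun p => ?_)
    by_cases hp : ‖p‖ ≤ C.r / 4
    · simp only [hG]; rw [eta_eq_one hp, mul_one]
    · have e1 : G (p, s) = 0 := by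
        by_contra h; exact hp (hGs _ h).1
      have e2 : ψ (point x C.ν p (C.f p + s * C.eta p)) = 0 := by
        by_contra h
        have := (hs _ h).2.1
        rw [hcoord_point] at this
        exact hp this
      simp only [e1, e2]
  simp only [h1]
  have hψi : Integrable (fun q : Hyper C.ν × ℝ => ψ (point x C.ν q.1 q.2))
      (volume.prod volume) := by
    refine (hψ.comp continuous_point).integrable_of_hasCompactSupport (HasCompactSupport.intro
      ((isCompact_closedBall (0 : Hyper C.ν) (C.r / 4)).prod
        (isCompact_Icc (a := -C.h) (b := C.h))) fun q hq => ?_)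
    by_contra h
    have := hs _ h
    rw [tube, Set.mem_ofPred_eq, mem_cyl_iff, hcoord_point, tcoord_point C.norm_ν] at this
    exact hq ⟨mem_closedBall_zero_iff.2 this.2.1, abs_le.1 this.1.2.le⟩
  have h2 : ∫ y, ψ y = ∫ q : Hyper C.ν × ℝ, ψ (point x C.ν q.1 q.2) ∂(volume.prod volume) := by
    have hmp := measurePreserving_point (x := x) C.norm_ν
    rw [← hmp.map_eq]
    exact integral_map hmp.measurable.aemeasurable (hψ.aestronglyMeasurable)
  rw [h2, integral_prod _ hψi]
  have h3 : ∀ p : Hyper C.ν, (∫ t, ψ (point x C.ν p t)) = ∫ t, G (p, t) := fun p => by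
    simp only [hG]
    exact (integral_add_left_eq_self (fun t => ψ (point x C.ν p t)) (C.f p)).symm
  simp only [h3]
  rw [← integral_prod _ hGi, integral_prod_symm _ hGi]
  refine intervalIntegral.integral_eq_integral_of_support_subset fun s hs' => ?_
  have hne : ∃ p, G (p, s) ≠ 0 := by
    by_contra! h0
    exact hs' (by simp [h0])
  obtain ⟨p, hp⟩ := hne
  have := abs_le.1 (hGs _ hp).2
  dsimp only at this
  exact ⟨by linarith, by linarith⟩

namespace LevelFamily

variable {ρ : ℝ} {ψ : Space N → ℝ} {F : C.LevelFamily ρ ψ}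

lemma mem_perturb_iff {z : ℝ × ℝ} (hz : |z.1| < F.lam) {y : Space N} (hy : y ∈ C.cyl) :
    y ∈ C.perturb (F.g z) ↔
      tcoord x C.ν y - z.1 * ψ y ≤ C.f (hcoord x C.ν y) + z.2 * C.eta (hcoord x C.ν y) := by
  rw [mem_perturb_of_mem_cyl hy]
  have := F.mem_iff z hz (hcoord x C.ν y) (tcoord x C.ν y)
  rw [point_coords C.norm_ν] at this
  exact this.symm

lemma mem_perturb_iff_of_eq_zero {lam s : ℝ} (hlam : |lam| < F.lam) {y : Space N}
    (hy : ψ y = 0) : y ∈ C.perturb (F.g (lam, s)) ↔ y ∈ C.leaf s := by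
  by_cases hc : y ∈ C.cyl
  · rw [mem_perturb_iff (z := (lam, s)) hlam hc, leaf, mem_perturb_of_mem_cyl hc, hy, mul_zero,
      sub_zero]
  · rw [leaf, mem_perturb_of_notMem_cyl hc, mem_perturb_of_notMem_cyl hc]

lemma measurableSet_deformation (hβ : β ≤ 1) {lam : ℝ} (hlam : |lam| < F.lam) :
    MeasurableSet {q : ℝ × Space N | q.2 ∈ C.perturb (F.g (lam, q.1))} :=
  measurableSet_perturb_family (G := fun q : ℝ × Hyper C.ν => F.g (lam, q.1) q.2)
    (continuous_iff_continuousAt.2 fun q =>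
      ContinuousAt.comp (g := fun q : (ℝ × ℝ) × Hyper C.ν => F.g q.1 q.2)
        (f := fun q : ℝ × Hyper C.ν => ((lam, q.1), q.2)) (x := q)
        (holder_g hβ (z := (lam, q.1)) hlam q.2).1.continuousAt (by fun_prop))

/-- The mean of the deformed leaves is the mean of the leaves plus a multiple of `ψ`. -/
lemma mean_deformation {σ lam : ℝ} (hσ : 0 < σ) (hlam : |lam| < F.lam)
    (hs : ∀ y, ψ y ≠ 0 → y ∈ C.tube (σ / 2)) (hsmall : ∀ y, |lam * ψ y| ≤ σ / 2) (y : Space N) :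
    unitMeasure.real {θ | y ∈ C.perturb (F.g (lam, σ - 2 * σ * θ))} =
      unitMeasure.real {θ | y ∈ C.leaf (σ - 2 * σ * θ)} + lam * ψ y / (2 * σ) := by
  by_cases hy : ψ y = 0
  · simp only [mem_perturb_iff_of_eq_zero hlam hy, hy, mul_zero, zero_div, add_zero]
  · have ht := hs y hy
    have h1 : ∀ s, y ∈ C.perturb (F.g (lam, s)) ↔
        tcoord x C.ν y - C.f (hcoord x C.ν y) - lam * ψ y ≤ s := fun s => by
      rw [mem_perturb_iff (z := (lam, s)) hlam ht.1, eta_eq_one ht.2.1, mul_one]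
      constructor <;> intro h <;> linarith
    simp only [h1, mem_leaf_of_mem_tube ht]
    have h2 := ht.2.2
    have h3 := abs_le.1 (hsmall y)
    rw [unitMeasure_real_threshold hσ (h2.trans (by linarith)), unitMeasure_real_threshold hσ
      (abs_le.2 (by have := abs_le.1 h2; exact ⟨by linarith, by linarith⟩))]
    ring

end LevelFamily

end GraphChart

end MeanInequality

section RandomModification

variable {ℓ : ℕ} {β : ℝ≥0} {J : Set (Space N) → ℝ≥0∞}

namespace GraphChart

variable {U : Set (Space N)} {x : Space N} {C : GraphChart ℓ β U x}

namespace LevelFamily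

variable {ρ : ℝ} {ψ : Space N → ℝ} {F : C.LevelFamily ρ ψ}

/-- The coarea extension of `J` at the mean of the deformed leaves, from below. -/
lemma ofReal_le_levelPerimeter (hβ : β ≤ 1) (hJ : IsGeneralizedPerimeter ℓ β J) {σ : ℝ}
    (hσ0 : 0 < σ) {lam : ℝ} (hlam : |lam| < F.lam) {k : ℝ → ℝ}
    (hk : Integrable (fun θ => k (σ - 2 * σ * θ)) unitMeasure)
    (hkJ : ∀ s : ℝ, |s| ≤ σ → k s ≤ (J (C.perturb (F.g (lam, s)))).toReal) :
    ENNReal.ofReal (∫ θ, k (σ - 2 * σ * θ) ∂unitMeasure) ≤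
      levelPerimeter J
        (fun y => unitMeasure.real {θ | y ∈ C.perturb (F.g (lam, σ - 2 * σ * θ))}) := by
  have hA : MeasurableSet {q : ℝ × Space N | q.2 ∈ C.perturb (F.g (lam, σ - 2 * σ * q.1))} := by
    have hmeas : Measurable fun q : ℝ × Space N => (σ - 2 * σ * q.1, q.2) := by fun_prop
    exact hmeas (measurableSet_deformation (F := F) hβ hlam)
  have h := hJ.levelPerimeter_mean_of_antitone hA fun y θ θ' hθ hy => by
    change y ∈ C.perturb _ at hy
    change y ∈ C.perturb _
    by_cases hc : y ∈ C.cyl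
    · rw [mem_perturb_iff (z := (lam, _)) hlam hc] at hy ⊢
      refine hy.trans ?_
      have h1 : σ - 2 * σ * θ ≤ σ - 2 * σ * θ' := by nlinarith
      have := mul_le_mul_of_nonneg_right h1 (C.eta.nonneg (x := hcoord x C.ν y))
      dsimp only
      linarith
    · rwa [mem_perturb_of_notMem_cyl hc] at hy ⊢
  refine le_trans ?_ h.symm.le
  have hint : (∫ θ, k (σ - 2 * σ * θ) ∂unitMeasure) ≤
      ∫ θ, max (k (σ - 2 * σ * θ)) 0 ∂unitMeasure :=
    integral_mono hk hk.pos_part fun θ => le_max_left _ _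
  refine (ENNReal.ofReal_le_ofReal hint).trans ?_
  rw [ofReal_integral_eq_lintegral_ofReal hk.pos_part
    (Eventually.of_forall fun θ => le_max_right _ _)]
  refine setLIntegral_mono' measurableSet_Ioo fun θ hθ => ?_
  have hs : |σ - 2 * σ * θ| ≤ σ :=
    abs_le.2 ⟨by nlinarith [hθ.1, hθ.2], by nlinarith [hθ.1, hθ.2]⟩
  refine ENNReal.ofReal_le_of_le_toReal (max_le (hkJ _ hs) ENNReal.toReal_nonneg)

set_option maxHeartbeats 1000000 in
/-- If the leaves can be modified at random, with intensity `w`, in such a way that the mean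
changes by `ψ` and the values of `J` increase by at most `b`, then `b` times the total intensity
is bounded below by the first variation of `J`, up to the error due to the oscillation of the
curvature and of the slope in the chart. -/
theorem mean_inequality (hβ : β ≤ 1) (hℓ : 1 ≤ ℓ) (hJ : IsGeneralizedPerimeter ℓ β J)
    {κ : Space N → Set (Space N) → ℝ} (hκ : IsFirstVariation ℓ β J κ)
    (hC : IsContinuousCurvature ℓ β κ) (hU : RegularOpen ℓ β U) (F : C.LevelFamily ρ ψ)
    {ε κ₀ σ : ℝ} (hε : 0 < ε) (hε4 : ε ≤ 1 / 4) (hρ : ρ < C.r / 4) (hσ0 : 0 < σ)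
    (hσ : σ ≤ C.h / 8) {L : Hyper C.ν →L[ℝ] ℝ}
    (hL : ∀ p, ‖p‖ ≤ ρ → ‖fderiv ℝ C.f p - L‖ ≤ ε)
    (hκ₀ : ∀ s : ℝ, |s| ≤ σ → ∀ p : Hyper C.ν, ‖p‖ ≤ ρ →
      |κ (point x C.ν p (C.f p + s * C.eta p)) (C.leaf s) - κ₀| ≤ ε)
    (hψ : Continuous ψ) (hψs : ∀ y, ψ y ≠ 0 → y ∈ C.tube (σ / 2)) {M : ℝ} (hM : ∀ y, |ψ y| ≤ M)
    {w : ℝ → ℝ} (hw : Continuous w) (hw0 : ∀ s, 0 ≤ w s) {B : ℝ} (hwB : ∀ s, w s ≤ B)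
    {Ω : Type} [MeasurableSpace Ω] (P : Measure Ω) [IsProbabilityMeasure P]
    {D : Set ((ℝ × Ω) × Space N)} (hD : MeasurableSet D)
    (hmean : ∀ y, ψ y = 2 * σ * ∫ θ, w (σ - 2 * σ * θ) *
      (P.real {a | ((σ - 2 * σ * θ, a), y) ∈ D} -
        {θ | y ∈ C.leaf (σ - 2 * σ * θ)}.indicator 1 θ) ∂unitMeasure)
    {S : Set Ω} (hS : ∀ᵐ a ∂P, a ∈ S) {b : ℝ}
    (hJD : ∀ s : ℝ, |s| ≤ σ → 0 < w s → ∀ a ∈ S, J {y | ((s, a), y) ∈ D} ≠ ⊤ ∧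
      (J {y | ((s, a), y) ∈ D}).toReal ≤ (J (C.leaf s)).toReal + b) :
    κ₀ * (∫ y, ψ y) - variationError N κ₀ (√(1 + ‖L‖ ^ 2)) (2 * ε) * (∫ y, |ψ y|) ≤
      b * ∫ s in (-σ)..σ, w s := by
  set err := variationError N κ₀ (√(1 + ‖L‖ ^ 2)) (2 * ε)
  refine le_of_forall_pos_le_add fun η hη => ?_
  obtain ⟨δ, hδ, hδl, hlow⟩ := exists_lower_bound (F := F) hβ hℓ hκ hC hU hε hε4 hρ hσ hL hκ₀
    (ε' := η / (2 * σ)) (by positivity)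
  have hM0 : 0 ≤ M := (abs_nonneg _).trans (hM x)
  have hB0 : 0 ≤ B := (hw0 0).trans (hwB 0)
  -- `lam * w s` has to be a probability, and the displacements `lam * ψ` have to be at most `σ / 2`
  -- for the mean of the deformed leaves to be computed in the tube
  set lam := min δ (min (σ / (2 * (M + 1))) (1 / (B + 1)))
  have hlam0 : 0 < lam := by positivity
  have hlamδ : lam ≤ δ := min_le_left _ _
  have hlamF : |lam| < F.lam := by rw [abs_of_pos hlam0]; exact hlamδ.trans_lt hδl
  have hlamM : lam * M ≤ σ / 2 := by
    have h : lam ≤ σ / (2 * (M + 1)) := (min_le_right _ _).trans (min_le_left _ _)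
    rw [le_div_iff₀ (by positivity)] at h
    nlinarith
  have hlamB : lam * B ≤ 1 := by
    have h : lam ≤ 1 / (B + 1) := (min_le_right _ _).trans (min_le_right _ _)
    rw [le_div_iff₀ (by positivity)] at h
    nlinarith
  set sθ : ℝ → ℝ := fun θ => σ - 2 * σ * θ with hsθ
  have hsθc : Continuous sθ := by fun_prop
  have hsσ : ∀ᵐ θ ∂unitMeasure, |sθ θ| ≤ σ := by
    filter_upwards [ae_restrict_mem measurableSet_Ioo] with θ hθ
    exact abs_le.2 ⟨by simp only [hsθ]; nlinarith [hθ.1, hθ.2],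
      by simp only [hsθ]; nlinarith [hθ.1, hθ.2]⟩
  -- the values of `J` on the leaves, extended continuously to all parameters
  set clamp : ℝ → ℝ := fun s => max (-σ) (min s σ)
  have hclampc : Continuous clamp := by fun_prop
  have hclampm : ∀ s, clamp s ∈ Set.Icc (-σ) σ := fun s =>
    ⟨le_max_left _ _, max_le (by linarith) (min_le_right _ _)⟩
  have hclamp : ∀ {s : ℝ}, |s| ≤ σ → clamp s = s := fun {s} hs => by
    have := abs_le.1 hs
    simp only [clamp]
    rw [min_eq_left this.2, max_eq_right this.1]
  set j : ℝ → ℝ := fun s => (J (C.leaf (clamp s))).toReal with hj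
  have hjc : Continuous j :=
    (continuousOn_leaf hβ hℓ hκ hU hσ).comp_continuous hclampc hclampm
  have hjs : ∀ {s : ℝ}, |s| ≤ σ → j s = (J (C.leaf s)).toReal := fun {s} hs => by
    simp only [hj]; rw [hclamp hs]
  obtain ⟨Bj, hBj⟩ := isCompact_Icc.exists_bound_of_continuousOn
    (continuousOn_leaf (C := C) hβ hℓ hκ hU hσ)
  have hjB : ∀ s, ‖j s‖ ≤ Bj := fun s => hBj _ (hclampm s)
  have hji : Integrable (fun θ => j (sθ θ)) unitMeasure :=
    Integrable.of_bound (hjc.comp hsθc).aestronglyMeasurable Bj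
      (Eventually.of_forall fun _ => hjB _)
  have hwi : Integrable (fun θ => w (sθ θ)) unitMeasure :=
    Integrable.of_bound (hw.comp hsθc).aestronglyMeasurable B (Eventually.of_forall fun θ => by
      rw [Real.norm_eq_abs, abs_of_nonneg (hw0 _)]; exact hwB _)
  -- the lower bound for the coarea extension, at the mean of the deformed leaves
  have hfam : ∀ (φ : Space N → ℝ), Continuous φ → (∀ y, φ y ≠ 0 → y ∈ C.tube (σ / 2)) →
      Continuous fun s => ∫ p, φ (point x C.ν p (C.f p + s * C.eta p)) := by
    intro φ hφ hφs
    refine continuousOn_univ.1 (continuousOn_integral_of_compact_support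
      (isCompact_closedBall (0 : Hyper C.ν) (C.r / 4)) (f := fun s p =>
        φ (point x C.ν p (C.f p + s * C.eta p))) ?_ fun s p _ hp => ?_)
    · refine (hφ.comp (continuous_point.comp (continuous_snd.prodMk
        ((C.continuous.comp continuous_snd).add
          (continuous_fst.mul (C.eta.continuous.comp continuous_snd)))))).continuousOn
    · by_contra h
      have := (hφs _ h).2.1
      rw [hcoord_point] at this
      exact hp (mem_closedBall_zero_iff.2 this)
  have hψa : ∀ y, |ψ y| ≠ 0 → y ∈ C.tube (σ / 2) := fun y hy => hψs y (by simpa using hy)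
  set I₁ : ℝ → ℝ := fun s => ∫ p, ψ (point x C.ν p (C.f p + s * C.eta p))
  set I₂ : ℝ → ℝ := fun s => ∫ p, |ψ (point x C.ν p (C.f p + s * C.eta p))|
  have hI₁c : Continuous I₁ := hfam ψ hψ hψs
  have hI₂c : Continuous I₂ := hfam (fun y => |ψ y|) hψ.abs hψa
  have hint : ∀ {k : ℝ → ℝ}, Continuous k → Integrable (fun θ => k (sθ θ)) unitMeasure := by
    intro k hk
    have : IntegrableOn (fun θ => k (sθ θ)) (Set.Icc 0 1) :=
      (hk.comp hsθc).continuousOn.integrableOn_compact isCompact_Icc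
    exact this.mono_set Set.Ioo_subset_Icc_self
  have hI₁ : 2 * σ * ∫ θ, I₁ (sθ θ) ∂unitMeasure = ∫ y, ψ y :=
    integral_leaves (by linarith) hψ hψs
  have hI₂ : 2 * σ * ∫ θ, I₂ (sθ θ) ∂unitMeasure = ∫ y, |ψ y| :=
    integral_leaves (by linarith) hψ.abs hψa
  set k : ℝ → ℝ := fun s => j s + lam * (κ₀ * I₁ s - err * I₂ s - η / (2 * σ)) with hk
  have hkc : Continuous k := by fun_prop
  have hlower := ofReal_le_levelPerimeter (F := F) hβ hJ hσ0 hlamF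
    (k := k) (hint hkc) fun s hs => by
      have := hlow lam hlam0 hlamδ s hs
      simp only [hk]
      rwa [hjs hs]
  have hkint : ∫ θ, k (sθ θ) ∂unitMeasure = (∫ θ, j (sθ θ) ∂unitMeasure) +
      lam * (κ₀ * (∫ θ, I₁ (sθ θ) ∂unitMeasure) - err * (∫ θ, I₂ (sθ θ) ∂unitMeasure) -
        η / (2 * σ)) := by
    have i1 : Integrable (fun θ => κ₀ * I₁ (sθ θ)) unitMeasure := (hint hI₁c).const_mul _
    have i2 : Integrable (fun θ => err * I₂ (sθ θ)) unitMeasure := (hint hI₂c).const_mul _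
    have i3 : Integrable (fun θ => κ₀ * I₁ (sθ θ) - err * I₂ (sθ θ)) unitMeasure := i1.sub i2
    have i4 : Integrable (fun θ => κ₀ * I₁ (sθ θ) - err * I₂ (sθ θ) - η / (2 * σ)) unitMeasure :=
      i3.sub (integrable_const _)
    simp only [hk]
    rw [integral_add hji (i4.const_mul lam), integral_const_mul,
      integral_sub i3 (integrable_const _), integral_sub i1 i2, integral_const_mul,
      integral_const_mul]
    simp
  -- the upper bound: the same mean is that of the random sets which are equal to a random
  -- modification of the leaf with parameter `s`, with probability `lam * w s`, and to this leaf
  -- otherwise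
  set w' : ℝ → ℝ := fun θ => lam * w (sθ θ) with hw'
  have hw'c : Continuous w' := by fun_prop
  have hw'I : ∀ θ, w' θ ∈ Set.Icc (0 : ℝ) 1 := fun θ =>
    ⟨mul_nonneg hlam0.le (hw0 _), (mul_le_mul_of_nonneg_left (hwB _) hlam0.le).trans hlamB⟩
  set Q := unitMeasure.prod (unitMeasure.prod P)
  set A : Set ((ℝ × (ℝ × Ω)) × Space N) := {q | (q.1.2.1 < w' q.1.1 ∧
    ((sθ q.1.1, q.1.2.2), q.2) ∈ D) ∨ (w' q.1.1 ≤ q.1.2.1 ∧ q.2 ∈ C.leaf (sθ q.1.1))}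
  have hAm : MeasurableSet A := by
    have m1 : Measurable fun q : (ℝ × (ℝ × Ω)) × Space N => w' q.1.1 :=
      hw'c.measurable.comp (by fun_prop)
    have m2 : Measurable fun q : (ℝ × (ℝ × Ω)) × Space N => q.1.2.1 := by fun_prop
    have m3 : Measurable fun q : (ℝ × (ℝ × Ω)) × Space N => ((sθ q.1.1, q.1.2.2), q.2) :=
      ((hsθc.measurable.comp (by fun_prop)).prodMk (by fun_prop)).prodMk (by fun_prop)
    have m4 : Measurable fun q : (ℝ × (ℝ × Ω)) × Space N => (sθ q.1.1, q.2) :=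
      (hsθc.measurable.comp (by fun_prop)).prodMk (by fun_prop)
    exact ((measurableSet_lt m2 m1).inter (m3 hD)).union
      ((measurableSet_le m1 m2).inter (m4 measurableSet_leaf))
  have hmeanA : ∀ y, Q.real {q | (q, y) ∈ A} =
      unitMeasure.real {θ | y ∈ C.perturb (F.g (lam, σ - 2 * σ * θ))} := by
    intro y
    have hBm : MeasurableSet {q : ℝ × Ω | ((sθ q.1, q.2), y) ∈ D} := by
      have : Measurable fun q : ℝ × Ω => ((sθ q.1, q.2), y) :=
        ((hsθc.measurable.comp measurable_fst).prodMk measurable_snd).prodMk measurable_const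
      exact this hD
    have hLm : MeasurableSet {θ | y ∈ C.leaf (sθ θ)} := by
      have : Measurable fun θ : ℝ => (sθ θ, y) := hsθc.measurable.prodMk measurable_const
      exact this measurableSet_leaf
    have e := mixture_real P hw'c.measurable hw'I hBm hLm
    rw [mean_deformation hσ0 hlamF hψs (fun y => by
      rw [abs_mul, abs_of_pos hlam0]
      exact (mul_le_mul_of_nonneg_left (hM y) hlam0.le).trans hlamM)]
    refine e.trans ?_
    have i1 : Integrable ({θ | y ∈ C.leaf (sθ θ)}.indicator (1 : ℝ → ℝ)) unitMeasure :=
      (integrable_const (1 : ℝ)).indicator hLm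
    have i2 : Integrable (fun θ => P.real {a | (θ, a) ∈ {q : ℝ × Ω | ((sθ q.1, q.2), y) ∈ D}})
        unitMeasure := by
      have hme : Measurable fun θ => P.real {a | (θ, a) ∈ {q : ℝ × Ω | ((sθ q.1, q.2), y) ∈ D}} :=
        (measurable_measure_prodMk_left (ν := P) hBm).ennreal_toReal
      refine Integrable.of_bound hme.aestronglyMeasurable 1 (Eventually.of_forall fun θ => ?_)
      rw [Real.norm_eq_abs, abs_of_nonneg measureReal_nonneg]
      exact measureReal_le_one
    have i3 : Integrable (fun θ => w' θ *
        (P.real {a | (θ, a) ∈ {q : ℝ × Ω | ((sθ q.1, q.2), y) ∈ D}} -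
          {θ | y ∈ C.leaf (sθ θ)}.indicator 1 θ)) unitMeasure := by
      refine (i2.sub i1).bdd_mul (c := 1) hw'c.aestronglyMeasurable
        (Eventually.of_forall fun θ => ?_)
      rw [Real.norm_eq_abs, abs_of_nonneg (hw'I θ).1]
      exact (hw'I θ).2
    rw [integral_add i1 i3, integral_indicator_one hLm]
    congr 1
    have hσ' : 2 * σ ≠ 0 := by positivity
    have e5 := integral_const_mul (μ := unitMeasure) lam fun θ => w (sθ θ) *
      (P.real {a | (θ, a) ∈ {q : ℝ × Ω | ((sθ q.1, q.2), y) ∈ D}} -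
        {θ | y ∈ C.leaf (sθ θ)}.indicator 1 θ)
    rw [hmean y, mul_div_assoc, mul_div_cancel_left₀ _ hσ']
    simp only [← mul_assoc] at e5
    exact e5
  set g : ℝ × (ℝ × Ω) → ℝ := fun q => j (sθ q.1) + {q : ℝ × (ℝ × Ω) | q.2.1 < w' q.1}.indicator
    (fun _ => b) q with hg
  have hTm : MeasurableSet {q : ℝ × (ℝ × Ω) | q.2.1 < w' q.1} :=
    measurableSet_lt (by fun_prop) (hw'c.measurable.comp measurable_fst)
  have hgm : Measurable g :=
    ((hjc.comp hsθc).measurable.comp measurable_fst).add (measurable_const.indicator hTm)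
  have hgi1 : Integrable (fun q : ℝ × (ℝ × Ω) => j (sθ q.1)) Q := hji.comp_fst _
  have hgi2 : Integrable ({q : ℝ × (ℝ × Ω) | q.2.1 < w' q.1}.indicator fun _ => b) Q :=
    (integrable_const b).indicator hTm
  have hJg : ∀ᵐ q ∂Q, J {y | (q, y) ∈ A} ≤ ENNReal.ofReal (g q) ∧ 0 ≤ g q := by
    have a1 : ∀ᵐ q ∂Q, |sθ q.1| ≤ σ := Measure.quasiMeasurePreserving_fst.ae hsσ
    have a2 : ∀ᵐ q ∂Q, q.2.2 ∈ S := by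
      have : ∀ᵐ q ∂(unitMeasure.prod P), q.2 ∈ S := Measure.quasiMeasurePreserving_snd.ae hS
      exact Measure.quasiMeasurePreserving_snd.ae this
    have a3 : ∀ᵐ q ∂Q, q.2.1 ∈ Set.Ioo (0 : ℝ) 1 := by
      have : ∀ᵐ q ∂(unitMeasure.prod P), q.1 ∈ Set.Ioo (0 : ℝ) 1 :=
        Measure.quasiMeasurePreserving_fst.ae (ae_restrict_mem measurableSet_Ioo)
      exact Measure.quasiMeasurePreserving_snd.ae this
    filter_upwards [a1, a2, a3] with q h1 h2 h0
    by_cases hq : q.2.1 < w' q.1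
    · have hpos : 0 < w (sθ q.1) := by
        exact pos_of_mul_pos_right (h0.1.trans hq) hlam0.le
      have e : {y | (q, y) ∈ A} = {y | ((sθ q.1, q.2.2), y) ∈ D} := by
        ext y; simp [A, hq]
      have hgq : g q = (J (C.leaf (sθ q.1))).toReal + b := by
        have := Set.indicator_of_mem (s := {q : ℝ × (ℝ × Ω) | q.2.1 < w' q.1}) hq fun _ => b
        simp only [hg]
        rw [this, hjs h1]
      obtain ⟨h3, h4⟩ := hJD _ h1 hpos _ h2
      rw [e, hgq]
      exact ⟨(ENNReal.le_ofReal_iff_toReal_le h3 (ENNReal.toReal_nonneg.trans h4)).2 h4,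
        ENNReal.toReal_nonneg.trans h4⟩
    · have e : {y | (q, y) ∈ A} = C.leaf (sθ q.1) := by
        ext y; simp [A, hq, not_lt.1 hq]
      have hgq : g q = (J (C.leaf (sθ q.1))).toReal := by
        have := Set.indicator_of_notMem (s := {q : ℝ × (ℝ × Ω) | q.2.1 < w' q.1}) hq fun _ => b
        simp only [hg]
        rw [this, hjs h1, add_zero]
      have hfin := hJ.finite_of_regular _
        ((admissible_leaf (C := C) hβ (h1.trans hσ)).isRegular hβ hU)
      rw [e, hgq]
      exact ⟨(ENNReal.ofReal_toReal hfin.ne).ge, ENNReal.toReal_nonneg⟩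
  have hupper := hJ.levelPerimeter_mean_le Q hAm (g := fun q => ENNReal.ofReal (g q))
    hgm.ennreal_ofReal (hJg.mono fun q hq => hq.1)
  rw [← ofReal_integral_eq_lintegral_ofReal (f := g) (hgi1.add hgi2)
    (hJg.mono fun q hq => hq.2)] at hupper
  have hgint : ∫ q, g q ∂Q = (∫ θ, j (sθ θ) ∂unitMeasure) +
      lam * (b * ∫ θ, w (sθ θ) ∂unitMeasure) := by
    have e1 : ∫ q : ℝ × (ℝ × Ω), j (sθ q.1) ∂Q = ∫ θ, j (sθ θ) ∂unitMeasure := by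
      rw [integral_fun_fst (fun θ => j (sθ θ))]
      simp
    have e2 := mixture_real P hw'c.measurable hw'I MeasurableSet.univ MeasurableSet.empty
    have e3 : Q.real {q : ℝ × (ℝ × Ω) | q.2.1 < w' q.1} = lam * ∫ θ, w (sθ θ) ∂unitMeasure := by
      rw [← integral_const_mul]
      simpa using e2
    simp only [hg]
    rw [integral_add hgi1 hgi2, e1, integral_indicator_const b hTm, e3, smul_eq_mul]
    ring
  have hfinal := hlower.trans ((le_of_eq (by simp only [hmeanA])).trans hupper)
  rw [ENNReal.ofReal_le_ofReal_iff (integral_nonneg_of_ae (hJg.mono fun q hq => hq.2)), hkint,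
    hgint] at hfinal
  have h5 := le_of_mul_le_mul_left (le_of_add_le_add_left hfinal) hlam0
  have h6 := mul_le_mul_of_nonneg_left h5 (by positivity : 0 ≤ 2 * σ)
  have hW : 2 * σ * ∫ θ, w (sθ θ) ∂unitMeasure = ∫ s in (-σ)..σ, w s := integral_unitMeasure σ w
  rw [← hI₁, ← hI₂, ← hW]
  have h7 : 2 * σ * (η / (2 * σ)) = η := by field_simp
  nlinarith [h6, h7]

end LevelFamily

end GraphChart

end RandomModification

/-! ### The cost of modifying a nearby leaf -/

section Cost

variable {ℓ : ℕ} {β : ℝ≥0} {J : Set (Space N) → ℝ≥0∞}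

/-- Submodularity and lower semicontinuity, on measurable sets. These properties, unlike the class
of regular sets, are invariant under passing to complements. -/
structure IsLscSubmodular (J : Set (Space N) → ℝ≥0∞) : Prop where
  le_liminf : ∀ {A : ℕ → Set (Space N)} {B : Set (Space N)}, (∀ n, MeasurableSet (A n)) →
    MeasurableSet B → (∀ᵐ y, ∀ᶠ n in atTop, (y ∈ A n ↔ y ∈ B)) →
    J B ≤ liminf (fun n => J (A n)) atTop
  submodular : ∀ {A B : Set (Space N)}, MeasurableSet A → MeasurableSet B →
    J (A ∪ B) + J (A ∩ B) ≤ J A + J B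

lemma IsGeneralizedPerimeter.isLscSubmodular (hJ : IsGeneralizedPerimeter ℓ β J) :
    IsLscSubmodular J :=
  ⟨hJ.le_liminf, fun hA hB => hJ.submodular _ _ hA.nullMeasurableSet hB.nullMeasurableSet⟩

lemma IsLscSubmodular.compl (hJ : IsLscSubmodular J) : IsLscSubmodular fun A => J Aᶜ :=
  ⟨fun hA hB h => hJ.le_liminf (fun n => (hA n).compl) hB.compl (h.mono fun y hy =>
    hy.mono fun n hn => not_congr hn), fun {A B} hA hB => by
      have := hJ.submodular hA.compl hB.compl
      rw [Set.compl_union, Set.compl_inter, add_comm]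
      exact this⟩

lemma IsLscSubmodular.eventually_le (hJ : IsLscSubmodular J) {A : ℕ → Set (Space N)}
    {B : Set (Space N)} (hA : ∀ n, MeasurableSet (A n)) (hB : MeasurableSet B)
    (h : ∀ᵐ y, ∀ᶠ n in atTop, (y ∈ A n ↔ y ∈ B)) (hBf : J B ≠ ⊤) {η : ℝ≥0∞} (hη : 0 < η) :
    ∀ᶠ n in atTop, J B ≤ J (A n) + η := by
  rcases le_or_gt (J B) η with hle | hlt
  · exact Eventually.of_forall fun n => hle.trans le_add_self
  · have h1 : J B - η < liminf (fun n => J (A n)) atTop :=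
      (ENNReal.sub_lt_self hBf (hη.trans hlt).ne' hη.ne').trans_le (hJ.le_liminf hA hB h)
    filter_upwards [eventually_lt_of_lt_liminf h1] with n hn
    exact tsub_le_iff_right.1 hn.le

/-- Adding `W` to sets `A n` close to `E` costs at most what it costs to add `W` to `E`, provided
that the `A n` contain `E` near `W`: this means that there are sets `A' n ⊇ A n ∪ W`, of convergent
cost, in which `E` is contained in `A n`. -/
lemma IsLscSubmodular.eventually_union_le (hJ : IsLscSubmodular J) {A A' : ℕ → Set (Space N)}
    {E E' W : Set (Space N)} (hA : ∀ n, MeasurableSet (A n)) (hA' : ∀ n, MeasurableSet (A' n))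
    (hE : MeasurableSet E) (hE' : MeasurableSet E') (hW : MeasurableSet W) (hEE' : E ⊆ E')
    (hlim : ∀ᵐ y, ∀ᶠ n in atTop, (y ∈ A n ↔ y ∈ E))
    (hlim' : ∀ᵐ y, ∀ᶠ n in atTop, (y ∈ A' n ↔ y ∈ E'))
    (hsub : ∀ n, A n ⊆ A' n) (hWsub : ∀ n, W ⊆ A' n) (hcond : ∀ n, E ∩ A' n ⊆ A n)
    (hEf : J E ≠ ⊤) (hE'f : J E' ≠ ⊤)
    (hle : ∀ η : ℝ≥0∞, 0 < η → ∀ᶠ n in atTop, J (A' n) ≤ J E' + η)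
    {η : ℝ≥0∞} (hη : 0 < η) :
    ∀ᶠ n in atTop, J (A n ∪ W) + J E ≤ J (A n) + J (E ∪ W) + η := by
  have hη4 : 0 < η / 4 := ENNReal.div_pos hη.ne' (by norm_num)
  have l1 := hJ.eventually_le (A := fun n => E ∪ A' n) (B := E') (fun n => hE.union (hA' n)) hE'
    (by
      filter_upwards [hlim'] with y hy
      filter_upwards [hy] with n hn
      exact ⟨fun h => h.elim (fun h => hEE' h) hn.1, fun h => Or.inr (hn.2 h)⟩) hE'f hη4
  have l2 := hJ.eventually_le (A := fun n => (A n ∪ E) ∩ (E ∪ W)) (B := E)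
    (fun n => ((hA n).union hE).inter (hE.union hW)) hE
    (by
      filter_upwards [hlim] with y hy
      filter_upwards [hy] with n hn
      exact ⟨fun h => h.1.elim hn.1 id, fun h => ⟨Or.inr h, Or.inl h⟩⟩) hEf hη4
  have l3 := hJ.eventually_le (A := fun n => A n ∩ E) (B := E) (fun n => (hA n).inter hE) hE
    (by
      filter_upwards [hlim] with y hy
      filter_upwards [hy] with n hn
      exact ⟨fun h => h.2, fun h => ⟨hn.2 h, h⟩⟩) hEf hη4
  filter_upwards [l1, l2, l3, hle _ hη4] with n h1 h2 h3 h4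
  have s1 := hJ.submodular ((((hA n).union hE).union hW)) (hA' n)
  have s2 := hJ.submodular ((hA n).union hE) (hE.union hW)
  have s3 := hJ.submodular (hA n) hE
  have e1 : A n ∪ E ∪ W ∪ A' n = E ∪ A' n := by
    ext y
    have := @hsub n y
    have := @hWsub n y
    simp only [Set.mem_union]; tauto
  have e2 : (A n ∪ E ∪ W) ∩ A' n = A n ∪ W := by
    ext y
    have := @hsub n y
    have := @hWsub n y
    have := @hcond n y
    simp only [Set.mem_union, Set.mem_inter_iff] at *; tauto
  have e3 : A n ∪ E ∪ (E ∪ W) = A n ∪ E ∪ W := by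
    ext y; simp only [Set.mem_union]; tauto
  rw [e1, e2] at s1
  rw [e3] at s2
  have key : J (A n ∪ W) + J E + (J E' + J E) ≤
      J (A n) + J (E ∪ W) + η + (J E' + J E) := by
    calc J (A n ∪ W) + J E + (J E' + J E)
        ≤ J (A n ∪ W) + (J ((A n ∪ E) ∩ (E ∪ W)) + η / 4) +
          ((J (E ∪ A' n) + η / 4) + (J (A n ∩ E) + η / 4)) := by gcongr
      _ = (J (E ∪ A' n) + J (A n ∪ W)) + J ((A n ∪ E) ∩ (E ∪ W)) + J (A n ∩ E) +
          (η / 4 + η / 4 + η / 4) := by ring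
      _ ≤ (J (A n ∪ E ∪ W) + J (A' n)) + J ((A n ∪ E) ∩ (E ∪ W)) + J (A n ∩ E) +
          (η / 4 + η / 4 + η / 4) := by gcongr
      _ = (J (A n ∪ E ∪ W) + J ((A n ∪ E) ∩ (E ∪ W))) + J (A n ∩ E) + J (A' n) +
          (η / 4 + η / 4 + η / 4) := by ring
      _ ≤ (J (A n ∪ E) + J (E ∪ W)) + J (A n ∩ E) + J (A' n) + (η / 4 + η / 4 + η / 4) := by
          gcongr
      _ = (J (A n ∪ E) + J (A n ∩ E)) + J (E ∪ W) + J (A' n) + (η / 4 + η / 4 + η / 4) := by ring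
      _ ≤ (J (A n) + J E) + J (E ∪ W) + (J E' + η / 4) + (η / 4 + η / 4 + η / 4) := by gcongr
      _ = J (A n) + J (E ∪ W) + (η / 4 + η / 4 + (η / 4 + η / 4)) + (J E' + J E) := by ring
      _ = J (A n) + J (E ∪ W) + η + (J E' + J E) := by
          have h2 : η / 4 + η / 4 = η / 2 := by
            rw [← ENNReal.add_halves (η / 2), ENNReal.div_eq_inv_mul, ENNReal.div_eq_inv_mul,
              ENNReal.div_eq_inv_mul, ← mul_assoc, ← ENNReal.mul_inv (by simp) (by simp)]
            norm_num
          rw [h2, ENNReal.add_halves]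
  exact (ENNReal.add_le_add_iff_right (by finiteness)).1 key

lemma IsGeneralizedPerimeter.translate (hJ : IsGeneralizedPerimeter ℓ β J) {A : Set (Space N)}
    (hA : MeasurableSet A) (a : Space N) : J {y | y + a ∈ A} = J A := by
  rw [← hJ.translation A (-a) hA.nullMeasurableSet]
  congr 1
  ext y
  simp only [Set.mem_image, Set.mem_ofPred_eq]
  exact ⟨fun h => ⟨y + a, h, by abel⟩, by rintro ⟨z, hz, rfl⟩; simpa using hz⟩

lemma RegularOpen.volume_frontier (hβ : β ≤ 1) {U : Set (Space N)} (hU : RegularOpen ℓ β U) :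
    volume (frontier U) = 0 := by
  refine measure_null_of_locally_null _ fun x hx => ?_
  obtain ⟨C, -⟩ := exists_graphChart hβ hU.1 hx univ_mem (hU.2.2 x hx)
  have hG : Continuous fun y : Space N => tcoord x C.ν y - C.f (hcoord x C.ν y) :=
    continuous_tcoord.sub (C.continuous.comp continuous_hcoord)
  refine ⟨{y | tcoord x C.ν y - C.f (hcoord x C.ν y) = 0}, ?_, ?_⟩
  · rw [mem_nhdsWithin]
    refine ⟨C.cyl, GraphChart.isOpen_cyl, ?_, fun y hy => ?_⟩
    · rw [GraphChart.mem_cyl_iff]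
      simp [C.r_pos, C.h_pos]
    · refine sub_eq_zero.2 ((mem_frontier_subgraph_iff C.norm_ν hU.1 C.continuous ?_).1 hy.2)
      filter_upwards [GraphChart.isOpen_cyl.mem_nhds hy.1] with z hz
      exact C.mem_iff z hz
  · have hmp := measurePreserving_point (x := x) C.norm_ν
    rw [← hmp.measure_preimage (isClosed_eq hG continuous_const).measurableSet.nullMeasurableSet,
      Measure.measure_prod_null
        (hmp.measurable (isClosed_eq hG continuous_const).measurableSet)]
    refine Eventually.of_forall fun p => ?_
    refine measure_mono_null (t := {C.f p}) (fun t ht => ?_) (by simp)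
    simp only [Set.mem_preimage, Set.mem_ofPred_eq, tcoord_point C.norm_ν, hcoord_point] at ht
    rw [Set.mem_singleton_iff]
    linarith

namespace GraphChart

variable {U : Set (Space N)} {x : Space N} {C : GraphChart ℓ β U x}

lemma Admissible.mem_perturb_iff_of_notMem_core {g g' : Hyper C.ν → ℝ} (hg : C.Admissible g)
    (hg' : C.Admissible g') {y : Space N} (hy : y ∉ C.core) :
    y ∈ C.perturb g ↔ y ∈ C.perturb g' := by
  by_cases hc : y ∈ C.cyl
  · rw [mem_perturb_of_mem_cyl hc, mem_perturb_of_mem_cyl hc]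
    by_cases hp : ‖hcoord x C.ν y‖ ≤ C.r / 2
    · have ht : C.h / 2 < |tcoord x C.ν y| := by
        by_contra h
        exact hy ⟨hp, not_lt.1 h⟩
      have h1 := abs_le.1 (hg.abs_add_le (mem_cyl_iff.1 hc).1.le)
      have h2 := abs_le.1 (hg'.abs_add_le (mem_cyl_iff.1 hc).1.le)
      rcases lt_abs.1 ht with h | h
      · exact ⟨fun h' => by linarith, fun h' => by linarith⟩
      · exact ⟨fun _ => by linarith, fun _ => by linarith⟩
    · rw [hg.supp _ (not_le.1 hp).le, hg'.supp _ (not_le.1 hp).le]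
  · rw [mem_perturb_of_notMem_cyl hc, mem_perturb_of_notMem_cyl hc]

lemma Admissible.volume_frontier (hβ : β ≤ 1) (hU : RegularOpen ℓ β U) {g : Hyper C.ν → ℝ}
    (hg : C.Admissible g) : volume (frontier (C.perturb g)) = 0 := by
  refine measure_mono_null ?_ ((hg.regularOpen hβ hU).volume_frontier hβ)
  rw [← hg.closure_perturbOpen]
  exact frontier_closure_subset

/-- Small perturbations and small translations do not affect whether a point belongs to the set,
except on the boundary. -/
lemma eventually_mem_translate {G : ℝ × Hyper C.ν → ℝ} (hG : Continuous G)
    (hadm : ∀ᶠ s in 𝓝 0, C.Admissible fun p => G (s, p)) {y : Space N}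
    (hy : y ∉ frontier (C.perturb fun p => G (0, p))) :
    ∀ᶠ q : ℝ × Space N in 𝓝 (0, 0), (y + q.2 ∈ C.perturb (fun p => G (q.1, p)) ↔
      y ∈ C.perturb fun p => G (0, p)) := by
  have hadd : Tendsto (fun q : ℝ × Space N => y + q.2) (𝓝 (0, 0)) (𝓝 y) := by
    have : Continuous fun q : ℝ × Space N => y + q.2 := by fun_prop
    simpa using this.tendsto (0, 0)
  have hadm' : ∀ᶠ q : ℝ × Space N in 𝓝 (0, 0), C.Admissible fun p => G (q.1, p) :=
    (continuous_fst.tendsto ((0 : ℝ), (0 : Space N))).eventually hadm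
  have hadm0 : C.Admissible fun p => G (0, p) := hadm.self_of_nhds
  by_cases hc : y ∈ C.cyl
  · have hcont : Continuous fun q : ℝ × Space N => tcoord x C.ν (y + q.2) -
        (C.f (hcoord x C.ν (y + q.2)) + G (q.1, hcoord x C.ν (y + q.2))) := by
      have hs : Continuous fun q : ℝ × Space N => y + q.2 := by fun_prop
      have hh := (continuous_hcoord (x := x) (ν := C.ν)).comp hs
      exact (continuous_tcoord.comp hs).sub
        ((C.continuous.comp hh).add (hG.comp (continuous_fst.prodMk hh)))
    rw [hadm0.mem_frontier_perturb_iff hc] at hy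
    rw [mem_perturb_of_mem_cyl hc]
    have hev := hadd.eventually (isOpen_cyl.mem_nhds hc)
    rcases lt_or_gt_of_ne hy with h | h
    · have h0 : tcoord x C.ν (y + (0 : ℝ × Space N).2) - (C.f (hcoord x C.ν (y + (0 : ℝ × Space N).2))
          + G ((0 : ℝ × Space N).1, hcoord x C.ν (y + (0 : ℝ × Space N).2))) < 0 := by
        simpa using h
      filter_upwards [hev, hcont.continuousAt.eventually (gt_mem_nhds h0)] with q hq1 hq2
      rw [mem_perturb_of_mem_cyl hq1]
      exact ⟨fun _ => h.le, fun _ => (sub_neg.1 hq2).le⟩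
    · have h0 : 0 < tcoord x C.ν (y + (0 : ℝ × Space N).2) -
          (C.f (hcoord x C.ν (y + (0 : ℝ × Space N).2))
          + G ((0 : ℝ × Space N).1, hcoord x C.ν (y + (0 : ℝ × Space N).2))) := by
        simpa using h
      filter_upwards [hev, hcont.continuousAt.eventually (lt_mem_nhds h0)] with q hq1 hq2
      rw [mem_perturb_of_mem_cyl hq1]
      exact ⟨fun h' => absurd h' (not_le.2 (sub_pos.1 hq2)), fun h' => absurd h' (not_le.2 h)⟩
  · have hK : y ∉ C.core := fun h => hc (core_subset_cyl h)
    have h1 : ∀ᶠ z in 𝓝 y, (z ∈ C.perturb (fun p => G (0, p)) ↔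
        y ∈ C.perturb fun p => G (0, p)) := by
      by_cases hyP : y ∈ C.perturb fun p => G (0, p)
      · have : y ∈ interior (C.perturb fun p => G (0, p)) := by
          by_contra h
          exact hy ⟨subset_closure hyP, h⟩
        filter_upwards [mem_interior_iff_mem_nhds.1 this] with z hz
        exact ⟨fun _ => hyP, fun _ => hz⟩
      · filter_upwards [hadm0.isClosed_perturb.isOpen_compl.mem_nhds hyP] with z hz
        exact ⟨fun h => absurd h hz, fun h => absurd h hyP⟩
    filter_upwards [hadm', hadd.eventually h1,
      hadd.eventually (isClosed_core.isOpen_compl.mem_nhds hK)] with q hq1 hq2 hq3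
    rw [hq1.mem_perturb_iff_of_notMem_core hadm0 hq3, hq2]

/-- A cutoff function with smaller support than `eta`. -/
def tip (C : GraphChart ℓ β U x) : ContDiffBump (0 : Hyper C.ν) :=
  ⟨C.r / 16, C.r / 8, by have := C.r_pos; positivity, by have := C.r_pos; linarith⟩

/-- The displacement by `s * η`, with an additional bump of height `H`. -/
def bumped (C : GraphChart ℓ β U x) (H : ℝ) (q : ℝ × Hyper C.ν) : ℝ :=
  q.1 * C.eta q.2 + H * C.tip q.2

lemma tip_eq_one {p : Hyper C.ν} (hp : ‖p‖ ≤ C.r / 16) : C.tip p = 1 :=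
  C.tip.one_of_mem_closedBall (by rw [Metric.mem_closedBall, dist_zero_right]; exact hp)

lemma tip_eq_zero {p : Hyper C.ν} (hp : C.r / 8 ≤ ‖p‖) : C.tip p = 0 :=
  C.tip.zero_of_le_dist (by rw [dist_zero_right]; exact hp)

lemma continuous_bumped (H : ℝ) : Continuous (C.bumped H) :=
  (continuous_fst.mul (C.eta.continuous.comp continuous_snd)).add
    (continuous_const.mul (C.tip.continuous.comp continuous_snd))

lemma holderAt_bumped (hβ : β ≤ 1) (H : ℝ) (q : ℝ × Hyper C.ν) :
    IsHolderAt ℓ β (C.bumped H) q :=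
  IsHolderAt.of_contDiff hβ (n := ⊤) ((contDiff_fst.mul (C.eta.contDiff.comp contDiff_snd)).add
    (contDiff_const.mul (C.tip.contDiff.comp contDiff_snd))) le_top _

lemma admissible_bumped (hβ : β ≤ 1) {H s : ℝ} (hH : |H| ≤ C.h / 8) (hs : |s| ≤ C.h / 8) :
    C.Admissible fun p => C.bumped H (s, p) := by
  refine ⟨fun p => ?_, fun p hp => ?_, fun p => ?_⟩
  · have hin : ContDiff ℝ (⊤ : ℕ∞) fun p : Hyper C.ν => s * C.eta p + H * C.tip p :=
      (contDiff_const.mul C.eta.contDiff).add (contDiff_const.mul C.tip.contDiff)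
    exact IsHolderAt.of_contDiff hβ (n := ⊤) hin le_top _
  · have := C.r_pos
    simp only [bumped]
    rw [eta_eq_zero (by linarith), tip_eq_zero (by linarith), mul_zero, mul_zero, add_zero]
  · refine (_root_.abs_add_le _ _).trans ?_
    have h1 := abs_mul_eta_le (C := C) s p
    have h2 : |H * C.tip p| ≤ |H| := by
      rw [abs_mul, abs_of_nonneg C.tip.nonneg]
      exact mul_le_of_le_one_right (abs_nonneg _) C.tip.le_one
    dsimp only
    linarith

lemma eventually_admissible_bumped (hβ : β ≤ 1) {H : ℝ} (hH : |H| ≤ C.h / 8) :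
    ∀ᶠ s in 𝓝 0, C.Admissible fun p => C.bumped H (s, p) := by
  have : ∀ᶠ s : ℝ in 𝓝 0, |s| < C.h / 8 :=
    continuous_abs.continuousAt.eventually (gt_mem_nhds (by
      have := C.h_pos
      rw [abs_zero]; positivity))
  filter_upwards [this] with s hs
  exact admissible_bumped hβ hH hs.le

/-- Upper semicontinuity of `J` along the bumped leaves, which holds because `J` is differentiable
along smooth families. -/
lemma eventually_bumped_le (hβ : β ≤ 1) (hℓ : 1 ≤ ℓ) (hJ : IsGeneralizedPerimeter ℓ β J)
    {κ : Space N → Set (Space N) → ℝ} (hκ : IsFirstVariation ℓ β J κ) (hU : RegularOpen ℓ β U)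
    {H : ℝ} (hH : |H| ≤ C.h / 8) {η : ℝ≥0∞} (hη : 0 < η) :
    ∀ᶠ s in 𝓝 0, J (C.perturb fun p => C.bumped H (s, p)) ≤
      J (C.perturb fun p => C.bumped H (0, p)) + η := by
  have hc : ContinuousAt (fun s => (J (C.perturb fun p => C.bumped H (s, p))).toReal) 0 :=
    (hasDerivAt_perturb hβ hℓ hκ hU (g := fun s p => C.bumped H (s, p)) (c := 0)
      (eventually_admissible_bumped hβ hH)
      (Eventually.of_forall fun s p => holderAt_bumped hβ H (s, p))).2.continuousAt
  have hfin := fun {s : ℝ} (hs : C.Admissible fun p => C.bumped H (s, p)) =>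
    (hJ.finite_of_regular _ (hs.isRegular hβ hU)).ne
  have h0 := (eventually_admissible_bumped (C := C) hβ hH).self_of_nhds
  rcases eq_or_ne η ⊤ with rfl | hη'
  · simp
  have h1 : (J (C.perturb fun p => C.bumped H (0, p))).toReal <
      (J (C.perturb fun p => C.bumped H (0, p)) + η).toReal := by
    rw [ENNReal.toReal_add (hfin h0) hη']
    linarith [ENNReal.toReal_pos hη.ne' hη']
  filter_upwards [hc.eventually (gt_mem_nhds h1), eventually_admissible_bumped (C := C) hβ hH]
    with s hs hs'
  exact (ENNReal.toReal_le_toReal (hfin hs') (by finiteness [hfin h0])).1 hs.le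

lemma exists_lipschitz (hℓ : 1 ≤ ℓ) (C : GraphChart ℓ β U x) : ∃ K : ℝ, 0 ≤ K ∧
    ∀ p q : Hyper C.ν, ‖p‖ ≤ C.r / 2 → ‖q‖ ≤ C.r / 2 → |C.f p - C.f q| ≤ K * ‖p - q‖ := by
  have hne : (ℓ : WithTop ℕ∞) ≠ 0 := by
    have : ℓ ≠ 0 := by omega
    exact_mod_cast this
  have hcd : ContDiff ℝ ℓ C.f := contDiff_iff_contDiffAt.2 fun p => (C.holder p).1
  obtain ⟨K, hK⟩ := (isCompact_closedBall (0 : Hyper C.ν) (C.r / 2)).exists_bound_of_continuousOn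
    (hcd.continuous_fderiv hne).continuousOn
  refine ⟨K, (norm_nonneg _).trans (hK 0
    (Metric.mem_closedBall_self (by linarith [C.r_pos]))), fun p q hp hq => ?_⟩
  exact (convex_closedBall (0 : Hyper C.ν) (C.r / 2)).norm_image_sub_le_of_norm_fderiv_le
    (fun p _ => hcd.differentiable hne p) hK (mem_closedBall_zero_iff.2 hq)
    (mem_closedBall_zero_iff.2 hp)

end GraphChart

end Cost

section LeafCost

variable {ℓ : ℕ} {β : ℝ≥0} {J : Set (Space N) → ℝ≥0∞}

namespace GraphChart

variable {U : Set (Space N)} {x : Space N} {C : GraphChart ℓ β U x}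

lemma abs_tcoord_add_sub_le (C : GraphChart ℓ β U x) (y a : Space N) :
    |tcoord x C.ν (y + a) - tcoord x C.ν y| ≤ ‖a‖ := by
  rw [tcoord_sub, add_sub_cancel_left]; exact abs_inner_le C.norm_ν a

lemma norm_hcoord_add_sub_le (C : GraphChart ℓ β U x) (y a : Space N) :
    ‖hcoord x C.ν (y + a) - hcoord x C.ν y‖ ≤ ‖a‖ := by
  rw [hcoord_sub, add_sub_cancel_left]; exact norm_projection_le a

lemma mem_closure_iff_of_mem_cyl {y : Space N} (hy : y ∈ C.cyl) :
    y ∈ closure U ↔ tcoord x C.ν y ≤ C.f (hcoord x C.ν y) := by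
  rw [← perturb_zero (C := C), mem_perturb_of_mem_cyl hy, add_zero]

/-- Comparison of a point and of its translate near the centre of the chart. -/
lemma translate_bounds {K : ℝ} (hK0 : 0 ≤ K)
    (hK : ∀ p q : Hyper C.ν, ‖p‖ ≤ C.r / 2 → ‖q‖ ≤ C.r / 2 → |C.f p - C.f q| ≤ K * ‖p - q‖)
    {y a : Space N} (ha : ‖a‖ ≤ C.r / 8) (ha' : ‖a‖ ≤ C.h / 8)
    (hp : ‖hcoord x C.ν (y + a)‖ < C.r / 8) (ht : |tcoord x C.ν (y + a)| ≤ C.h / 2) :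
    y ∈ C.cyl ∧ |(tcoord x C.ν (y + a) - C.f (hcoord x C.ν (y + a))) -
      (tcoord x C.ν y - C.f (hcoord x C.ν y))| ≤ (K + 1) * ‖a‖ := by
  have h1 := C.norm_hcoord_add_sub_le y a
  have h2 := C.abs_tcoord_add_sub_le y a
  have hr := C.r_pos
  have hh := C.h_pos
  have h3 : ‖hcoord x C.ν y‖ ≤ C.r / 4 := by
    have := norm_sub_norm_le (hcoord x C.ν y) (hcoord x C.ν (y + a))
    rw [norm_sub_rev] at this
    linarith
  have h4 : |tcoord x C.ν y| ≤ 5 * C.h / 8 := by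
    have := abs_le.1 h2
    have := abs_le.1 ht
    exact abs_le.2 ⟨by linarith, by linarith⟩
  refine ⟨mem_cyl_iff.2 ⟨by linarith, by linarith⟩, ?_⟩
  have h5 := hK (hcoord x C.ν (y + a)) (hcoord x C.ν y) (by linarith) (by linarith)
  have h6 : K * ‖hcoord x C.ν (y + a) - hcoord x C.ν y‖ ≤ K * ‖a‖ :=
    mul_le_mul_of_nonneg_left h1 hK0
  have h7 := abs_le.1 (h5.trans h6)
  have h8 := abs_le.1 h2
  exact abs_le.2 ⟨by linarith, by linarith⟩

lemma leaf_subset_bumped {s H : ℝ} (hH : 0 ≤ H) :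
    C.leaf s ⊆ C.perturb fun p => C.bumped H (s, p) := by
  intro y hy
  by_cases hc : y ∈ C.cyl
  · rw [leaf, mem_perturb_of_mem_cyl hc] at hy
    rw [mem_perturb_of_mem_cyl hc]
    have := mul_nonneg hH (C.tip.nonneg (x := hcoord x C.ν y))
    simp only [bumped]
    linarith
  · rw [leaf, mem_perturb_of_notMem_cyl hc] at hy
    rwa [mem_perturb_of_notMem_cyl hc]

lemma bumped_subset_leaf {s H : ℝ} (hH : H ≤ 0) :
    (C.perturb fun p => C.bumped H (s, p)) ⊆ C.leaf s := by
  intro y hy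
  by_cases hc : y ∈ C.cyl
  · rw [mem_perturb_of_mem_cyl hc] at hy
    rw [leaf, mem_perturb_of_mem_cyl hc]
    have := mul_nonpos_of_nonpos_of_nonneg hH (C.tip.nonneg (x := hcoord x C.ν y))
    simp only [bumped] at hy
    linarith
  · rw [mem_perturb_of_notMem_cyl hc] at hy
    rwa [leaf, mem_perturb_of_notMem_cyl hc]

lemma mem_bumped_iff_of_le {s H : ℝ} {y : Space N} (hy : y ∉ C.cyl ∨ C.r / 8 ≤ ‖hcoord x C.ν y‖) :
    y ∈ C.perturb (fun p => C.bumped H (s, p)) ↔ y ∈ C.leaf s := by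
  by_cases hc : y ∈ C.cyl
  · rw [leaf, mem_perturb_of_mem_cyl hc, mem_perturb_of_mem_cyl hc, bumped,
      tip_eq_zero (hy.resolve_left (not_not.2 hc)), mul_zero, add_zero]
  · rw [leaf, mem_perturb_of_notMem_cyl hc, mem_perturb_of_notMem_cyl hc]

/-- If `‖a‖` is small compared to `s`, the translate of `closure U` by `a` is contained in the leaf
with parameter `s`, as far as it lies in the leaf with the additional bump. -/
lemma mem_leaf_of_translate {K : ℝ} (hK0 : 0 ≤ K)
    (hK : ∀ p q : Hyper C.ν, ‖p‖ ≤ C.r / 2 → ‖q‖ ≤ C.r / 2 → |C.f p - C.f q| ≤ K * ‖p - q‖)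
    {s : ℝ} (hs : 0 ≤ s) (hsh : s ≤ C.h / 8) {y a : Space N} (ha : ‖a‖ ≤ C.r / 8)
    (has : (K + 1) * ‖a‖ ≤ s) (hy : y ∈ closure U)
    (hya : y + a ∈ C.perturb fun p => C.bumped (C.h / 8) (s, p)) : y + a ∈ C.leaf s := by
  by_cases hz : y + a ∉ C.cyl ∨ C.r / 8 ≤ ‖hcoord x C.ν (y + a)‖
  · exact (mem_bumped_iff_of_le hz).1 hya
  push Not at hz
  obtain ⟨hc, hp⟩ := hz
  have hr := C.r_pos
  have hh := C.h_pos
  have hη : C.eta (hcoord x C.ν (y + a)) = 1 := eta_eq_one (by linarith)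
  have hf := abs_le.1 (C.f_le (hcoord x C.ν (y + a)) (by linarith))
  rw [mem_perturb_of_mem_cyl hc, bumped, hη, mul_one] at hya
  rw [leaf, mem_perturb_of_mem_cyl hc, hη, mul_one]
  rcases lt_or_ge (tcoord x C.ν (y + a)) (-(C.h / 2)) with hlow | hlow
  · linarith
  have htip : C.h / 8 * C.tip (hcoord x C.ν (y + a)) ≤ C.h / 8 :=
    mul_le_of_le_one_right (by linarith) C.tip.le_one
  dsimp only at hya
  have ha1 : ‖a‖ ≤ (K + 1) * ‖a‖ := by nlinarith [norm_nonneg a]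
  obtain ⟨h1, h2⟩ := translate_bounds hK0 hK ha (by linarith) hp
    (abs_le.2 ⟨hlow, by linarith⟩)
  rw [mem_closure_iff_of_mem_cyl h1] at hy
  have := (abs_le.1 h2).2
  linarith

/-- If `‖a‖` is small compared to `-s`, the points of the leaf with parameter `s` that do not come
from `closure U` under the translation by `a` lie even in the leaf with an additional dent. -/
lemma mem_bumped_of_translate {K : ℝ} (hK0 : 0 ≤ K)
    (hK : ∀ p q : Hyper C.ν, ‖p‖ ≤ C.r / 2 → ‖q‖ ≤ C.r / 2 → |C.f p - C.f q| ≤ K * ‖p - q‖)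
    {s : ℝ} (hs : s ≤ 0) (hsh : -(C.h / 8) ≤ s) {y a : Space N} (ha : ‖a‖ ≤ C.r / 8)
    (has : (K + 1) * ‖a‖ ≤ -s) (hy : y ∉ closure U) (hya : y + a ∈ C.leaf s) :
    y + a ∈ C.perturb fun p => C.bumped (-(C.h / 8)) (s, p) := by
  by_cases hz : y + a ∉ C.cyl ∨ C.r / 8 ≤ ‖hcoord x C.ν (y + a)‖
  · exact (mem_bumped_iff_of_le hz).2 hya
  push Not at hz
  obtain ⟨hc, hp⟩ := hz
  have hr := C.r_pos
  have hh := C.h_pos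
  have hη : C.eta (hcoord x C.ν (y + a)) = 1 := eta_eq_one (by linarith)
  have hf := abs_le.1 (C.f_le (hcoord x C.ν (y + a)) (by linarith))
  rw [leaf, mem_perturb_of_mem_cyl hc, hη, mul_one] at hya
  rw [mem_perturb_of_mem_cyl hc, bumped, hη, mul_one]
  have htip : C.h / 8 * C.tip (hcoord x C.ν (y + a)) ≤ C.h / 8 :=
    mul_le_of_le_one_right (by linarith) C.tip.le_one
  dsimp only
  rcases lt_or_ge (tcoord x C.ν (y + a)) (-(C.h / 2)) with hlow | hlow
  · linarith
  have ha1 : ‖a‖ ≤ (K + 1) * ‖a‖ := by nlinarith [norm_nonneg a]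
  obtain ⟨h1, h2⟩ := translate_bounds hK0 hK ha (by linarith) hp
    (abs_le.2 ⟨hlow, by linarith⟩)
  rw [mem_closure_iff_of_mem_cyl h1, not_le] at hy
  have := (abs_le.1 h2).1
  linarith

/-- The height above the leaf through the centre is small near the centre. -/
lemma abs_height_le {K : ℝ} (hK0 : 0 ≤ K)
    (hK : ∀ p q : Hyper C.ν, ‖p‖ ≤ C.r / 2 → ‖q‖ ≤ C.r / 2 → |C.f p - C.f q| ≤ K * ‖p - q‖)
    {y : Space N} (hy : ‖y - x‖ ≤ C.r / 16) :
    |tcoord x C.ν y - C.f (hcoord x C.ν y)| ≤ (K + 1) * ‖y - x‖ := by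
  have hr := C.r_pos
  have h1 := norm_hcoord_le (x := x) (ν := C.ν) y
  have h2 := abs_tcoord_le (x := x) C.norm_ν y
  have h3 := hK (hcoord x C.ν y) 0 (by linarith) (by rw [norm_zero]; linarith)
  rw [C.f_zero, sub_zero, sub_zero] at h3
  have h4 : K * ‖hcoord x C.ν y‖ ≤ K * ‖y - x‖ := mul_le_mul_of_nonneg_left h1 hK0
  have h5 := abs_le.1 (h3.trans h4)
  have h6 := abs_le.1 h2
  exact abs_le.2 ⟨by linarith, by linarith⟩

lemma mem_cyl_of_norm_le {y : Space N} (hy : ‖y - x‖ ≤ C.r / 16) (hy' : ‖y - x‖ ≤ C.h / 16) :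
    y ∈ C.cyl := by
  have hr := C.r_pos
  have hh := C.h_pos
  have h1 := norm_hcoord_le (x := x) (ν := C.ν) y
  have h2 := abs_tcoord_le (x := x) C.norm_ν y
  exact mem_cyl_iff.2 ⟨by linarith, by linarith⟩

lemma mem_bumped_of_near {K : ℝ} (hK0 : 0 ≤ K)
    (hK : ∀ p q : Hyper C.ν, ‖p‖ ≤ C.r / 2 → ‖q‖ ≤ C.r / 2 → |C.f p - C.f q| ≤ K * ‖p - q‖)
    {z : Space N} (hz : ‖z - x‖ ≤ C.r / 16) (hz' : (K + 1) * ‖z - x‖ ≤ C.h / 16) {s : ℝ}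
    (hs : 0 ≤ s) : z ∈ C.perturb fun p => C.bumped (C.h / 8) (s, p) := by
  have hr := C.r_pos
  have hh := C.h_pos
  have h2 := (abs_le.1 (abs_height_le hK0 hK hz)).2
  have h4 := norm_hcoord_le (x := x) (ν := C.ν) z
  have h5 : ‖z - x‖ ≤ (K + 1) * ‖z - x‖ := by nlinarith [norm_nonneg (z - x)]
  rw [mem_perturb_of_mem_cyl (mem_cyl_of_norm_le hz (h5.trans hz')), bumped,
    tip_eq_one (h4.trans hz), eta_eq_one (by linarith)]
  dsimp only
  linarith

lemma notMem_bumped_of_near {K : ℝ} (hK0 : 0 ≤ K)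
    (hK : ∀ p q : Hyper C.ν, ‖p‖ ≤ C.r / 2 → ‖q‖ ≤ C.r / 2 → |C.f p - C.f q| ≤ K * ‖p - q‖)
    {z : Space N} (hz : ‖z - x‖ ≤ C.r / 16) (hz' : (K + 1) * ‖z - x‖ ≤ C.h / 16) {s : ℝ}
    (hs : s ≤ 0) : z ∉ C.perturb fun p => C.bumped (-(C.h / 8)) (s, p) := by
  have hr := C.r_pos
  have hh := C.h_pos
  have h2 := (abs_le.1 (abs_height_le hK0 hK hz)).1
  have h4 := norm_hcoord_le (x := x) (ν := C.ν) z
  have h5 : ‖z - x‖ ≤ (K + 1) * ‖z - x‖ := by nlinarith [norm_nonneg (z - x)]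
  rw [mem_perturb_of_mem_cyl (mem_cyl_of_norm_le hz (h5.trans hz')), bumped,
    tip_eq_one (h4.trans hz), eta_eq_one (by linarith)]
  dsimp only
  linarith

lemma leaf_eq_bumped (s : ℝ) : C.leaf s = C.perturb fun p => C.bumped 0 (s, p) := by
  rw [leaf]
  congr 1
  ext p
  simp [bumped]

lemma measurableSet_bumped (H s : ℝ) :
    MeasurableSet (C.perturb fun p => C.bumped H (s, p)) :=
  measurable_prodMk_left (x := s) (measurableSet_perturb_family (C := C) (continuous_bumped H))

lemma ae_eventually_mem_translate (hβ : β ≤ 1) (hU : RegularOpen ℓ β U) {H : ℝ}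
    (hH : |H| ≤ C.h / 8) {s : ℕ → ℝ} {a : ℕ → Space N} (hs : Tendsto s atTop (𝓝 0))
    (ha : Tendsto a atTop (𝓝 0)) :
    ∀ᵐ y, ∀ᶠ n in atTop, (y + a n ∈ C.perturb (fun p => C.bumped H (s n, p)) ↔
      y ∈ C.perturb fun p => C.bumped H (0, p)) := by
  have h0 := (eventually_admissible_bumped (C := C) hβ hH)
  have hnull := h0.self_of_nhds.volume_frontier hβ hU
  rw [← compl_compl (frontier _), ← mem_ae_iff] at hnull
  filter_upwards [hnull] with y hy
  exact (hs.prodMk_nhds ha).eventually (eventually_mem_translate (continuous_bumped H) h0 hy)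

/-- Adding a small set, slightly translated, to a leaf slightly larger than the set itself costs
hardly more than adding it to the set. -/
lemma exists_union_cost (hβ : β ≤ 1) (hℓ : 1 ≤ ℓ) (hJ : IsGeneralizedPerimeter ℓ β J)
    {κ : Space N → Set (Space N) → ℝ} (hκ : IsFirstVariation ℓ β J κ) (hU : RegularOpen ℓ β U)
    (C : GraphChart ℓ β U x) :
    ∃ ρ > 0, ∃ c > 0, ∀ W, MeasurableSet W → W ⊆ Metric.ball x ρ → ∀ η : ℝ≥0∞, 0 < η →
      ∃ σ > 0, ∀ s : ℝ, 0 < s → s ≤ σ → ∀ a : Space N, ‖a‖ ≤ c * s →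
        J (C.leaf s ∪ {y | y - a ∈ W}) + J (closure U) ≤
          J (C.leaf s) + J (closure U ∪ W) + η := by
  obtain ⟨K, hK0, hK⟩ := exists_lipschitz hℓ C
  have hr := C.r_pos
  have hh := C.h_pos
  set ρ := min (C.r / 64) (C.h / (64 * (K + 1)))
  have hρ : 0 < ρ := by positivity
  have hρr : ρ ≤ C.r / 64 := min_le_left _ _
  have hρK : (K + 1) * ρ ≤ C.h / 64 := by
    have h : ρ ≤ C.h / (64 * (K + 1)) := min_le_right _ _
    rw [le_div_iff₀ (by positivity)] at h
    linarith
  have hρh : ρ ≤ C.h / 64 := by nlinarith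
  have hH : |C.h / 8| ≤ C.h / 8 := (abs_of_pos (by positivity)).le
  refine ⟨ρ, hρ, 1 / (K + 1), by positivity, fun W hW hWρ η hη => ?_⟩
  by_contra! hcon
  set σ : ℕ → ℝ := fun n => min (1 / ((n : ℝ) + 1)) ρ
  have hσ : ∀ n, 0 < σ n := fun n => by
    have : (0 : ℝ) < 1 / ((n : ℝ) + 1) := by positivity
    exact lt_min this hρ
  have hσ0 : Tendsto σ atTop (𝓝 0) :=
    squeeze_zero (fun n => (hσ n).le) (fun n => min_le_left _ _)
      tendsto_one_div_add_atTop_nhds_zero_nat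
  -- along a sequence of counterexamples, everything is translated by `-a n`, so that the added set
  -- becomes `W` itself; the leaves with an additional bump contain `W`
  choose s hs0 hsσ a ha hbad using fun n => hcon (σ n) (hσ n)
  have has : ∀ n, (K + 1) * ‖a n‖ ≤ s n := fun n => by
    have := mul_le_mul_of_nonneg_left (ha n) (by positivity : 0 ≤ K + 1)
    rwa [← mul_assoc, mul_one_div_cancel (by positivity), one_mul] at this
  have has' : ∀ n, ‖a n‖ ≤ s n := fun n => by
    have := has n
    nlinarith [norm_nonneg (a n)]
  have hsρ : ∀ n, s n ≤ ρ := fun n => (hsσ n).trans (min_le_right _ _)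
  have hlims : Tendsto s atTop (𝓝 0) := squeeze_zero (fun n => (hs0 n).le) hsσ hσ0
  have hlima : Tendsto a atTop (𝓝 0) := squeeze_zero_norm has' hlims
  have hmeas : ∀ n (H : ℝ), MeasurableSet {y | y + a n ∈ C.perturb fun p => C.bumped H (s n, p)} :=
    fun n H => (measurable_add_const (a n)) (measurableSet_bumped H (s n))
  have hE0 : closure U = C.perturb fun p => C.bumped 0 (0, p) := by
    rw [← leaf_eq_bumped, leaf_zero]
  have hH0 : |(0 : ℝ)| ≤ C.h / 8 := by rw [abs_zero]; positivity
  have hnear : ∀ n, ∀ y ∈ W, ‖y + a n - x‖ ≤ 2 * ρ := fun n y hy => by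
    have hyρ := mem_ball_iff_norm.1 (hWρ hy)
    have := norm_add_le (y - x) (a n)
    rw [sub_add_eq_add_sub] at this
    linarith [has' n, hsρ n]
  have hnear' : ∀ n, ∀ y ∈ W, (K + 1) * ‖y + a n - x‖ ≤ C.h / 16 := fun n y hy => by
    have := mul_le_mul_of_nonneg_left (hnear n y hy) (by positivity : 0 ≤ K + 1)
    linarith
  have c1 : ∀ᵐ y, ∀ᶠ n in atTop, (y ∈ {y | y + a n ∈ C.leaf (s n)} ↔ y ∈ closure U) := by
    rw [hE0]
    simp only [leaf_eq_bumped]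
    exact ae_eventually_mem_translate hβ hU hH0 hlims hlima
  have c2 : ∀ n, W ⊆ {y | y + a n ∈ C.perturb fun p => C.bumped (C.h / 8) (s n, p)} :=
    fun n y hy => mem_bumped_of_near hK0 hK (by linarith [hnear n y hy]) (hnear' n y hy) (hs0 n).le
  have c3 : ∀ n, closure U ∩ {y | y + a n ∈ C.perturb fun p => C.bumped (C.h / 8) (s n, p)} ⊆
      {y | y + a n ∈ C.leaf (s n)} := fun n y hy =>
    mem_leaf_of_translate hK0 hK (hs0 n).le (by linarith [hsρ n]) (by linarith [has' n, hsρ n])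
      (has n) hy.1 hy.2
  have c4 : ∀ η : ℝ≥0∞, 0 < η → ∀ᶠ n in atTop,
      J {y | y + a n ∈ C.perturb fun p => C.bumped (C.h / 8) (s n, p)} ≤
        J (C.perturb fun p => C.bumped (C.h / 8) (0, p)) + η := fun η hη => by
    filter_upwards [hlims.eventually (eventually_bumped_le (C := C) hβ hℓ hJ hκ hU hH hη)] with n hn
    rwa [hJ.translate (measurableSet_bumped _ _)]
  have h8 : 0 ≤ C.h / 8 := by linarith
  have c5 : ∀ n, MeasurableSet {y | y + a n ∈ C.leaf (s n)} := fun n => by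
    rw [leaf_eq_bumped]; exact hmeas n 0
  have c6 : closure U ⊆ C.perturb fun p => C.bumped (C.h / 8) (0, p) := by
    rw [← leaf_zero (C := C)]; exact leaf_subset_bumped (s := 0) (H := C.h / 8) h8
  have c7 : ∀ n, {y | y + a n ∈ C.leaf (s n)} ⊆
      {y | y + a n ∈ C.perturb fun p => C.bumped (C.h / 8) (s n, p)} :=
    fun n y hy => by
      change y + a n ∈ C.leaf (s n) at hy
      rw [Set.mem_ofPred_eq]
      exact leaf_subset_bumped (s := s n) (H := C.h / 8) h8 hy
  have c8 : J (closure U) ≠ ⊤ := (hJ.finite_of_regular _ hU.isRegular).ne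
  have c9 : J (C.perturb fun p => C.bumped (C.h / 8) (0, p)) ≠ ⊤ := (hJ.finite_of_regular _
    ((eventually_admissible_bumped (C := C) hβ hH).self_of_nhds.isRegular hβ hU)).ne
  have key := hJ.isLscSubmodular.eventually_union_le c5 (fun n => hmeas n _)
    isClosed_closure.measurableSet (measurableSet_bumped _ _) hW c6 c1
    (ae_eventually_mem_translate hβ hU hH hlims hlima) c7 c2 c3 c8 c9 c4 hη
  obtain ⟨n, hn⟩ := key.exists
  refine absurd hn (not_le.2 ?_)
  have hWm : MeasurableSet {y | y - a n ∈ W} := (measurable_sub_const (a n)) hW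
  have hLm : MeasurableSet (C.leaf (s n)) :=
    leaf_eq_bumped (C := C) (s n) ▸ measurableSet_bumped _ _
  have e : {y | y + a n ∈ C.leaf (s n)} ∪ W = {y | y + a n ∈ C.leaf (s n) ∪ {y | y - a n ∈ W}} := by
    ext y; simp
  have hbn := hbad n
  rw [e, hJ.translate hLm, hJ.translate (hLm.union hWm)]
  exact hbn

/-- Removing a small set, slightly translated, from a leaf slightly smaller than the set itself
costs hardly more than removing it from the set. -/
lemma exists_sdiff_cost (hβ : β ≤ 1) (hℓ : 1 ≤ ℓ) (hJ : IsGeneralizedPerimeter ℓ β J)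
    {κ : Space N → Set (Space N) → ℝ} (hκ : IsFirstVariation ℓ β J κ) (hU : RegularOpen ℓ β U)
    (C : GraphChart ℓ β U x) :
    ∃ ρ > 0, ∃ c > 0, ∀ W, MeasurableSet W → W ⊆ Metric.ball x ρ → ∀ η : ℝ≥0∞, 0 < η →
      ∃ σ > 0, ∀ s : ℝ, s < 0 → -σ ≤ s → ∀ a : Space N, ‖a‖ ≤ c * -s →
        J (C.leaf s \ {y | y - a ∈ W}) + J (closure U) ≤
          J (C.leaf s) + J (closure U \ W) + η := by
  obtain ⟨K, hK0, hK⟩ := exists_lipschitz hℓ C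
  have hr := C.r_pos
  have hh := C.h_pos
  set ρ := min (C.r / 64) (C.h / (64 * (K + 1)))
  have hρ : 0 < ρ := by positivity
  have hρr : ρ ≤ C.r / 64 := min_le_left _ _
  have hρK : (K + 1) * ρ ≤ C.h / 64 := by
    have h : ρ ≤ C.h / (64 * (K + 1)) := min_le_right _ _
    rw [le_div_iff₀ (by positivity)] at h
    linarith
  have hρh : ρ ≤ C.h / 64 := by nlinarith
  have hH : |-(C.h / 8)| ≤ C.h / 8 := by rw [abs_neg, abs_of_pos (by positivity)]
  refine ⟨ρ, hρ, 1 / (K + 1), by positivity, fun W hW hWρ η hη => ?_⟩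
  by_contra! hcon
  set σ : ℕ → ℝ := fun n => min (1 / ((n : ℝ) + 1)) ρ
  have hσ : ∀ n, 0 < σ n := fun n => by
    have : (0 : ℝ) < 1 / ((n : ℝ) + 1) := by positivity
    exact lt_min this hρ
  have hσ0 : Tendsto σ atTop (𝓝 0) :=
    squeeze_zero (fun n => (hσ n).le) (fun n => min_le_left _ _)
      tendsto_one_div_add_atTop_nhds_zero_nat
  -- the previous argument is applied to the complements: the leaves with an additional dent do not
  -- meet `W`
  choose s hs0 hsσ a ha hbad using fun n => hcon (σ n) (hσ n)
  have has : ∀ n, (K + 1) * ‖a n‖ ≤ -s n := fun n => by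
    have := mul_le_mul_of_nonneg_left (ha n) (by positivity : 0 ≤ K + 1)
    rwa [← mul_assoc, mul_one_div_cancel (by positivity), one_mul] at this
  have has' : ∀ n, ‖a n‖ ≤ -s n := fun n => by
    have := has n
    nlinarith [norm_nonneg (a n)]
  have hsρ : ∀ n, -s n ≤ ρ := fun n => (neg_le.1 (hsσ n)).trans (min_le_right _ _)
  have hlims' : Tendsto (fun n => -s n) atTop (𝓝 0) :=
    squeeze_zero (fun n => by linarith [hs0 n]) (fun n => neg_le.1 (hsσ n)) hσ0
  have hlims : Tendsto s atTop (𝓝 0) := by simpa using hlims'.neg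
  have hlima : Tendsto a atTop (𝓝 0) := squeeze_zero_norm has' hlims'
  have hmeas : ∀ n (H : ℝ), MeasurableSet {y | y + a n ∈ C.perturb fun p => C.bumped H (s n, p)} :=
    fun n H => (measurable_add_const (a n)) (measurableSet_bumped H (s n))
  have hE0 : closure U = C.perturb fun p => C.bumped 0 (0, p) := by
    rw [← leaf_eq_bumped, leaf_zero]
  have hH0 : |(0 : ℝ)| ≤ C.h / 8 := by rw [abs_zero]; positivity
  have hneg : -(C.h / 8) ≤ 0 := by linarith
  have hnear : ∀ n, ∀ y ∈ W, ‖y + a n - x‖ ≤ 2 * ρ := fun n y hy => by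
    have hyρ := mem_ball_iff_norm.1 (hWρ hy)
    have := norm_add_le (y - x) (a n)
    rw [sub_add_eq_add_sub] at this
    linarith [has' n, hsρ n]
  have hnear' : ∀ n, ∀ y ∈ W, (K + 1) * ‖y + a n - x‖ ≤ C.h / 16 := fun n y hy => by
    have := mul_le_mul_of_nonneg_left (hnear n y hy) (by positivity : 0 ≤ K + 1)
    linarith
  have c1 : ∀ᵐ y, ∀ᶠ n in atTop, (y ∈ {y | y + a n ∈ C.leaf (s n)}ᶜ ↔ y ∈ (closure U)ᶜ) := by
    rw [hE0]
    simp only [leaf_eq_bumped]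
    exact (ae_eventually_mem_translate hβ hU hH0 hlims hlima).mono fun y hy =>
      hy.mono fun n hn => not_congr hn
  have c1' : ∀ᵐ y, ∀ᶠ n in atTop,
      (y ∈ {y | y + a n ∈ C.perturb fun p => C.bumped (-(C.h / 8)) (s n, p)}ᶜ ↔
        y ∈ (C.perturb fun p => C.bumped (-(C.h / 8)) (0, p))ᶜ) :=
    (ae_eventually_mem_translate hβ hU hH hlims hlima).mono fun y hy =>
      hy.mono fun n hn => not_congr hn
  have c2 : ∀ n, W ⊆ {y | y + a n ∈ C.perturb fun p => C.bumped (-(C.h / 8)) (s n, p)}ᶜ :=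
    fun n y hy =>
    notMem_bumped_of_near hK0 hK (by linarith [hnear n y hy]) (hnear' n y hy) (hs0 n).le
  have c3 : ∀ n, (closure U)ᶜ ∩
      {y | y + a n ∈ C.perturb fun p => C.bumped (-(C.h / 8)) (s n, p)}ᶜ ⊆
      {y | y + a n ∈ C.leaf (s n)}ᶜ := fun n y hy hya =>
    hy.2 (mem_bumped_of_translate hK0 hK (hs0 n).le (by linarith [hsρ n])
      (by linarith [has' n, hsρ n]) (has n) hy.1 hya)
  have c4 : ∀ η : ℝ≥0∞, 0 < η → ∀ᶠ n in atTop,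
      J ({y | y + a n ∈ C.perturb fun p => C.bumped (-(C.h / 8)) (s n, p)}ᶜ)ᶜ ≤
        J (C.perturb fun p => C.bumped (-(C.h / 8)) (0, p))ᶜᶜ + η := fun η hη => by
    filter_upwards [hlims.eventually (eventually_bumped_le (C := C) hβ hℓ hJ hκ hU hH hη)] with n hn
    rw [compl_compl, compl_compl]
    rwa [hJ.translate (measurableSet_bumped _ _)]
  have c5 : ∀ n, MeasurableSet {y | y + a n ∈ C.leaf (s n)}ᶜ := fun n => by
    rw [leaf_eq_bumped]; exact (hmeas n 0).compl
  have c6 : (closure U)ᶜ ⊆ (C.perturb fun p => C.bumped (-(C.h / 8)) (0, p))ᶜ := by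
    rw [← leaf_zero (C := C)]
    exact Set.compl_subset_compl.2 (bumped_subset_leaf (s := 0) (H := -(C.h / 8)) hneg)
  have c7 : ∀ n, {y | y + a n ∈ C.leaf (s n)}ᶜ ⊆
      {y | y + a n ∈ C.perturb fun p => C.bumped (-(C.h / 8)) (s n, p)}ᶜ :=
    fun n y hy hy' => by
      change y + a n ∉ C.leaf (s n) at hy
      rw [Set.mem_ofPred_eq] at hy'
      exact hy (bumped_subset_leaf (s := s n) (H := -(C.h / 8)) hneg hy')
  have c8 : J (closure U)ᶜᶜ ≠ ⊤ := by
    rw [compl_compl]; exact (hJ.finite_of_regular _ hU.isRegular).ne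
  have c9 : J (C.perturb fun p => C.bumped (-(C.h / 8)) (0, p))ᶜᶜ ≠ ⊤ := by
    rw [compl_compl]
    exact (hJ.finite_of_regular _
      ((eventually_admissible_bumped (C := C) hβ hH).self_of_nhds.isRegular hβ hU)).ne
  have key := hJ.isLscSubmodular.compl.eventually_union_le c5 (fun n => (hmeas n _).compl)
    isClosed_closure.measurableSet.compl (measurableSet_bumped _ _).compl hW c6 c1
    c1' c7 c2 c3 c8 c9 c4 hη
  obtain ⟨n, hn⟩ := key.exists
  refine absurd hn (not_le.2 ?_)
  have hWm : MeasurableSet {y | y - a n ∈ W} := (measurable_sub_const (a n)) hW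
  have hLm : MeasurableSet (C.leaf (s n)) :=
    leaf_eq_bumped (C := C) (s n) ▸ measurableSet_bumped _ _
  have e : ({y | y + a n ∈ C.leaf (s n)}ᶜ ∪ W)ᶜ =
      {y | y + a n ∈ C.leaf (s n) \ {y | y - a n ∈ W}} := by
    ext y; simp
  have e' : ((closure U)ᶜ ∪ W)ᶜ = closure U \ W := by
    ext y; simp
  have hbn := hbad n
  rw [e, e', compl_compl, compl_compl, hJ.translate hLm, hJ.translate (hLm.diff hWm)]
  exact hbn

end GraphChart

end LeafCost

/-! ### Mollified sets and smooth steps -/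

section Mollifiers

/-- The translations by random vectors distributed according to a normalized bump function. -/
def bumpLaw (φ : ContDiffBump (0 : Space N)) : Measure (Space N) :=
  volume.withDensity fun a => ENNReal.ofReal (φ.normed volume a)

lemma bumpLaw_real (φ : ContDiffBump (0 : Space N)) {S : Set (Space N)} (hS : MeasurableSet S) :
    (bumpLaw φ).real S = ∫ a in S, φ.normed volume a := by
  rw [measureReal_def, bumpLaw, withDensity_apply _ hS,
    integral_eq_lintegral_of_nonneg_ae (Eventually.of_forall fun a => φ.nonneg_normed a)
      φ.integrable_normed.aestronglyMeasurable.restrict]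

instance isProbabilityMeasure_bumpLaw (φ : ContDiffBump (0 : Space N)) :
    IsProbabilityMeasure (bumpLaw φ) := by
  refine ⟨?_⟩
  rw [bumpLaw, withDensity_apply _ MeasurableSet.univ, Measure.restrict_univ,
    ← ofReal_integral_eq_lintegral_ofReal φ.integrable_normed
      (Eventually.of_forall fun a => φ.nonneg_normed a), φ.integral_normed, ENNReal.ofReal_one]

lemma ae_bumpLaw_norm_lt (φ : ContDiffBump (0 : Space N)) : ∀ᵐ a ∂bumpLaw φ, ‖a‖ < φ.rOut := by
  have hm : Measurable fun a => ENNReal.ofReal (φ.normed volume a) :=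
    φ.continuous_normed.measurable.ennreal_ofReal
  rw [bumpLaw, ae_withDensity_iff hm]
  refine Eventually.of_forall fun a ha => ?_
  have : a ∈ Function.support (φ.normed volume) := fun h => ha (by rw [h, ENNReal.ofReal_zero])
  rw [φ.support_normed_eq] at this
  exact mem_ball_zero_iff.1 this

/-- The mollified characteristic function of `W`: the probability that `y` belongs to a random
translate of `W`. -/
def mollified (φ : ContDiffBump (0 : Space N)) (W : Set (Space N)) (y : Space N) : ℝ :=
  (bumpLaw φ).real {a | y - a ∈ W}

variable {φ : ContDiffBump (0 : Space N)} {W : Set (Space N)}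

lemma mollified_eq (hW : MeasurableSet W) (y : Space N) : mollified φ W y =
    convolution (φ.normed volume) (W.indicator fun _ => (1 : ℝ)) (ContinuousLinearMap.lsmul ℝ ℝ)
      volume y := by
  have hm : MeasurableSet {a : Space N | y - a ∈ W} := (measurable_const.sub measurable_id) hW
  rw [mollified, bumpLaw_real _ hm, convolution, ← integral_indicator hm]
  refine integral_congr_ae (Eventually.of_forall fun a => ?_)
  by_cases ha : y - a ∈ W
  · simp [Set.indicator, ha]
  · simp [Set.indicator, ha]

lemma mollified_nonneg (y : Space N) : 0 ≤ mollified φ W y := measureReal_nonneg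

lemma mollified_le_one (y : Space N) : mollified φ W y ≤ 1 := measureReal_le_one

lemma mollified_eq_zero {x : Space N} {ρ : ℝ} (hWρ : W ⊆ Metric.ball x ρ) {y : Space N}
    (hy : ρ + φ.rOut ≤ ‖y - x‖) : mollified φ W y = 0 := by
  rw [mollified, measureReal_eq_zero_iff]
  refine measure_mono_null (t := {a | ¬ ‖a‖ < φ.rOut}) (fun a ha hlt => ?_) (ae_bumpLaw_norm_lt φ)
  have h1 := mem_ball_iff_norm.1 (hWρ ha)
  have h2 := norm_add_le (y - a - x) a
  rw [show y - a - x + a = y - x by abel] at h2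
  linarith

lemma locallyIntegrable_indicator (hW : MeasurableSet W) :
    LocallyIntegrable (W.indicator fun _ => (1 : ℝ)) (volume : Measure (Space N)) := by
  refine (locallyIntegrable_const (1 : ℝ)).mono
    (measurable_const.indicator hW).aestronglyMeasurable (Eventually.of_forall fun y => ?_)
  by_cases hy : y ∈ W <;> simp [hy]

lemma contDiff_mollified (hW : MeasurableSet W) : ContDiff ℝ (⊤ : ℕ∞) (mollified φ W) := by
  have h : mollified φ W = convolution (φ.normed volume) (W.indicator fun _ => (1 : ℝ))
      (ContinuousLinearMap.lsmul ℝ ℝ) volume := funext (mollified_eq hW)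
  rw [h]
  exact φ.hasCompactSupport_normed.contDiff_convolution_left _ φ.contDiff_normed
    (locallyIntegrable_indicator hW)

lemma ae_tendsto_mollified {φ : ℕ → ContDiffBump (0 : Space N)} (hW : MeasurableSet W)
    (hφ : Tendsto (fun n => (φ n).rOut) atTop (𝓝 0)) (hφ' : ∀ n, (φ n).rOut ≤ 2 * (φ n).rIn) :
    ∀ᵐ y, Tendsto (fun n => mollified (φ n) W y) atTop (𝓝 (W.indicator (fun _ => 1) y)) := by
  filter_upwards [ContDiffBump.ae_convolution_tendsto_right_of_locallyIntegrable hφ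
    (Eventually.of_forall hφ') (locallyIntegrable_indicator hW)] with y hy
  simp only [mollified_eq hW]
  exact hy

/-- A smooth increasing function which is `0` below `c` and `1` above `d`. -/
lemma exists_smooth_step {c d : ℝ} (hcd : c < d) : ∃ m : ℝ → ℝ, ContDiff ℝ (⊤ : ℕ∞) m ∧
    (∀ q ≤ c, m q = 0) ∧ (∀ q, d ≤ q → m q = 1) ∧ (∀ q, m q ∈ Set.Icc (0 : ℝ) 1) ∧
    (∀ q, 0 ≤ deriv m q) ∧ (∀ q, 0 < deriv m q → q ∈ Set.Icc c d) ∧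
    ∃ B, (∀ q, |m q| ≤ B) ∧ ∀ q, |deriv m q| ≤ B := by
  have hdc : 0 < d - c := sub_pos.2 hcd
  set m : ℝ → ℝ := fun q => Real.smoothTransition ((q - c) / (d - c)) with hm
  have hcont : ContDiff ℝ (⊤ : ℕ∞) m :=
    Real.smoothTransition.contDiff.comp ((contDiff_id.sub contDiff_const).div_const _)
  have h0 : ∀ q ≤ c, m q = 0 := fun q hq =>
    Real.smoothTransition.zero_of_nonpos (div_nonpos_of_nonpos_of_nonneg (by linarith) hdc.le)
  have h1 : ∀ q, d ≤ q → m q = 1 := fun q hq =>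
    Real.smoothTransition.one_of_one_le ((one_le_div hdc).2 (by linarith))
  have hI : ∀ q, m q ∈ Set.Icc (0 : ℝ) 1 := fun q =>
    ⟨Real.smoothTransition.nonneg _, Real.smoothTransition.le_one _⟩
  have hmono : Monotone m := fun a b hab =>
    Real.smoothTransition.monotone (div_le_div_of_nonneg_right (by linarith) hdc.le)
  have hd0 : ∀ q, 0 ≤ deriv m q := fun q => hmono.deriv_nonneg
  have hdz : ∀ q, q ∉ Set.Icc c d → deriv m q = 0 := fun q hq => by
    rcases lt_or_ge q c with hqc | hqc
    · have : m =ᶠ[𝓝 q] fun _ => 0 := by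
        filter_upwards [gt_mem_nhds hqc] with y hy
        exact h0 y hy.le
      rw [this.deriv_eq, deriv_const]
    · have hdq : d < q := by
        by_contra h
        exact hq ⟨hqc, not_lt.1 h⟩
      have : m =ᶠ[𝓝 q] fun _ => 1 := by
        filter_upwards [lt_mem_nhds hdq] with y hy
        exact h1 y hy.le
      rw [this.deriv_eq, deriv_const]
  obtain ⟨B, hB⟩ := (isCompact_Icc (a := c) (b := d)).exists_bound_of_continuousOn
    (hcont.continuous_deriv (by simp)).continuousOn
  refine ⟨m, hcont, h0, h1, hI, hd0, fun q hq => ?_, max B 1, fun q => ?_, fun q => ?_⟩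
  · by_contra h
    exact hq.ne' (hdz q h)
  · rw [abs_of_nonneg (hI q).1]
    exact (hI q).2.trans (le_max_right _ _)
  · by_cases hq : q ∈ Set.Icc c d
    · exact (hB q hq).trans (le_max_left _ _)
    · rw [hdz q hq, abs_zero]
      exact zero_le_one.trans (le_max_right _ _)

lemma intervalIntegrable_deriv_indicator {m : ℝ → ℝ} (hm : ContDiff ℝ (⊤ : ℕ∞) m) (q a b : ℝ) :
    IntervalIntegrable (fun s => deriv m s * (Set.Ici q).indicator 1 s) volume a b := by
  have hc : Continuous (deriv m) := hm.continuous_deriv (by simp)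
  have : (fun s => deriv m s * (Set.Ici q).indicator 1 s) =
      (Set.Ici q).indicator fun s => deriv m s := by
    ext s
    by_cases hs : q ≤ s <;> simp [Set.indicator, hs]
  rw [this, intervalIntegrable_iff]
  exact (hc.intervalIntegrable a b).def'.indicator measurableSet_Ici

lemma integral_deriv_indicator {m : ℝ → ℝ} (hm : ContDiff ℝ (⊤ : ℕ∞) m) {σ q : ℝ} (hq : |q| ≤ σ) :
    (∫ s in (-σ)..σ, deriv m s * (Set.Ici q).indicator 1 s) = m σ - m q := by
  have hq' := abs_le.1 hq
  have hc : Continuous (deriv m) := hm.continuous_deriv (by simp)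
  have hii := intervalIntegrable_deriv_indicator hm q
  rw [← intervalIntegral.integral_add_adjacent_intervals (hii (-σ) q) (hii q σ)]
  have e1 : (∫ s in (-σ)..q, deriv m s * (Set.Ici q).indicator 1 s) = 0 := by
    rw [intervalIntegral.integral_of_le hq'.1, integral_Ioc_eq_integral_Ioo]
    refine setIntegral_eq_zero_of_forall_eq_zero fun s hs => ?_
    rw [Set.indicator_of_notMem (by simpa using hs.2), mul_zero]
  have e2 : (∫ s in q..σ, deriv m s * (Set.Ici q).indicator 1 s) = ∫ s in q..σ, deriv m s := by
    refine intervalIntegral.integral_congr fun s hs => ?_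
    rw [Set.uIcc_of_le hq'.2] at hs
    have hs1 : s ∈ Set.Ici q := hs.1
    simp only [Set.indicator_of_mem hs1, Pi.one_apply, mul_one]
  rw [e1, e2, zero_add, intervalIntegral.integral_deriv_eq_sub
    (fun s _ => hm.differentiable (by simp) s) (hc.intervalIntegrable q σ)]

end Mollifiers

/-! ### Comparison with arbitrary small modifications -/

section Comparison

variable {ℓ : ℕ} {β : ℝ≥0} {J : Set (Space N) → ℝ≥0∞} {κ : Space N → Set (Space N) → ℝ}

namespace GraphChart

variable {U : Set (Space N)} {x : Space N}

set_option maxHeartbeats 1000000 in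
/-- The mean inequality near the centre of a chart, for modifications of the leaves by random sets
which are the same for all leaves. In the applications `e = 1` if these sets are added to the
leaves, and `e = 0` if they are removed. -/
lemma exists_mean_inequality (hβ : β ≤ 1) (hℓ : 1 ≤ ℓ) (hJ : IsGeneralizedPerimeter ℓ β J)
    (hκ : IsFirstVariation ℓ β J κ) (hC : IsContinuousCurvature ℓ β κ) (hU : RegularOpen ℓ β U)
    (C : GraphChart ℓ β U x) {η : ℝ} (hη : 0 < η) :
    ∃ ρ > 0, ∃ σ > 0, σ ≤ C.h / 8 ∧ (∀ y, ‖y - x‖ < ρ → y ∈ C.tube (σ / 2)) ∧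
      ∀ (χ : Space N → ℝ) (m : ℝ → ℝ) (B e b : ℝ) (P : Measure (Space N)) [IsProbabilityMeasure P]
        (D : Set ((ℝ × Space N) × Space N)) (S : Set (Space N)),
        ContDiff ℝ (⊤ : ℕ∞) χ → (∀ y, |χ y| ≤ 1) → (∀ y, χ y ≠ 0 → ‖y - x‖ < ρ) →
        ContDiff ℝ (⊤ : ℕ∞) m → (∀ q, |m q| ≤ B) → (∀ q, |deriv m q| ≤ B) →
        (∀ q, 0 ≤ deriv m q) → e * (m σ - m (-σ)) = m σ → MeasurableSet D →
        (∀ s y, P.real {a | ((s, a), y) ∈ D} - {s | y ∈ C.leaf s}.indicator 1 s =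
          χ y * (e - {s | y ∈ C.leaf s}.indicator 1 s)) →
        (∀ᵐ a ∂P, a ∈ S) →
        (∀ s : ℝ, |s| ≤ σ → 0 < deriv m s → ∀ a ∈ S, J {y | ((s, a), y) ∈ D} ≠ ⊤ ∧
          (J {y | ((s, a), y) ∈ D}).toReal ≤ (J (C.leaf s)).toReal + b) →
        κ x (closure U) * (∫ y, χ y * m (tcoord x C.ν y - C.f (hcoord x C.ν y))) -
          η * (∫ y, |χ y * m (tcoord x C.ν y - C.f (hcoord x C.ν y))|) ≤ b * (m σ - m (-σ)) := by
  set κ₀ := κ x (closure U)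
  have hr := C.r_pos
  have hh := C.h_pos
  obtain ⟨K, hK0, hK⟩ := exists_lipschitz hℓ C
  set L := fderiv ℝ C.f 0
  obtain ⟨ε₂, hε₂, hε₂', herr⟩ := exists_variationError_le N κ₀ (√(1 + ‖L‖ ^ 2)) hη
  set ε := ε₂ / 2
  have hε : 0 < ε := by positivity
  have hε4 : ε ≤ 1 / 4 := by simp only [ε]; linarith
  have h2ε : 2 * ε = ε₂ := by simp only [ε]; ring
  obtain ⟨δ₀, hδ₀, hclose⟩ := exists_curvature_leaf_close (C := C) hβ hC hU hε
  have hne : (ℓ : WithTop ℕ∞) ≠ 0 := by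
    have : ℓ ≠ 0 := by omega
    exact_mod_cast this
  have hfd : ContinuousAt (fun p => ‖fderiv ℝ C.f p - L‖) 0 :=
    (((C.holder 0).1.continuousAt_fderiv hne).sub continuousAt_const).norm
  obtain ⟨δ₁, hδ₁, hslope⟩ := Metric.eventually_nhds_iff.1 (hfd.eventually (gt_mem_nhds
    (show ‖fderiv ℝ C.f 0 - L‖ < ε by
      rw [sub_self]
      exact lt_of_eq_of_lt (norm_zero (E := Hyper C.ν →L[ℝ] ℝ)) hε)))
  set ρ' := min δ₀ (min (δ₁ / 2) (C.r / 8))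
  have hρ'0 : 0 < ρ' := by positivity
  have hρ'1 : ρ' ≤ δ₀ := min_le_left _ _
  have hρ'2 : ρ' ≤ δ₁ / 2 := (min_le_right _ _).trans (min_le_left _ _)
  have hρ'3 : ρ' ≤ C.r / 8 := (min_le_right _ _).trans (min_le_right _ _)
  set σ := min δ₀ (C.h / 8)
  have hσ0 : 0 < σ := by positivity
  have hσ1 : σ ≤ δ₀ := min_le_left _ _
  have hσ2 : σ ≤ C.h / 8 := min_le_right _ _
  set ρ := min (min ρ' (C.r / 16)) (min (C.h / 16) (σ / (2 * (K + 1))))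
  have hρ0 : 0 < ρ := by positivity
  have hρ1 : ρ ≤ ρ' := (min_le_left _ _).trans (min_le_left _ _)
  have hρ2 : ρ ≤ C.r / 16 := (min_le_left _ _).trans (min_le_right _ _)
  have hρ3 : ρ ≤ C.h / 16 := (min_le_right _ _).trans (min_le_left _ _)
  have hρ4 : (K + 1) * ρ ≤ σ / 2 := by
    have h : ρ ≤ σ / (2 * (K + 1)) := (min_le_right _ _).trans (min_le_right _ _)
    rw [le_div_iff₀ (by positivity)] at h
    linarith
  have htube : ∀ y, ‖y - x‖ < ρ → y ∈ C.tube (σ / 2) := fun y hy => by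
    refine ⟨mem_cyl_of_norm_le (by linarith) (by linarith),
      (norm_hcoord_le (x := x) (ν := C.ν) y).trans (by linarith),
      (abs_height_le hK0 hK (by linarith)).trans ?_⟩
    exact (mul_le_mul_of_nonneg_left hy.le (by positivity)).trans hρ4
  refine ⟨ρ, hρ0, σ, hσ0, hσ2, htube, ?_⟩
  intro χ m B e b P _ D S hχ hχ1 hχs hm hmB hmB' hm0 he hD hmean hS hJD
  have hχc : HasCompactSupport χ := HasCompactSupport.intro (isCompact_closedBall x ρ) fun y hy => by
    by_contra h
    exact hy (by rw [mem_closedBall_iff_norm]; exact (hχs y h).le)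
  obtain ⟨F⟩ := exists_levelFamily (C := C) hβ hℓ hχ hχc hm hmB hmB' (ρ := ρ') fun y hy =>
    ((norm_hcoord_le (x := x) (ν := C.ν) y).trans_lt (hχs y hy)).trans_le hρ1
  have hB0 : 0 ≤ B := (abs_nonneg _).trans (hmB 0)
  have hq : Continuous fun y : Space N => tcoord x C.ν y - C.f (hcoord x C.ν y) :=
    continuous_tcoord.sub (C.continuous.comp continuous_hcoord)
  set ψ : Space N → ℝ := fun y => χ y * m (tcoord x C.ν y - C.f (hcoord x C.ν y)) with hψ
  have hmc : Continuous (deriv m) := hm.continuous_deriv (by simp)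
  have key := LevelFamily.mean_inequality hβ hℓ hJ hκ hC hU F (κ₀ := κ₀) (σ := σ) (L := L) hε hε4
    (by linarith) hσ0 hσ2
    (fun p hp => (hslope (by rw [dist_zero_right]; linarith)).le)
    (fun s hs p hp => hclose s (hs.trans hσ1) p (hp.trans hρ'1))
    (hχ.continuous.mul (hm.continuous.comp hq))
    (fun y hy => htube y (hχs y (left_ne_zero_of_mul hy))) (M := B)
    (fun y => by
      rw [abs_mul]
      exact (mul_le_of_le_one_left (abs_nonneg _) (hχ1 y)).trans (hmB _))
    (w := deriv m) hmc hm0 (B := B) (fun s => (le_abs_self _).trans (hmB' s)) P hD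
    (fun y => ?_) hS hJD
  · rw [h2ε] at key
    have hint : ∫ s in (-σ)..σ, deriv m s = m σ - m (-σ) :=
      intervalIntegral.integral_deriv_eq_sub (fun s _ => hm.differentiable (by simp) s)
        (hmc.intervalIntegrable _ _)
    rw [hint] at key
    have h0 : 0 ≤ ∫ y, |ψ y| := integral_nonneg fun y => abs_nonneg _
    have := mul_le_mul_of_nonneg_right herr h0
    linarith
  · have h1 := integral_unitMeasure σ fun s => deriv m s *
      (P.real {a | ((s, a), y) ∈ D} - {s | y ∈ C.leaf s}.indicator 1 s)
    refine Eq.trans ?_ h1.symm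
    simp only [hmean]
    by_cases hy : χ y = 0
    · simp [hψ, hy]
    have ht := htube y (hχs y hy)
    set q := tcoord x C.ν y - C.f (hcoord x C.ν y)
    have hset : {s | y ∈ C.leaf s} = Set.Ici q := by
      ext s
      exact mem_leaf_of_mem_tube ht
    have h2 := integral_deriv_indicator hm (σ := σ) (q := q) (ht.2.2.trans (by linarith))
    rw [hset]
    have e1 : ∀ s, deriv m s * (χ y * (e - (Set.Ici q).indicator 1 s)) =
        χ y * (e * deriv m s - deriv m s * (Set.Ici q).indicator 1 s) := fun s => by ring
    have hint : ∫ s in (-σ)..σ, deriv m s = m σ - m (-σ) :=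
      intervalIntegral.integral_deriv_eq_sub (fun s _ => hm.differentiable (by simp) s)
        (hmc.intervalIntegrable _ _)
    simp only [e1]
    rw [intervalIntegral.integral_const_mul, intervalIntegral.integral_sub
      ((hmc.intervalIntegrable _ _).const_mul e) (intervalIntegrable_deriv_indicator hm _ _ _),
      intervalIntegral.integral_const_mul, hint, h2, he]
    ring

end GraphChart

end Comparison

section LocalComparison

variable {ℓ : ℕ} {β : ℝ≥0} {J : Set (Space N) → ℝ≥0∞} {κ : Space N → Set (Space N) → ℝ}

namespace GraphChart

variable {U : Set (Space N)} {x : Space N}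

/-- The integrals of the mollifications of `W` against bounded functions which converge on `W` to
`e` times the indicator of `A`. -/
lemma tendsto_integral_mollified {W : Set (Space N)} (hW : MeasurableSet W) {ρ : ℝ}
    (hWρ : W ⊆ Metric.ball x ρ) {φ : ℕ → ContDiffBump (0 : Space N)}
    (hφ : Tendsto (fun n => (φ n).rOut) atTop (𝓝 0)) (hφ' : ∀ n, (φ n).rOut ≤ 2 * (φ n).rIn)
    (hφρ : ∀ n, (φ n).rOut ≤ ρ) {k : ℕ → Space N → ℝ} (hk : ∀ n, Continuous (k n))
    (hk1 : ∀ n y, |k n y| ≤ 1) {A : Set (Space N)} (hA : MeasurableSet A) {e : ℝ}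
    (hkA : ∀ y ∈ W, Tendsto (fun n => k n y) atTop (𝓝 (A.indicator (fun _ => e) y))) :
    Tendsto (fun n => ∫ y, mollified (φ n) W y * k n y) atTop (𝓝 (e * volume.real (W ∩ A))) := by
  have hlim : ∫ y, (W ∩ A).indicator (fun _ => e) y = e * volume.real (W ∩ A) := by
    rw [integral_indicator_const e (hW.inter hA), smul_eq_mul, mul_comm]
  rw [← hlim]
  refine tendsto_integral_of_dominated_convergence
    ((Metric.ball x (2 * ρ)).indicator fun _ => 1) (fun n => ?_) ?_ (fun n => ?_) ?_
  · exact ((contDiff_mollified hW).continuous.mul (hk n)).aestronglyMeasurable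
  · exact (integrable_indicator_iff measurableSet_ball).2
      (integrableOn_const (hs := measure_ball_lt_top.ne))
  · refine Eventually.of_forall fun y => ?_
    by_cases hy : y ∈ Metric.ball x (2 * ρ)
    · rw [Set.indicator_of_mem hy, Real.norm_eq_abs, abs_mul, abs_of_nonneg (mollified_nonneg y)]
      exact mul_le_one₀ (mollified_le_one y) (abs_nonneg _) (hk1 n y)
    · rw [mem_ball_iff_norm, not_lt] at hy
      rw [mollified_eq_zero hWρ (by linarith [hφρ n]), zero_mul, norm_zero]
      exact Set.indicator_nonneg (fun _ _ => zero_le_one) _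
  · filter_upwards [ae_tendsto_mollified hW hφ hφ'] with y hy
    by_cases hyW : y ∈ W
    · have := hy.mul (hkA y hyW)
      rw [Set.indicator_of_mem hyW, one_mul] at this
      rwa [← Set.indicator_indicator, Set.indicator_of_mem hyW]
    · rw [Set.indicator_of_notMem hyW] at hy
      rw [Set.indicator_of_notMem fun h => hyW h.1]
      refine squeeze_zero_norm (fun n => ?_) hy
      rw [Real.norm_eq_abs, abs_mul, abs_of_nonneg (mollified_nonneg y)]
      exact mul_le_of_le_one_right (mollified_nonneg y) (hk1 n y)

set_option maxHeartbeats 1000000 in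
/-- The increase of `J` by adding a small set is at least the first variation, up to a small
error. -/
lemma exists_union_lower_bound (hβ : β ≤ 1) (hℓ : 1 ≤ ℓ) (hJ : IsGeneralizedPerimeter ℓ β J)
    (hκ : IsFirstVariation ℓ β J κ) (hC : IsContinuousCurvature ℓ β κ) (hU : RegularOpen ℓ β U)
    (C : GraphChart ℓ β U x) {η : ℝ} (hη : 0 < η) :
    ∃ ρ > 0, ∀ W, MeasurableSet W → W ⊆ Metric.ball x ρ → J (closure U ∪ W) ≠ ⊤ →
      (κ x (closure U) - η) * volume.real (W \ closure U) ≤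
        (J (closure U ∪ W)).toReal - (J (closure U)).toReal := by
  obtain ⟨ρ₁, hρ₁, σ, hσ, hσh, htube, hmean⟩ := exists_mean_inequality hβ hℓ hJ hκ hC hU C hη
  obtain ⟨ρ₂, hρ₂, c, hc, hcost⟩ := exists_union_cost hβ hℓ hJ hκ hU C
  set ρ := min (ρ₁ / 2) ρ₂
  have hρ : 0 < ρ := by positivity
  have hρ1 : 2 * ρ ≤ ρ₁ := by have : ρ ≤ ρ₁ / 2 := min_le_left _ _; linarith
  refine ⟨ρ, hρ, fun W hW hWρ hfin => ?_⟩
  have hEf : J (closure U) ≠ ⊤ := (hJ.finite_of_regular _ hU.isRegular).ne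
  refine le_of_forall_pos_le_add fun ε hε => ?_
  obtain ⟨σ', hσ', hcost'⟩ := hcost W hW (hWρ.trans (Metric.ball_subset_ball (min_le_right _ _)))
    (ENNReal.ofReal ε) (ENNReal.ofReal_pos.2 hε)
  -- The steps `m n` rise in `[τ n, 2 * τ n]`. For `s` in this interval and `‖a‖ ≤ c * τ n` the cost
  -- of adding the translate of `W` to the leaf is controlled.
  set τ : ℕ → ℝ := fun n => min (1 / ((n : ℝ) + 1)) (min (σ' / 2) (σ / 2))
  have hτ0 : ∀ n, 0 < τ n := fun n => by
    have : (0 : ℝ) < 1 / ((n : ℝ) + 1) := by positivity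
    exact lt_min this (by positivity)
  have hτ1 : ∀ n, 2 * τ n ≤ σ' := fun n => by
    have : τ n ≤ σ' / 2 := (min_le_right _ _).trans (min_le_left _ _)
    linarith
  have hτ2 : ∀ n, 2 * τ n ≤ σ := fun n => by
    have : τ n ≤ σ / 2 := (min_le_right _ _).trans (min_le_right _ _)
    linarith
  have hτlim : Tendsto τ atTop (𝓝 0) :=
    squeeze_zero (fun n => (hτ0 n).le) (fun n => min_le_left _ _)
      tendsto_one_div_add_atTop_nhds_zero_nat
  choose m hm hm0 hm1 hmI hmd hmd' B hB hB' using fun n =>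
    exists_smooth_step (show τ n < 2 * τ n by linarith [hτ0 n])
  set δ : ℕ → ℝ := fun n => min (c * τ n) ρ
  have hδ0 : ∀ n, 0 < δ n := fun n => lt_min (mul_pos hc (hτ0 n)) hρ
  set φ : ℕ → ContDiffBump (0 : Space N) := fun n =>
    ⟨δ n / 2, δ n, half_pos (hδ0 n), half_lt_self (hδ0 n)⟩
  have hφr : ∀ n, (φ n).rOut = δ n := fun n => rfl
  have hδlim : Tendsto δ atTop (𝓝 0) := by
    refine squeeze_zero (fun n => (hδ0 n).le) (fun n => min_le_left _ _) ?_
    simpa using hτlim.const_mul c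
  set q : Space N → ℝ := fun y => tcoord x C.ν y - C.f (hcoord x C.ν y)
  have hq : Continuous q := continuous_tcoord.sub (C.continuous.comp continuous_hcoord)
  have hstep : ∀ n, (κ x (closure U) - η) * (∫ y, mollified (φ n) W y * m n (q y)) ≤
      (J (closure U ∪ W)).toReal - (J (closure U)).toReal + ε := by
    intro n
    have e1 : m n σ = 1 := hm1 n σ (hτ2 n)
    have e2 : m n (-σ) = 0 := hm0 n (-σ) (by linarith [hτ0 n])
    have hD : MeasurableSet {q : (ℝ × Space N) × Space N |
        q.2 ∈ C.leaf q.1.1 ∨ q.2 - q.1.2 ∈ W} := by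
      have m1 : Measurable fun q : (ℝ × Space N) × Space N => (q.1.1, q.2) := by fun_prop
      have m2 : Measurable fun q : (ℝ × Space N) × Space N => q.2 - q.1.2 := by fun_prop
      exact (m1 measurableSet_leaf).union (m2 hW)
    have h := hmean (mollified (φ n) W) (m n) (B n) 1
      ((J (closure U ∪ W)).toReal - (J (closure U)).toReal + ε) (bumpLaw (φ n))
      {q | q.2 ∈ C.leaf q.1.1 ∨ q.2 - q.1.2 ∈ W} {a | ‖a‖ < δ n} (contDiff_mollified hW)
      (fun y => by rw [abs_of_nonneg (mollified_nonneg y)]; exact mollified_le_one y)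
      (fun y hy => by
        by_contra hn
        refine hy (mollified_eq_zero hWρ ?_)
        have : δ n ≤ ρ := min_le_right _ _
        rw [hφr]; linarith [not_lt.1 hn])
      (hm n) (hB n) (hB' n) (hmd n) (by rw [e1, e2]; ring) hD
      (fun s y => by
        by_cases hs : y ∈ C.leaf s
        · simp [hs]
        · simp [hs, mollified])
      (ae_bumpLaw_norm_lt (φ n))
      (fun s hs hs' a ha => by
        have hsI := hmd' n s hs'
        have h1 := hcost' s (by linarith [hτ0 n, hsI.1]) (by linarith [hτ1 n, hsI.2]) a (by
          have h2 : δ n ≤ c * τ n := min_le_left _ _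
          have h3 : c * τ n ≤ c * s := mul_le_mul_of_nonneg_left hsI.1 hc.le
          exact (le_of_lt ha).trans (h2.trans h3))
        change J (C.leaf s ∪ {y | y - a ∈ W}) ≠ ⊤ ∧ (J (C.leaf s ∪ {y | y - a ∈ W})).toReal ≤ _
        have hLf : J (C.leaf s) ≠ ⊤ :=
          (hJ.finite_of_regular _ ((admissible_leaf (C := C) hβ (hs.trans hσh)).isRegular hβ hU)).ne
        have hR : J (C.leaf s) + J (closure U ∪ W) + ENNReal.ofReal ε ≠ ⊤ := by finiteness
        have hX : J (C.leaf s ∪ {y | y - a ∈ W}) ≠ ⊤ :=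
          ne_top_of_le_ne_top hR (le_self_add.trans h1)
        refine ⟨hX, ?_⟩
        have h4 := ENNReal.toReal_mono hR h1
        rw [ENNReal.toReal_add hX hEf, ENNReal.toReal_add (by finiteness) (by finiteness),
          ENNReal.toReal_add hLf hfin, ENNReal.toReal_ofReal hε.le] at h4
        linarith)
    rw [e1, e2, sub_zero, mul_one] at h
    have habs : (fun y => |mollified (φ n) W y * m n (tcoord x C.ν y - C.f (hcoord x C.ν y))|) =
        fun y => mollified (φ n) W y * m n (q y) := by
      ext y
      exact abs_of_nonneg (mul_nonneg (mollified_nonneg y) (hmI n _).1)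
    rw [habs] at h
    rw [sub_mul]
    exact h
  have hlim := tendsto_integral_mollified (x := x) hW hWρ (φ := φ) hδlim
    (fun n => by change δ n ≤ 2 * (δ n / 2); linarith) (fun n => min_le_right _ _)
    (k := fun n y => m n (q y)) (fun n => (hm n).continuous.comp hq)
    (fun n y => by rw [abs_of_nonneg (hmI n _).1]; exact (hmI n _).2)
    (A := (closure U)ᶜ) isClosed_closure.measurableSet.compl (e := 1) (fun y hy => by
      have hyρ : ‖y - x‖ < ρ₁ := by
        have := mem_ball_iff_norm.1 (hWρ hy)
        linarith
      have hiff := mem_closure_iff_of_mem_cyl (htube y hyρ).1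
      by_cases hyU : y ∈ closure U
      · rw [Set.indicator_of_notMem (by simpa using hyU)]
        refine tendsto_const_nhds.congr fun n => (hm0 n _ ?_).symm
        have : q y ≤ 0 := sub_nonpos.2 (hiff.1 hyU)
        linarith [hτ0 n]
      · rw [Set.indicator_of_mem (by simpa using hyU)]
        have hpos : 0 < q y := by
          by_contra hn
          exact hyU (hiff.2 (sub_nonpos.1 (not_lt.1 hn)))
        have hev : ∀ᶠ n in atTop, 2 * τ n < q y := by
          have := hτlim.const_mul 2
          rw [mul_zero] at this
          exact this.eventually (gt_mem_nhds hpos)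
        refine tendsto_const_nhds.congr' ?_
        filter_upwards [hev] with n hn
        exact (hm1 n _ hn.le).symm)
  have := le_of_tendsto (hlim.const_mul (κ x (closure U) - η)) (Eventually.of_forall hstep)
  rwa [one_mul, ← Set.sdiff_eq] at this

end GraphChart

end LocalComparison

section LocalComparisonRemoval

variable {ℓ : ℕ} {β : ℝ≥0} {J : Set (Space N) → ℝ≥0∞} {κ : Space N → Set (Space N) → ℝ}

namespace GraphChart

variable {U : Set (Space N)} {x : Space N}

set_option maxHeartbeats 1000000 in
/-- The decrease of `J` by removing a small set is at most the first variation, up to a small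
error. -/
lemma exists_sdiff_upper_bound (hβ : β ≤ 1) (hℓ : 1 ≤ ℓ) (hJ : IsGeneralizedPerimeter ℓ β J)
    (hκ : IsFirstVariation ℓ β J κ) (hC : IsContinuousCurvature ℓ β κ) (hU : RegularOpen ℓ β U)
    (C : GraphChart ℓ β U x) {η : ℝ} (hη : 0 < η) :
    ∃ ρ > 0, ∀ W, MeasurableSet W → W ⊆ Metric.ball x ρ → J (closure U \ W) ≠ ⊤ →
      (J (closure U)).toReal - (J (closure U \ W)).toReal ≤
        (κ x (closure U) + η) * volume.real (W ∩ closure U) := by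
  obtain ⟨ρ₁, hρ₁, σ, hσ, hσh, htube, hmean⟩ := exists_mean_inequality hβ hℓ hJ hκ hC hU C hη
  obtain ⟨ρ₂, hρ₂, c, hc, hcost⟩ := exists_sdiff_cost hβ hℓ hJ hκ hU C
  set ρ := min (ρ₁ / 2) ρ₂
  have hρ : 0 < ρ := by positivity
  have hρ1 : 2 * ρ ≤ ρ₁ := by have : ρ ≤ ρ₁ / 2 := min_le_left _ _; linarith
  refine ⟨ρ, hρ, fun W hW hWρ hfin => ?_⟩
  have hEf : J (closure U) ≠ ⊤ := (hJ.finite_of_regular _ hU.isRegular).ne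
  have hvol : volume.real (W ∩ closure U) = volume.real (W ∩ U) := by
    refine measureReal_congr (EventuallyEq.rfl.inter ?_)
    refine (ae_eq_set.2 ⟨?_, ?_⟩)
    · rw [← hU.1.frontier_eq]
      exact hU.volume_frontier hβ
    · rw [Set.sdiff_eq_empty.2 subset_closure, measure_empty]
  refine le_of_forall_pos_le_add fun ε hε => ?_
  obtain ⟨σ', hσ', hcost'⟩ := hcost W hW (hWρ.trans (Metric.ball_subset_ball (min_le_right _ _)))
    (ENNReal.ofReal ε) (ENNReal.ofReal_pos.2 hε)
  -- The steps rise in `[-2 * τ n, -τ n]`. Removal of sets corresponds to the steps minus `1`, which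
  -- vanish above this interval.
  set τ : ℕ → ℝ := fun n => min (1 / ((n : ℝ) + 1)) (min (σ' / 2) (σ / 2))
  have hτ0 : ∀ n, 0 < τ n := fun n => by
    have : (0 : ℝ) < 1 / ((n : ℝ) + 1) := by positivity
    exact lt_min this (by positivity)
  have hτ1 : ∀ n, 2 * τ n ≤ σ' := fun n => by
    have : τ n ≤ σ' / 2 := (min_le_right _ _).trans (min_le_left _ _)
    linarith
  have hτ2 : ∀ n, 2 * τ n ≤ σ := fun n => by
    have : τ n ≤ σ / 2 := (min_le_right _ _).trans (min_le_right _ _)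
    linarith
  have hτlim : Tendsto τ atTop (𝓝 0) :=
    squeeze_zero (fun n => (hτ0 n).le) (fun n => min_le_left _ _)
      tendsto_one_div_add_atTop_nhds_zero_nat
  choose m hm hm0 hm1 hmI hmd hmd' B hB hB' using fun n =>
    exists_smooth_step (show -(2 * τ n) < -τ n by linarith [hτ0 n])
  set δ : ℕ → ℝ := fun n => min (c * τ n) ρ
  have hδ0 : ∀ n, 0 < δ n := fun n => lt_min (mul_pos hc (hτ0 n)) hρ
  set φ : ℕ → ContDiffBump (0 : Space N) := fun n =>
    ⟨δ n / 2, δ n, half_pos (hδ0 n), half_lt_self (hδ0 n)⟩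
  have hφr : ∀ n, (φ n).rOut = δ n := fun n => rfl
  have hδlim : Tendsto δ atTop (𝓝 0) := by
    refine squeeze_zero (fun n => (hδ0 n).le) (fun n => min_le_left _ _) ?_
    simpa using hτlim.const_mul c
  set q : Space N → ℝ := fun y => tcoord x C.ν y - C.f (hcoord x C.ν y)
  have hq : Continuous q := continuous_tcoord.sub (C.continuous.comp continuous_hcoord)
  have hstep : ∀ n, (κ x (closure U) + η) * (∫ y, mollified (φ n) W y * (m n (q y) - 1)) ≤
      (J (closure U \ W)).toReal - (J (closure U)).toReal + ε := by
    intro n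
    have e1 : m n σ = 1 := hm1 n σ (by linarith [hτ0 n])
    have e2 : m n (-σ) = 0 := hm0 n (-σ) (by linarith [hτ2 n])
    have hD : MeasurableSet {q : (ℝ × Space N) × Space N |
        q.2 ∈ C.leaf q.1.1 ∧ q.2 - q.1.2 ∉ W} := by
      have m1 : Measurable fun q : (ℝ × Space N) × Space N => (q.1.1, q.2) := by fun_prop
      have m2 : Measurable fun q : (ℝ × Space N) × Space N => q.2 - q.1.2 := by fun_prop
      exact (m1 measurableSet_leaf).inter (m2 hW).compl
    have hderiv : deriv (fun q => m n q - 1) = deriv (m n) := by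
      ext q
      rw [deriv_sub_const]
    have h := hmean (mollified (φ n) W) (fun q => m n q - 1) (max (B n) 1) 0
      ((J (closure U \ W)).toReal - (J (closure U)).toReal + ε) (bumpLaw (φ n))
      {q | q.2 ∈ C.leaf q.1.1 ∧ q.2 - q.1.2 ∉ W} {a | ‖a‖ < δ n} (contDiff_mollified hW)
      (fun y => by rw [abs_of_nonneg (mollified_nonneg y)]; exact mollified_le_one y)
      (fun y hy => by
        by_contra hn
        refine hy (mollified_eq_zero hWρ ?_)
        have : δ n ≤ ρ := min_le_right _ _
        rw [hφr]; linarith [not_lt.1 hn])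
      ((hm n).sub contDiff_const)
      (fun q => (abs_le.2 ⟨by linarith [(hmI n q).1], by linarith [(hmI n q).2]⟩ :
        |m n q - 1| ≤ 1).trans (le_max_right _ _))
      (fun q => by rw [hderiv]; exact (hB' n q).trans (le_max_left _ _))
      (fun q => by rw [hderiv]; exact hmd n q) (by rw [e1]; ring) hD
      (fun s y => by
        by_cases hs : y ∈ C.leaf s
        · have h1 : (bumpLaw (φ n)).real {a | y - a ∈ W}ᶜ = 1 - mollified (φ n) W y :=
            probReal_compl_eq_one_sub ((measurable_const.sub measurable_id) hW)
          have h2 : {a | ((s, a), y) ∈ {q : (ℝ × Space N) × Space N |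
              q.2 ∈ C.leaf q.1.1 ∧ q.2 - q.1.2 ∉ W}} = {a | y - a ∈ W}ᶜ := by
            ext a
            simp [hs]
          rw [h2, h1, Set.indicator_of_mem (s := {s | y ∈ C.leaf s}) hs, Pi.one_apply]
          ring
        · simp [hs])
      (ae_bumpLaw_norm_lt (φ n))
      (fun s hs hs' a ha => by
        have hsI := hmd' n s (by rwa [hderiv] at hs')
        have h1 := hcost' s (by linarith [hτ0 n, hsI.2]) (by linarith [hτ1 n, hsI.1]) a (by
          have h2 : δ n ≤ c * τ n := min_le_left _ _
          have h3 : c * τ n ≤ c * -s := mul_le_mul_of_nonneg_left (by linarith [hsI.2]) hc.le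
          exact (le_of_lt ha).trans (h2.trans h3))
        change J (C.leaf s \ {y | y - a ∈ W}) ≠ ⊤ ∧ (J (C.leaf s \ {y | y - a ∈ W})).toReal ≤ _
        have hLf : J (C.leaf s) ≠ ⊤ :=
          (hJ.finite_of_regular _ ((admissible_leaf (C := C) hβ (hs.trans hσh)).isRegular hβ hU)).ne
        have hR : J (C.leaf s) + J (closure U \ W) + ENNReal.ofReal ε ≠ ⊤ := by finiteness
        have hX : J (C.leaf s \ {y | y - a ∈ W}) ≠ ⊤ :=
          ne_top_of_le_ne_top hR (le_self_add.trans h1)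
        refine ⟨hX, ?_⟩
        have h4 := ENNReal.toReal_mono hR h1
        rw [ENNReal.toReal_add hX hEf, ENNReal.toReal_add (by finiteness) (by finiteness),
          ENNReal.toReal_add hLf hfin, ENNReal.toReal_ofReal hε.le] at h4
        linarith)
    rw [e1, e2, show ((1 : ℝ) - 1) - (0 - 1) = 1 by norm_num, mul_one] at h
    have habs : (fun y => |mollified (φ n) W y *
        (m n (tcoord x C.ν y - C.f (hcoord x C.ν y)) - 1)|) =
        fun y => -(mollified (φ n) W y * (m n (q y) - 1)) := by
      ext y
      exact abs_of_nonpos (mul_nonpos_of_nonneg_of_nonpos (mollified_nonneg y)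
        (sub_nonpos.2 (hmI n _).2))
    rw [habs, integral_neg, mul_neg, sub_neg_eq_add] at h
    rw [add_mul]
    exact h
  have hlim := tendsto_integral_mollified (x := x) hW hWρ (φ := φ) hδlim
    (fun n => by change δ n ≤ 2 * (δ n / 2); linarith) (fun n => min_le_right _ _)
    (k := fun n y => m n (q y) - 1) (fun n => ((hm n).continuous.comp hq).sub continuous_const)
    (fun n y => abs_le.2 ⟨by linarith [(hmI n (q y)).1], by linarith [(hmI n (q y)).2]⟩)
    (A := U) hU.1.measurableSet (e := -1) (fun y hy => by
      have hyρ : ‖y - x‖ < ρ₁ := by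
        have := mem_ball_iff_norm.1 (hWρ hy)
        linarith
      have hiff := C.mem_iff y (htube y hyρ).1
      by_cases hyU : y ∈ U
      · rw [Set.indicator_of_mem hyU]
        have hneg : q y < 0 := sub_neg.2 (hiff.1 hyU)
        have hev : ∀ᶠ n in atTop, 2 * τ n < -q y := by
          have := hτlim.const_mul 2
          rw [mul_zero] at this
          exact this.eventually (gt_mem_nhds (neg_pos.2 hneg))
        refine tendsto_const_nhds.congr' ?_
        filter_upwards [hev] with n hn
        rw [hm0 n _ (by linarith), zero_sub]
      · rw [Set.indicator_of_notMem hyU]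
        refine tendsto_const_nhds.congr fun n => ?_
        have : 0 ≤ q y := sub_nonneg.2 (not_lt.1 fun h => hyU (hiff.2 h))
        rw [hm1 n _ (by linarith [hτ0 n]), sub_self])
  have := le_of_tendsto (hlim.const_mul (κ x (closure U) + η)) (Eventually.of_forall hstep)
  rw [hvol]
  linarith

end GraphChart

end LocalComparisonRemoval

/-! ### Small bumps as test sets -/

section TestSets

variable {ℓ : ℕ} {β : ℝ≥0} {J : Set (Space N) → ℝ≥0∞} {κ : Space N → Set (Space N) → ℝ}

namespace GraphChart

variable {U : Set (Space N)} {x : Space N} {C : GraphChart ℓ β U x} {g g' : Hyper C.ν → ℝ}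

lemma perturb_mono (h : ∀ p, g p ≤ g' p) : C.perturb g ⊆ C.perturb g' := fun y hy => by
  by_cases hc : y ∈ C.cyl
  · rw [mem_perturb_of_mem_cyl hc] at hy ⊢
    linarith [h (hcoord x C.ν y)]
  · rwa [mem_perturb_of_notMem_cyl hc] at hy ⊢

lemma mem_perturb_sdiff (hg : C.Admissible g) (hg' : C.Admissible g') {y : Space N} :
    y ∈ C.perturb g' \ C.perturb g ↔ C.f (hcoord x C.ν y) + g (hcoord x C.ν y) < tcoord x C.ν y ∧
      tcoord x C.ν y ≤ C.f (hcoord x C.ν y) + g' (hcoord x C.ν y) := by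
  by_cases hc : y ∈ C.cyl
  · rw [Set.mem_sdiff, mem_perturb_of_mem_cyl hc, mem_perturb_of_mem_cyl hc, not_le, and_comm]
  · rw [Set.mem_sdiff, mem_perturb_of_notMem_cyl hc, mem_perturb_of_notMem_cyl hc]
    refine ⟨fun h => absurd h.1 h.2, fun h => ?_⟩
    -- outside of the cylinder, either both displacements vanish or the height is too large
    rcases lt_or_ge ‖hcoord x C.ν y‖ C.r with hp | hp
    · have h1 := abs_le.1 (hg.abs_add_le hp.le)
      have h2 := abs_le.1 (hg'.abs_add_le hp.le)
      have := C.h_pos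
      exact absurd (mem_cyl_iff.2 ⟨hp, abs_lt.2 ⟨by linarith, by linarith⟩⟩) hc
    · have h1 := hg.supp (hcoord x C.ν y) (by linarith [C.r_pos])
      have h2 := hg'.supp (hcoord x C.ν y) (by linarith [C.r_pos])
      rw [h1] at h
      rw [h2] at h
      exact absurd h.1 (not_lt.2 h.2)

/-- The volume between the graphs of two perturbations. -/
lemma volume_perturb_sdiff (hg : C.Admissible g) (hg' : C.Admissible g') (h : ∀ p, g p ≤ g' p) :
    volume (C.perturb g' \ C.perturb g) = ENNReal.ofReal (∫ p, (g' p - g p)) := by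
  have hmp := measurePreserving_point (x := x) C.norm_ν
  have hm : MeasurableSet (C.perturb g' \ C.perturb g) :=
    hg'.isClosed_perturb.measurableSet.diff hg.isClosed_perturb.measurableSet
  rw [← hmp.measure_preimage hm.nullMeasurableSet, Measure.prod_apply (hmp.measurable hm)]
  have hfib : ∀ p : Hyper C.ν, Prod.mk p ⁻¹' ((fun q : Hyper C.ν × ℝ => point x C.ν q.1 q.2) ⁻¹'
      (C.perturb g' \ C.perturb g)) = Set.Ioc (C.f p + g p) (C.f p + g' p) := fun p => by
    ext t
    rw [Set.mem_preimage, Set.mem_preimage, mem_perturb_sdiff hg hg', hcoord_point,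
      tcoord_point C.norm_ν, Set.mem_Ioc]
  have hsupp : HasCompactSupport fun p => g' p - g p :=
    HasCompactSupport.intro (isCompact_closedBall (0 : Hyper C.ν) (C.r / 2)) fun p hp => by
      rw [Metric.mem_closedBall, dist_zero_right, not_le] at hp
      rw [hg.supp p hp.le, hg'.supp p hp.le, sub_zero]
  simp only [hfib, Real.volume_Ioc, add_sub_add_left_eq_sub]
  exact (ofReal_integral_eq_lintegral_ofReal
    ((hg'.continuous.sub hg.continuous).integrable_of_hasCompactSupport hsupp)
    (Eventually.of_forall fun p => sub_nonneg.2 (h p))).symm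

lemma admissible_mul_bump (hβ : β ≤ 1) {b : ContDiffBump (0 : Hyper C.ν)} (hb : b.rOut ≤ C.r / 2)
    {lam : ℝ} (hlam : |lam| ≤ C.h / 4) : C.Admissible fun p => lam * b p := by
  refine ⟨fun p => IsHolderAt.of_contDiff hβ (n := ⊤) (contDiff_const.mul b.contDiff) le_top _,
    fun p hp => ?_, fun p => ?_⟩
  · rw [b.zero_of_le_dist (by rw [dist_zero_right]; exact hb.trans hp), mul_zero]
  · rw [abs_mul, abs_of_nonneg b.nonneg]
    exact (mul_le_of_le_one_right (abs_nonneg _) b.le_one).trans hlam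

set_option maxHeartbeats 1000000 in
/-- The change of `J` by a small bump of the boundary near the centre of the chart. -/
lemma exists_bump_variation (hβ : β ≤ 1) (hℓ : 1 ≤ ℓ) (hκ : IsFirstVariation ℓ β J κ)
    (hC : IsContinuousCurvature ℓ β κ) (hU : RegularOpen ℓ β U) (C : GraphChart ℓ β U x)
    {η δ : ℝ} (hη : 0 < η) (hδ : 0 < δ) :
    ∃ b : ContDiffBump (0 : Hyper C.ν), b.rOut ≤ δ ∧ b.rOut ≤ C.r / 2 ∧ ∀ᶠ lam : ℝ in 𝓝 0,
      |(J (C.perturb fun p => lam * b p)).toReal - (J (closure U)).toReal -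
        lam * (κ x (closure U) * ∫ p, b p)| ≤ |lam| * (η * ∫ p, b p) := by
  have hr := C.r_pos
  have hh := C.h_pos
  set κ₀ := κ x (closure U)
  set L := fderiv ℝ C.f 0
  obtain ⟨ε, hε, hε', herr⟩ := exists_variationError_le N κ₀ (√(1 + ‖L‖ ^ 2)) (half_pos hη)
  obtain ⟨δ₀, hδ₀, hclose⟩ := exists_curvature_leaf_close (C := C) hβ hC hU hε
  have hne : (ℓ : WithTop ℕ∞) ≠ 0 := by
    have : ℓ ≠ 0 := by omega
    exact_mod_cast this
  have hfd : ContinuousAt (fun p => ‖fderiv ℝ C.f p - L‖) 0 :=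
    (((C.holder 0).1.continuousAt_fderiv hne).sub continuousAt_const).norm
  obtain ⟨δ₁, hδ₁, hslope⟩ := Metric.eventually_nhds_iff.1 (hfd.eventually (gt_mem_nhds
    (show ‖fderiv ℝ C.f 0 - L‖ < ε by
      rw [sub_self]
      exact lt_of_eq_of_lt (norm_zero (E := Hyper C.ν →L[ℝ] ℝ)) hε)))
  set ρ := min (min δ (C.r / 2)) (min δ₀ δ₁)
  have hρ : 0 < ρ := by positivity
  have hρr : ρ ≤ C.r / 2 := (min_le_left _ _).trans (min_le_right _ _)
  have hρ0 : ρ ≤ δ₀ := (min_le_right _ _).trans (min_le_left _ _)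
  have hρ1 : ρ ≤ δ₁ := (min_le_right _ _).trans (min_le_right _ _)
  let b : ContDiffBump (0 : Hyper C.ν) := ⟨ρ / 2, ρ, half_pos hρ, half_lt_self hρ⟩
  refine ⟨b, (min_le_left _ _).trans (min_le_left _ _), hρr, ?_⟩
  have hb0 : 0 < ∫ p, b p := b.integral_pos
  have hgz : (fun p : Hyper C.ν => (0 : ℝ) * b p) = fun _ => 0 := by
    ext p
    rw [zero_mul]
  have hadm : ∀ᶠ lam : ℝ in 𝓝 0, C.Admissible fun p => lam * b p := by
    have : ∀ᶠ lam : ℝ in 𝓝 0, |lam| < C.h / 4 :=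
      continuous_abs.continuousAt.eventually (gt_mem_nhds (by rw [abs_zero]; positivity))
    filter_upwards [this] with lam hlam
    exact admissible_mul_bump hβ hρr hlam.le
  obtain ⟨hI, hD⟩ := hasDerivAt_perturb hβ hℓ hκ hU (g := fun lam p => lam * b p) (c := 0) hadm
    (Eventually.of_forall fun lam p => IsHolderAt.of_contDiff hβ (n := ⊤)
      (contDiff_fst.mul (b.contDiff.comp contDiff_snd)) le_top _)
  have hderiv : ∀ c : ℝ, deriv (fun lam : ℝ => lam * c) 0 = c := fun c => by
    simp
  simp only [hderiv] at hI hD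
  rw [hgz] at hI hD
  have hest := (admissible_zero (C := C) hβ).abs_firstVariation_sub_le hℓ (L := L)
    (k := fun y => κ y (C.perturb fun _ => 0)) (κ₀ := κ₀) (ε := ε) (ρ := ρ) hε.le hε' hρr
    (fun p hp => by
      simp only [add_zero]
      exact (hslope (by rw [dist_zero_right]; linarith)).le)
    (fun p hp => by
      have := hclose 0 (by rw [abs_zero]; exact hδ₀.le) p (by linarith)
      simp only [leaf, zero_mul] at this
      exact this)
    (u := b) b.continuous (fun p hp => b.zero_of_le_dist (by rw [dist_zero_right]; exact hp)) hI
  simp only [abs_of_nonneg b.nonneg] at hest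
  set I := ∫ y in frontier (C.perturb fun _ => 0), κ y (C.perturb fun _ => 0) *
    ⟪(C.chi (tcoord x C.ν y) * b (hcoord x C.ν y)) • C.ν,
      outerNormal (C.perturb fun _ => 0) y⟫ ∂μHE[N - 1]
  have hest' := hest.trans (mul_le_mul_of_nonneg_right herr hb0.le)
  filter_upwards [(hasDerivAt_iff_isLittleO.1 hD).bound (c := η / 2 * ∫ p, b p) (by positivity)]
    with lam hlam
  simp only [sub_zero, smul_eq_mul, Real.norm_eq_abs, hgz, perturb_zero] at hlam
  have e : (J (C.perturb fun p => lam * b p)).toReal - (J (closure U)).toReal -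
      lam * (κ₀ * ∫ p, b p) = ((J (C.perturb fun p => lam * b p)).toReal - (J (closure U)).toReal -
      lam * I) + lam * (I - κ₀ * ∫ p, b p) := by ring
  rw [e]
  refine (_root_.abs_add_le _ _).trans ?_
  rw [abs_mul lam]
  have := mul_le_mul_of_nonneg_left hest' (abs_nonneg lam)
  linarith

/-- The sets between the graph of `f` and the graph of `f + lam * b` are contained in small
balls. -/
lemma mem_ball_of_mem_between {K : ℝ} (hK0 : 0 ≤ K)
    (hK : ∀ p q : Hyper C.ν, ‖p‖ ≤ C.r / 2 → ‖q‖ ≤ C.r / 2 → |C.f p - C.f q| ≤ K * ‖p - q‖)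
    {b : ContDiffBump (0 : Hyper C.ν)} {δ lam : ℝ} (hbδ : (K + 1) * b.rOut ≤ δ / 2)
    (hb : b.rOut ≤ C.r / 2) (hlam : |lam| < δ / 2) {y : Space N}
    (hy : |tcoord x C.ν y - C.f (hcoord x C.ν y)| ≤ |lam| * b (hcoord x C.ν y))
    (hb0 : b (hcoord x C.ν y) ≠ 0) : y ∈ Metric.ball x δ := by
  have hp : ‖hcoord x C.ν y‖ < b.rOut := by
    by_contra h
    exact hb0 (b.zero_of_le_dist (by rw [dist_zero_right]; exact not_lt.1 h))
  have h1 := hK (hcoord x C.ν y) 0 (by linarith) (by rw [norm_zero]; linarith [C.r_pos])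
  rw [C.f_zero, sub_zero, sub_zero] at h1
  have h2 : |lam| * b (hcoord x C.ν y) ≤ |lam| := mul_le_of_le_one_right (abs_nonneg _) b.le_one
  have h3 := norm_sub_le_coords (x := x) C.norm_ν y
  have h4 : |tcoord x C.ν y| ≤ |tcoord x C.ν y - C.f (hcoord x C.ν y)| +
      |C.f (hcoord x C.ν y)| := by
    have := _root_.abs_add_le (tcoord x C.ν y - C.f (hcoord x C.ν y)) (C.f (hcoord x C.ν y))
    rwa [sub_add_cancel] at this
  have h5 := mul_le_mul_of_nonneg_left hp.le hK0
  rw [mem_ball_iff_norm]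
  linarith

/-- The bump and its amplitude can be chosen so that the displaced region is in a given ball. -/
lemma exists_small_bump (hβ : β ≤ 1) (hℓ : 1 ≤ ℓ) (hκ : IsFirstVariation ℓ β J κ)
    (hC : IsContinuousCurvature ℓ β κ) (hU : RegularOpen ℓ β U) (C : GraphChart ℓ β U x)
    {η δ : ℝ} (hη : 0 < η) (hδ : 0 < δ) :
    ∃ (b : ContDiffBump (0 : Hyper C.ν)) (lam₀ : ℝ), 0 < lam₀ ∧ ∀ lam : ℝ, |lam| ≤ lam₀ →
      C.Admissible (fun p => lam * b p) ∧
      (∀ y, |tcoord x C.ν y - C.f (hcoord x C.ν y)| ≤ |lam| * b (hcoord x C.ν y) →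
        b (hcoord x C.ν y) ≠ 0 → y ∈ Metric.ball x δ) ∧
      |(J (C.perturb fun p => lam * b p)).toReal - (J (closure U)).toReal -
        lam * (κ x (closure U) * ∫ p, b p)| ≤ |lam| * (η * ∫ p, b p) := by
  obtain ⟨K, hK0, hK⟩ := exists_lipschitz hℓ C
  obtain ⟨b, hb, hb', hev⟩ := exists_bump_variation hβ hℓ hκ hC hU C hη
    (show 0 < δ / (2 * (K + 1)) by positivity)
  rw [le_div_iff₀ (by positivity)] at hb
  obtain ⟨δ₁, hδ₁, hball⟩ := Metric.eventually_nhds_iff.1 hev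
  have hh := C.h_pos
  refine ⟨b, min (δ₁ / 2) (min (δ / 4) (C.h / 4)), by positivity, fun lam hlam => ?_⟩
  have h1 : |lam| ≤ δ₁ / 2 := hlam.trans (min_le_left _ _)
  have h2 : |lam| ≤ δ / 4 := hlam.trans ((min_le_right _ _).trans (min_le_left _ _))
  have h3 : |lam| ≤ C.h / 4 := hlam.trans ((min_le_right _ _).trans (min_le_right _ _))
  exact ⟨admissible_mul_bump hβ hb' h3,
    fun y hy hy0 => mem_ball_of_mem_between hK0 hK (by linarith) hb' (by linarith) hy hy0,
    hball (by rw [Real.dist_eq, sub_zero]; linarith)⟩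

/-- Small sets whose addition increases `J` by the first variation, up to a small error. -/
lemma exists_union_test_set (hβ : β ≤ 1) (hℓ : 1 ≤ ℓ) (hJ : IsGeneralizedPerimeter ℓ β J)
    (hκ : IsFirstVariation ℓ β J κ) (hC : IsContinuousCurvature ℓ β κ) (hU : RegularOpen ℓ β U)
    (C : GraphChart ℓ β U x) {η δ : ℝ} (hη : 0 < η) (hδ : 0 < δ) :
    ∃ W, MeasurableSet W ∧ W ⊆ Metric.ball x δ ∧ 0 < volume.real (W \ closure U) ∧
      J (closure U ∪ W) ≠ ⊤ ∧ (J (closure U ∪ W)).toReal - (J (closure U)).toReal ≤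
        (κ x (closure U) + η) * volume.real (W \ closure U) := by
  obtain ⟨b, lam, hlam, hb⟩ := exists_small_bump hβ hℓ hκ hC hU C hη hδ
  have habs : |lam| = lam := abs_of_pos hlam
  obtain ⟨hadm, hball, hest⟩ := hb lam habs.le
  have h0 := admissible_zero (C := C) hβ
  have hle : ∀ p, (fun _ => (0 : ℝ)) p ≤ (fun p => lam * b p) p := fun p =>
    mul_nonneg hlam.le b.nonneg
  have hsub : closure U ⊆ C.perturb fun p => lam * b p := by
    rw [← perturb_zero (C := C)]
    exact perturb_mono hle
  have hvol : volume.real ((C.perturb fun p => lam * b p) \ closure U) = lam * ∫ p, b p := by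
    rw [measureReal_def, ← perturb_zero (C := C), volume_perturb_sdiff h0 hadm hle]
    simp only [sub_zero]
    rw [integral_const_mul, ENNReal.toReal_ofReal (mul_nonneg hlam.le b.integral_pos.le)]
  have hWW : ((C.perturb fun p => lam * b p) \ closure U) \ closure U =
      (C.perturb fun p => lam * b p) \ closure U := by rw [sdiff_idem]
  refine ⟨(C.perturb fun p => lam * b p) \ closure U,
    hadm.isClosed_perturb.measurableSet.diff isClosed_closure.measurableSet, fun y hy => ?_, ?_,
    ?_, ?_⟩
  · rw [← perturb_zero (C := C), mem_perturb_sdiff h0 hadm, add_zero] at hy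
    refine hball y ?_ fun h => ?_
    · rw [habs, abs_of_pos (sub_pos.2 hy.1)]
      linarith [hy.2]
    · rw [h, mul_zero, add_zero] at hy
      exact absurd hy.1 (not_lt.2 hy.2)
  · rw [hWW, hvol]
    exact mul_pos hlam b.integral_pos
  · rw [Set.union_sdiff_cancel hsub]
    exact (hJ.finite_of_regular _ (hadm.isRegular hβ hU)).ne
  · rw [Set.union_sdiff_cancel hsub, hWW, hvol]
    rw [habs] at hest
    linarith [(abs_le.1 hest).2]

/-- Small sets whose removal decreases `J` by the first variation, up to a small error. -/
lemma exists_sdiff_test_set (hβ : β ≤ 1) (hℓ : 1 ≤ ℓ) (hJ : IsGeneralizedPerimeter ℓ β J)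
    (hκ : IsFirstVariation ℓ β J κ) (hC : IsContinuousCurvature ℓ β κ) (hU : RegularOpen ℓ β U)
    (C : GraphChart ℓ β U x) {η δ : ℝ} (hη : 0 < η) (hδ : 0 < δ) :
    ∃ W, MeasurableSet W ∧ W ⊆ Metric.ball x δ ∧ 0 < volume.real (W ∩ closure U) ∧
      J (closure U \ W) ≠ ⊤ ∧ (κ x (closure U) - η) * volume.real (W ∩ closure U) ≤
        (J (closure U)).toReal - (J (closure U \ W)).toReal := by
  obtain ⟨b, lam, hlam, hb⟩ := exists_small_bump hβ hℓ hκ hC hU C hη hδ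
  have habs : |-lam| = lam := by rw [abs_neg, abs_of_pos hlam]
  obtain ⟨hadm, hball, hest⟩ := hb (-lam) habs.le
  have h0 := admissible_zero (C := C) hβ
  have hle : ∀ p, (fun p => -lam * b p) p ≤ (fun _ => (0 : ℝ)) p := fun p =>
    mul_nonpos_of_nonpos_of_nonneg (by linarith) b.nonneg
  have hsub : (C.perturb fun p => -lam * b p) ⊆ closure U := by
    rw [← perturb_zero (C := C)]
    exact perturb_mono hle
  have hvol : volume.real (closure U \ C.perturb fun p => -lam * b p) = lam * ∫ p, b p := by
    rw [measureReal_def, ← perturb_zero (C := C), volume_perturb_sdiff hadm h0 hle]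
    simp only [zero_sub, neg_mul, neg_neg]
    rw [integral_const_mul, ENNReal.toReal_ofReal (mul_nonneg hlam.le b.integral_pos.le)]
  have hWW : (closure U \ C.perturb fun p => -lam * b p) ∩ closure U =
      closure U \ C.perturb fun p => -lam * b p := Set.inter_eq_left.2 Set.sdiff_subset
  refine ⟨closure U \ C.perturb fun p => -lam * b p,
    isClosed_closure.measurableSet.diff hadm.isClosed_perturb.measurableSet, fun y hy => ?_, ?_,
    ?_, ?_⟩
  · rw [← perturb_zero (C := C), mem_perturb_sdiff hadm h0, add_zero] at hy
    refine hball y ?_ fun h => ?_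
    · rw [habs, abs_of_nonpos (sub_nonpos.2 hy.2)]
      linarith [hy.1]
    · rw [h, mul_zero, add_zero] at hy
      exact absurd hy.1 (not_lt.2 hy.2)
  · rw [hWW, hvol]
    exact mul_pos hlam b.integral_pos
  · rw [Set.sdiff_sdiff_cancel_left hsub]
    exact (hJ.finite_of_regular _ (hadm.isRegular hβ hU)).ne
  · rw [Set.sdiff_sdiff_cancel_left hsub, hWW, hvol]
    rw [habs] at hest
    linarith [(abs_le.1 hest).2]

end GraphChart

end TestSets

/-! ### The weak curvatures -/

section WeakCurvature

variable {ℓ : ℕ} {β : ℝ≥0} {J : Set (Space N) → ℝ≥0∞} {κ : Space N → Set (Space N) → ℝ}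

lemma ereal_coe_toReal {a : ℝ≥0∞} (ha : a ≠ ⊤) : ((a.toReal : ℝ) : EReal) = (a : EReal) := by
  rw [← EReal.toReal_coe_ennreal, EReal.coe_toReal (by simpa using ha) (EReal.coe_ennreal_ne_bot a)]

lemma ereal_quotient_eq {a b v : ℝ≥0∞} (ha : a ≠ ⊤) (hb : b ≠ ⊤) (hv : v ≠ ⊤) :
    ((a : EReal) - (b : EReal)) / (v : EReal) =
      (((a.toReal - b.toReal) / v.toReal : ℝ) : EReal) := by
  rw [← ereal_coe_toReal ha, ← ereal_coe_toReal hb, ← ereal_coe_toReal hv, ← EReal.coe_sub,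
    ← EReal.coe_div]

/-- A lower bound for a difference quotient, whose first term may be infinite. -/
lemma coe_le_ereal_quotient {a b v : ℝ≥0∞} {c : ℝ} (hb : b ≠ ⊤) (hv0 : 0 < v) (hv : v ≠ ⊤)
    (h : a ≠ ⊤ → c * v.toReal ≤ a.toReal - b.toReal) :
    (c : EReal) ≤ ((a : EReal) - (b : EReal)) / (v : EReal) := by
  rcases eq_or_ne a ⊤ with rfl | ha
  · rw [← ereal_coe_toReal hb, EReal.coe_ennreal_top, EReal.top_sub_coe,
      EReal.top_div_of_pos_ne_top (by exact_mod_cast hv0) (by simpa using hv)]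
    exact le_top
  · rw [ereal_quotient_eq ha hb hv, EReal.coe_le_coe_iff,
      le_div_iff₀ (ENNReal.toReal_pos hv0.ne' hv)]
    exact h ha

/-- An upper bound for a difference quotient, whose second term may be infinite. -/
lemma ereal_quotient_le_coe {a b v : ℝ≥0∞} {c : ℝ} (ha : a ≠ ⊤) (hv0 : 0 < v) (hv : v ≠ ⊤)
    (h : b ≠ ⊤ → a.toReal - b.toReal ≤ c * v.toReal) :
    ((a : EReal) - (b : EReal)) / (v : EReal) ≤ (c : EReal) := by
  rcases eq_or_ne b ⊤ with rfl | hb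
  · rw [← ereal_coe_toReal ha, EReal.coe_ennreal_top, EReal.sub_top,
      EReal.bot_div_of_pos_ne_top (by exact_mod_cast hv0) (by simpa using hv)]
    exact bot_le
  · rw [ereal_quotient_eq ha hb hv, EReal.coe_le_coe_iff,
      div_le_iff₀ (ENNReal.toReal_pos hv0.ne' hv)]
    exact h hb

lemma ShrinksTo.eventually_subset {W : ℕ → Set (Space N)} {x : Space N} (hW : ShrinksTo W x)
    {ρ : ℝ} (hρ : 0 < ρ) : ∀ᶠ n in atTop, W n ⊆ Metric.ball x ρ := by
  filter_upwards [hW.2.eventually (gt_mem_nhds (ENNReal.ofReal_pos.2 hρ))] with n hn y hy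
  obtain ⟨z, hz, hyz⟩ := Metric.exists_edist_lt_of_hausdorffEDist_lt (subset_closure hy) hn
  rw [Set.mem_singleton_iff.1 hz, edist_lt_ofReal] at hyz
  exact hyz

lemma shrinksTo_of_subset_ball {W : ℕ → Set (Space N)} {x : Space N}
    (hm : ∀ n, MeasurableSet (W n)) (hne : ∀ n, (W n).Nonempty)
    (hs : ∀ n : ℕ, W n ⊆ Metric.ball x (1 / ((n : ℝ) + 1))) : ShrinksTo W x := by
  refine ⟨fun n => (hm n).nullMeasurableSet, ?_⟩
  have hlim : Tendsto (fun n : ℕ => ENNReal.ofReal (1 / ((n : ℝ) + 1))) atTop (𝓝 0) := by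
    have := ENNReal.tendsto_ofReal (tendsto_one_div_add_atTop_nhds_zero_nat (𝕜 := ℝ))
    rwa [ENNReal.ofReal_zero] at this
  refine tendsto_of_tendsto_of_tendsto_of_le_of_le tendsto_const_nhds hlim (fun n => zero_le)
    fun n => ?_
  have hb : ∀ y ∈ W n, edist y x ≤ ENNReal.ofReal (1 / ((n : ℝ) + 1)) := fun y hy =>
    (edist_lt_ofReal.2 (hs n hy)).le
  dsimp only
  rw [Metric.hausdorffEDist_closure_left]
  refine Metric.hausdorffEDist_le_of_mem_edist (fun y hy => ⟨x, rfl, hb y hy⟩) fun z hz => ?_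
  obtain ⟨y, hy⟩ := hne n
  refine ⟨y, hy, ?_⟩
  rw [Set.mem_singleton_iff.1 hz, edist_comm]
  exact hb y hy

lemma volume_ne_top_of_subset_ball {A : Set (Space N)} {x : Space N} {ρ : ℝ}
    (h : A ⊆ Metric.ball x ρ) : volume A ≠ ⊤ :=
  measure_ne_top_of_subset h measure_ball_lt_top.ne

namespace GraphChart

variable {U : Set (Space N)} {x : Space N}

lemma le_kappaPlus (hβ : β ≤ 1) (hℓ : 1 ≤ ℓ) (hJ : IsGeneralizedPerimeter ℓ β J)
    (hκ : IsFirstVariation ℓ β J κ) (hC : IsContinuousCurvature ℓ β κ) (hU : RegularOpen ℓ β U)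
    (C : GraphChart ℓ β U x) : (κ x (closure U) : EReal) ≤ kappaPlus J x (closure U) := by
  have hfin : J (closure U) ≠ ⊤ := (hJ.finite_of_regular _ hU.isRegular).ne
  have hE : NullMeasurableSet (closure U) volume := isClosed_closure.measurableSet.nullMeasurableSet
  refine le_sInf ?_
  rintro _ ⟨W, hW, hpos, rfl⟩
  refine EReal.ge_of_forall_gt_iff_ge.1 fun c hc => ?_
  rw [EReal.coe_lt_coe_iff] at hc
  obtain ⟨ρ, hρ, h⟩ := exists_union_lower_bound hβ hℓ hJ hκ hC hU C (sub_pos.2 hc)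
  refine le_liminf_of_le (h := ?_)
  filter_upwards [hW.eventually_subset hρ] with n hn
  obtain ⟨W', hW'W, hW'm, hW'⟩ := NullMeasurableSet.exists_measurable_subset_ae_eq (hW.1 n)
  have hv : volume (W' \ closure U) = volume (W n \ closure U) :=
    measure_congr (hW'.diff EventuallyEq.rfl)
  have hJW : J (closure U ∪ W') = J (closure U ∪ W n) :=
    hJ.congr_null _ _ (hE.union hW'm.nullMeasurableSet) (hE.union (hW.1 n))
      (measure_symmDiff_eq_zero_iff.2 (EventuallyEq.rfl.union hW'))
  refine coe_le_ereal_quotient hfin (hpos n)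
    (volume_ne_top_of_subset_ball (Set.sdiff_subset.trans hn)) fun hfin' => ?_
  have := h W' hW'm (hW'W.trans hn) (by rwa [hJW])
  rwa [sub_sub_cancel, measureReal_def, hv, hJW] at this

lemma kappaMinus_le (hβ : β ≤ 1) (hℓ : 1 ≤ ℓ) (hJ : IsGeneralizedPerimeter ℓ β J)
    (hκ : IsFirstVariation ℓ β J κ) (hC : IsContinuousCurvature ℓ β κ) (hU : RegularOpen ℓ β U)
    (C : GraphChart ℓ β U x) : kappaMinus J x (closure U) ≤ (κ x (closure U) : EReal) := by
  have hfin : J (closure U) ≠ ⊤ := (hJ.finite_of_regular _ hU.isRegular).ne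
  have hE : NullMeasurableSet (closure U) volume := isClosed_closure.measurableSet.nullMeasurableSet
  refine sSup_le ?_
  rintro _ ⟨W, hW, hpos, rfl⟩
  refine EReal.le_of_forall_lt_iff_le.1 fun c hc => ?_
  rw [EReal.coe_lt_coe_iff] at hc
  obtain ⟨ρ, hρ, h⟩ := exists_sdiff_upper_bound hβ hℓ hJ hκ hC hU C (sub_pos.2 hc)
  refine limsup_le_of_le (h := ?_)
  filter_upwards [hW.eventually_subset hρ] with n hn
  obtain ⟨W', hW'W, hW'm, hW'⟩ := NullMeasurableSet.exists_measurable_subset_ae_eq (hW.1 n)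
  have hv : volume (W' ∩ closure U) = volume (W n ∩ closure U) :=
    measure_congr (hW'.inter EventuallyEq.rfl)
  have hJW : J (closure U \ W') = J (closure U \ W n) :=
    hJ.congr_null _ _ (hE.diff hW'm.nullMeasurableSet) (hE.diff (hW.1 n))
      (measure_symmDiff_eq_zero_iff.2 (EventuallyEq.rfl.diff hW'))
  refine ereal_quotient_le_coe hfin (hpos n)
    (volume_ne_top_of_subset_ball (Set.inter_subset_left.trans hn)) fun hfin' => ?_
  have := h W' hW'm (hW'W.trans hn) (by rwa [hJW])
  rwa [add_sub_cancel, measureReal_def, hv, hJW] at this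

lemma kappaPlus_le (hβ : β ≤ 1) (hℓ : 1 ≤ ℓ) (hJ : IsGeneralizedPerimeter ℓ β J)
    (hκ : IsFirstVariation ℓ β J κ) (hC : IsContinuousCurvature ℓ β κ) (hU : RegularOpen ℓ β U)
    (C : GraphChart ℓ β U x) : kappaPlus J x (closure U) ≤ (κ x (closure U) : EReal) := by
  have hfin : J (closure U) ≠ ⊤ := (hJ.finite_of_regular _ hU.isRegular).ne
  refine EReal.le_of_forall_lt_iff_le.1 fun c hc => ?_
  rw [EReal.coe_lt_coe_iff] at hc
  choose W hWm hWs hpos hfin' hle using fun n : ℕ =>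
    exists_union_test_set hβ hℓ hJ hκ hC hU C (sub_pos.2 hc)
      (show (0 : ℝ) < 1 / ((n : ℝ) + 1) by positivity)
  have hpos' : ∀ n, 0 < volume (W n \ closure U) := fun n => (ENNReal.toReal_pos_iff.1 (hpos n)).1
  refine sInf_le_of_le ⟨W, shrinksTo_of_subset_ball hWm (fun n =>
    (nonempty_of_measure_ne_zero (hpos' n).ne').mono Set.sdiff_subset) hWs, hpos', rfl⟩
    (liminf_le_of_frequently_le' (Eventually.of_forall fun n => ?_).frequently)
  refine ereal_quotient_le_coe (hfin' n) (hpos' n)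
    (volume_ne_top_of_subset_ball (Set.sdiff_subset.trans (hWs n))) fun _ => ?_
  have := hle n
  rwa [add_sub_cancel] at this

lemma le_kappaMinus (hβ : β ≤ 1) (hℓ : 1 ≤ ℓ) (hJ : IsGeneralizedPerimeter ℓ β J)
    (hκ : IsFirstVariation ℓ β J κ) (hC : IsContinuousCurvature ℓ β κ) (hU : RegularOpen ℓ β U)
    (C : GraphChart ℓ β U x) : (κ x (closure U) : EReal) ≤ kappaMinus J x (closure U) := by
  have hfin : J (closure U) ≠ ⊤ := (hJ.finite_of_regular _ hU.isRegular).ne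
  refine EReal.ge_of_forall_gt_iff_ge.1 fun c hc => ?_
  rw [EReal.coe_lt_coe_iff] at hc
  choose W hWm hWs hpos hfin' hle using fun n : ℕ =>
    exists_sdiff_test_set hβ hℓ hJ hκ hC hU C (sub_pos.2 hc)
      (show (0 : ℝ) < 1 / ((n : ℝ) + 1) by positivity)
  have hpos' : ∀ n, 0 < volume (W n ∩ closure U) := fun n => (ENNReal.toReal_pos_iff.1 (hpos n)).1
  refine le_sSup_of_le ⟨W, shrinksTo_of_subset_ball hWm (fun n =>
    (nonempty_of_measure_ne_zero (hpos' n).ne').mono Set.inter_subset_left) hWs, hpos', rfl⟩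
    (le_limsup_of_frequently_le' (Eventually.of_forall fun n => ?_).frequently)
  refine coe_le_ereal_quotient (hfin' n) (hpos' n)
    (volume_ne_top_of_subset_ball (Set.inter_subset_left.trans (hWs n))) fun _ => ?_
  have := hle n
  rwa [sub_sub_cancel] at this

end GraphChart

end WeakCurvature

end NonlocalCurvature

end

theorem mainTheorem6 (N ℓ : ℕ) (hℓ : 2 ≤ ℓ) (β : ℝ≥0) (hβ : β ≤ 1)
    (J : Set (NonlocalCurvature.Space N) → ℝ≥0∞)
    (hJ : NonlocalCurvature.IsGeneralizedPerimeter ℓ β J)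
    (κ : NonlocalCurvature.Space N → Set (NonlocalCurvature.Space N) → ℝ)
    (hκ : NonlocalCurvature.IsFirstVariation ℓ β J κ)
    (hC : NonlocalCurvature.IsContinuousCurvature ℓ β κ) :
    ∀ E : Set (NonlocalCurvature.Space N), NonlocalCurvature.IsRegular ℓ β E →
      ∀ x ∈ frontier E,
        NonlocalCurvature.kappaPlus J x E = ((κ x E : ℝ) : EReal) ∧
        NonlocalCurvature.kappaMinus J x E = ((κ x E : ℝ) : EReal) := by
  intro E hE x hx
  obtain ⟨U, hUo, hUc, rfl, hU⟩ := hE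
  have hxU : x ∈ frontier U := frontier_closure_subset hx
  obtain ⟨C, -⟩ := NonlocalCurvature.exists_graphChart hβ hUo hxU univ_mem (hU x hxU)
  have hr : NonlocalCurvature.RegularOpen ℓ β U := ⟨hUo, hUc, hU⟩
  have h1 : 1 ≤ ℓ := by omega
  exact ⟨le_antisymm (NonlocalCurvature.GraphChart.kappaPlus_le hβ h1 hJ hκ hC hr C)
      (NonlocalCurvature.GraphChart.le_kappaPlus hβ h1 hJ hκ hC hr C),
    le_antisymm (NonlocalCurvature.GraphChart.kappaMinus_le hβ h1 hJ hκ hC hr C)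
      (NonlocalCurvature.GraphChart.le_kappaMinus hβ h1 hJ hκ hC hr C)⟩
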